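/- **Setting.** Let $m,n\ge 0$, let $\theta\neq0$ be real, and let $\eta_1,\dots,\eta_n\in\{1,-1\}$. On $\mathbb R^{2m|n}$, with coordinates $z=(x,\xi)$, $x=(q,p)\in\mathbb R^{2m}$, put $\omega(z_1,z_2)=q_1\cdot p_2-p_1\cdot q_2+\sum_k\eta_k\,\xi_1^k\xi_2^k$. Let $A$ be a complex Fréchet algebra (jointly continuous product, not necessarily unital), with topology defined by seminorms $(|\cdot|_j)_{j\in\mathbb N}$. Suppose that $A$ is $\mathbb Z_2$-graded, $A=A_0\oplus A_1$ with closed $A_0,A_1$ and $A_iA_j\subset A_{i+j}$; an ungraded algebra is included as $A=A_0$. An $A$-valued superfunction on $\mathbb R^{2m|n}$ is $f(x,\xi)=\sum_I f_I(x)\,\xi^I$ with $f_I:\mathbb R^{2m}\to A$, $I\subset\{1,\dots,n\}$; products are formed with $\xi^i a=(-1)^{|a|}a\,\xi^i$ for homogeneous $a\in A$. Let $\rho$ be an action of the supergroup $\mathbb R^{2m|n}$ on $A$, $\rho_{(x,\xi)}(a)=\sum_I\rho_x(a)_I\,\xi^I$ with continuous linear maps $a\mapsto\rho_x(a)_I$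 of $A$, such that $\rho_{z_1+z_2}=\rho_{z_1}\rho_{z_2}$, $\rho_0=\mathrm{id}$, $\rho_z(ab)=\rho_z(a)\rho_z(b)$; the maps $x\mapsto\rho_x(a)_I$ are continuous; and $\rho$ is subisometric: there is $C>0$ such that for all $a\in A$, $I$, $j$ there is $k$ with $|\rho_x(a)_I|_j\le C|a|_k$ for all $x\in\mathbb R^{2m}$. Suppose that $A=A_0$ (ungraded case), or that $\rho$ is compatible with the degree: $\rho_x(A_i)_I\subset A_{i+|I|}$. Let $A^\infty$ be the space of the $a\in A$ for which $\rho^a:z\mapsto\rho_z(a)$ is smooth, and for superfunctions $f,g$ put $$(f\star_\theta g)(z)=\frac1{\pi^{2m}\theta^{2m-n}}\int dz_1\,dz_2\;e^{-\frac{2i}\theta\omega(z_1,z_2)}f(z+z_1)\,g(z+z_2),$$ a Berezin integral in $\xi_1,\xi_2$ and an oscillatory integral in $x_1,x_2$ (the limit as $\varepsilon\to0^+$ of the integrals with a cut-off $\chi(\varepsilon x_1,\varepsilon x_2)$, the same for all $\chi\in C_c^\infty$ with $\chi(0)=1$). A *Hilbert superspace* is a $\mathbb Z_2$-graded complex vector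 space $H$ with a sesquilinear form $\langle\cdot,\cdot\rangle$, homogeneous of some degree $r\in\mathbb Z_2$, with $\overline{\langle x,y\rangle}=(-1)^{|x||y|}\langle y,x\rangle$, for which there is a linear map $J$ of degree $r$ such that $J^2x=(-1)^{(r+1)|x|}x$, $\langle Jx,Jy\rangle=\langle x,y\rangle$, and $\langle x,Jy\rangle$ is a positive definite hermitian scalar product for which $H$ is complete. A *superinvolution* on a $\mathbb Z_2$-graded algebra is an antilinear map $\dagger$ of degree $0$ with $a^{\dagger\dagger}=a$ and $(ab)^\dagger=(-1)^{|a||b|}b^\dagger a^\dagger$. A *C\*-superalgebra* is a $\mathbb Z_2$-graded algebra with superinvolution that has a faithful representation of degree $0$ by bounded operators on a Hilbert superspace, closed in operator norm, in which $\dagger$ becomes the superadjoint, $\langle T^\dagger x,y\rangle=(-1)^{|T||x|}\langle x,Ty\rangle$; its topology is the one given by the operator norm. **Theorem.** (1) For $a,b\in A^\infty$ the oscillatory integrals in $\rho^a\star_\theta\rho^b$ converge, $a\star_\theta b:=(\rho^a\star_\theta\rho^b)(0)$ lies in $A^\infty$, and $\star_\theta$ is a bilinear associative product on $A^\infty$.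 (2) Suppose moreover that $A$ is a C\*-superalgebra, and that $\rho$ is compatible with the degree and with the superinvolution, that is, $\rho_x(a^\dagger)_I=(\rho_x(a)_I)^\dagger$. Then $(A^\infty,\star_\theta)$ can be completed to a C\*-superalgebra $A_\theta$: there are a C\*-superalgebra $A_\theta$ and an injective linear map $\iota:A^\infty\to A_\theta$ of degree $0$ with dense range, such that $\iota(a\star_\theta b)=\iota(a)\iota(b)$, and $\iota(a)^\dagger=\iota\big((-1)^n a^\dagger\big)$ for all $a,b\in A^\infty$ (in particular $a^\dagger\in A^\infty$). -/

import Mathlib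

open Filter Topology MeasureTheory
open scoped ContDiff ComplexConjugate

universe u v

noncomputable section

namespace SuperDeformation

/-! ### Gradings by `ℤ/2` -/

/-- The sign `(-1)^i`, for `i ∈ ℤ/2`. -/
def ksign (i : ZMod 2) : ℂ := (-1) ^ i.val

/-- A `ℤ/2`-grading `V = V₀ ⊕ V₁` of a complex vector space. -/
structure Supergrading (V : Type*) [AddCommGroup V] [Module ℂ V] where
  even : Submodule ℂ V
  odd : Submodule ℂ V
  isCompl : IsCompl even odd

/-- The homogeneous component of degree `i`. -/
def Supergrading.part {V : Type*} [AddCommGroup V] [Module ℂ V] (G : Supergrading V)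
    (i : ZMod 2) : Submodule ℂ V :=
  if i = 0 then G.even else G.odd

/-- The grading automorphism `v ↦ (-1)^|v| v`. -/
def Supergrading.parity {V : Type*} [AddCommGroup V] [Module ℂ V] (G : Supergrading V) :
    V →ₗ[ℂ] V :=
  G.even.projection G.odd G.isCompl - G.odd.projection G.even G.isCompl.symm

/-- The grading is one of an algebra: degrees add under the product. -/
def Supergrading.IsAlgebraGrading {A : Type*} [NonUnitalRing A] [Module ℂ A]
    (G : Supergrading A) : Prop :=
  ∀ (i j : ZMod 2) (a b : A), a ∈ G.part i → b ∈ G.part j → a * b ∈ G.part (i + j)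

/-! ### Hilbert superspaces and C*-superalgebras -/

/-- A Hilbert superspace, given together with a fundamental symmetry `J`: the inner product and
the norm of `H` are those of the (complete) scalar product `(x, y)_J = ⟨x, J y⟩`, where `form` is
the superhermitian inner product `⟨x, y⟩`, antilinear in its first argument.  The Hilbert topology
does not depend on the choice of `J`. -/
structure HilbertSuperspace (H : Type*) [NormedAddCommGroup H] [InnerProductSpace ℂ H] where
  grading : Supergrading H
  /-- the degree of the inner product -/
  degree : ZMod 2
  form : H →ₗ⋆[ℂ] H →ₗ[ℂ] ℂ
  superhermitian : ∀ (i j : ZMod 2) (x y : H), x ∈ grading.part i → y ∈ grading.part j →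
    conj (form x y) = ksign (i * j) * form y x
  homogeneous : ∀ (i j : ZMod 2) (x y : H), x ∈ grading.part i → y ∈ grading.part j →
    i + j ≠ degree → form x y = 0
  J : H →ₗ[ℂ] H
  J_degree : ∀ (i : ZMod 2) (x : H), x ∈ grading.part i → J x ∈ grading.part (i + degree)
  J_sq : ∀ (i : ZMod 2) (x : H), x ∈ grading.part i → J (J x) = ksign ((degree + 1) * i) • x
  J_isometry : ∀ x y : H, form (J x) (J y) = form x y
  inner_eq : ∀ x y : H, inner ℂ x y = form x (J y)

/-- A superinvolution: antilinear (by its type), of degree `0`, involutive, and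
`(a b)† = (-1)^{|a||b|} b† a†`. -/
structure IsSuperinvolution {A : Type*} [NonUnitalRing A] [Module ℂ A] (G : Supergrading A)
    (dag : A →ₗ⋆[ℂ] A) : Prop where
  degree : ∀ (i : ZMod 2) (a : A), a ∈ G.part i → dag a ∈ G.part i
  involutive : ∀ a : A, dag (dag a) = a
  mul : ∀ (i j : ZMod 2) (a b : A), a ∈ G.part i → b ∈ G.part j →
    dag (a * b) = ksign (i * j) • (dag b * dag a)

/-- The topological algebra `A`, with the grading `G` and the superinvolution `dag`, is a
C*-superalgebra: there is a faithful representation `π` of degree `0` on a Hilbert superspace `H`,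
turning `dag` into the superadjoint, `⟨T† x, y⟩ = (-1)^{|T||x|} ⟨x, T y⟩`, whose range is closed for
the operator norm and which induces the topology of `A`. -/
def IsCStarSuperalgebra {A : Type u} [NonUnitalRing A] [Module ℂ A] [TopologicalSpace A]
    (G : Supergrading A) (dag : A →ₗ⋆[ℂ] A) : Prop :=
  G.IsAlgebraGrading ∧ IsSuperinvolution G dag ∧
  ∃ (H : Type v) (_ : NormedAddCommGroup H) (_ : InnerProductSpace ℂ H) (_ : CompleteSpace H)
    (S : HilbertSuperspace H) (π : A →ₙₐ[ℂ] (H →L[ℂ] H)),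
    IsClosedEmbedding (π : A → (H →L[ℂ] H)) ∧
    (∀ (i j : ZMod 2) (a : A) (x : H), a ∈ G.part i → x ∈ S.grading.part j →
      π a x ∈ S.grading.part (i + j)) ∧
    (∀ (i j : ZMod 2) (a : A) (x y : H), a ∈ G.part i → x ∈ S.grading.part j →
      S.form (π (dag a) x) y = ksign (i * j) * S.form x (π a y))

/-! ### Grassmann algebras with coefficients -/

/-- The sign `ε(I, J)`: zero if `I` and `J` meet, and otherwise the parity of the concatenation of
the increasing lists of `I` and of `J`. -/
def eps {S : Type*} [LinearOrder S] (I J : Finset S) : ℤ :=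
  if Disjoint I J then (-1) ^ ((I ×ˢ J).filter fun p => p.2 < p.1).card else 0

/-- The product of `A ⊗ ⋀S`, where a function `u : Finset S → A` stands for `∑ I, u_I ξ^I`, with
`ξ^I ξ^J = ε(I, J) ξ^{I ∪ J}` and `ξ^i a = γ(a) ξ^i`; here `γ` is the grading automorphism
of `A`. -/
def grMul {S A : Type*} [LinearOrder S] [NonUnitalRing A] (γ : A → A)
    (u w : Finset S → A) : Finset S → A := fun Q =>
  ∑ I ∈ Q.powerset, eps I (Q \ I) • (u I * γ^[I.card] (w (Q \ I)))

/-- The product of an element of `⋀S` (over `ℂ`) with an element of `A ⊗ ⋀S`. -/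
def grSMul {S A : Type*} [LinearOrder S] [AddCommGroup A] [Module ℂ A] (γ : A → A)
    (c : Finset S → ℂ) (u : Finset S → A) : Finset S → A := fun Q =>
  ∑ I ∈ Q.powerset, eps I (Q \ I) • (c I • γ^[I.card] (u (Q \ I)))

/-- The exponential of a nilpotent element of `⋀S`: powers beyond the number of generators
vanish. -/
def grExp {S : Type*} [LinearOrder S] [Fintype S] (w : Finset S → ℂ) : Finset S → ℂ := fun Q =>
  ∑ j ∈ Finset.range (Fintype.card S + 1),
    (1 / (j.factorial : ℂ)) * ((grMul id w)^[j] (fun I => if I = ∅ then 1 else 0)) Q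

/-! ### Superfunctions on `ℝ^{2m|n}` -/

/-- The body `ℝ^{2m}` of `ℝ^{2m|n}`, with points `(q, p)`. -/
abbrev Body (m : ℕ) : Type := (Fin m → ℝ) × (Fin m → ℝ)

/-- The standard symplectic form of `ℝ^{2m}`. -/
def omega0 {m : ℕ} (x y : Body m) : ℝ := ∑ i, (x.1 i * y.2 i - x.2 i * y.1 i)

/-- `A`-valued superfunctions `f(x, ξ) = ∑ I, f_I(x) ξ^I` on `ℝ^{2m|n}`. -/
abbrev Superfun (m n : ℕ) (A : Type*) : Type _ := Body m → Finset (Fin n) → A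

/-- Three copies `ξ, ξ₁, ξ₂` of the odd coordinates, ordered `ξ < ξ₁ < ξ₂`. -/
abbrev Gen (n : ℕ) : Type := Fin 3 ×ₗ Fin n

/-- The set of the generators `ξ_k^i`, `i ∈ I`. -/
def layer {n : ℕ} (k : Fin 3) (I : Finset (Fin n)) : Finset (Gen n) :=
  I.image fun i => toLex (k, i)

/-- The set of those `i` for which `ξ_k^i` belongs to `Q`. -/
def slice {n : ℕ} (k : Fin 3) (Q : Finset (Gen n)) : Finset (Fin n) :=
  Finset.univ.filter fun i => toLex (k, i) ∈ Q

/-- The substitution `∑ I, u_I ξ^I ↦ ∑ I, u_I (ξ + ξ_k)^I`: as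
`(ξ + ξ_k)^I = ∑ ε(P, R) ξ^P ξ_k^R` over the partitions `I = P ⊔ R`, the coefficient of
`ξ^P ξ_k^R` is `ε(P, R) u_{P ∪ R}`. -/
def shift {n : ℕ} {A : Type*} [AddCommGroup A] (k : Fin 3) (u : Finset (Fin n) → A) :
    Finset (Gen n) → A := fun Q =>
  if ∀ l : Fin 3, l ≠ 0 → l ≠ k → slice l Q = ∅ then
    eps (slice 0 Q) (slice k Q) • u (slice 0 Q ∪ slice k Q)
  else 0

/-- The odd factor `exp((-2i/θ) ∑ k, η_k ξ₁^k ξ₂^k)` of the cocycle. -/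
def oddKernel {n : ℕ} (θ : ℝ) (η : Fin n → ℤˣ) : Finset (Gen n) → ℂ :=
  grExp fun Q => ∑ k : Fin n,
    if Q = layer 1 {k} ∪ layer 2 {k} then -2 * Complex.I / θ * ((η k : ℤ) : ℂ) else 0

/-! ### Oscillatory integrals with values in a locally convex space -/

section Integrals

variable {A : Type*} [AddCommGroup A] [Module ℂ A] [TopologicalSpace A]

/-- `a` is the (weak) integral of `f`. -/
def IsWeakIntegral {X : Type*} [MeasureSpace X] (f : X → A) (a : A) : Prop :=
  ∀ φ : A →L[ℂ] ℂ, Integrable (fun x => φ (f x)) ∧ ∫ x, φ (f x) = φ a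

/-- The oscillatory integral of `F` converges to `a`: for each smooth compactly supported cut-off
`χ` with `χ(0) = 1`, the integrals of `χ(ε ·) F` tend to `a` as `ε → 0⁺`. -/
def HasOscIntegral {m : ℕ} (F : Body m × Body m → A) (a : A) : Prop :=
  ∀ χ : Body m × Body m → ℂ, ContDiff ℝ ∞ χ → HasCompactSupport χ → χ 0 = 1 →
    ∃ I : ℝ → A, (∀ ε : ℝ, 0 < ε → IsWeakIntegral (fun p => χ (ε • p) • F p) (I ε)) ∧
      Tendsto I (𝓝[>] 0) (𝓝 a)

open Classical in
/-- The value of a convergent oscillatory integral. -/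
def oscIntegral {m : ℕ} (F : Body m × Body m → A) : A :=
  if h : ∃ a, HasOscIntegral F a then h.choose else 0

/-- `f` is of class `C^k`: all directional derivatives up to order `k` exist and are
continuous. -/
def IsClassC {m : ℕ} : ℕ → (Body m → A) → Prop
  | 0, f => Continuous f
  | k + 1, f => Continuous f ∧ ∀ e : Body m, ∃ g : Body m → A,
      (∀ x, Tendsto (fun t : ℝ => (t : ℂ)⁻¹ • (f (x + t • e) - f x)) (𝓝[≠] 0) (𝓝 (g x))) ∧
      IsClassC k g

/-- A superfunction is smooth when all its coefficients are. -/
def IsSmooth {m n : ℕ} (f : Superfun m n A) : Prop :=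
  ∀ (I : Finset (Fin n)) (k : ℕ), IsClassC k fun x => f x I

theorem IsClassC.zero {m : ℕ} (k : ℕ) : IsClassC k (fun _ : Body m => (0 : A)) := by
  induction k with
  | zero => exact continuous_const
  | succ k ih =>
    refine ⟨continuous_const, fun e => ⟨fun _ => 0, fun x => ?_, ih⟩⟩
    simpa using tendsto_const_nhds

theorem IsClassC.add [ContinuousAdd A] {m : ℕ} (k : ℕ) : ∀ {f g : Body m → A},
    IsClassC k f → IsClassC k g → IsClassC k fun x => f x + g x := by
  induction k with
  | zero => exact fun hf hg => Continuous.add hf hg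
  | succ k ih =>
    intro f g hf hg
    refine ⟨hf.1.add hg.1, fun e => ?_⟩
    obtain ⟨f', hf', hf''⟩ := hf.2 e
    obtain ⟨g', hg', hg''⟩ := hg.2 e
    refine ⟨fun x => f' x + g' x, fun x => ?_, ih hf'' hg''⟩
    refine ((hf' x).add (hg' x)).congr fun t => ?_
    rw [← smul_add]
    exact congrArg _ (add_sub_add_comm _ _ _ _).symm

theorem IsClassC.smul [ContinuousConstSMul ℂ A] {m : ℕ} (k : ℕ) (c : ℂ) : ∀ {f : Body m → A},
    IsClassC k f → IsClassC k fun x => c • f x := by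
  induction k with
  | zero => exact fun hf => Continuous.const_smul hf c
  | succ k ih =>
    intro f hf
    refine ⟨hf.1.const_smul c, fun e => ?_⟩
    obtain ⟨f', hf', hf''⟩ := hf.2 e
    refine ⟨fun x => c • f' x, fun x => ?_, ih hf''⟩
    refine ((hf' x).const_smul c).congr fun t => ?_
    rw [← smul_sub, smul_comm]

end Integrals

/-! ### The star product of superfunctions -/

section Star

variable {A : Type*} [NonUnitalRing A] [Module ℂ A] [TopologicalSpace A] {m n : ℕ}

/-- The coefficient of `ξ^K`, after Berezin integration over `ξ₁` and `ξ₂`, of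
`K_θ(z₁, z₂) f(z + z₁) g(z + z₂)`, where `z = (x, ξ)`, the even parts of `z₁` and `z₂` are the
components of `p`, and `K_θ(z₁, z₂) = exp((-2i/θ) ω(z₁, z₂))` with
`ω(z₁, z₂) = ω₀(x₁, x₂) + ∑ k, η_k ξ₁^k ξ₂^k`. -/
def starIntegrand (θ : ℝ) (η : Fin n → ℤˣ) (γ : A → A) (f g : Superfun m n A)
    (x : Body m) (K : Finset (Fin n)) : Body m × Body m → A := fun p =>
  Complex.exp (-2 * Complex.I / θ * omega0 p.1 p.2) •
    grSMul γ (oddKernel θ η) (grMul γ (shift 1 (f (x + p.1))) (shift 2 (g (x + p.2))))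
      (layer 0 K ∪ layer 1 Finset.univ ∪ layer 2 Finset.univ)

/-- The star product `f ⋆_θ g`, with the factor `1 / (π^{2m} θ^{2m-n})`. -/
def starProduct (θ : ℝ) (η : Fin n → ℤˣ) (γ : A → A) (f g : Superfun m n A) :
    Superfun m n A := fun x K =>
  ((1 / (Real.pi ^ (2 * m) * θ ^ (2 * (m : ℤ) - (n : ℤ))) : ℝ) : ℂ) •
    oscIntegral (starIntegrand θ η γ f g x K)

/-- All the oscillatory integrals in the definition of `f ⋆_θ g` converge. -/
def StarConverges (θ : ℝ) (η : Fin n → ℤˣ) (γ : A → A) (f g : Superfun m n A) : Prop :=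
  ∀ (x : Body m) (K : Finset (Fin n)),
    HasOscIntegral (starIntegrand θ η γ f g x K) (oscIntegral (starIntegrand θ η γ f g x K))

end Star

/-! ### Actions of `ℝ^{2m|n}` -/

/-- An action of the supergroup `ℝ^{2m|n}` on a graded topological algebra by continuous linear
maps, `ρ_{(x,ξ)}(a) = ∑ I, ρ_x(a)_I ξ^I`, where `ρ_x(a)_I` is `coeff x I a`.  The field `add` is
`ρ_{z₁+z₂} = ρ_{z₁} ρ_{z₂}`, read off at `ξ₁^I ξ₂^J`; `mul` is `ρ_z(ab) = ρ_z(a) ρ_z(b)`. -/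
structure SuperAction (m n : ℕ) (A : Type*) [NonUnitalRing A] [Module ℂ A] [TopologicalSpace A]
    (G : Supergrading A) where
  coeff : Body m → Finset (Fin n) → A →L[ℂ] A
  zero : ∀ a : A, coeff 0 ∅ a = a
  add : ∀ (x y : Body m) (I J : Finset (Fin n)) (a : A),
    coeff x I (coeff y J a) = eps I J • coeff (x + y) (I ∪ J) a
  mul : ∀ (x : Body m) (a b : A),
    (fun K => coeff x K (a * b)) = grMul G.parity (fun I => coeff x I a) (fun J => coeff x J b)
  continuous : ∀ (I : Finset (Fin n)) (a : A), Continuous fun x => coeff x I a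

namespace SuperAction

variable {A : Type*} [NonUnitalRing A] [Module ℂ A] [TopologicalSpace A] {G : Supergrading A}
  {m n : ℕ}

/-- The superfunction `ρ^a : z ↦ ρ_z(a)`. -/
def orbit (ρ : SuperAction m n A G) (a : A) : Superfun m n A := fun x I => ρ.coeff x I a

/-- Subisometric actions, for a given family of seminorms. -/
def IsSubisometric (ρ : SuperAction m n A G) (p : ℕ → Seminorm ℂ A) : Prop :=
  ∃ C : ℝ, 0 < C ∧ ∀ (a : A) (I : Finset (Fin n)) (j : ℕ), ∃ k : ℕ, ∀ x : Body m,
    p j (ρ.coeff x I a) ≤ C * p k a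

/-- Compatibility with the degree: `ρ_z(a)` has the total degree of `a`. -/
def PreservesDegree (ρ : SuperAction m n A G) : Prop :=
  ∀ (i : ZMod 2) (a : A), a ∈ G.part i → ∀ (x : Body m) (I : Finset (Fin n)),
    ρ.coeff x I a ∈ G.part (i + (I.card : ZMod 2))

/-- Compatibility with the superinvolution: `ρ_z(a†) = ρ_z(a)†`, where
`(∑ I, a_I ξ^I)† = ∑ I, a_I† ξ^I`. -/
def PreservesDag (ρ : SuperAction m n A G) (dag : A →ₗ⋆[ℂ] A) : Prop :=
  ∀ (x : Body m) (I : Finset (Fin n)) (a : A), ρ.coeff x I (dag a) = dag (ρ.coeff x I a)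

/-- The space `A^∞` of smooth vectors. -/
def smoothVectors [ContinuousAdd A] [ContinuousConstSMul ℂ A] (ρ : SuperAction m n A G) :
    Submodule ℂ A where
  carrier := {a | IsSmooth (ρ.orbit a)}
  zero_mem' := fun I k => by simpa [orbit] using IsClassC.zero k
  add_mem' := fun ha hb I k => by simpa [orbit] using (ha I k).add k (hb I k)
  smul_mem' := fun c _ ha I k => by simpa [orbit] using (ha I k).smul k c

end SuperAction

end SuperDeformation

end

/-! The even and the odd directions are treated separately. Let α be the action of the body, `x ↦
ρ.coeff x ∅`, let D_I be `ρ.coeff 0 I` on smooth vectors, γ the parity, l = 1/θ and c = 2/θ.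

Even directions. The density `gam` is the kernel of the inverse of (1 - d/dt)^4 on bounded
functions. A smooth vector a is therefore the Gamma average of the translates of another smooth
vector a', obtained by applying (1 - ∂)^4 in every coordinate direction (`Smooth.exists_smoothing`).
Moving the averages of two vectors onto e^{-icω} replaces this factor by `moyalKernel`, which is
absolutely integrable (`norm_moyalKernel_le`). Fourier inversion of the cut-off then shows that the
oscillatory integrals converge to absolutely convergent weak integrals (`hasOscIntegral_moyal`);
this is the unnormalized product `mprod`.

For associativity, `symb` sends a to the function δ ↦ ∫ wig(x, δ) α_x(a) dx, where `wig` is the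
Wigner transform of coherent states. A Gaussian computation (`integral_wig_mul_wig`) shows that
`symb` turns `mprod` into a twisted convolution (`dual_symb_mprod`), up to the factor 2^m. Twisted
convolution is associative by the cocycle identity of ω, and `symb` is injective by uniqueness of
Fourier transforms (`eq_zero_of_symb`).

Odd directions. The Berezin integral is a finite sum over sets J of terms in which D_J acts on both
factors (`berezin_eq`). Up to a constant, it deforms the product successively by M ↦ M + κ_k M(D_k
·, γ D_k ·), one generator at a time (`oddDeform_insert`). In the graded case the D_k are
anticommuting superderivations of square zero, and each step preserves associativity
(`IsCompatible.step`). In the ungraded case D_k is a derivation of square zero, so D_k a · D_k b = 0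
and no odd correction survives.

Completion. A Hilbert superspace amounts to a Hilbert space with a unitary grading γ and a
fundamental symmetry J (`Krein`). A C*-superalgebra A on H yields a covariant representation on
L²(ℝ^{2m}, H): elements of A act by multiplication with their orbits, ℝ^{2m} by magnetic
translations (`regular`). Integrating the symbols against the translations represents `mprod`
faithfully by bounded operators (`quant_mul`, `quant_injective`) and respects superadjoints
(`sadj_quant`). Each odd step is represented by 2 × 2 block operators on H ⊕ H, the second copy
having shifted parity (`IsRep.double`). The norm closure of the resulting operators, rescaled, is
A_θ. The sign (-1)^n appears because the normalizing constant contains n purely imaginary factors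
(`conj_starConst`). -/

set_option linter.unusedSectionVars false

noncomputable section

namespace SuperDeformation

/-! ### Locally convex spaces: duality, weak integrals, closed graphs, uniform boundedness. -/

section LocallyConvex

variable {A : Type*} [AddCommGroup A] [Module ℂ A] [UniformSpace A] [IsUniformAddGroup A]
  [ContinuousSMul ℂ A] [PolynormableSpace ℂ A]

/-- Hahn–Banach, extending the functional t a ↦ t q(a) from the line spanned by a. -/
theorem exists_dual_eq_seminorm {q : Seminorm ℂ A} (hq : Continuous q) (a : A) :
    ∃ φ : A →L[ℂ] ℂ, φ a = (q a : ℂ) ∧ ∀ x, ‖φ x‖ ≤ q x := by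
  obtain ⟨g, -, hg⟩ := Module.Dual.exists_extension_of_le_seminorm (𝕜 := ℂ) (E := A) ⊥ 0
    (p := q) (fun x => by simp)
  by_cases ha : q a = 0
  · refine ⟨0, by simp [ha], fun x => by simp⟩
  have hane : a ≠ 0 := fun h => ha (by simp [h])
  let e := LinearEquiv.toSpanNonzeroSingleton ℂ A a hane
  let f : Module.Dual ℂ (ℂ ∙ a) := (q a : ℂ) • (e.symm : (ℂ ∙ a) →ₗ[ℂ] ℂ)
  have hf : ∀ x : (ℂ ∙ a), ‖f x‖ ≤ q x := by
    intro x
    obtain ⟨c, rfl⟩ := e.surjective x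
    have h1 : f (e c) = (q a : ℂ) * c := by simp [f]
    have h2 : ((e c : (ℂ ∙ a)) : A) = c • a := rfl
    rw [h1, h2, map_smul_eq_mul, norm_mul, Complex.norm_real, Real.norm_eq_abs,
      abs_of_nonneg (apply_nonneg q a), mul_comm]
  obtain ⟨φ, hφ, hφ'⟩ := Module.Dual.exists_continuous_extension_of_le_seminorm _ f hq hf
  refine ⟨φ, ?_, hφ'⟩
  have h3 := hφ (e 1)
  have h2 : ((e 1 : (ℂ ∙ a)) : A) = a := one_smul ℂ a
  rw [h2] at h3
  rw [h3]
  simp [f]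

/-- Weak integrals are known only through functionals; this turns scalar estimates, uniform over the
functionals dominated by q, into an estimate for q without loss. -/
theorem seminorm_le_of_dual {q : Seminorm ℂ A} (hq : Continuous q) {a : A} {c : ℝ}
    (h : ∀ φ : A →L[ℂ] ℂ, (∀ x, ‖φ x‖ ≤ q x) → ‖φ a‖ ≤ c) : q a ≤ c := by
  obtain ⟨φ, h1, h2⟩ := exists_dual_eq_seminorm hq a
  have := h φ h2
  rwa [h1, Complex.norm_real, Real.norm_eq_abs, abs_of_nonneg (apply_nonneg q a)] at this

theorem tendsto_iff_seminorm {ι : Type*} {l : Filter ι} {f : ι → A} {a : A} :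
    Tendsto f l (𝓝 a) ↔
      ∀ q : Seminorm ℂ A, Continuous q → Tendsto (fun i => q (f i - a)) l (𝓝 0) := by
  constructor
  · intro h q hq
    have h1 : Tendsto (fun i => f i - a) l (𝓝 0) := by
      simpa using h.sub (tendsto_const_nhds (x := a))
    have h2 := (hq.tendsto 0).comp h1
    rwa [map_zero] at h2
  · intro h
    rw [(PolynormableSpace.withSeminorms ℂ A).tendsto_nhds]
    intro q ε hε
    exact (h q.1 q.2).eventually_lt_const hε

theorem eq_of_seminorm [T2Space A] {a b : A}
    (h : ∀ q : Seminorm ℂ A, Continuous q → q (a - b) = 0) : a = b := by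
  refine tendsto_nhds_unique (l := (pure () : Filter Unit)) (f := fun _ => a) ?_ ?_
  · exact tendsto_const_nhds
  · rw [tendsto_iff_seminorm]
    intro q hq
    simp [h q hq]

theorem eq_of_dual [T2Space A] {a b : A} (h : ∀ φ : A →L[ℂ] ℂ, φ a = φ b) : a = b := by
  refine eq_of_seminorm fun q hq => le_antisymm (seminorm_le_of_dual hq fun φ _ => ?_)
    (apply_nonneg _ _)
  simp [h φ]

theorem dual_seminorm_continuous (φ : A →L[ℂ] ℂ) :
    ∃ q : Seminorm ℂ A, Continuous q ∧ ∀ x, ‖φ x‖ ≤ q x :=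
  ⟨(normSeminorm ℂ ℂ).comp φ.toLinearMap, φ.continuous.norm, fun _ => le_rfl⟩

/-- A map into a locally convex space is bounded when all continuous seminorms are. -/
def SemBdd {X : Type*} (F : X → A) : Prop :=
  ∀ q : Seminorm ℂ A, Continuous q → ∃ C : ℝ, ∀ x, q (F x) ≤ C

theorem SemBdd.dual {X : Type*} {F : X → A} (h : SemBdd F) (φ : A →L[ℂ] ℂ) :
    ∃ C : ℝ, ∀ x, ‖φ (F x)‖ ≤ C := by
  obtain ⟨q, hq, hφ⟩ := dual_seminorm_continuous φ
  obtain ⟨C, hC⟩ := h q hq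
  exact ⟨C, fun x => (hφ _).trans (hC x)⟩

section WeakIntegral

variable {X : Type*} [TopologicalSpace X] [SecondCountableTopology X] [MeasurableSpace X]
  [BorelSpace X] {μ : Measure X}

theorem SemBdd.integrable_dual {F : X → A} (h : SemBdd F) (hF : Continuous F) {κ : X → ℂ}
    (hκ : Integrable κ μ) (φ : A →L[ℂ] ℂ) : Integrable (fun x => κ x * φ (F x)) μ := by
  obtain ⟨C, hC⟩ := h.dual φ
  exact hκ.mul_bdd (c := C) ((φ.continuous.comp hF).aestronglyMeasurable)
    (Eventually.of_forall hC)

/-- The range of F is separable, so F is a pointwise limit of simple functions with values in that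
range. Their integrals against κ form a Cauchy sequence by dominated convergence, seminorm by
seminorm, and completeness gives the vector. -/
theorem exists_weak_integral [CompleteSpace A] [FirstCountableTopology A]
    {κ : X → ℂ} (hκ : Integrable κ μ) {F : X → A} (hF : Continuous F) (hb : SemBdd F) :
    ∃ a : A, ∀ φ : A →L[ℂ] ℂ, φ a = ∫ x, κ x * φ (F x) ∂μ := by
  classical
  rcases isEmpty_or_nonempty X with hX | ⟨⟨x₀⟩⟩
  · exact ⟨0, fun φ => by simp [Measure.eq_zero_of_isEmpty μ]⟩
  -- A compatible pseudometric exists; it serves only to build the approximating simple functions.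
  have : (uniformity A).IsCountablyGenerated := IsUniformAddGroup.uniformity_countably_generated
  let : PseudoEMetricSpace A := (UniformSpace.pseudoMetricSpace A).toPseudoEMetricSpace
  let : MeasurableSpace A := borel A
  have : BorelSpace A := ⟨rfl⟩
  have hsep : TopologicalSpace.IsSeparable (Set.range F) := TopologicalSpace.isSeparable_range hF
  have : TopologicalSpace.SeparableSpace (Set.range F) := hsep.separableSpace
  let s : ℕ → SimpleFunc X A := fun n => SimpleFunc.approxOn F hF.measurable (Set.range F) (F x₀)
    ⟨x₀, rfl⟩ n
  have hs1 : ∀ n x, s n x ∈ Set.range F := fun n x => SimpleFunc.approxOn_mem _ _ _ _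
  have hs2 : ∀ x, Tendsto (fun n => s n x) atTop (𝓝 (F x)) := fun x =>
    SimpleFunc.tendsto_approxOn _ _ (subset_closure ⟨x, rfl⟩)
  let a : ℕ → A := fun n => ∑ v ∈ (s n).range, (∫ x in (s n) ⁻¹' {v}, κ x ∂μ) • v
  have ha : ∀ n (φ : A →L[ℂ] ℂ), φ (a n) = ∫ x, κ x * φ (s n x) ∂μ := by
    intro n φ
    have h1 : ∀ x, κ x * φ (s n x) =
        ∑ v ∈ (s n).range, ((s n) ⁻¹' {v}).indicator (fun x => κ x * φ v) x := by
      intro x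
      rw [Finset.sum_eq_single (s n x)]
      · simp
      · intro v _ hv
        simp [Set.indicator, Ne.symm hv]
      · intro h
        exact absurd (SimpleFunc.mem_range_self _ _) h
    simp_rw [h1]
    rw [integral_finsetSum]
    · simp only [a, map_sum, map_smul, smul_eq_mul]
      refine Finset.sum_congr rfl fun v _ => ?_
      rw [integral_indicator ((s n).measurableSet_preimage _), integral_mul_const]
    · intro v _
      exact (hκ.mul_const _).indicator ((s n).measurableSet_preimage _)
  have hsb : ∀ q : Seminorm ℂ A, Continuous q → ∃ C : ℝ, ∀ n x, q (s n x) ≤ C ∧ q (F x) ≤ C := by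
    intro q hq
    obtain ⟨C, hC⟩ := hb q hq
    refine ⟨C, fun n x => ⟨?_, hC x⟩⟩
    obtain ⟨y, hy⟩ := hs1 n x
    rw [← hy]; exact hC y
  have hconv : ∀ q : Seminorm ℂ A, Continuous q →
      Tendsto (fun n => ∫ x, ‖κ x‖ * q (s n x - F x) ∂μ) atTop (𝓝 0) := by
    intro q hq
    obtain ⟨C, hC⟩ := hsb q hq
    have : (0 : ℝ) = ∫ x, (0 : ℝ) ∂μ := by simp
    rw [this]
    refine tendsto_integral_of_dominated_convergence (fun x => ‖κ x‖ * (C + C)) ?_ ?_ ?_ ?_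
    · intro n
      refine hκ.1.norm.mul ?_
      have h1 : StronglyMeasurable (fun x => s n x - F x) :=
        (s n).stronglyMeasurable.sub hF.stronglyMeasurable
      exact (hq.comp_stronglyMeasurable h1).aestronglyMeasurable
    · exact hκ.norm.mul_const _
    · intro n
      refine Eventually.of_forall fun x => ?_
      rw [norm_mul, norm_norm, Real.norm_eq_abs, abs_of_nonneg (apply_nonneg _ _)]
      gcongr
      exact (map_sub_le_add q _ _).trans (add_le_add (hC n x).1 (hC n x).2)
    · refine Eventually.of_forall fun x => ?_
      have := ((tendsto_iff_seminorm (a := F x)).1 (hs2 x) q hq).const_mul ‖κ x‖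
      simpa using this
  have hint : ∀ (q : Seminorm ℂ A), Continuous q → ∀ n,
      Integrable (fun x => ‖κ x‖ * q (s n x - F x)) μ := by
    intro q hq n
    obtain ⟨C, hC⟩ := hsb q hq
    refine hκ.norm.mul_bdd (c := C + C) ?_ (Eventually.of_forall fun x => ?_)
    · have h1 : StronglyMeasurable (fun x => s n x - F x) :=
        (s n).stronglyMeasurable.sub hF.stronglyMeasurable
      exact (hq.comp_stronglyMeasurable h1).aestronglyMeasurable
    · rw [Real.norm_eq_abs, abs_of_nonneg (apply_nonneg _ _)]
      exact (map_sub_le_add q _ _).trans (add_le_add (hC n x).1 (hC n x).2)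
  have hsint : ∀ n (φ : A →L[ℂ] ℂ), Integrable (fun x => κ x * φ (s n x)) μ := by
    intro n φ
    obtain ⟨q, hq, hφ⟩ := dual_seminorm_continuous φ
    obtain ⟨C, hC⟩ := hsb q hq
    refine hκ.mul_bdd (c := C) ?_ (Eventually.of_forall fun x => (hφ _).trans (hC n x).1)
    exact (φ.continuous.comp_stronglyMeasurable (s n).stronglyMeasurable).aestronglyMeasurable
  -- The bound is the same for all φ dominated by q, which is what makes the sequence Cauchy for q
  -- and not merely weakly convergent.
  have hdiff : ∀ (q : Seminorm ℂ A), Continuous q → ∀ φ : A →L[ℂ] ℂ, (∀ x, ‖φ x‖ ≤ q x) → ∀ n,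
      ‖φ (a n) - ∫ x, κ x * φ (F x) ∂μ‖ ≤ ∫ x, ‖κ x‖ * q (s n x - F x) ∂μ := by
    intro q hq φ hφ n
    rw [ha, ← integral_sub (hsint n φ) (hb.integrable_dual hF hκ φ)]
    refine norm_integral_le_of_norm_le (hint q hq n) (Eventually.of_forall fun x => ?_)
    rw [← mul_sub, norm_mul, ← map_sub]
    gcongr
    exact hφ _
  have hcauchy : CauchySeq a := by
    rw [cauchySeq_iff_tendsto, uniformity_eq_comap_nhds_zero, tendsto_comap_iff,
      tendsto_iff_seminorm]
    intro q hq
    have h2 : Tendsto (fun x : ℕ × ℕ => (∫ y, ‖κ y‖ * q (s x.2 y - F y) ∂μ) +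
        ∫ y, ‖κ y‖ * q (s x.1 y - F y) ∂μ) atTop (𝓝 0) := by
      rw [← prod_atTop_atTop_eq]
      simpa using ((hconv q hq).comp tendsto_snd).add ((hconv q hq).comp tendsto_fst)
    refine squeeze_zero (fun _ => apply_nonneg _ _) (fun x => ?_) h2
    refine seminorm_le_of_dual hq fun φ hφ => ?_
    have e : φ (((fun x : A × A => x.2 - x.1) ∘ Prod.map a a) x - 0) =
        (φ (a x.2) - ∫ y, κ y * φ (F y) ∂μ) - (φ (a x.1) - ∫ y, κ y * φ (F y) ∂μ) := by
      simp
    rw [e]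
    exact (norm_sub_le _ _).trans (add_le_add (hdiff q hq φ hφ _) (hdiff q hq φ hφ _))
  obtain ⟨b, hb'⟩ := cauchySeq_tendsto_of_complete hcauchy
  refine ⟨b, fun φ => ?_⟩
  obtain ⟨q, hq, hφ⟩ := dual_seminorm_continuous φ
  refine tendsto_nhds_unique ((φ.continuous.tendsto b).comp hb') ?_
  rw [tendsto_iff_norm_sub_tendsto_zero]
  exact squeeze_zero (fun _ => norm_nonneg _) (fun n => hdiff q hq φ hφ n) (hconv q hq)

end WeakIntegral

theorem exists_seminorm_of_mem_nhds {U : Set A} (hU : U ∈ 𝓝 (0 : A)) :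
    ∃ q : Seminorm ℂ A, Continuous q ∧ ∀ x, q x < 1 → x ∈ U := by
  obtain ⟨s, r, hr, h⟩ := ((PolynormableSpace.withSeminorms ℂ A).mem_nhds_iff 0 U).1 hU
  set Q : Seminorm ℂ A := s.sup fun p : {p : Seminorm ℂ A // Continuous p} => p.1 with hQdef
  have hQ : Continuous Q := by
    refine Seminorm.continuous_of_continuousAt_zero ?_
    have h1 : ∀ i ∈ s, Tendsto (fun x => i.1 x) (𝓝 0) (𝓝 0) := fun i _ => by
      simpa using i.2.tendsto 0
    have h2 : Tendsto (fun x => ∑ i ∈ s, i.1 x) (𝓝 0) (𝓝 0) := by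
      simpa using tendsto_finsetSum s h1
    have h3 : ∀ x, Q x ≤ ∑ i ∈ s, i.1 x := fun x => by
      refine Seminorm.finset_sup_apply_le (Finset.sum_nonneg fun i _ => apply_nonneg _ _)
        fun i hi => ?_
      exact Finset.single_le_sum (f := fun i : {p : Seminorm ℂ A // Continuous p} => i.1 x)
        (fun i _ => apply_nonneg i.1 x) hi
    have := squeeze_zero (fun x => apply_nonneg Q x) h3 h2
    simpa [ContinuousAt] using this
  have hr' : ((r⁻¹).toNNReal : ℝ) = r⁻¹ := Real.coe_toNNReal _ (by positivity)
  refine ⟨(r⁻¹).toNNReal • Q, ?_, fun x hx => h ?_⟩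
  · exact (continuous_const (y := ((r⁻¹).toNNReal : ℝ))).mul hQ
  · have hx' : ((r⁻¹).toNNReal : ℝ) * Q x < 1 := hx
    rw [hr'] at hx'
    rw [Seminorm.mem_ball_zero]
    rwa [inv_mul_lt_iff₀ hr, mul_one] at hx'

/-- The closed graph theorem for Fréchet spaces. -/
theorem continuous_of_closed_graph [CompleteSpace A] [FirstCountableTopology A] (f : A →ₗ[ℂ] A)
    (hf : IsClosed {x : A × A | x.2 = f x.1}) : Continuous f := by
  have hcg : (uniformity A).IsCountablyGenerated := IsUniformAddGroup.uniformity_countably_generated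
  -- Baire: one of the covering closed sets has an interior point x. For y near 0 both x + (n+1)y
  -- and x lie in that closed set, and 2n(ε/3)/(n+1) < ε bounds q(f ·) on the rescaled difference.
  have key : ∀ (q : Seminorm ℂ A) (ε : ℝ), 0 < ε →
      closure {x | q (f x) < ε} ∈ 𝓝 (0 : A) := by
    intro q ε hε
    have hcov : (⋃ n : ℕ, closure {x : A | q (f x) ≤ n * (ε / 3)}) = Set.univ := by
      refine Set.eq_univ_of_forall fun x => Set.mem_iUnion.2 ?_
      obtain ⟨n, hn⟩ := exists_nat_ge (q (f x) / (ε / 3))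
      exact ⟨n, subset_closure ((div_le_iff₀ (by positivity)).1 hn)⟩
    obtain ⟨n, x, hx⟩ := nonempty_interior_of_iUnion_of_closed (fun _ => isClosed_closure) hcov
    rw [mem_interior_iff_mem_nhds] at hx
    have h1 : ∀ᶠ y in 𝓝 (0 : A), x + (n + 1 : ℂ) • y ∈ closure {x : A | q (f x) ≤ n * (ε / 3)} := by
      have : Tendsto (fun y : A => x + (n + 1 : ℂ) • y) (𝓝 0) (𝓝 x) := by
        have h : Continuous (fun y : A => x + (n + 1 : ℂ) • y) := by fun_prop
        simpa using h.tendsto 0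
      exact this hx
    have hx' := mem_of_mem_nhds hx
    filter_upwards [h1] with y hy
    have h3 : (n + 1 : ℂ) ≠ 0 := Nat.cast_add_one_ne_zero n
    have h2 : (n + 1 : ℂ)⁻¹ • ((x + (n + 1 : ℂ) • y) - x) ∈ closure {x | q (f x) < ε} := by
      refine map_mem_closure₂ (f := fun z w : A => (n + 1 : ℂ)⁻¹ • (z - w)) (by fun_prop) hy hx' ?_
      intro a ha b hb
      have ha' : q (f a) ≤ n * (ε / 3) := ha
      have hb' : q (f b) ≤ n * (ε / 3) := hb
      have h4 : ‖(n + 1 : ℂ)‖ = n + 1 := by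
        rw [← Nat.cast_add_one, Complex.norm_natCast, Nat.cast_add_one]
      change q (f ((n + 1 : ℂ)⁻¹ • (a - b))) < ε
      rw [map_smul, map_smul_eq_mul, norm_inv, h4, inv_mul_lt_iff₀ (by positivity), map_sub]
      have := map_sub_le_add q (f a) (f b)
      have hn : (0 : ℝ) ≤ n := Nat.cast_nonneg n
      nlinarith
    simpa [smul_smul, h3] using h2
  obtain ⟨V, hV⟩ := (𝓝 (0 : A)).exists_antitone_basis
  choose r hr hrV using fun n => exists_seminorm_of_mem_nhds (hV.1.mem_of_mem (i := n) trivial)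
  -- Successive approximation: subtract from z_n a vector y_n whose image has size below ε/2^n, so
  -- that z_n tends to 0. The images f(z_n) are Cauchy, the closed graph identifies their limit as
  -- f(0) = 0, and the geometric series bounds q(f x) by 2ε.
  have main : ∀ (q : Seminorm ℂ A), Continuous q → ∀ ε : ℝ, 0 < ε →
      ∀ᶠ x in 𝓝 (0 : A), q (f x) ≤ 2 * ε := by
    intro q hq ε hε
    -- Adding the first n+1 seminorms r_i, which control a neighbourhood basis, makes smallness for
    -- Q_n imply the Cauchy property in A and not only for q.
    let Q : ℕ → Seminorm ℂ A := fun n => q + ∑ i ∈ Finset.range (n + 1), r i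
    have hQapp : ∀ n x, Q n x = q x + ∑ i ∈ Finset.range (n + 1), r i x := by
      intro n x
      simp only [Q, add_apply]
      congr 1
      induction (Finset.range (n + 1)) using Finset.induction_on with
      | empty => simp
      | insert a s ha ih => simp [Finset.sum_insert ha, ih]
    have hQmono : ∀ {n m : ℕ} (x : A), n ≤ m → Q n x ≤ Q m x := by
      intro n m x h
      rw [hQapp, hQapp]
      gcongr
    have hQq : ∀ n x, q x ≤ Q n x := by
      intro n x
      rw [hQapp]
      exact le_add_of_nonneg_right (Finset.sum_nonneg fun i _ => apply_nonneg (r i) x)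
    have hQr : ∀ n x, r n x ≤ Q n x := by
      intro n x
      rw [hQapp]
      have : r n x ≤ ∑ i ∈ Finset.range (n + 1), r i x :=
        Finset.single_le_sum (f := fun i => r i x) (fun i _ => apply_nonneg (r i) x) (by simp)
      linarith [apply_nonneg q x]
    let U : ℕ → Set A := fun n => closure {x | Q n (f x) < ε / 2 ^ n}
    have hU : ∀ n, U n ∈ 𝓝 (0 : A) := fun n => key _ _ (by positivity)
    have step : ∀ n z, ∃ y, z ∈ U n → Q n (f y) < ε / 2 ^ n ∧ z - y ∈ U (n + 1) ∩ V (n + 1) := by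
      intro n z
      by_cases hz : z ∈ U n
      · have h1 : ∀ᶠ y in 𝓝 z, z - y ∈ U (n + 1) ∩ V (n + 1) := by
          have : Tendsto (fun y => z - y) (𝓝 z) (𝓝 0) := by
            have h : Continuous (fun y => z - y) := by fun_prop
            simpa using h.tendsto z
          exact this (inter_mem (hU _) (hV.1.mem_of_mem trivial))
        obtain ⟨y, hy1, hy2⟩ := ((mem_closure_iff_frequently.1 hz).and_eventually h1).exists
        exact ⟨y, fun _ => ⟨hy1, hy2⟩⟩
      · exact ⟨0, fun h => absurd h hz⟩
    choose g hg using step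
    filter_upwards [hU 0] with x hx
    let z : ℕ → A := fun n => Nat.rec x (fun k w => w - g k w) n
    have hz0 : z 0 = x := rfl
    have hzs : ∀ n, z (n + 1) = z n - g n (z n) := fun n => rfl
    have hzU : ∀ n, z n ∈ U n := by
      intro n
      induction n with
      | zero => exact hx
      | succ k ih => rw [hzs]; exact ((hg k _ ih).2).1
    have hzV : Tendsto z atTop (𝓝 0) := by
      rw [← tendsto_add_atTop_iff_nat 1]
      refine hV.1.tendsto_right_iff.2 fun i _ => ?_
      filter_upwards [eventually_ge_atTop i] with n hn
      rw [hzs]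
      exact hV.2 (by omega : i ≤ n + 1) ((hg n _ (hzU n)).2).2
    have hincr : ∀ n, Q n (f (z n) - f (z (n + 1))) < ε / 2 ^ n := by
      intro n
      rw [hzs, ← map_sub, sub_sub_cancel]
      exact (hg n _ (hzU n)).1
    have htail : ∀ n k, Q n (f (z n) - f (z (n + k))) ≤ 2 * ε / 2 ^ n - 2 * ε / 2 ^ (n + k) := by
      intro n k
      induction k with
      | zero => simp
      | succ k ih =>
        have h1 : f (z n) - f (z (n + (k + 1))) =
          (f (z n) - f (z (n + k))) + (f (z (n + k)) - f (z (n + k + 1))) := by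
          rw [← add_assoc]; abel
        rw [h1]
        refine (map_add_le_add (Q n) _ _).trans ?_
        have h2 := (hQmono (f (z (n + k)) - f (z (n + k + 1))) (by omega : n ≤ n + k)).trans
          (hincr (n + k)).le
        have h3 : 2 * ε / 2 ^ (n + (k + 1)) = ε / 2 ^ (n + k) := by
          rw [← add_assoc, pow_succ]; field_simp
        have h4 : 2 * ε / 2 ^ (n + k) = 2 * (ε / 2 ^ (n + k)) := by ring
        linarith
    have htail' : ∀ n k, n ≤ k → Q n (f (z n) - f (z k)) ≤ 2 * ε / 2 ^ n := by
      intro n k h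
      obtain ⟨j, rfl⟩ := Nat.exists_eq_add_of_le h
      have : 0 ≤ 2 * ε / 2 ^ (n + j) := by positivity
      linarith [htail n j]
    have hc : CauchySeq fun n => f (z n) := by
      refine cauchySeq_of_controlled (fun N => {x : A × A | Q N (x.1 - x.2) ≤ 4 * ε / 2 ^ N})
        ?_ ?_
      · intro s hs
        rw [uniformity_eq_comap_nhds_zero_swapped] at hs
        obtain ⟨t, ht, hts⟩ := hs
        obtain ⟨k, -, hk⟩ := hV.1.mem_iff.1 ht
        have hlim : Tendsto (fun N : ℕ => 4 * ε / 2 ^ N) atTop (𝓝 0) := by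
          have h1 := (tendsto_pow_atTop_nhds_zero_of_lt_one (r := (1 / 2 : ℝ)) (by norm_num)
            (by norm_num)).const_mul (4 * ε)
          simpa [div_eq_mul_inv] using h1
        obtain ⟨N, hN1, hN2⟩ := ((hlim.eventually_lt_const one_pos).and
          (eventually_ge_atTop k)).exists
        refine ⟨N, fun x hx => hts (hk (hrV k _ ?_))⟩
        exact ((hQr k _).trans (hQmono _ hN2)).trans_lt (lt_of_le_of_lt hx hN1)
      · intro N m n hm hn
        have h1 := htail' N m hm
        have h2 := htail' N n hn
        have h3 : f (z m) - f (z n) = (f (z N) - f (z n)) - (f (z N) - f (z m)) := by abel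
        change Q N (f (z m) - f (z n)) ≤ _
        rw [h3]
        refine (map_sub_le_add (Q N) _ _).trans ?_
        have h4 : 4 * ε / 2 ^ N = 2 * ε / 2 ^ N + 2 * ε / 2 ^ N := by ring
        linarith
    obtain ⟨w, hw⟩ := cauchySeq_tendsto_of_complete hc
    have hw0 : w = f 0 := hf.mem_of_tendsto (hzV.prodMk_nhds hw) (Eventually.of_forall fun n => rfl)
    rw [map_zero] at hw0
    have hlim : Tendsto (fun n => q (f (z 0) - f (z n))) atTop (𝓝 (q (f x))) := by
      have h1 := (hq.tendsto _).comp (hw.const_sub (f (z 0)))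
      rwa [hw0, sub_zero] at h1
    refine le_of_tendsto' hlim fun n => ?_
    have := (hQq 0 _).trans (htail' 0 n (Nat.zero_le n))
    simpa using this
  refine continuous_of_continuousAt_zero f ?_
  rw [ContinuousAt, map_zero, tendsto_iff_seminorm]
  intro q hq
  rw [Metric.tendsto_nhds]
  intro ε hε
  filter_upwards [main q hq (ε / 3) (by positivity)] with x hx
  rw [dist_zero_right, sub_zero, Real.norm_eq_abs, abs_of_nonneg (apply_nonneg _ _)]
  linarith

/-- Continuity of a bilinear product in terms of seminorms. -/
theorem exists_seminorm_mul {A : Type*} [NonUnitalRing A] [Module ℂ A] [IsScalarTower ℂ A A]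
    [SMulCommClass ℂ A A] [UniformSpace A] [IsUniformAddGroup A] [ContinuousSMul ℂ A]
    [PolynormableSpace ℂ A] [ContinuousMul A] {q : Seminorm ℂ A} (hq : Continuous q) :
    ∃ q' : Seminorm ℂ A, Continuous q' ∧ ∀ a b, q (a * b) ≤ q' a * q' b := by
  have h1 : {x : A × A | q (x.1 * x.2) < 1} ∈ 𝓝 ((0, 0) : A × A) := by
    have hc : Continuous (fun x : A × A => q (x.1 * x.2)) := hq.comp continuous_mul
    refine hc.continuousAt.eventually_lt_const ?_
    simp
  rw [nhds_prod_eq, mem_prod_self_iff] at h1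
  obtain ⟨U, hU, hUq⟩ := h1
  obtain ⟨q', hq', h'⟩ := exists_seminorm_of_mem_nhds hU
  refine ⟨q', hq', fun a b => ?_⟩
  -- Strict upper bounds s and t replace q'(a) and q'(b), which may vanish and cannot be divided by;
  -- the slack ε is removed at the end.
  have h2 : ∀ s t : ℝ, q' a < s → q' b < t → q (a * b) ≤ s * t := by
    intro s t hs ht
    have hs0 : 0 < s := (apply_nonneg _ _).trans_lt hs
    have ht0 : 0 < t := (apply_nonneg _ _).trans_lt ht
    have h3 : ∀ (c : A) (u : ℝ), 0 < u → q' c < u → q' ((u⁻¹ : ℂ) • c) < 1 := by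
      intro c u hu hc
      rw [map_smul_eq_mul, norm_inv, Complex.norm_real, Real.norm_eq_abs, abs_of_pos hu,
        inv_mul_lt_iff₀ hu, mul_one]
      exact hc
    have h4 : q (((s⁻¹ : ℂ) • a) * ((t⁻¹ : ℂ) • b)) < 1 :=
      hUq (Set.mk_mem_prod (h' _ (h3 a s hs0 hs)) (h' _ (h3 b t ht0 ht)))
    rw [smul_mul_smul_comm, map_smul_eq_mul, norm_mul, norm_inv, norm_inv, Complex.norm_real,
      Complex.norm_real, Real.norm_eq_abs, Real.norm_eq_abs, abs_of_pos hs0, abs_of_pos ht0,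
      ← mul_inv, inv_mul_lt_iff₀ (by positivity), mul_one] at h4
    exact h4.le
  have h5 : Tendsto (fun ε : ℝ => (q' a + ε) * (q' b + ε)) (𝓝[>] 0) (𝓝 (q' a * q' b)) := by
    have hc : Continuous (fun ε : ℝ => (q' a + ε) * (q' b + ε)) := by fun_prop
    simpa using (hc.tendsto 0).mono_left nhdsWithin_le_nhds
  refine ge_of_tendsto h5 ?_
  filter_upwards [self_mem_nhdsWithin] with ε hε
  have hε' : (0 : ℝ) < ε := hε
  exact h2 _ _ (by linarith) (by linarith)

/-- A uniformly bounded family of continuous maps is dominated by a continuous seminorm. -/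
theorem exists_seminorm_forall_le [BarrelledSpace ℂ A] {ι : Type*} (T : ι → A →L[ℂ] A)
    (hT : ∀ a, SemBdd fun i => T i a) {q : Seminorm ℂ A} (hq : Continuous q) :
    ∃ q' : Seminorm ℂ A, Continuous q' ∧ ∀ i a, q (T i a) ≤ q' a := by
  let Q : ι → Seminorm ℂ A := fun i => q.comp (T i).toLinearMap
  have hb : BddAbove (Set.range Q) := by
    rw [Seminorm.bddAbove_range_iff]
    intro a
    obtain ⟨C, hC⟩ := hT a q hq
    exact ⟨C, by rintro _ ⟨i, rfl⟩; exact hC i⟩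
  -- In a barrelled space a pointwise bounded supremum of continuous seminorms is continuous.
  refine ⟨⨆ i, Q i, ?_, fun i a => ?_⟩
  · rw [Seminorm.coe_iSup_eq hb]
    exact Seminorm.continuous_iSup Q (fun i => hq.comp (T i).continuous) hb
  · exact (le_ciSup hb i : Q i ≤ ⨆ i, Q i) a

end LocallyConvex

/-! ### Gradings by ℤ/2 and the parity automorphism. -/

section Parity

variable {V : Type*} [AddCommGroup V] [Module ℂ V] (G : Supergrading V)

theorem ksign_zero : ksign 0 = 1 := by simp [ksign]

theorem ksign_one : ksign 1 = -1 := by simp [ksign, ZMod.val_one]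

theorem zmod_two_cases (i : ZMod 2) : i = 0 ∨ i = 1 := by
  fin_cases i
  · exact Or.inl rfl
  · exact Or.inr rfl

theorem ksign_add (i j : ZMod 2) : ksign (i + j) = ksign i * ksign j := by
  have h : (1 + 1 : ZMod 2) = 0 := rfl
  rcases zmod_two_cases i with rfl | rfl <;> rcases zmod_two_cases j with rfl | rfl <;>
    simp [h, ksign_zero, ksign_one]

theorem ksign_mul_self (i : ZMod 2) : ksign i * ksign i = 1 := by
  rcases zmod_two_cases i with rfl | rfl <;> simp [ksign_zero, ksign_one]

theorem ksign_natCast (k : ℕ) : ksign (k : ZMod 2) = (-1) ^ k := by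
  induction k with
  | zero => simp [ksign_zero]
  | succ k ih => rw [Nat.cast_succ, ksign_add, ih, ksign_one, pow_succ]

theorem conj_ksign (i : ZMod 2) : conj (ksign i) = ksign i := by
  rcases zmod_two_cases i with rfl | rfl <;> simp [ksign_zero, ksign_one]

namespace Supergrading

@[simp] theorem part_zero : G.part 0 = G.even := by simp [part]

@[simp] theorem part_one : G.part 1 = G.odd := by simp [part]

theorem parity_of_mem_part {i : ZMod 2} {v : V} (h : v ∈ G.part i) : G.parity v = ksign i • v := by
  rcases zmod_two_cases i with rfl | rfl
  · rw [part_zero] at h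
    simp [parity, ksign_zero, Submodule.projection_apply_of_mem_left _ h,
      (Submodule.projection_apply_eq_zero_iff G.isCompl.symm).2 h]
  · rw [part_one] at h
    simp [parity, ksign_one, Submodule.projection_apply_of_mem_left _ h,
      (Submodule.projection_apply_eq_zero_iff G.isCompl).2 h]

theorem exists_add (v : V) : ∃ v₀ ∈ G.even, ∃ v₁ ∈ G.odd, v₀ + v₁ = v :=
  Submodule.mem_sup.1 (G.isCompl.sup_eq_top ▸ Submodule.mem_top)

theorem parity_add {v₀ v₁ : V} (h₀ : v₀ ∈ G.even) (h₁ : v₁ ∈ G.odd) :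
    G.parity (v₀ + v₁) = v₀ - v₁ := by
  rw [map_add, G.parity_of_mem_part (i := 0) (by simpa), G.parity_of_mem_part (i := 1) (by simpa),
    ksign_zero, ksign_one]
  module

@[simp] theorem parity_parity (v : V) : G.parity (G.parity v) = v := by
  obtain ⟨a, ha, b, hb, rfl⟩ := G.exists_add v
  rw [G.parity_add ha hb, sub_eq_add_neg, G.parity_add ha (neg_mem hb), sub_neg_eq_add]

/-- Since 2 is invertible, the homogeneous subspaces are exactly the eigenspaces of the parity;
degree questions become identities between operators. -/
theorem mem_part_iff {i : ZMod 2} {v : V} : v ∈ G.part i ↔ G.parity v = ksign i • v := by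
  refine ⟨G.parity_of_mem_part, fun h => ?_⟩
  obtain ⟨a, ha, b, hb, rfl⟩ := G.exists_add v
  rw [G.parity_add ha hb] at h
  rcases zmod_two_cases i with rfl | rfl
  · rw [ksign_zero, one_smul] at h
    have h2 : (2 : ℂ) • b = 0 := by
      have : (2 : ℂ) • b = (a + b) - (a - b) := by module
      rw [this, h, sub_self]
    rw [smul_eq_zero_iff_right two_ne_zero] at h2
    simpa [h2] using ha
  · rw [ksign_one] at h
    have h2 : (2 : ℂ) • a = 0 := by
      have : (2 : ℂ) • a = (a - b) - (-1 : ℂ) • (a + b) := by module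
      rw [this, h, sub_self]
    rw [smul_eq_zero_iff_right two_ne_zero] at h2
    simpa [h2] using hb

theorem parity_eq_id (h : G.odd = ⊥) (v : V) : G.parity v = v := by
  obtain ⟨a, ha, b, hb, rfl⟩ := G.exists_add v
  rw [G.parity_add ha hb]
  rw [h, Submodule.mem_bot] at hb
  simp [hb]

theorem parity_mul {A : Type*} [NonUnitalRing A] [Module ℂ A] {G : Supergrading A}
    (hG : G.IsAlgebraGrading) (a b : A) : G.parity (a * b) = G.parity a * G.parity b := by
  obtain ⟨a₀, ha₀, a₁, ha₁, rfl⟩ := G.exists_add a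
  obtain ⟨b₀, hb₀, b₁, hb₁, rfl⟩ := G.exists_add b
  rw [G.parity_add ha₀ ha₁, G.parity_add hb₀ hb₁]
  have h00 := hG 0 0 a₀ b₀ (by simpa) (by simpa)
  have h01 := hG 0 1 a₀ b₁ (by simpa) (by simpa)
  have h10 := hG 1 0 a₁ b₀ (by simpa) (by simpa)
  have h11 := hG 1 1 a₁ b₁ (by simpa) (by simpa)
  have e : (1 + 1 : ZMod 2) = 0 := rfl
  simp only [e, zero_add, add_zero, part_zero, part_one] at h00 h01 h10 h11
  have : (a₀ + a₁) * (b₀ + b₁) = (a₀ * b₀ + a₁ * b₁) + (a₀ * b₁ + a₁ * b₀) := by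
    simp only [add_mul, mul_add]; abel
  rw [this, G.parity_add (add_mem h00 h11) (add_mem h01 h10)]
  simp only [sub_mul, mul_sub]; abel

/-- Closed graph theorem: (x, y) is on the graph exactly when x + y is even and x - y is odd, a
closed condition. -/
theorem parity_continuous {A : Type*} [AddCommGroup A] [Module ℂ A] [UniformSpace A]
    [IsUniformAddGroup A] [ContinuousSMul ℂ A] [PolynormableSpace ℂ A] [CompleteSpace A]
    [FirstCountableTopology A] (G : Supergrading A) (h0 : IsClosed (G.even : Set A))
    (h1 : IsClosed (G.odd : Set A)) : Continuous G.parity := by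
  refine continuous_of_closed_graph _ ?_
  have : {x : A × A | x.2 = G.parity x.1} =
      (fun x : A × A => x.1 + x.2) ⁻¹' (G.even : Set A) ∩
        (fun x : A × A => x.1 - x.2) ⁻¹' (G.odd : Set A) := by
    ext ⟨x, y⟩
    simp only [Set.mem_ofPred_eq, Set.mem_inter_iff, Set.mem_preimage, SetLike.mem_coe]
    obtain ⟨a, ha, b, hb, rfl⟩ := G.exists_add x
    rw [G.parity_add ha hb]
    constructor
    · rintro rfl
      refine ⟨?_, ?_⟩
      · have : a + b + (a - b) = a + a := by abel
        rw [this]; exact add_mem ha ha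
      · have : a + b - (a - b) = b + b := by abel
        rw [this]; exact add_mem hb hb
    · rintro ⟨h, h'⟩
      have h2 : b + y ∈ G.even := by
        have : b + y = (a + b + y) - a := by abel
        rw [this]; exact sub_mem h ha
      have h3 : a - y ∈ G.odd := by
        have : a - y = (a + b - y) - b := by abel
        rw [this]; exact sub_mem h' hb
      have h4 : a - b - y ∈ G.even := by
        have : a - b - y = a - (b + y) := by abel
        rw [this]; exact sub_mem ha h2
      have h5 : a - b - y ∈ G.odd := by
        have : a - b - y = (a - y) - b := by abel
        rw [this]; exact sub_mem h3 hb
      exact (sub_eq_zero.1 (Submodule.disjoint_def.1 G.isCompl.disjoint _ h4 h5)).symm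
  rw [this]
  exact (h0.preimage (by fun_prop)).inter (h1.preimage (by fun_prop))

end Supergrading

end Parity

/-! ### Scalar kernels on the body -/

section Scalar

/-- The unitary character `r ↦ e^{ir}`. -/
def cis (r : ℝ) : ℂ := Complex.exp (r * Complex.I)

@[simp] theorem norm_cis (r : ℝ) : ‖cis r‖ = 1 := Complex.norm_exp_ofReal_mul_I r

@[simp] theorem cis_zero : cis 0 = 1 := by simp [cis]

theorem cis_add (r s : ℝ) : cis (r + s) = cis r * cis s := by
  simp [cis, add_mul, Complex.exp_add]

theorem conj_cis (r : ℝ) : conj (cis r) = cis (-r) := by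
  simp [cis, ← Complex.exp_conj]

theorem continuous_cis : Continuous cis := by unfold cis; fun_prop

@[fun_prop] theorem Continuous.cis' {X : Type*} [TopologicalSpace X] {f : X → ℝ}
    (hf : Continuous f) : Continuous fun x => cis (f x) := continuous_cis.comp hf

theorem cis_sum {ι : Type*} (s : Finset ι) (f : ι → ℝ) : cis (∑ i ∈ s, f i) = ∏ i ∈ s, cis (f i) := by
  simp [cis, Finset.sum_mul, Complex.exp_sum]

/-- The density `t³ e^{-t} / 6` of the Gamma distribution. -/
def gam (t : ℝ) : ℝ := if 0 < t then t ^ 3 * Real.exp (-t) / 6 else 0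

theorem gam_nonneg (t : ℝ) : 0 ≤ gam t := by
  unfold gam; split_ifs <;> positivity

theorem integrableOn_pow_mul_exp (k : ℕ) :
    IntegrableOn (fun t : ℝ => t ^ k * Real.exp (-t)) (Set.Ioi 0) := by
  have h := Real.GammaIntegral_convergent (s := k + 1) (by positivity)
  refine h.congr_fun (fun t _ => ?_) measurableSet_Ioi
  simp [mul_comm]

theorem integrable_gam_mul_pow (k : ℕ) : Integrable fun t => gam t * t ^ k := by
  have : (fun t => gam t * t ^ k) =
      (Set.Ioi 0).indicator fun t => t ^ (k + 3) * Real.exp (-t) / 6 := by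
    ext t
    simp only [gam, Set.indicator, Set.mem_Ioi]
    split_ifs
    · ring
    · simp
  rw [this, integrable_indicator_iff measurableSet_Ioi]
  exact (integrableOn_pow_mul_exp _).div_const 6

theorem integrable_gam : Integrable gam := by simpa using integrable_gam_mul_pow 0

/-- The weight `1 / (1 + t²)`. -/
def wt (t : ℝ) : ℝ := (1 + t ^ 2)⁻¹

theorem wt_pos (t : ℝ) : 0 < wt t := by unfold wt; positivity

theorem wt_le_one (t : ℝ) : wt t ≤ 1 := by
  unfold wt; exact inv_le_one_of_one_le₀ (by nlinarith [sq_nonneg t])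

@[fun_prop] theorem continuous_wt : Continuous wt := by
  unfold wt
  exact Continuous.inv₀ (by fun_prop) fun t => by positivity

theorem integrable_wt : Integrable wt := integrable_inv_one_add_sq

/-- Peetre's inequality costs a factor 1 / `wt`; the exponential in `gam` absorbs it. -/
theorem integrable_gam_div : Integrable fun t => gam t * ((wt t)⁻¹) ^ 2 := by
  have : (fun t => gam t * ((wt t)⁻¹) ^ 2) =
      fun t => gam t * t ^ 0 + 2 * (gam t * t ^ 2) + gam t * t ^ 4 := by
    ext t; simp only [wt, inv_inv]; ring
  rw [this]
  exact ((integrable_gam_mul_pow 0).add ((integrable_gam_mul_pow 2).const_mul 2)).add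
    (integrable_gam_mul_pow 4)

theorem integrableOn_pow_mul_exp_mul (k : ℕ) {f : ℝ → ℂ} (hf : Continuous f) {C : ℝ}
    (hC : ∀ t, ‖f t‖ ≤ C) :
    IntegrableOn (fun t : ℝ => ((t ^ k * Real.exp (-t) : ℝ) : ℂ) * f t) (Set.Ioi 0) :=
  (integrableOn_pow_mul_exp k).ofReal.mul_bdd (c := C) hf.aestronglyMeasurable
    (Eventually.of_forall hC)

theorem tendsto_pow_mul_exp_mul (k : ℕ) {f : ℝ → ℂ} {C : ℝ} (hC : ∀ t, ‖f t‖ ≤ C) :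
    Tendsto (fun t : ℝ => ((t ^ k * Real.exp (-t) : ℝ) : ℂ) * f t) atTop (𝓝 0) := by
  refine squeeze_zero_norm' ?_ (by simpa using
    (Real.tendsto_pow_mul_exp_neg_atTop_nhds_zero k).mul_const C)
  filter_upwards [eventually_ge_atTop 0] with t ht
  rw [norm_mul, Complex.norm_real, Real.norm_eq_abs, abs_of_nonneg (by positivity)]
  gcongr
  exact hC t

/-- Integration by parts against `e^{-t}`. -/
theorem integral_exp_mul_sub_deriv {f g : ℝ → ℂ} (hg : Continuous g) {C : ℝ}
    (hfC : ∀ t, ‖f t‖ ≤ C) (hgC : ∀ t, ‖g t‖ ≤ C) (h : ∀ t, HasDerivAt f (f t - g t) t) :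
    ∫ t in Set.Ioi (0 : ℝ), ((t ^ 0 * Real.exp (-t) : ℝ) : ℂ) * g t = f 0 := by
  have h1 : ∀ t : ℝ, HasDerivAt (fun t : ℝ => ((Real.exp (-t) : ℝ) : ℂ) * f t)
      (-(((t ^ 0 * Real.exp (-t) : ℝ) : ℂ) * g t)) t := by
    intro t
    have h2 : HasDerivAt (fun t : ℝ => ((Real.exp (-t) : ℝ) : ℂ)) ((-Real.exp (-t) : ℝ) : ℂ) t := by
      have := ((hasDerivAt_neg t).exp).ofReal_comp
      simpa using this
    refine (h2.mul (h t)).congr_deriv ?_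
    push_cast; ring
  have h3 := integral_Ioi_of_hasDerivAt_of_tendsto (a := (0 : ℝ))
    (h1 0).continuousAt.continuousWithinAt (fun t _ => h1 t)
    (integrableOn_pow_mul_exp_mul 0 hg hgC).neg (by simpa using tendsto_pow_mul_exp_mul 0 hfC)
  rw [integral_neg] at h3
  simpa using h3

theorem integral_pow_mul_exp_mul_sub_deriv (k : ℕ) {f g : ℝ → ℂ} (hf : Continuous f)
    (hg : Continuous g) {C : ℝ} (hfC : ∀ t, ‖f t‖ ≤ C) (hgC : ∀ t, ‖g t‖ ≤ C)
    (h : ∀ t, HasDerivAt f (f t - g t) t) :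
    ∫ t in Set.Ioi (0 : ℝ), ((t ^ (k + 1) * Real.exp (-t) : ℝ) : ℂ) * g t =
      (k + 1) * ∫ t in Set.Ioi (0 : ℝ), ((t ^ k * Real.exp (-t) : ℝ) : ℂ) * f t := by
  have h1 : ∀ t : ℝ, HasDerivAt (fun t : ℝ => ((t ^ (k + 1) * Real.exp (-t) : ℝ) : ℂ) * f t)
      ((k + 1) * (((t ^ k * Real.exp (-t) : ℝ) : ℂ) * f t) -
        ((t ^ (k + 1) * Real.exp (-t) : ℝ) : ℂ) * g t) t := by
    intro t
    have h2 : HasDerivAt (fun t : ℝ => ((t ^ (k + 1) * Real.exp (-t) : ℝ) : ℂ))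
        (((k + 1) * t ^ k * Real.exp (-t) - t ^ (k + 1) * Real.exp (-t) : ℝ) : ℂ) t := by
      have := ((hasDerivAt_pow (k + 1) t).mul (hasDerivAt_neg t).exp).ofReal_comp
      refine this.congr_deriv ?_
      push_cast; simp; ring
    refine (h2.mul (h t)).congr_deriv ?_
    push_cast; ring
  have hi1 := (integrableOn_pow_mul_exp_mul k hf hfC).const_mul (k + 1 : ℂ)
  have hi2 := integrableOn_pow_mul_exp_mul (k + 1) hg hgC
  have h3 := integral_Ioi_of_hasDerivAt_of_tendsto (a := (0 : ℝ))
    (h1 0).continuousAt.continuousWithinAt (fun t _ => h1 t)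
    (hi1.sub hi2) (tendsto_pow_mul_exp_mul (k + 1) hfC)
  rw [integral_sub hi1 hi2, integral_const_mul] at h3
  simp only [ne_eq, Nat.add_eq_zero_iff, one_ne_zero, and_false, not_false_eq_true, zero_pow,
    zero_mul, Complex.ofReal_zero, sub_zero] at h3
  exact (sub_eq_zero.1 h3).symm

/-- With f_{k+1} = (1 - d/dt) f_k, four integrations by parts against t³e^{-t} lead back to f_0(0);
the factors 3, 2, 1 cancel the 6. Thus `gam` inverts (1 - d/dt)^4 on bounded functions. -/
theorem integral_gam_mul {f : ℕ → ℝ → ℂ} (hf : ∀ k, Continuous (f k)) {C : ℝ}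
    (hC : ∀ k ≤ 4, ∀ t, ‖f k t‖ ≤ C)
    (h : ∀ k t, HasDerivAt (f k) (f k t - f (k + 1) t) t) :
    ∫ t, (gam t : ℂ) * f 4 t = f 0 0 := by
  have h0 := integral_exp_mul_sub_deriv (hf 1) (hC 0 (by norm_num)) (hC 1 (by norm_num)) (h 0)
  have h1 := integral_pow_mul_exp_mul_sub_deriv 0 (hf 1) (hf 2) (hC 1 (by norm_num))
    (hC 2 (by norm_num)) (h 1)
  have h2 := integral_pow_mul_exp_mul_sub_deriv 1 (hf 2) (hf 3) (hC 2 (by norm_num))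
    (hC 3 (by norm_num)) (h 2)
  have h3 := integral_pow_mul_exp_mul_sub_deriv 2 (hf 3) (hf 4) (hC 3 (by norm_num))
    (hC 4 (by norm_num)) (h 3)
  have h4 : ∫ t, (gam t : ℂ) * f 4 t =
      ∫ t in Set.Ioi (0 : ℝ), (((t ^ (2 + 1) * Real.exp (-t) : ℝ) : ℂ) * f 4 t) / 6 := by
    rw [← integral_indicator measurableSet_Ioi]
    congr 1
    ext t
    simp only [gam, Set.indicator, Set.mem_Ioi]
    split_ifs with ht
    · push_cast; ring
    · simp
  rw [h4, integral_div, h3, h2, h1, h0]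
  push_cast; ring

theorem norm_one_sub_sq (u : ℝ) : ‖1 - (u : ℂ) * Complex.I‖ ^ 2 = 1 + u ^ 2 := by
  rw [← Complex.normSq_eq_norm_sq, Complex.normSq_apply]
  simp; ring

/-- A character is an eigenfunction of 1 - d/dt with eigenvalue 1 - iu, so `integral_gam_mul`
applies to its multiples by powers of this eigenvalue. -/
theorem integral_gam_cis (u : ℝ) : ∫ t, (gam t : ℂ) * cis (u * t) = (1 / (1 - u * Complex.I)) ^ 4 := by
  have h0 : (1 - u * Complex.I) ≠ 0 := by
    intro h
    have := norm_one_sub_sq u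
    rw [h] at this
    have h2 : 0 < 1 + u ^ 2 := by positivity
    simp at this; linarith
  have h1 := integral_gam_mul (f := fun k t => (1 - u * Complex.I) ^ k * cis (u * t))
    (fun k => by fun_prop) (C := ∑ k ∈ Finset.range 5, ‖(1 - u * Complex.I) ^ k‖) ?_ ?_
  · have h2 : ∀ t : ℝ, (gam t : ℂ) * ((1 - u * Complex.I) ^ 4 * cis (u * t)) =
      (1 - u * Complex.I) ^ 4 * ((gam t : ℂ) * cis (u * t)) := fun t => by ring
    simp only [h2] at h1
    rw [integral_const_mul] at h1
    simp only [pow_zero, mul_zero, cis_zero, mul_one] at h1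
    rw [div_pow, one_pow, eq_div_iff (pow_ne_zero _ h0), mul_comm]
    exact h1
  · intro k hk t
    rw [norm_mul, norm_cis, mul_one]
    exact Finset.single_le_sum (f := fun k => ‖(1 - u * Complex.I) ^ k‖)
      (fun _ _ => norm_nonneg _) (by simp; omega)
  · intro k t
    have h3 : HasDerivAt (fun t : ℝ => cis (u * t)) (u * Complex.I * cis (u * t)) t := by
      have h4 : HasDerivAt (fun t : ℝ => ((u * t : ℝ) : ℂ) * Complex.I) (u * Complex.I) t := by
        have := (((hasDerivAt_id t).const_mul u).ofReal_comp).mul_const Complex.I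
        simpa using this
      refine h4.cexp.congr_deriv ?_
      simp only [cis]; ring
    refine (h3.const_mul _).congr_deriv ?_
    ring

/-- The order 4 is chosen so that the square of `wt` appears here: half of this decay is given up
below, in geometric means of bounds in two variables, and `wt` itself is still integrable. -/
theorem norm_integral_gam_cis (u : ℝ) : ‖∫ t, (gam t : ℂ) * cis (u * t)‖ = wt u ^ 2 := by
  rw [integral_gam_cis]
  rw [norm_pow, norm_div, norm_one, wt, ← norm_one_sub_sq]
  field_simp

/-- Peetre's inequality. -/
theorem wt_peetre {c : ℝ} (hc : c ≠ 0) (s t : ℝ) :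
    wt (c * (s - t)) ≤ 2 * (1 + (c⁻¹) ^ 2) * wt s * (wt t)⁻¹ := by
  unfold wt
  rw [inv_inv]
  have h0 : 0 < 1 + s ^ 2 := by positivity
  have h1 : 0 < 1 + (c * (s - t)) ^ 2 := by positivity
  rw [inv_eq_one_div, div_le_iff₀ h1]
  have h2 : (2 * (1 + c⁻¹ ^ 2) * (1 + s ^ 2)⁻¹ * (1 + t ^ 2) * (1 + (c * (s - t)) ^ 2)) =
      (2 * (1 + c⁻¹ ^ 2) * (1 + t ^ 2) * (1 + (c * (s - t)) ^ 2)) / (1 + s ^ 2) := by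
    field_simp
  rw [h2, le_div_iff₀ h0, one_mul]
  have h3 : (s - t) ^ 2 = c⁻¹ ^ 2 * (c * (s - t)) ^ 2 := by field_simp
  have h4 : 1 + (s - t) ^ 2 ≤ (1 + c⁻¹ ^ 2) * (1 + (c * (s - t)) ^ 2) := by
    rw [h3]
    nlinarith [sq_nonneg c⁻¹, sq_nonneg (c * (s - t))]
  have h5 : 1 + s ^ 2 ≤ 2 * (1 + t ^ 2) * (1 + (s - t) ^ 2) := by
    nlinarith [sq_nonneg (s - t - t), sq_nonneg (t * (s - t)), sq_nonneg (s-t), sq_nonneg t]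
  calc 1 + s ^ 2 ≤ 2 * (1 + t ^ 2) * (1 + (s - t) ^ 2) := h5
    _ ≤ 2 * (1 + t ^ 2) * ((1 + c⁻¹ ^ 2) * (1 + (c * (s - t)) ^ 2)) := by gcongr
    _ = _ := by ring

end Scalar

/-! ### Product weights and the symplectic Fourier transform on ℝ^{2m}. -/

section Body

variable {m : ℕ}

/-- The product `∏ f(q_i) ∏ f(p_i)`. -/
def bprod {R : Type*} [CommMonoid R] (f : ℝ → R) (x : Body m) : R :=
  (∏ i, f (x.1 i)) * ∏ i, f (x.2 i)

theorem integrable_bprod_aux {𝕜 : Type*} [RCLike 𝕜] {f g : Fin m → ℝ → 𝕜}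
    (hf : ∀ i, Integrable (f i)) (hg : ∀ i, Integrable (g i)) :
    Integrable fun x : Body m => (∏ i, f i (x.1 i)) * ∏ i, g i (x.2 i) :=
  (Integrable.fintype_prod hf).mul_prod (Integrable.fintype_prod hg)

theorem integral_bprod_aux {𝕜 : Type*} [RCLike 𝕜] (f g : Fin m → ℝ → 𝕜) :
    ∫ x : Body m, (∏ i, f i (x.1 i)) * ∏ i, g i (x.2 i) =
      (∏ i, ∫ t, f i t) * ∏ i, ∫ t, g i t := by
  rw [Measure.volume_eq_prod, integral_prod_mul (fun x : Fin m → ℝ => ∏ i, f i (x i))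
    (fun x : Fin m → ℝ => ∏ i, g i (x i)), integral_fintype_prod_volume_eq_prod,
    integral_fintype_prod_volume_eq_prod]

theorem integrable_bprod {f : ℝ → ℝ} (hf : Integrable f) :
    Integrable (bprod f : Body m → ℝ) := integrable_bprod_aux (fun _ => hf) fun _ => hf

theorem bprod_nonneg {f : ℝ → ℝ} (hf : ∀ t, 0 ≤ f t) (x : Body m) : 0 ≤ bprod f x :=
  mul_nonneg (Finset.prod_nonneg fun _ _ => hf _) (Finset.prod_nonneg fun _ _ => hf _)

theorem bprod_le {f g : ℝ → ℝ} {x y : Body m} (hf : ∀ t, 0 ≤ f t)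
    (h1 : ∀ i, f (x.1 i) ≤ g (y.1 i)) (h2 : ∀ i, f (x.2 i) ≤ g (y.2 i)) : bprod f x ≤ bprod g y :=
  mul_le_mul (Finset.prod_le_prod (fun _ _ => hf _) fun i _ => h1 i)
    (Finset.prod_le_prod (fun _ _ => hf _) fun i _ => h2 i) (Finset.prod_nonneg fun _ _ => hf _)
    (Finset.prod_nonneg fun i _ => (hf _).trans (h1 i))

@[fun_prop] theorem continuous_bprod {R : Type*} [CommMonoid R] [TopologicalSpace R]
    [ContinuousMul R] {f : ℝ → R} (hf : Continuous f) : Continuous (bprod f : Body m → R) := by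
  unfold bprod; fun_prop

/-- The density of the product of Gamma distributions. -/
def gamB (x : Body m) : ℝ := bprod gam x

theorem gamB_nonneg (x : Body m) : 0 ≤ gamB x := bprod_nonneg gam_nonneg x

theorem integrable_gamB : Integrable (gamB : Body m → ℝ) := integrable_bprod integrable_gam

/-- The weight `∏ 1 / (1 + x_j²)`. -/
def wtB (x : Body m) : ℝ := bprod wt x

theorem wtB_pos (x : Body m) : 0 < wtB x :=
  mul_pos (Finset.prod_pos fun _ _ => wt_pos _) (Finset.prod_pos fun _ _ => wt_pos _)

theorem wtB_le_one (x : Body m) : wtB x ≤ 1 :=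
  mul_le_one₀ (Finset.prod_le_one (fun _ _ => (wt_pos _).le) fun _ _ => wt_le_one _)
    (Finset.prod_nonneg fun _ _ => (wt_pos _).le)
    (Finset.prod_le_one (fun _ _ => (wt_pos _).le) fun _ _ => wt_le_one _)

@[fun_prop] theorem continuous_wtB : Continuous (wtB : Body m → ℝ) := continuous_bprod continuous_wt

theorem integrable_wtB : Integrable (wtB : Body m → ℝ) := integrable_bprod integrable_wt

theorem wtB_neg (x : Body m) : wtB (-x) = wtB x := by simp [wtB, bprod, wt]

theorem wtB_peetre {c : ℝ} (hc : c ≠ 0) : ∃ C : ℝ, 0 ≤ C ∧ ∀ s t : Body m,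
    wtB (c • (s - t)) ≤ C * wtB s * (wtB t)⁻¹ := by
  refine ⟨(2 * (1 + (c⁻¹) ^ 2)) ^ m * (2 * (1 + (c⁻¹) ^ 2)) ^ m, by positivity, fun s t => ?_⟩
  have h : ∀ s t : Fin m → ℝ, ∏ i, wt (c * (s i - t i)) ≤
      (2 * (1 + (c⁻¹) ^ 2)) ^ m * (∏ i, wt (s i)) * (∏ i, wt (t i))⁻¹ := by
    intro s t
    refine (Finset.prod_le_prod (fun _ _ => (wt_pos _).le) fun i _ => wt_peetre hc _ _).trans_eq ?_
    rw [Finset.prod_mul_distrib, Finset.prod_mul_distrib, Finset.prod_inv_distrib]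
    simp
  have hp : ∀ s : Fin m → ℝ, 0 < ∏ i, wt (s i) := fun s => Finset.prod_pos fun _ _ => wt_pos _
  have h1 := mul_le_mul (h s.1 t.1) (h s.2 t.2)
    (Finset.prod_nonneg fun _ _ => (wt_pos _).le)
    (by have := hp s.1; have := hp t.1; positivity)
  refine (le_of_eq ?_).trans (h1.trans_eq ?_)
  · simp [wtB, bprod]
  · simp only [wtB, bprod, mul_inv]; ring

theorem integrable_gamB_div : Integrable fun y : Body m => gamB y * ((wtB y)⁻¹) ^ 2 := by
  have : (fun y : Body m => gamB y * ((wtB y)⁻¹) ^ 2) = bprod fun t => gam t * ((wt t)⁻¹) ^ 2 := by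
    ext y
    simp only [gamB, wtB, bprod, Finset.prod_mul_distrib, Finset.prod_pow, Finset.prod_inv_distrib,
      mul_inv]
    ring
  rw [this]
  exact integrable_bprod integrable_gam_div

/-- A convolution with the Gamma density preserves the decay. -/
theorem integral_gamB_mul_wtB_sq_le {c : ℝ} (hc : c ≠ 0) : ∃ C : ℝ, 0 ≤ C ∧ ∀ s : Body m,
    Integrable (fun y => gamB y * wtB (c • (s - y)) ^ 2) ∧
    ∫ y, gamB y * wtB (c • (s - y)) ^ 2 ≤ C * wtB s ^ 2 := by
  obtain ⟨C, hC0, hC⟩ := wtB_peetre (m := m) hc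
  have hle : ∀ s y : Body m, gamB y * wtB (c • (s - y)) ^ 2 ≤
      (C ^ 2 * wtB s ^ 2) * (gamB y * ((wtB y)⁻¹) ^ 2) := by
    intro s y
    have h1 := pow_le_pow_left₀ (wtB_pos _).le (hC s y) 2
    calc _ ≤ gamB y * (C * wtB s * (wtB y)⁻¹) ^ 2 := by
          gcongr
          · exact gamB_nonneg y
      _ = _ := by ring
  have hint : ∀ s : Body m, Integrable (fun y => gamB y * wtB (c • (s - y)) ^ 2) := by
    intro s
    refine integrable_gamB.mul_bdd (c := 1) ?_ (Eventually.of_forall fun y => ?_)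
    · exact Continuous.aestronglyMeasurable (by fun_prop)
    · rw [Real.norm_eq_abs, abs_of_nonneg (by positivity)]
      exact pow_le_one₀ (wtB_pos _).le (wtB_le_one _)
  refine ⟨C ^ 2 * ∫ y : Body m, gamB y * ((wtB y)⁻¹) ^ 2, ?_, fun s => ⟨hint s, ?_⟩⟩
  · exact mul_nonneg (by positivity) (integral_nonneg fun y =>
      mul_nonneg (gamB_nonneg y) (by positivity))
  · refine (integral_mono (hint s) (integrable_gamB_div.const_mul _) (hle s)).trans_eq ?_
    rw [integral_const_mul]; ring

@[fun_prop] theorem Continuous.omega0 {X : Type*} [TopologicalSpace X] {f g : X → Body m}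
    (hf : Continuous f) (hg : Continuous g) : Continuous fun x => omega0 (f x) (g x) := by
  unfold SuperDeformation.omega0; fun_prop

theorem omega0_add_left (x y z : Body m) : omega0 (x + y) z = omega0 x z + omega0 y z := by
  simp only [omega0, ← Finset.sum_add_distrib]
  exact Finset.sum_congr rfl fun i _ => by simp; ring

theorem omega0_swap (x y : Body m) : omega0 x y = -omega0 y x := by
  simp only [omega0, ← Finset.sum_neg_distrib]
  exact Finset.sum_congr rfl fun i _ => by ring

theorem omega0_add_right (x y z : Body m) : omega0 x (y + z) = omega0 x y + omega0 x z := by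
  rw [omega0_swap, omega0_add_left, omega0_swap y, omega0_swap z]; ring

theorem omega0_smul_left (c : ℝ) (x y : Body m) : omega0 (c • x) y = c * omega0 x y := by
  simp only [omega0, Finset.mul_sum]
  exact Finset.sum_congr rfl fun i _ => by simp; ring

theorem omega0_smul_right (c : ℝ) (x y : Body m) : omega0 x (c • y) = c * omega0 x y := by
  rw [omega0_swap, omega0_smul_left, omega0_swap y]; ring

theorem omega0_neg_left (x y : Body m) : omega0 (-x) y = -omega0 x y := by
  simpa using omega0_smul_left (-1) x y

theorem omega0_neg_right (x y : Body m) : omega0 x (-y) = -omega0 x y := by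
  simpa using omega0_smul_right (-1) x y

theorem omega0_sub_left (x y z : Body m) : omega0 (x - y) z = omega0 x z - omega0 y z := by
  rw [sub_eq_add_neg, omega0_add_left, omega0_neg_left]; ring

theorem omega0_sub_right (x y z : Body m) : omega0 x (y - z) = omega0 x y - omega0 x z := by
  rw [sub_eq_add_neg, omega0_add_right, omega0_neg_right]; ring

@[simp] theorem omega0_self (x : Body m) : omega0 x x = 0 := by
  simp only [omega0]
  exact Finset.sum_eq_zero fun i _ => by ring

theorem cis_omega0 (v y : Body m) :
    cis (omega0 v y) = (∏ i, cis (-(v.2 i) * y.1 i)) * ∏ i, cis (v.1 i * y.2 i) := by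
  rw [← cis_sum, ← cis_sum, ← cis_add]
  congr 1
  rw [omega0, ← Finset.sum_add_distrib]
  exact Finset.sum_congr rfl fun i _ => by ring

/-- The symplectic Fourier transform of the Gamma density. -/
theorem norm_integral_gamB_cis (v : Body m) :
    ‖∫ y, (gamB y : ℂ) * cis (omega0 v y)‖ = wtB v ^ 2 := by
  have h : ∀ y : Body m, (gamB y : ℂ) * cis (omega0 v y) =
      (∏ i, ((gam (y.1 i) : ℂ) * cis (-(v.2 i) * y.1 i))) *
        ∏ i, ((gam (y.2 i) : ℂ) * cis (v.1 i * y.2 i)) := by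
    intro y
    rw [cis_omega0, Finset.prod_mul_distrib, Finset.prod_mul_distrib]
    simp only [gamB, bprod, Complex.ofReal_mul, Complex.ofReal_prod]
    ring
  simp_rw [h]
  rw [integral_bprod_aux (fun i t => (gam t : ℂ) * cis (-(v.2 i) * t))
    (fun i t => (gam t : ℂ) * cis (v.1 i * t)), norm_mul, norm_prod, norm_prod]
  simp_rw [norm_integral_gam_cis]
  simp only [wtB, bprod, wt, neg_sq, Finset.prod_pow]
  ring

end Body

/-! ### The smoothed Moyal kernel and its integrability. -/

section Kernels

variable {m : ℕ}

instance isAddHaar_body : (volume : Measure (Body m)).IsAddHaarMeasure :=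
  Measure.prod.instIsAddHaarMeasure (volume : Measure (Fin m → ℝ)) (volume : Measure (Fin m → ℝ))

instance isAddHaar_body_prod : (volume : Measure (Body m × Body m)).IsAddHaarMeasure :=
  Measure.prod.instIsAddHaarMeasure (volume : Measure (Body m)) (volume : Measure (Body m))

theorem continuous_gam : Continuous gam := by
  have : gam = fun t => (max t 0) ^ 3 * Real.exp (-t) / 6 := by
    ext t
    simp only [gam]
    split_ifs with h
    · rw [max_eq_left h.le]
    · rw [max_eq_right (not_lt.1 h)]; simp
  rw [this]; fun_prop

@[fun_prop] theorem continuous_gamB : Continuous (gamB : Body m → ℝ) := continuous_bprod continuous_gam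

/-- Geometric mean of two bounds: quadratic decay in each variable separately becomes simple decay
in both jointly. -/
theorem le_mul_of_le_sq {x a b : ℝ} (hx : 0 ≤ x) (ha : 0 ≤ a) (hb : 0 ≤ b) (h1 : x ≤ a ^ 2)
    (h2 : x ≤ b ^ 2) : x ≤ a * b := by
  refine abs_le_of_sq_le_sq' ?_ (by positivity) |>.2
  calc x ^ 2 = x * x := sq x
    _ ≤ a ^ 2 * b ^ 2 := mul_le_mul h1 h2 hx (by positivity)
    _ = (a * b) ^ 2 := by ring

/-- The oscillating kernel `e^{-icω}` on `V × V`, smoothed by the Gamma density. -/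
def moyalKernel (c : ℝ) (p : Body m × Body m) : ℂ :=
  ∫ y : Body m × Body m, ((gamB y.1 * gamB y.2 : ℝ) : ℂ) *
    cis (-(c * omega0 (p.1 - y.1) (p.2 - y.2)))

theorem integrable_gamB_prod :
    Integrable fun y : Body m × Body m => ((gamB y.1 * gamB y.2 : ℝ) : ℂ) :=
  (integrable_gamB.mul_prod integrable_gamB).ofReal

theorem integrable_mul_cis {X : Type*} [TopologicalSpace X] [MeasurableSpace X]
    [OpensMeasurableSpace X] [SecondCountableTopology X] {μ : Measure X} {f : X → ℂ}
    (hf : Integrable f μ) {g : X → ℝ} (hg : Continuous g) :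
    Integrable (fun x => f x * cis (g x)) μ :=
  hf.mul_bdd (c := 1) (Continuous.aestronglyMeasurable (by fun_prop))
    (Eventually.of_forall fun x => by simp)

theorem continuous_moyalKernel (c : ℝ) : Continuous (moyalKernel c : Body m × Body m → ℂ) := by
  unfold moyalKernel
  refine continuous_of_dominated (bound := fun y => ‖((gamB y.1 * gamB y.2 : ℝ) : ℂ)‖) ?_ ?_ ?_ ?_
  · intro p
    exact Continuous.aestronglyMeasurable (by fun_prop)
  · intro p
    exact Eventually.of_forall fun y => by simp
  · exact integrable_gamB_prod.norm
  · exact Eventually.of_forall fun y => by fun_prop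

/-- Averaging over y.2 is a Fourier transform of the Gamma density at the frequency c(p.1 - y.1), of
modulus `wtB` squared; p.2 enters only through a phase. The remaining average over y.1 preserves the
decay, by Peetre's inequality. -/
theorem norm_moyalKernel_le_sq {c : ℝ} (hc : c ≠ 0) : ∃ C : ℝ, 0 ≤ C ∧ ∀ p : Body m × Body m,
    ‖moyalKernel c p‖ ≤ C * wtB p.1 ^ 2 := by
  obtain ⟨C, hC0, hC⟩ := integral_gamB_mul_wtB_sq_le (m := m) hc
  refine ⟨C, hC0, fun p => ?_⟩
  have hint : Integrable (fun y : Body m × Body m => ((gamB y.1 * gamB y.2 : ℝ) : ℂ) *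
      cis (-(c * omega0 (p.1 - y.1) (p.2 - y.2)))) :=
    integrable_mul_cis integrable_gamB_prod (by fun_prop)
  rw [moyalKernel, Measure.volume_eq_prod, integral_prod _ hint]
  refine (norm_integral_le_of_norm_le (hC p.1).1 (Eventually.of_forall fun y => ?_)).trans (hC p.1).2
  have h1 : ∀ y' : Body m, ((gamB y * gamB y' : ℝ) : ℂ) *
      cis (-(c * omega0 (p.1 - y) (p.2 - y'))) =
      ((gamB y : ℂ) * cis (-(c * omega0 (p.1 - y) p.2))) *
        ((gamB y' : ℂ) * cis (omega0 (c • (p.1 - y)) y')) := by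
    intro y'
    rw [omega0_sub_right, omega0_smul_left, mul_sub, neg_sub, sub_eq_neg_add, cis_add]
    push_cast; ring
  simp_rw [h1]
  rw [integral_const_mul, norm_mul, norm_mul, norm_cis, mul_one, norm_integral_gamB_cis,
    Complex.norm_real, Real.norm_eq_abs, abs_of_nonneg (gamB_nonneg y)]

theorem moyalKernel_swap (c : ℝ) (p : Body m × Body m) :
    moyalKernel c p.swap = moyalKernel (-c) p := by
  unfold moyalKernel
  rw [Measure.volume_eq_prod, ← integral_prod_swap]
  congr 1
  ext y
  simp only [Prod.fst_swap, Prod.snd_swap]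
  rw [omega0_swap, mul_comm (gamB y.2)]
  congr 2; ring

/-- Exchanging the two arguments changes c into -c, so the quadratic decay holds in p.2 as well; the
geometric mean of the two bounds is integrable on the product. -/
theorem norm_moyalKernel_le {c : ℝ} (hc : c ≠ 0) : ∃ C : ℝ, 0 ≤ C ∧ ∀ p : Body m × Body m,
    ‖moyalKernel c p‖ ≤ C * (wtB p.1 * wtB p.2) := by
  obtain ⟨C₁, h1, h1'⟩ := norm_moyalKernel_le_sq (m := m) hc
  obtain ⟨C₂, h2, h2'⟩ := norm_moyalKernel_le_sq (m := m) (neg_ne_zero.2 hc)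
  refine ⟨√C₁ * √C₂, by positivity, fun p => ?_⟩
  have h3 := h2' p.swap
  rw [moyalKernel_swap, neg_neg] at h3
  have := le_mul_of_le_sq (x := ‖moyalKernel c p‖) (a := √C₁ * wtB p.1) (b := √C₂ * wtB p.2)
    (norm_nonneg _) (mul_nonneg (by positivity) (wtB_pos _).le)
    (mul_nonneg (by positivity) (wtB_pos _).le)
    (by rw [mul_pow, Real.sq_sqrt h1]; exact h1' p) (by rw [mul_pow, Real.sq_sqrt h2]; exact h3)
  exact this.trans_eq (by ring)

theorem integrable_moyalKernel {c : ℝ} (hc : c ≠ 0) :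
    Integrable (moyalKernel c : Body m × Body m → ℂ) := by
  obtain ⟨C, -, hC⟩ := norm_moyalKernel_le (m := m) hc
  exact ((integrable_wtB.mul_prod integrable_wtB).const_mul C).mono'
    (continuous_moyalKernel c).aestronglyMeasurable (Eventually.of_forall hC)

/-! ### Gaussians -/

/-- The Gaussian `e^{-b|x|²}` on the body. -/
def gauss (b : ℝ) (x : Body m) : ℝ := bprod (fun t => Real.exp (-b * t ^ 2)) x

theorem gauss_pos (b : ℝ) (x : Body m) : 0 < gauss b x :=
  mul_pos (Finset.prod_pos fun _ _ => Real.exp_pos _) (Finset.prod_pos fun _ _ => Real.exp_pos _)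

/-- The square of the euclidean norm. -/
def nsq (x : Body m) : ℝ := ∑ i, (x.1 i ^ 2 + x.2 i ^ 2)

theorem gauss_eq (b : ℝ) (x : Body m) : gauss b x = Real.exp (-b * nsq x) := by
  simp only [gauss, bprod, nsq, Finset.sum_add_distrib, mul_add, Finset.mul_sum, Real.exp_add,
    Real.exp_sum]

@[fun_prop] theorem continuous_gauss (b : ℝ) : Continuous (gauss b : Body m → ℝ) :=
  continuous_bprod (f := fun t : ℝ => Real.exp (-b * t ^ 2)) (by fun_prop)

theorem gauss_le_one {b : ℝ} (hb : 0 ≤ b) (x : Body m) : gauss b x ≤ 1 := by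
  rw [gauss_eq, Real.exp_le_one_iff]
  have : 0 ≤ nsq x := Finset.sum_nonneg fun i _ => by positivity
  nlinarith

theorem integrable_gauss {b : ℝ} (hb : 0 < b) : Integrable (gauss b : Body m → ℝ) :=
  integrable_bprod (integrable_exp_neg_mul_sq hb)

theorem exp_le_wt_sq {b : ℝ} (hb : 0 < b) (t : ℝ) :
    Real.exp (-b * t ^ 2) ≤ (2 + 4 / b ^ 2) * wt t ^ 2 := by
  have h1 := Real.quadratic_le_exp_of_nonneg (x := b * t ^ 2) (by positivity)
  rw [neg_mul, Real.exp_neg, wt, inv_pow, inv_eq_one_div, div_le_iff₀ (Real.exp_pos _)]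
  have h2 : (1 + t ^ 2) ^ 2 ≤ (2 + 4 / b ^ 2) * Real.exp (b * t ^ 2) := by
    calc (1 + t ^ 2) ^ 2 ≤ 2 + 2 * t ^ 4 := by nlinarith [sq_nonneg (1 - t ^ 2)]
      _ ≤ (2 + 4 / b ^ 2) * (1 + (b * t ^ 2) ^ 2 / 2) := by
          have : (2 + 4 / b ^ 2) * (1 + (b * t ^ 2) ^ 2 / 2) =
            2 + 2 * t ^ 4 + 4 / b ^ 2 + b ^ 2 * t ^ 4 := by field_simp; ring
          rw [this]
          have : 0 ≤ 4 / b ^ 2 + b ^ 2 * t ^ 4 := by positivity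
          linarith
      _ ≤ _ := by
          gcongr
          have : 0 ≤ b * t ^ 2 := by positivity
          linarith
  have h3 : 0 < (1 + t ^ 2) ^ 2 := by positivity
  calc (1 : ℝ) = (1 + t ^ 2) ^ 2 * ((1 + t ^ 2) ^ 2)⁻¹ := by field_simp
    _ ≤ ((2 + 4 / b ^ 2) * Real.exp (b * t ^ 2)) * ((1 + t ^ 2) ^ 2)⁻¹ := by gcongr
    _ = _ := by ring

theorem gauss_le_wtB_sq {b : ℝ} (hb : 0 < b) : ∃ C : ℝ, 0 ≤ C ∧ ∀ x : Body m,
    gauss b x ≤ C * wtB x ^ 2 := by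
  refine ⟨(2 + 4 / b ^ 2) ^ m * (2 + 4 / b ^ 2) ^ m, by positivity, fun x => ?_⟩
  have := bprod_le (x := x) (y := x) (f := fun t => Real.exp (-b * t ^ 2))
    (g := fun t => (2 + 4 / b ^ 2) * wt t ^ 2) (fun t => (Real.exp_pos _).le)
    (fun i => exp_le_wt_sq hb _) (fun i => exp_le_wt_sq hb _)
  refine this.trans_eq ?_
  simp only [bprod, wtB, Finset.prod_mul_distrib, Finset.prod_const, Finset.card_univ,
    Fintype.card_fin, Finset.prod_pow]
  ring

theorem gauss_half_sq (b : ℝ) (x : Body m) : gauss b x = gauss (b / 2) x ^ 2 := by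
  rw [gauss_eq, gauss_eq, ← Real.exp_nat_mul]
  congr 1; push_cast; ring

/-- The symplectic Fourier transform of a Gaussian. -/
theorem integral_gauss_cis {b : ℝ} (hb : 0 < b) (v : Body m) :
    ∫ u, (gauss b u : ℂ) * cis (omega0 v u) = ((Real.pi / b) ^ m * gauss (1 / (4 * b)) v : ℝ) := by
  have h : ∀ y : Body m, (gauss b y : ℂ) * cis (omega0 v y) =
      (∏ i, (Complex.exp (Complex.I * ((-(v.2 i) : ℝ) : ℂ) * y.1 i) *
        Complex.exp (-b * (y.1 i : ℂ) ^ 2))) *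
      ∏ i, (Complex.exp (Complex.I * (v.1 i : ℂ) * y.2 i) *
        Complex.exp (-b * (y.2 i : ℂ) ^ 2)) := by
    intro y
    rw [cis_omega0, Finset.prod_mul_distrib, Finset.prod_mul_distrib]
    simp only [gauss, bprod, Complex.ofReal_mul, Complex.ofReal_prod, Complex.ofReal_exp, cis,
      Complex.ofReal_neg, Complex.ofReal_pow]
    simp_rw [mul_comm Complex.I _, mul_assoc, mul_comm Complex.I _]
    ring
  simp_rw [h]
  rw [integral_bprod_aux (fun i (t : ℝ) => Complex.exp (Complex.I * ((-(v.2 i) : ℝ) : ℂ) * t) *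
      Complex.exp (-b * (t : ℂ) ^ 2)) (fun i (t : ℝ) => Complex.exp (Complex.I * (v.1 i : ℂ) * t) *
      Complex.exp (-b * (t : ℂ) ^ 2))]
  have hb' : 0 < (b : ℂ).re := by simpa
  simp_rw [fourierIntegral_gaussian hb']
  rw [Finset.prod_mul_distrib, Finset.prod_mul_distrib]
  simp only [Finset.prod_const, Finset.card_univ, Fintype.card_fin]
  have h2 : ((Real.pi / b : ℂ) ^ (1 / 2 : ℂ)) ^ m * ((Real.pi / b : ℂ) ^ (1 / 2 : ℂ)) ^ m =
      (Real.pi / b : ℂ) ^ m := by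
    rw [← mul_pow, ← Complex.cpow_add _ _ (by
      have : (b : ℂ) ≠ 0 := by exact_mod_cast hb.ne'
      have : (Real.pi : ℂ) ≠ 0 := by exact_mod_cast Real.pi_ne_zero
      positivity)]
    norm_num
  have h3 : ((gauss (1 / (4 * b)) v : ℝ) : ℂ) =
      (∏ i, Complex.exp (-((-(v.2 i) : ℝ) : ℂ) ^ 2 / (4 * b))) *
        ∏ i, Complex.exp (-(v.1 i : ℂ) ^ 2 / (4 * b)) := by
    simp only [gauss, bprod]
    push_cast
    rw [mul_comm]
    congr 1 <;> exact Finset.prod_congr rfl fun i _ => by congr 1; ring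
  push_cast
  rw [h3, ← h2]
  push_cast
  ring

end Kernels

/-! ### The Wigner kernel of coherent states: reproducing identity and decay. -/

section WignerKernel

variable {m : ℕ}

/-- The Wigner transform of the coherent states, in difference coordinates. -/
def wig (l : ℝ) (x δ : Body m) : ℂ :=
  (gauss |l| (x + (1 / 2 : ℝ) • δ) : ℂ) * cis (l * omega0 x δ)

@[fun_prop] theorem Continuous.wig {X : Type*} [TopologicalSpace X] (l : ℝ) {f g : X → Body m}
    (hf : Continuous f) (hg : Continuous g) : Continuous fun x => wig l (f x) (g x) := by
  unfold SuperDeformation.wig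
  have := continuous_gauss (m := m) |l|
  fun_prop

theorem norm_wig (l : ℝ) (x δ : Body m) : ‖wig l x δ‖ = gauss |l| (x + (1 / 2 : ℝ) • δ) := by
  rw [wig, norm_mul, norm_cis, mul_one, Complex.norm_real, Real.norm_eq_abs,
    abs_of_pos (gauss_pos _ _)]

theorem integrable_wig {l : ℝ} (hl : l ≠ 0) (δ : Body m) : Integrable fun x => wig l x δ := by
  refine ((integrable_gauss (abs_pos.2 hl)).comp_add_right ((1 / 2 : ℝ) • δ)).mono'
    (Continuous.aestronglyMeasurable (by fun_prop)) (Eventually.of_forall fun x => ?_)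
  rw [norm_wig]

theorem finrank_body : Module.finrank ℝ (Body m) = m + m := by
  simp

/-- The substitution d = 2M - w, with Jacobian 2^{2m}; it introduces the midpoint variable in a
product of two Gaussians. -/
theorem integral_eq_two_smul_sub (F : Body m → ℂ) (w : Body m) :
    ∫ d, F d = (2 : ℂ) ^ (m + m) * ∫ M, F ((2 : ℝ) • M - w) := by
  have h1 := Measure.integral_comp_smul (volume : Measure (Body m)) (fun x => F (x - w)) 2
  rw [h1, integral_sub_right_eq_self, finrank_body, abs_of_pos (by positivity)]
  simp only [Complex.real_smul]
  push_cast
  rw [← mul_assoc, mul_inv_cancel₀ (pow_ne_zero _ two_ne_zero), one_mul]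

theorem gauss_mul_gauss (b : ℝ) (M D : Body m) :
    gauss b (M + (1 / 2 : ℝ) • D) * gauss b (M - (1 / 2 : ℝ) • D) =
      gauss (2 * b) M * gauss (b / 2) D := by
  simp only [gauss_eq, ← Real.exp_add, nsq, Finset.mul_sum, ← Finset.sum_add_distrib]
  congr 1
  exact Finset.sum_congr rfl fun i _ => by simp; ring

theorem gauss_smul (b c : ℝ) (x : Body m) : gauss b (c • x) = gauss (b * c ^ 2) x := by
  simp only [gauss_eq, nsq, Finset.mul_sum]
  congr 1
  exact Finset.sum_congr rfl fun i _ => by simp; ring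

/-- After the shift x = u - δ/2 the Gaussian is centred at 0 and the terms of the phase quadratic in
u cancel; what remains is the Fourier transform of a Gaussian at 2l(s - t - δ/2). -/
theorem integral_wig_mul_cis {l : ℝ} (hl : l ≠ 0) (s t δ : Body m) :
    ∫ x, wig l x δ * cis (-(2 * l * omega0 (s - x) (t - x))) =
      cis (-(2 * l * omega0 (s + (1 / 2 : ℝ) • δ) (t + (1 / 2 : ℝ) • δ))) *
        ((Real.pi / |l|) ^ m * gauss |l| (s - t - (1 / 2 : ℝ) • δ) : ℝ) := by
  have hb : 0 < |l| := abs_pos.2 hl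
  rw [← integral_sub_right_eq_self _ ((1 / 2 : ℝ) • δ)]
  have h : ∀ u : Body m, wig l (u - (1 / 2 : ℝ) • δ) δ *
      cis (-(2 * l * omega0 (s - (u - (1 / 2 : ℝ) • δ)) (t - (u - (1 / 2 : ℝ) • δ)))) =
      cis (-(2 * l * omega0 (s + (1 / 2 : ℝ) • δ) (t + (1 / 2 : ℝ) • δ))) *
        ((gauss |l| u : ℂ) * cis (omega0 ((2 * l) • (s - t - (1 / 2 : ℝ) • δ)) u)) := by
    intro u
    rw [wig, sub_add_cancel, mul_assoc, ← cis_add, mul_left_comm, ← cis_add]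
    congr 2
    simp only [omega0, Finset.mul_sum, ← Finset.sum_neg_distrib, ← Finset.sum_add_distrib]
    exact Finset.sum_congr rfl fun i _ => by simp; ring
  simp_rw [h]
  rw [integral_const_mul, integral_gauss_cis hb, gauss_smul]
  congr 5
  have h2 : l ^ 2 = |l| * |l| := by rw [← sq, sq_abs]
  rw [mul_pow, h2]; field_simp; norm_num

/-- The reproducing property of the Wigner kernel under the twisted convolution. -/
theorem integral_wig_mul_wig {l : ℝ} (hl : l ≠ 0) (s t δ : Body m) :
    ∫ d, wig l s d * wig l (t + d) (δ - d) * cis (-(l / 2 * omega0 d δ)) =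
      2 ^ m * ∫ x, wig l x δ * cis (-(2 * l * omega0 (s - x) (t - x))) := by
  have hb : 0 < |l| := abs_pos.2 hl
  rw [integral_wig_mul_cis hl, integral_eq_two_smul_sub _ (s + t + (1 / 2 : ℝ) • δ)]
  -- With d = 2M - (s + t + δ/2) the Gaussians sit at M ± D/2, where D = s - t - δ/2, and the
  -- parallelogram identity separates M from D. The integral over M contributes a second factor of
  -- width |l|/2 in D, and 2^{2m}(π/2|l|)^m = 2^m(π/|l|)^m explains the constant.
  have h : ∀ M : Body m,
      wig l s ((2 : ℝ) • M - (s + t + (1 / 2 : ℝ) • δ)) *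
        wig l (t + ((2 : ℝ) • M - (s + t + (1 / 2 : ℝ) • δ)))
          (δ - ((2 : ℝ) • M - (s + t + (1 / 2 : ℝ) • δ))) *
        cis (-(l / 2 * omega0 ((2 : ℝ) • M - (s + t + (1 / 2 : ℝ) • δ)) δ)) =
      (cis (-(2 * l * omega0 (s + (1 / 2 : ℝ) • δ) (t + (1 / 2 : ℝ) • δ))) *
        (gauss (|l| / 2) (s - t - (1 / 2 : ℝ) • δ) : ℂ)) *
        ((gauss (2 * |l|) M : ℂ) * cis (omega0 ((2 * l) • (s - t - (1 / 2 : ℝ) • δ)) M)) := by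
    intro M
    have e1 : s + (1 / 2 : ℝ) • ((2 : ℝ) • M - (s + t + (1 / 2 : ℝ) • δ)) =
        M + (1 / 2 : ℝ) • (s - t - (1 / 2 : ℝ) • δ) := by module
    have e2 : t + ((2 : ℝ) • M - (s + t + (1 / 2 : ℝ) • δ)) +
        (1 / 2 : ℝ) • (δ - ((2 : ℝ) • M - (s + t + (1 / 2 : ℝ) • δ))) =
        M - (1 / 2 : ℝ) • (s - t - (1 / 2 : ℝ) • δ) := by module
    rw [wig, wig, e1, e2]
    have e3 := gauss_mul_gauss |l| M (s - t - (1 / 2 : ℝ) • δ)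
    have e3' : (gauss |l| (M + (1 / 2 : ℝ) • (s - t - (1 / 2 : ℝ) • δ)) : ℂ) *
      (gauss |l| (M - (1 / 2 : ℝ) • (s - t - (1 / 2 : ℝ) • δ)) : ℂ) =
      (gauss (2 * |l|) M : ℂ) * (gauss (|l| / 2) (s - t - (1 / 2 : ℝ) • δ) : ℂ) := by
      exact_mod_cast e3
    rw [mul_mul_mul_comm, e3', mul_assoc, ← cis_add, ← cis_add]
    have e4 : ∀ a b c d : ℂ, a * b * (c * d) = b * c * (a * d) := fun a b c d => by ring
    have e5 : ∀ a b c d : ℂ, a * b * c = d → b * a * c = d := fun a b c d h => by rw [← h]; ring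
    have e6 : ∀ (g₁ g₂ c c₁ c₂ : ℂ), c = c₁ * c₂ → g₁ * g₂ * c = c₁ * g₂ * (g₁ * c₂) :=
      fun g₁ g₂ c c₁ c₂ h => by rw [h]; ring
    refine e6 _ _ _ _ _ ?_
    rw [← cis_add]
    congr 1
    simp only [omega0, Finset.mul_sum, ← Finset.sum_neg_distrib, ← Finset.sum_add_distrib]
    exact Finset.sum_congr rfl fun i _ => by simp; ring
  simp_rw [h]
  rw [integral_const_mul, integral_gauss_cis (by positivity), gauss_smul]
  have h2 : 1 / (4 * (2 * |l|)) * (2 * l) ^ 2 = |l| / 2 := by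
    have h2 : l ^ 2 = |l| * |l| := by rw [← sq, sq_abs]
    rw [mul_pow, h2]; field_simp; norm_num
  rw [h2, gauss_half_sq |l|]
  push_cast
  rw [div_pow, div_pow, mul_pow, pow_add]
  have : ((|l| : ℝ) : ℂ) ≠ 0 := by exact_mod_cast hb.ne'
  field_simp

/-- The Wigner kernel, smoothed by the Gamma density. -/
def wigS (l : ℝ) (s δ : Body m) : ℂ := ∫ y, (gamB y : ℂ) * wig l (s - y) δ

theorem norm_wig_le_one (l : ℝ) (x δ : Body m) : ‖wig l x δ‖ ≤ 1 := by
  rw [norm_wig]; exact gauss_le_one (abs_nonneg _) _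

theorem continuous_wigS (l : ℝ) : Continuous fun z : Body m × Body m => wigS l z.1 z.2 := by
  unfold wigS
  refine continuous_of_dominated (bound := gamB) ?_ ?_ ?_ ?_
  · intro p
    exact Continuous.aestronglyMeasurable (by fun_prop)
  · refine fun p => Eventually.of_forall fun y => ?_
    rw [norm_mul, Complex.norm_real, Real.norm_eq_abs, abs_of_nonneg (gamB_nonneg y)]
    exact mul_le_of_le_one_right (gamB_nonneg y) (norm_wig_le_one _ _ _)
  · exact integrable_gamB
  · exact Eventually.of_forall fun y => by fun_prop

theorem norm_wigS_le_fst {l : ℝ} (hl : l ≠ 0) : ∃ C : ℝ, 0 ≤ C ∧ ∀ s δ : Body m,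
    ‖wigS l s δ‖ ≤ C * wtB (s + (1 / 2 : ℝ) • δ) ^ 2 := by
  obtain ⟨C₁, h1, h1'⟩ := gauss_le_wtB_sq (m := m) (abs_pos.2 hl)
  obtain ⟨C₂, h2, h2'⟩ := integral_gamB_mul_wtB_sq_le (m := m) one_ne_zero
  refine ⟨C₁ * C₂, by positivity, fun s δ => ?_⟩
  obtain ⟨h3, h4⟩ := h2' (s + (1 / 2 : ℝ) • δ)
  refine (norm_integral_le_of_norm_le (h3.const_mul C₁) (Eventually.of_forall fun y => ?_)).trans ?_
  · rw [norm_mul, Complex.norm_real, Real.norm_eq_abs, abs_of_nonneg (gamB_nonneg y), norm_wig,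
      mul_left_comm, one_smul]
    have e : s - y + (1 / 2 : ℝ) • δ = s + (1 / 2 : ℝ) • δ - y := by abel
    rw [e]
    exact mul_le_mul_of_nonneg_left (h1' _) (gamB_nonneg y)
  · rw [integral_const_mul, mul_assoc]
    exact mul_le_mul_of_nonneg_left h4 h1

/-- Fourier inversion for Gaussians, read off from `integral_gauss_cis` with the dual width; it
turns the dependence of `wig` on its first argument into a pure phase. -/
theorem gauss_eq_integral {b : ℝ} (hb : 0 < b) (x : Body m) :
    (gauss b x : ℂ) = ((4 * Real.pi * b : ℝ) : ℂ)⁻¹ ^ m *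
      ∫ ξ, (gauss (1 / (4 * b)) ξ : ℂ) * cis (omega0 x ξ) := by
  rw [integral_gauss_cis (by positivity)]
  have h1 : 1 / (4 * (1 / (4 * b))) = b := by field_simp
  have h2 : Real.pi / (1 / (4 * b)) = 4 * Real.pi * b := by field_simp
  rw [h1, h2]
  have h3 : ((4 * Real.pi * b : ℝ) : ℂ) ≠ 0 := by
    have : 0 < 4 * Real.pi * b := by positivity
    exact_mod_cast this.ne'
  rw [Complex.ofReal_mul ((4 * Real.pi * b) ^ m), Complex.ofReal_pow, ← mul_assoc, ← mul_pow, inv_mul_cancel₀ h3, one_pow,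
    one_mul]

/-- Once the Gaussian is a Fourier integral over ξ, the smoothing variable y occurs only in the
phase ω(ξ + lδ, y), and its average has modulus `wtB (ξ + l • δ)` squared. Peetre's inequality moves
this decay onto δ, paid for by the Gaussian in ξ. -/
theorem norm_wigS_le_snd {l : ℝ} (hl : l ≠ 0) : ∃ C : ℝ, 0 ≤ C ∧ ∀ s δ : Body m,
    ‖wigS l s δ‖ ≤ C * wtB δ ^ 2 := by
  have hb : 0 < |l| := abs_pos.2 hl
  set b' := 1 / (4 * |l|) with hb'def
  have hb' : 0 < b' := by positivity
  obtain ⟨C₁, h1, h1'⟩ := gauss_le_wtB_sq (m := m) (half_pos hb')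
  obtain ⟨C₂, h2, h2'⟩ := wtB_peetre (m := m) one_ne_zero
  obtain ⟨C₃, h3, h3'⟩ := wtB_peetre (m := m) hl
  set K : ℂ := ((4 * Real.pi * |l| : ℝ) : ℂ)⁻¹ ^ m with hK
  have hle : ∀ δ ξ : Body m, gauss b' ξ * wtB (ξ + l • δ) ^ 2 ≤
      (C₁ ^ 2 * C₂ ^ 2 * C₃ ^ 2 * wtB δ ^ 2) * wtB ξ := by
    intro δ ξ
    have e1 : wtB (ξ + l • δ) ≤ C₂ * (C₃ * wtB δ) * (wtB ξ)⁻¹ := by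
      have h4 := h2' (l • δ) (-ξ)
      rw [one_smul, sub_neg_eq_add, add_comm, wtB_neg] at h4
      refine h4.trans ?_
      have h5 := h3' δ 0
      have h6 : wtB (0 : Body m) = 1 := by simp [wtB, bprod, wt]
      rw [sub_zero, h6, inv_one, mul_one] at h5
      have := (wtB_pos ξ).le
      gcongr
    have e2 : gauss b' ξ ≤ (C₁ * wtB ξ ^ 2) ^ 2 := by
      rw [gauss_half_sq]
      exact pow_le_pow_left₀ (gauss_pos _ _).le (h1' ξ) 2
    have hp := wtB_pos ξ
    calc gauss b' ξ * wtB (ξ + l • δ) ^ 2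
        ≤ (C₁ * wtB ξ ^ 2) ^ 2 * (C₂ * (C₃ * wtB δ) * (wtB ξ)⁻¹) ^ 2 := by
          have := (wtB_pos (ξ + l • δ)).le
          gcongr
      _ = (C₁ ^ 2 * C₂ ^ 2 * C₃ ^ 2 * wtB δ ^ 2) * (wtB ξ * wtB ξ) := by field_simp
      _ ≤ (C₁ ^ 2 * C₂ ^ 2 * C₃ ^ 2 * wtB δ ^ 2) * (wtB ξ * 1) := by
          gcongr
          exact wtB_le_one _
      _ = _ := by ring
  have hint : ∀ δ : Body m, Integrable fun ξ : Body m => gauss b' ξ * wtB (ξ + l • δ) ^ 2 := by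
    intro δ
    refine (integrable_wtB.const_mul
      (C₁ ^ 2 * C₂ ^ 2 * C₃ ^ 2 * wtB δ ^ 2)).mono' (Continuous.aestronglyMeasurable (by
      have := continuous_gauss (m := m) b'
      fun_prop))
      (Eventually.of_forall fun ξ => ?_)
    rw [Real.norm_eq_abs, abs_of_nonneg (mul_nonneg (gauss_pos _ _).le (by positivity))]
    exact hle δ ξ
  refine ⟨‖K‖ * (C₁ ^ 2 * C₂ ^ 2 * C₃ ^ 2) * ∫ ξ : Body m, wtB ξ, ?_, fun s δ => ?_⟩
  · exact mul_nonneg (by positivity) (integral_nonneg fun ξ => (wtB_pos ξ).le)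
  have e1 : ∀ y : Body m, (gamB y : ℂ) * wig l (s - y) δ = K * ∫ ξ : Body m,
      ((gamB y : ℂ) * (gauss b' ξ : ℂ)) *
        cis (omega0 (s - y + (1 / 2 : ℝ) • δ) ξ + l * omega0 (s - y) δ) := by
    intro y
    rw [wig, gauss_eq_integral hb]
    simp_rw [cis_add]
    have : ∀ ξ : Body m, ((gamB y : ℂ) * (gauss b' ξ : ℂ)) *
        (cis (omega0 (s - y + (1 / 2 : ℝ) • δ) ξ) * cis (l * omega0 (s - y) δ)) =
        ((gamB y : ℂ) * cis (l * omega0 (s - y) δ)) *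
          ((gauss b' ξ : ℂ) * cis (omega0 (s - y + (1 / 2 : ℝ) • δ) ξ)) := fun ξ => by ring
    simp_rw [this]
    rw [integral_const_mul]
    ring
  rw [wigS]
  simp_rw [e1]
  rw [integral_const_mul, integral_integral_swap]
  · rw [norm_mul, mul_assoc, mul_assoc]
    gcongr
    have e2 : ∀ ξ : Body m, ‖∫ y : Body m, ((gamB y : ℂ) * (gauss b' ξ : ℂ)) *
        cis (omega0 (s - y + (1 / 2 : ℝ) • δ) ξ + l * omega0 (s - y) δ)‖ =
        gauss b' ξ * wtB (ξ + l • δ) ^ 2 := by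
      intro ξ
      have e3 : ∀ y : Body m, ((gamB y : ℂ) * (gauss b' ξ : ℂ)) *
        cis (omega0 (s - y + (1 / 2 : ℝ) • δ) ξ + l * omega0 (s - y) δ) =
        ((gauss b' ξ : ℂ) * cis (omega0 (s + (1 / 2 : ℝ) • δ) ξ + l * omega0 s δ)) *
          ((gamB y : ℂ) * cis (omega0 (ξ + l • δ) y)) := by
        intro y
        have e4 : omega0 (s - y + (1 / 2 : ℝ) • δ) ξ + l * omega0 (s - y) δ =
          (omega0 (s + (1 / 2 : ℝ) • δ) ξ + l * omega0 s δ) + omega0 (ξ + l • δ) y := by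
          rw [omega0_add_left, omega0_sub_left, omega0_add_left, omega0_sub_left, omega0_swap _ y,
            omega0_add_right, omega0_smul_right]
          ring
        rw [e4, cis_add]; ring
      simp_rw [e3]
      rw [integral_const_mul, norm_mul, norm_integral_gamB_cis, norm_mul, norm_cis, mul_one,
        Complex.norm_real, Real.norm_eq_abs, abs_of_pos (gauss_pos _ _)]
    refine (norm_integral_le_of_norm_le (hint δ)
      (Eventually.of_forall fun ξ => (e2 ξ).le)).trans ?_
    refine (integral_mono (hint δ) (integrable_wtB.const_mul _) (hle δ)).trans_eq ?_
    rw [integral_const_mul]; ring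
  · exact integrable_mul_cis (integrable_gamB.ofReal.mul_prod (integrable_gauss hb').ofReal)
      (by fun_prop)

/-- The geometric mean of the Gaussian decay in s + δ/2 and of the decay in δ gained by smoothing.
The unsmoothed kernel has no decay in δ uniform in s + δ/2, so it is smoothness of the vector that
makes symbols integrable. -/
theorem norm_wigS_le {l : ℝ} (hl : l ≠ 0) : ∃ C : ℝ, 0 ≤ C ∧ ∀ s δ : Body m,
    ‖wigS l s δ‖ ≤ C * (wtB (s + (1 / 2 : ℝ) • δ) * wtB δ) := by
  obtain ⟨C₁, h1, h1'⟩ := norm_wigS_le_fst (m := m) hl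
  obtain ⟨C₂, h2, h2'⟩ := norm_wigS_le_snd (m := m) hl
  refine ⟨√C₁ * √C₂, by positivity, fun s δ => ?_⟩
  have := le_mul_of_le_sq (x := ‖wigS l s δ‖) (a := √C₁ * wtB (s + (1 / 2 : ℝ) • δ))
    (b := √C₂ * wtB δ) (norm_nonneg _) (mul_nonneg (by positivity) (wtB_pos _).le)
    (mul_nonneg (by positivity) (wtB_pos _).le)
    (by rw [mul_pow, Real.sq_sqrt h1]; exact h1' s δ)
    (by rw [mul_pow, Real.sq_sqrt h2]; exact h2' s δ)
  exact this.trans_eq (by ring)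

end WignerKernel

/-! ### Weak integrals with parameters. -/

section WeakIntegral

variable {A : Type*} [AddCommGroup A] [Module ℂ A] [UniformSpace A] [IsUniformAddGroup A]
  [ContinuousSMul ℂ A] [PolynormableSpace ℂ A] [CompleteSpace A] [T2Space A]
  [FirstCountableTopology A]
  {X : Type*} [TopologicalSpace X] [SecondCountableTopology X] [MeasureSpace X] [BorelSpace X]

open Classical in
/-- The weak integral `∫ κ F`. -/
def wint (κ : X → ℂ) (F : X → A) : A :=
  if h : ∃ a : A, ∀ φ : A →L[ℂ] ℂ, φ a = ∫ x, κ x * φ (F x) then h.choose else 0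

theorem dual_wint {κ : X → ℂ} (hκ : Integrable κ) {F : X → A} (hF : Continuous F) (hb : SemBdd F)
    (φ : A →L[ℂ] ℂ) : φ (wint κ F) = ∫ x, κ x * φ (F x) := by
  have h := exists_weak_integral hκ hF hb
  rw [wint, dif_pos h]
  exact h.choose_spec φ

/-- Dominated convergence, one seminorm at a time: separate continuity suffices because joint
boundedness supplies the dominating function. -/
theorem continuous_wint {Y : Type*} [TopologicalSpace Y] [FirstCountableTopology Y] {κ : X → ℂ}
    (hκ : Integrable κ) {F : Y → X → A} (h1 : ∀ y, Continuous (F y))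
    (h2 : ∀ x, Continuous fun y => F y x) (hb : SemBdd fun z : Y × X => F z.1 z.2) :
    Continuous fun y => wint κ (F y) := by
  rw [continuous_iff_continuousAt]
  intro y₀
  rw [ContinuousAt, tendsto_iff_seminorm]
  intro q hq
  obtain ⟨C, hC⟩ := hb q hq
  have hb' : ∀ y, SemBdd (F y) := fun y q hq => by
    obtain ⟨C, hC⟩ := hb q hq
    exact ⟨C, fun x => hC (y, x)⟩
  have hCC : ∀ y x, q (F y x - F y₀ x) ≤ C + C := fun y x =>
    (map_sub_le_add q _ _).trans (add_le_add (hC (y, x)) (hC (y₀, x)))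
  have hm : ∀ y, AEStronglyMeasurable (fun x => q (F y x - F y₀ x)) := fun y =>
    (hq.comp ((h1 y).sub (h1 y₀))).aestronglyMeasurable
  have hi : ∀ y, Integrable fun x => ‖κ x‖ * q (F y x - F y₀ x) := fun y =>
    hκ.norm.mul_bdd (c := C + C) (hm y) (Eventually.of_forall fun x => by
      rw [Real.norm_eq_abs, abs_of_nonneg (apply_nonneg _ _)]; exact hCC y x)
  have hlim : Tendsto (fun y => ∫ x, ‖κ x‖ * q (F y x - F y₀ x)) (𝓝 y₀) (𝓝 0) := by
    have : (0 : ℝ) = ∫ x : X, (0 : ℝ) := by simp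
    rw [this]
    refine tendsto_integral_filter_of_dominated_convergence (fun x => ‖κ x‖ * (C + C)) ?_ ?_ ?_ ?_
    · exact Eventually.of_forall fun y => hκ.norm.1.mul (hm y)
    · refine Eventually.of_forall fun y => Eventually.of_forall fun x => ?_
      rw [norm_mul, norm_norm, Real.norm_eq_abs, abs_of_nonneg (apply_nonneg _ _)]
      exact mul_le_mul_of_nonneg_left (hCC y x) (norm_nonneg _)
    · exact hκ.norm.mul_const _
    · refine Eventually.of_forall fun x => ?_
      have := ((tendsto_iff_seminorm (a := F y₀ x)).1 ((h2 x).tendsto y₀) q hq).const_mul ‖κ x‖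
      simpa using this
  refine squeeze_zero (fun _ => apply_nonneg _ _) (fun y => ?_) hlim
  refine seminorm_le_of_dual hq fun φ hφ => ?_
  rw [map_sub, dual_wint hκ (h1 y) (hb' y), dual_wint hκ (h1 y₀) (hb' y₀),
    ← integral_sub ((hb' y).integrable_dual (h1 y) hκ φ) ((hb' y₀).integrable_dual (h1 y₀) hκ φ)]
  refine norm_integral_le_of_norm_le (hi y) (Eventually.of_forall fun x => ?_)
  rw [← mul_sub, norm_mul, ← map_sub]
  exact mul_le_mul_of_nonneg_left (hφ _) (norm_nonneg _)

theorem seminorm_wint_le {κ : X → ℂ} (hκ : Integrable κ) {F : X → A} (hF : Continuous F)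
    (hb : SemBdd F) {q : Seminorm ℂ A} (hq : Continuous q) {C : ℝ} (hC : ∀ x, q (F x) ≤ C) :
    q (wint κ F) ≤ (∫ x, ‖κ x‖) * C := by
  refine seminorm_le_of_dual hq fun φ hφ => ?_
  rw [dual_wint hκ hF hb, ← integral_mul_const]
  refine norm_integral_le_of_norm_le (hκ.norm.mul_const C) (Eventually.of_forall fun x => ?_)
  rw [norm_mul]
  exact mul_le_mul_of_nonneg_left ((hφ _).trans (hC x)) (norm_nonneg _)

theorem SemBdd.comp {Y Z : Type*} {F : Y → A} (h : SemBdd F) (g : Z → Y) :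
    SemBdd fun z => F (g z) := fun q hq => by
  obtain ⟨C, hC⟩ := h q hq
  exact ⟨C, fun z => hC _⟩

theorem SemBdd.smul {Y : Type*} {F : Y → A} (h : SemBdd F) {g : Y → ℂ} {K : ℝ}
    (hg : ∀ y, ‖g y‖ ≤ K) : SemBdd fun y => g y • F y := fun q hq => by
  obtain ⟨C, hC⟩ := h q hq
  refine ⟨K * C, fun y => ?_⟩
  rw [map_smul_eq_mul]
  exact mul_le_mul (hg y) (hC y) (apply_nonneg _ _) ((norm_nonneg _).trans (hg y))

theorem SemBdd.mul {A : Type*} [NonUnitalRing A] [Module ℂ A] [IsScalarTower ℂ A A]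
    [SMulCommClass ℂ A A] [UniformSpace A] [IsUniformAddGroup A] [ContinuousSMul ℂ A]
    [PolynormableSpace ℂ A] [ContinuousMul A] {Y : Type*} {F G : Y → A} (hF : SemBdd F)
    (hG : SemBdd G) : SemBdd fun y => F y * G y := fun q hq => by
  obtain ⟨q', hq', h⟩ := exists_seminorm_mul hq
  obtain ⟨C, hC⟩ := hF q' hq'
  obtain ⟨D, hD⟩ := hG q' hq'
  exact ⟨C * D, fun y => (h _ _).trans (mul_le_mul (hC y) (hD y) (apply_nonneg _ _)
    ((apply_nonneg _ _).trans (hC y)))⟩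

end WeakIntegral

/-! ### Actions of the body, smooth vectors, and their presentation as Gamma averages. -/

/-- A strongly continuous, uniformly bounded action of the body by automorphisms. -/
structure BodyAction (m : ℕ) (A : Type*) [NonUnitalRing A] [Module ℂ A] [UniformSpace A] where
  act : Body m → A →L[ℂ] A
  act_zero : ∀ a, act 0 a = a
  act_add : ∀ x y a, act (x + y) a = act x (act y a)
  act_mul : ∀ x a b, act x (a * b) = act x a * act x b
  act_continuous : ∀ a, Continuous fun x => act x a
  act_bdd : ∀ a, SemBdd fun x => act x a

section Action

variable {A : Type*} [NonUnitalRing A] [Module ℂ A] [IsScalarTower ℂ A A] [SMulCommClass ℂ A A]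
  [UniformSpace A] [IsUniformAddGroup A] [ContinuousSMul ℂ A] [ContinuousMul A]
  [PolynormableSpace ℂ A] [CompleteSpace A] [T2Space A] [FirstCountableTopology A] {m : ℕ}

namespace BodyAction

variable (α : BodyAction m A)

instance barrelled_of_complete : BarrelledSpace ℂ A :=
  have : (uniformity A).IsCountablyGenerated := IsUniformAddGroup.uniformity_countably_generated
  inferInstance

@[fun_prop] theorem continuous_act {X : Type*} [TopologicalSpace X] {f : X → Body m}
    (hf : Continuous f) (a : A) : Continuous fun x => α.act (f x) a :=
  (α.act_continuous a).comp hf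

/-- Uniform boundedness principle: bounded orbits imply that the action is equicontinuous. -/
theorem exists_seminorm_act {q : Seminorm ℂ A} (hq : Continuous q) :
    ∃ q' : Seminorm ℂ A, Continuous q' ∧ ∀ x a, q (α.act x a) ≤ q' a :=
  exists_seminorm_forall_le α.act α.act_bdd hq

theorem semBdd_act {X : Type*} (f : X → Body m) {g : X → A} (hg : SemBdd g) :
    SemBdd fun x => α.act (f x) (g x) := fun q hq => by
  obtain ⟨q', hq', h⟩ := α.exists_seminorm_act hq
  obtain ⟨C, hC⟩ := hg q' hq'
  exact ⟨C, fun x => (h _ _).trans (hC x)⟩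

theorem semBdd_const {X : Type*} (a : A) : SemBdd fun _ : X => a := fun q _ => ⟨q a, fun _ => le_rfl⟩

/-- Equicontinuity together with strong continuity gives joint continuity. -/
theorem continuous_act_pair : Continuous fun z : Body m × A => α.act z.1 z.2 := by
  rw [continuous_iff_continuousAt]
  intro z₀
  rw [ContinuousAt, tendsto_iff_seminorm]
  intro q hq
  obtain ⟨q', hq', h⟩ := α.exists_seminorm_act hq
  have h1 : Tendsto (fun z : Body m × A => q' (z.2 - z₀.2) + q (α.act z.1 z₀.2 - α.act z₀.1 z₀.2))
      (𝓝 z₀) (𝓝 0) := by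
    have hc : Continuous fun z : Body m × A =>
        q' (z.2 - z₀.2) + q (α.act z.1 z₀.2 - α.act z₀.1 z₀.2) := by
      refine (hq'.comp (by fun_prop)).add (hq.comp (by fun_prop))
    simpa using hc.tendsto z₀
  refine squeeze_zero (fun _ => apply_nonneg _ _) (fun z => ?_) h1
  have e : α.act z.1 z.2 - α.act z₀.1 z₀.2 =
      α.act z.1 (z.2 - z₀.2) + (α.act z.1 z₀.2 - α.act z₀.1 z₀.2) := by
    rw [map_sub]; abel
  rw [e]
  exact (map_add_le_add q _ _).trans (add_le_add_left (h _ _) _)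

@[fun_prop] theorem continuous_act' {X : Type*} [TopologicalSpace X] {f : X → Body m} {g : X → A}
    (hf : Continuous f) (hg : Continuous g) : Continuous fun x => α.act (f x) (g x) :=
  α.continuous_act_pair.comp (hf.prodMk hg)

/-- Smooth vectors of a body action. -/
def Smooth (a : A) : Prop := ∀ k, IsClassC k fun x => α.act x a

variable {α}

theorem Smooth.add {a b : A} (ha : α.Smooth a) (hb : α.Smooth b) : α.Smooth (a + b) := fun k => by
  simpa using (ha k).add k (hb k)

theorem Smooth.smul (c : ℂ) {a : A} (ha : α.Smooth a) : α.Smooth (c • a) := fun k => by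
  simpa using (ha k).smul k c

theorem Smooth.sub {a b : A} (ha : α.Smooth a) (hb : α.Smooth b) : α.Smooth (a - b) := by
  have := ha.add (hb.smul (-1))
  rwa [neg_one_smul, ← sub_eq_add_neg] at this

theorem Smooth.act {a : A} (ha : α.Smooth a) (x : Body m) : α.Smooth (α.act x a) := by
  have key : ∀ (k : ℕ) (f : Body m → A), IsClassC k f → IsClassC k fun y => f (y + x) := by
    intro k
    induction k with
    | zero => exact fun f hf => Continuous.comp hf (by fun_prop)
    | succ k ih =>
      intro f hf
      refine ⟨hf.1.comp (by fun_prop), fun e => ?_⟩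
      obtain ⟨g, hg, hg'⟩ := hf.2 e
      refine ⟨_, fun y => ?_, ih g hg'⟩
      have := hg (y + x)
      refine this.congr fun t => ?_
      rw [add_right_comm]
  intro k
  have := key k _ (ha k)
  simpa only [α.act_add] using this

/-- `a'` is the derivative of `a` in the direction `e`. -/
def IsGen (α : BodyAction m A) (e : Body m) (a a' : A) : Prop :=
  Tendsto (fun t : ℝ => (t : ℂ)⁻¹ • (α.act (t • e) a - a)) (𝓝[≠] 0) (𝓝 a')

/-- Each order k supplies its own derivative of the orbit. All of them equal x ↦ α_x(g 0 0), since
the action carries difference quotients at 0 to those at x; hence the derivative at 0 is again a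
smooth vector. -/
theorem Smooth.exists_gen {a : A} (ha : α.Smooth a) (e : Body m) :
    ∃ a', α.Smooth a' ∧ IsGen α e a a' := by
  have h1 : ∀ k, ∃ g : Body m → A,
      (∀ x, Tendsto (fun t : ℝ => (t : ℂ)⁻¹ • (α.act (x + t • e) a - α.act x a)) (𝓝[≠] 0)
        (𝓝 (g x))) ∧ IsClassC k g := fun k => (ha (k + 1)).2 e
  choose g hg hg' using h1
  have h0 : IsGen α e a (g 0 0) := by
    have := hg 0 0
    simp only [zero_add, α.act_zero] at this
    exact this
  have hk : ∀ k x, g k x = α.act x (g 0 0) := by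
    intro k x
    refine tendsto_nhds_unique (hg k x) ?_
    have := ((α.act x).continuous.tendsto _).comp h0
    refine this.congr fun t => ?_
    simp [α.act_add]
  refine ⟨g 0 0, fun k => ?_, h0⟩
  have : (fun x => α.act x (g 0 0)) = g k := by
    ext x; exact (hk k x).symm
  rw [this]
  exact hg' k

theorem IsGen.hasDerivAt {e : Body m} {a a' : A} (h : IsGen α e a a') (φ : A →L[ℂ] ℂ) (x : Body m)
    (t : ℝ) : HasDerivAt (fun t : ℝ => φ (α.act (x + t • e) a)) (φ (α.act (x + t • e) a')) t := by
  rw [hasDerivAt_iff_tendsto_slope_zero]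
  have := ((φ.comp (α.act (x + t • e))).continuous.tendsto _).comp h
  refine this.congr fun s => ?_
  have e1 : x + (t + s) • e = (x + t • e) + s • e := by module
  rw [e1, α.act_add (x + t • e) (s • e) a]
  simp [Complex.real_smul]

/-- `a` is the average of the translates of `a'` for the Gamma density. -/
def IsSmoothing (α : BodyAction m A) (a a' : A) : Prop :=
  ∀ (φ : A →L[ℂ] ℂ) (x : Body m),
    φ (α.act x a) = ∫ y : Body m, (gamB y : ℂ) * φ (α.act (x + y) a')

/-- The vector is (1 - D_e)^4 a: along the line in direction e, applying 1 - D_e to the vector is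
applying 1 - d/dt to the scalar functions, and `integral_gam_mul` inverts the fourth power. -/
theorem Smooth.exists_smoothing_line {a : A} (ha : α.Smooth a) (e : Body m) :
    ∃ a', α.Smooth a' ∧ ∀ (φ : A →L[ℂ] ℂ) (x : Body m),
      φ (α.act x a) = ∫ t : ℝ, (gam t : ℂ) * φ (α.act (x + t • e) a') := by
  have h1 : ∀ b : A, ∃ b', α.Smooth b → α.Smooth b' ∧ IsGen α e b b' := by
    intro b
    by_cases hb : α.Smooth b
    · obtain ⟨b', h⟩ := hb.exists_gen e
      exact ⟨b', fun _ => h⟩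
    · exact ⟨0, fun h => absurd h hb⟩
  choose D hD using h1
  let u : ℕ → A := fun n => Nat.rec a (fun _ b => b - D b) n
  have hus : ∀ k, u (k + 1) = u k - D (u k) := fun k => rfl
  have hu : ∀ k, α.Smooth (u k) := by
    intro k
    induction k with
    | zero => exact ha
    | succ k ih => rw [hus]; exact ih.sub (hD _ ih).1
  refine ⟨u 4, hu 4, fun φ x => ?_⟩
  have hbd : ∀ k, ∃ C : ℝ, ∀ t : ℝ, ‖φ (α.act (x + t • e) (u k))‖ ≤ C := fun k =>
    ((α.act_bdd (u k)).comp fun t : ℝ => x + t • e).dual φ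
  choose C hC using hbd
  have hC0 : ∀ k, 0 ≤ C k := fun k => (norm_nonneg _).trans (hC k 0)
  have := integral_gam_mul (f := fun k t => φ (α.act (x + t • e) (u k)))
    (fun k => φ.continuous.comp (by fun_prop)) (C := ∑ k ∈ Finset.range 5, C k) ?_ ?_
  · rw [this]; simp [u]
  · intro k hk t
    exact (hC k t).trans (Finset.single_le_sum (fun i _ => hC0 i) (by simp; omega))
  · intro k t
    refine ((hD _ (hu k)).2.hasDerivAt φ x t).congr_deriv ?_
    rw [hus]; simp

theorem Smooth.exists_smoothing_pi (d : ℕ) : ∀ (e : Fin d → Body m) {a : A}, α.Smooth a →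
    ∃ a', α.Smooth a' ∧ ∀ (φ : A →L[ℂ] ℂ) (x : Body m), φ (α.act x a) =
      ∫ y : Fin d → ℝ, ((∏ i, gam (y i) : ℝ) : ℂ) * φ (α.act (x + ∑ i, y i • e i) a') := by
  induction d with
  | zero =>
    intro e a ha
    refine ⟨a, ha, fun φ x => ?_⟩
    rw [Measure.volume_pi_eq_dirac, integral_dirac]
    simp
  | succ d ih =>
    intro e a ha
    obtain ⟨a₁, ha₁, h₁⟩ := ha.exists_smoothing_line (e 0)
    obtain ⟨a₂, ha₂, h₂⟩ := ih (fun i => e i.succ) ha₁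
    refine ⟨a₂, ha₂, fun φ x => ?_⟩
    rw [h₁]
    simp_rw [h₂]
    have hmp := (volume_preserving_piFinSuccAbove (fun _ : Fin (d + 1) => ℝ) 0).symm
    rw [← hmp.integral_comp (MeasurableEquiv.measurableEmbedding _), Measure.volume_eq_prod,
      integral_prod]
    · refine integral_congr_ae (Eventually.of_forall fun t => ?_)
      simp only
      rw [← integral_const_mul]
      refine integral_congr_ae (Eventually.of_forall fun y => ?_)
      simp only [MeasurableEquiv.piFinSuccAbove_symm_apply, Fin.prod_univ_succ, Fin.sum_univ_succ,
        Fin.insertNthEquiv_zero, Fin.consEquiv_apply, Fin.cons_zero, Fin.cons_succ]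
      push_cast
      rw [add_assoc]; ring
    · have h3 : Integrable (fun z : Fin (d + 1) → ℝ => ((∏ i, gam (z i) : ℝ) : ℂ) *
          φ (α.act (x + ∑ i, z i • e i) a₂)) :=
        ((α.act_bdd a₂).comp _).integrable_dual (by fun_prop)
          (Integrable.fintype_prod fun _ => integrable_gam).ofReal φ
      exact (hmp.integrable_comp_emb (MeasurableEquiv.measurableEmbedding _)).2 h3

theorem Smooth.exists_smoothing {a : A} (ha : α.Smooth a) :
    ∃ a', α.Smooth a' ∧ IsSmoothing α a a' := by
  obtain ⟨a₁, ha₁, h₁⟩ := Smooth.exists_smoothing_pi m (fun i => (Pi.single i 1, 0)) ha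
  obtain ⟨a₂, ha₂, h₂⟩ := Smooth.exists_smoothing_pi m (fun i => (0, Pi.single i 1)) ha₁
  refine ⟨a₂, ha₂, fun φ x => ?_⟩
  rw [h₁]
  simp_rw [h₂]
  rw [Measure.volume_eq_prod, integral_prod]
  · refine integral_congr_ae (Eventually.of_forall fun y => ?_)
    simp only
    rw [← integral_const_mul]
    refine integral_congr_ae (Eventually.of_forall fun z => ?_)
    have e1 : x + ∑ i, y i • ((Pi.single i 1, 0) : Body m) + ∑ i, z i • ((0, Pi.single i 1) : Body m)
        = x + (y, z) := by
      rw [add_assoc]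
      congr 1
      ext i <;> simp [Prod.fst_sum, Prod.snd_sum, Finset.sum_apply, Pi.single_apply]
    simp only [e1, gamB, bprod]
    push_cast; ring
  · exact ((α.act_bdd a₂).comp _).integrable_dual (by fun_prop) integrable_gamB.ofReal φ

end BodyAction
end Action

/-! ### Convergence of the oscillatory integrals of pairs of orbits. -/

section Oscillatory

variable {m : ℕ}

instance isNegInvariant_body : (volume : Measure (Body m)).IsNegInvariant :=
  Measure.IsAddHaarMeasure.isNegInvariant_of_innerRegular _

instance isNegInvariant_body_prod : (volume : Measure (Body m × Body m)).IsNegInvariant := by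
  have := Measure.Regular.of_sigmaCompactSpace_of_isLocallyFiniteMeasure
    (volume : Measure (Body m × Body m))
  exact Measure.IsAddHaarMeasure.isNegInvariant_of_regular _

/-- The euclidean space of frequencies dual to `V × V`. -/
abbrev Freq (m : ℕ) : Type := EuclideanSpace ℝ ((Fin m ⊕ Fin m) ⊕ (Fin m ⊕ Fin m))

open scoped FourierTransform RealInnerProductSpace in
/-- Fourier inversion for cut-off functions on `V × V`. -/
theorem exists_fourier_rep {c : ℝ} (hc : c ≠ 0) {χ : Body m × Body m → ℂ} (hχ : ContDiff ℝ ∞ χ)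
    (hχ' : HasCompactSupport χ) :
    ∃ (g : Freq m → ℂ) (v : Freq m → Body m × Body m), Integrable g ∧ Continuous v ∧
      ∀ p, χ p = ∫ ξ, g ξ * cis (c * (omega0 p.1 (v ξ).2 + omega0 (v ξ).1 p.2)) := by
  -- A change of coordinates to a Euclidean space, where Fourier inversion of Schwartz functions
  -- applies.
  let L : Freq m ≃L[ℝ] Body m × Body m := LinearEquiv.toContinuousLinearEquiv
    { toFun := fun x => ((fun i => x (.inl (.inl i)), fun i => x (.inl (.inr i))),
        (fun i => x (.inr (.inl i)), fun i => x (.inr (.inr i))))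
      invFun := fun p => WithLp.toLp 2 (Sum.elim (Sum.elim p.1.1 p.1.2) (Sum.elim p.2.1 p.2.2))
      map_add' := fun x y => rfl
      map_smul' := fun r x => rfl
      left_inv := fun x => by
        ext i
        rcases i with (i | i) | (i | i) <;> rfl
      right_inv := fun p => rfl }
  have hs : ContDiff ℝ ∞ (χ ∘ L) := hχ.comp L.contDiff
  have hs' : HasCompactSupport (χ ∘ L) := hχ'.comp_homeomorph L.toHomeomorph
  let f : SchwartzMap (Freq m) ℂ := hs'.toSchwartzMap hs
  have hf : ∀ x, f x = χ (L x) := fun x => rfl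
  have hinv : 𝓕⁻ (𝓕 f) = f := FourierTransform.fourierInv_fourier_eq f
  -- Chosen so that c(ω(p.1, v.2) + ω(v.1, p.2)) is 2π times the Euclidean pairing of ξ with p.
  let v : Freq m → Body m × Body m := fun ξ =>
    (2 * Real.pi / c) • ((fun i => ξ (.inr (.inr i)), fun i => -ξ (.inr (.inl i))),
      (fun i => -ξ (.inl (.inr i)), fun i => ξ (.inl (.inl i))))
  let fh : SchwartzMap (Freq m) ℂ := 𝓕 f
  refine ⟨fh, v, fh.integrable, by fun_prop, fun p => ?_⟩
  have h1 : χ p = f (L.symm p) := by rw [hf, L.apply_symm_apply]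
  rw [h1, ← hinv, SchwartzMap.fourierInv_coe, Real.fourierInv_eq']
  refine integral_congr_ae (Eventually.of_forall fun ξ => ?_)
  simp only [smul_eq_mul]
  rw [mul_comm]
  congr 1
  rw [cis]
  congr 2
  norm_cast
  have h2 : ⟪ξ, L.symm p⟫ = ∑ i, ((ξ (.inl (.inl i)) * p.1.1 i + ξ (.inl (.inr i)) * p.1.2 i) +
    (ξ (.inr (.inl i)) * p.2.1 i + ξ (.inr (.inr i)) * p.2.2 i)) := by
    rw [PiLp.inner_apply, Fintype.sum_sum_type, Fintype.sum_sum_type, Fintype.sum_sum_type,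
      ← Finset.sum_add_distrib, ← Finset.sum_add_distrib, ← Finset.sum_add_distrib]
    refine Finset.sum_congr rfl fun i _ => ?_
    have e1 : (L.symm p) (.inl (.inl i)) = p.1.1 i := rfl
    have e2 : (L.symm p) (.inl (.inr i)) = p.1.2 i := rfl
    have e3 : (L.symm p) (.inr (.inl i)) = p.2.1 i := rfl
    have e4 : (L.symm p) (.inr (.inr i)) = p.2.2 i := rfl
    simp only [e1, e2, e3, e4, RCLike.inner_apply, conj_trivial]
    ring
  rw [h2]
  simp only [omega0, v, Finset.mul_sum, ← Finset.sum_add_distrib]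
  refine Finset.sum_congr rfl fun i _ => ?_
  simp
  field_simp
  ring

/-- Joint integrability of a translated kernel. -/
theorem integrable_shear {X G : Type*} [TopologicalSpace X] [MeasureSpace X] [BorelSpace X]
    [SecondCountableTopology X] [SFinite (volume : Measure X)]
    [NormedAddCommGroup G] [MeasureSpace G] [BorelSpace G] [SecondCountableTopology G]
    [(volume : Measure G).IsAddRightInvariant] [SFinite (volume : Measure G)] {f : X → ℂ}
    (hf : Integrable f) {κ : G → ℂ} (hκ : Integrable κ) (hκ' : Continuous κ) {w : X → G}
    (hw : Continuous w) :
    Integrable (fun z : X × G => f z.1 * κ (z.2 - w z.1)) (volume.prod volume) := by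
  have hm : AEStronglyMeasurable (fun z : X × G => f z.1 * κ (z.2 - w z.1))
      (volume.prod volume) :=
    hf.1.comp_fst.mul (Continuous.aestronglyMeasurable (by fun_prop))
  rw [integrable_prod_iff hm]
  refine ⟨Eventually.of_forall fun x => (hκ.comp_sub_right (w x)).const_mul (f x), ?_⟩
  have : ∀ x, ∫ y, ‖f x * κ (y - w x)‖ = ‖f x‖ * ∫ y, ‖κ y‖ := by
    intro x
    simp_rw [norm_mul]
    rw [integral_const_mul, integral_sub_right_eq_self (fun y => ‖κ y‖)]
  simp_rw [this]
  exact hf.norm.mul_const _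

variable {A : Type*} [NonUnitalRing A] [Module ℂ A] [IsScalarTower ℂ A A] [SMulCommClass ℂ A A]
  [UniformSpace A] [IsUniformAddGroup A] [ContinuousSMul ℂ A] [ContinuousMul A]
  [PolynormableSpace ℂ A] [CompleteSpace A] [T2Space A] [FirstCountableTopology A]

/-- Left multiplication, then a functional. -/
def mulLeftDual (φ : A →L[ℂ] ℂ) (a : A) : A →L[ℂ] ℂ where
  toFun b := φ (a * b)
  map_add' b c := by rw [mul_add, map_add]
  map_smul' r b := by rw [mul_smul_comm, map_smul, RingHom.id_apply]
  cont := φ.continuous.comp (by fun_prop)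

/-- Right multiplication, then a functional. -/
def mulRightDual (φ : A →L[ℂ] ℂ) (b : A) : A →L[ℂ] ℂ where
  toFun a := φ (a * b)
  map_add' a c := by rw [add_mul, map_add]
  map_smul' r a := by rw [smul_mul_assoc, map_smul, RingHom.id_apply]
  cont := φ.continuous.comp (by fun_prop)

@[simp] theorem mulLeftDual_apply (φ : A →L[ℂ] ℂ) (a b : A) : mulLeftDual φ a b = φ (a * b) := rfl

@[simp] theorem mulRightDual_apply (φ : A →L[ℂ] ℂ) (a b : A) : mulRightDual φ b a = φ (a * b) := rfl

namespace BodyAction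

variable (α : BodyAction m A)

/-- The function `(x, y) ↦ α_x(a) α_y(b)`. -/
def orb (a b : A) (p : Body m × Body m) : A := α.act p.1 a * α.act p.2 b

@[fun_prop] theorem continuous_orb {X : Type*} [TopologicalSpace X] {f g : X → A}
    {h : X → Body m × Body m} (hf : Continuous f) (hg : Continuous g) (hh : Continuous h) :
    Continuous fun x => α.orb (f x) (g x) (h x) := by
  unfold orb; fun_prop

theorem semBdd_orb {X : Type*} {f g : X → A} (hf : SemBdd f) (hg : SemBdd g)
    (h : X → Body m × Body m) : SemBdd fun x => α.orb (f x) (g x) (h x) :=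
  (α.semBdd_act _ hf).mul (α.semBdd_act _ hg)

theorem orb_act (a b : A) (v q : Body m × Body m) :
    α.orb (α.act v.1 a) (α.act v.2 b) q = α.orb a b (q + v) := by
  simp [orb, α.act_add]

theorem act_orb (a b : A) (x : Body m) (q : Body m × Body m) :
    α.act x (α.orb a b q) = α.orb (α.act x a) (α.act x b) q := by
  rw [orb, α.act_mul, orb, ← α.act_add, ← α.act_add, ← α.act_add, ← α.act_add, add_comm x,
    add_comm x]

variable {α}

theorem dual_orb_smoothing {a a' b b' : A} (ha : IsSmoothing α a a') (hb : IsSmoothing α b b')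
    (φ : A →L[ℂ] ℂ) (p : Body m × Body m) :
    φ (α.orb a b p) = ∫ y : Body m × Body m, ((gamB y.1 * gamB y.2 : ℝ) : ℂ) *
      φ (α.orb a' b' (p + y)) := by
  have hi : Integrable (fun y : Body m × Body m => ((gamB y.1 * gamB y.2 : ℝ) : ℂ) *
      φ (α.orb a' b' (p + y))) :=
    (α.semBdd_orb (semBdd_const a') (semBdd_const b') _).integrable_dual (by fun_prop)
      integrable_gamB_prod φ
  rw [Measure.volume_eq_prod, integral_prod _ hi]
  have h1 := ha (mulRightDual φ (α.act p.2 b)) p.1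
  simp only [mulRightDual_apply] at h1
  rw [orb, h1]
  refine integral_congr_ae (Eventually.of_forall fun y => ?_)
  simp only
  have h2 := hb (mulLeftDual φ (α.act (p.1 + y) a')) p.2
  simp only [mulLeftDual_apply] at h2
  rw [h2, ← integral_const_mul]
  refine integral_congr_ae (Eventually.of_forall fun z => ?_)
  simp only [orb, Prod.fst_add, Prod.snd_add]
  push_cast; ring

/-- The Moyal product, expressed through the smoothed kernel. -/
def moyal (α : BodyAction m A) (c : ℝ) (a' b' : A) : A :=
  wint (moyalKernel c) fun p => α.orb a' b' p

theorem continuous_moyal_act {c : ℝ} (hc : c ≠ 0) (a b : A) :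
    Continuous fun v : Body m × Body m => moyal α c (α.act v.1 a) (α.act v.2 b) := by
  unfold moyal
  refine continuous_wint (integrable_moyalKernel hc) (fun y => by fun_prop) (fun x => by fun_prop)
    ?_
  exact α.semBdd_orb (α.semBdd_act _ (semBdd_const a)) (α.semBdd_act _ (semBdd_const b)) _

theorem dual_moyal {c : ℝ} (hc : c ≠ 0) (a b : A) (φ : A →L[ℂ] ℂ) :
    φ (moyal α c a b) = ∫ p, moyalKernel c p * φ (α.orb a b p) :=
  dual_wint (integrable_moyalKernel hc) (by fun_prop)
    (α.semBdd_orb (semBdd_const a) (semBdd_const b) _) φ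

theorem semBdd_moyal {c : ℝ} (hc : c ≠ 0) {X : Type*} {f g : X → A} (hf : SemBdd f)
    (hg : SemBdd g) : SemBdd fun x => moyal α c (f x) (g x) := fun q hq => by
  obtain ⟨C, hC⟩ := α.semBdd_orb (X := X × (Body m × Body m)) (hf.comp Prod.fst)
    (hg.comp Prod.fst) Prod.snd q hq
  refine ⟨(∫ p : Body m × Body m, ‖moyalKernel c p‖) * C, fun x => ?_⟩
  exact seminorm_wint_le (integrable_moyalKernel hc) (by fun_prop)
    (α.semBdd_orb (semBdd_const _) (semBdd_const _) _) hq fun p => hC (x, p)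

/-- Completing the square: multiplying the kernel by a frequency of the cut-off translates the
kernel by v, up to a phase that does not depend on p. -/
theorem cis_shift (c : ℝ) (p v : Body m × Body m) :
    cis (c * (omega0 p.1 v.2 + omega0 v.1 p.2)) * cis (-(c * omega0 p.1 p.2)) =
      cis (c * omega0 v.1 v.2) * cis (-(c * omega0 (p.1 - v.1) (p.2 - v.2))) := by
  rw [← cis_add, ← cis_add]
  congr 1
  rw [omega0_sub_left, omega0_sub_right, omega0_sub_right]
  ring

/-- Convergence of the oscillatory integrals. -/
theorem hasOscIntegral_moyal {c : ℝ} (hc : c ≠ 0) {a a' b b' : A} (ha : IsSmoothing α a a')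
    (hb : IsSmoothing α b b') :
    HasOscIntegral (fun p => cis (-(c * omega0 p.1 p.2)) • α.orb a b p) (moyal α c a' b') := by
  intro χ hχ hχ' hχ0
  obtain ⟨g, v, hg, hv, hrep⟩ := exists_fourier_rep hc hχ hχ'
  let Θ : Body m × Body m → A := fun w => moyal α c (α.act w.1 a') (α.act w.2 b')
  have hΘc : Continuous Θ := continuous_moyal_act hc a' b'
  have hΘb : SemBdd Θ :=
    semBdd_moyal hc (α.semBdd_act _ (semBdd_const a')) (α.semBdd_act _ (semBdd_const b'))
  have hΘ : ∀ (φ : A →L[ℂ] ℂ) w, φ (Θ w) = ∫ q, moyalKernel c q * φ (α.orb a' b' (q + w)) := by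
    intro φ w
    rw [dual_moyal hc]
    simp_rw [orb_act]
  -- The contribution of one frequency of χ(ε ·): by `cis_shift` the kernel is translated by ε v(ξ),
  -- equivalently the two vectors are, and the phase is left over.
  let F : ℝ → Freq m → A := fun ε ξ =>
    cis (c * omega0 (ε • v ξ).1 (ε • v ξ).2) • Θ (ε • v ξ)
  have hFc : ∀ ε, Continuous (F ε) := fun ε => by fun_prop
  have hFc' : ∀ ξ, Continuous fun ε => F ε ξ := fun ξ => by fun_prop
  have hFb : SemBdd fun z : ℝ × Freq m => F z.1 z.2 :=
    (hΘb.comp _).smul (K := 1) fun z => by simp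
  have hFb' : ∀ ε, SemBdd (F ε) := fun ε => hFb.comp fun ξ => (ε, ξ)
  refine ⟨fun ε => wint g (F ε), fun ε hε => ?_, ?_⟩
  · intro φ
    have hcs : HasCompactSupport fun p => χ (ε • p) := hχ'.comp_smul hε.ne'
    have hcont : Continuous fun p => χ (ε • p) := hχ.continuous.comp (by fun_prop)
    obtain ⟨D, hD⟩ := (α.semBdd_orb (semBdd_const a') (semBdd_const b')
      (id : Body m × Body m → _)).dual φ
    let u : Body m × Body m → ℂ := fun p => χ (ε • p) * cis (-(c * omega0 p.1 p.2))
    have hu : Continuous u := by fun_prop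
    have hus : HasCompactSupport u := hcs.mul_right
    have hui : Integrable u := hu.integrable_of_hasCompactSupport hus
    have e0 : ∀ p, φ (χ (ε • p) • cis (-(c * omega0 p.1 p.2)) • α.orb a b p) =
        u p * φ (α.orb a b p) := fun p => by simp [u, mul_assoc]
    simp_rw [e0]
    refine ⟨(α.semBdd_orb (semBdd_const a) (semBdd_const b) _).integrable_dual (by fun_prop) hui φ,
      ?_⟩
    let h : Body m × Body m → ℂ := fun y => ((gamB y.1 * gamB y.2 : ℝ) : ℂ)
    have hh : Integrable h := integrable_gamB_prod
    have hhc : Continuous h := by fun_prop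
    let Φ : Body m × Body m → ℂ := fun q => φ (α.orb a' b' q)
    have hΦc : Continuous Φ := φ.continuous.comp (by fun_prop)
    have e1 : ∀ p, φ (α.orb a b p) = ∫ q, h (q - p) * Φ q := by
      intro p
      rw [dual_orb_smoothing ha hb, ← integral_add_right_eq_self (fun q => h (q - p) * Φ q) p]
      simp [h, Φ, add_comm p]
    have i1 : Integrable (fun z : (Body m × Body m) × (Body m × Body m) =>
        u z.1 * (h (z.2 - z.1) * Φ z.2)) (volume.prod volume) := by
      have := (integrable_shear hui hh hhc continuous_id).mul_bdd (c := D) (g := fun z => Φ z.2)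
        (Continuous.aestronglyMeasurable (by fun_prop)) (Eventually.of_forall fun z => hD z.2)
      simpa [mul_assoc] using this
    -- Fubini transfers the Gamma average from the orbit to the oscillating factor; this is where
    -- the smoothed kernel comes from.
    have e2 : ∫ p, u p * φ (α.orb a b p) = ∫ q, Φ q * ∫ y, u (q - y) * h y := by
      simp_rw [e1, ← integral_const_mul]
      rw [integral_integral_swap i1]
      refine integral_congr_ae (Eventually.of_forall fun q => ?_)
      simp only
      rw [← integral_sub_left_eq_self _ volume q]
      refine integral_congr_ae (Eventually.of_forall fun y => ?_)
      simp only [sub_sub_cancel]; ring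
    have e3 : ∀ q, ∫ y, u (q - y) * h y =
        ∫ ξ, g ξ * (cis (c * omega0 (ε • v ξ).1 (ε • v ξ).2) * moyalKernel c (q - ε • v ξ)) := by
      intro q
      have e4 : ∀ y, u (q - y) * h y = ∫ ξ, (g ξ * h y) *
          (cis (c * omega0 (ε • v ξ).1 (ε • v ξ).2) *
          cis (-(c * omega0 (q.1 - (ε • v ξ).1 - y.1) (q.2 - (ε • v ξ).2 - y.2)))) := by
        intro y
        simp only [u]
        rw [hrep, mul_assoc, ← integral_mul_const]
        refine integral_congr_ae (Eventually.of_forall fun ξ => ?_)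
        have e5 := cis_shift c (q - y) (ε • v ξ)
        have e6 : cis (c * (omega0 (ε • (q - y)).1 (v ξ).2 + omega0 (v ξ).1 (ε • (q - y)).2)) =
          cis (c * (omega0 (q - y).1 (ε • v ξ).2 + omega0 (ε • v ξ).1 (q - y).2)) := by
          simp only [Prod.smul_fst, Prod.smul_snd, omega0_smul_left, omega0_smul_right]
        simp only
        rw [e6]
        have e7 : q.1 - (ε • v ξ).1 - y.1 = (q - y).1 - (ε • v ξ).1 := by
          rw [Prod.fst_sub]; abel
        have e8 : q.2 - (ε • v ξ).2 - y.2 = (q - y).2 - (ε • v ξ).2 := by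
          rw [Prod.snd_sub]; abel
        rw [e7, e8, ← e5]
        ring
      simp_rw [e4]
      rw [integral_integral_swap]
      · refine integral_congr_ae (Eventually.of_forall fun ξ => ?_)
        simp only [moyalKernel]
        rw [← integral_const_mul, ← integral_const_mul]
        refine integral_congr_ae (Eventually.of_forall fun y => ?_)
        simp only [h, Prod.fst_sub, Prod.snd_sub]
        ring
      · have i2 : Integrable (fun z : (Body m × Body m) × Freq m => g z.2 * h z.1)
            (volume.prod volume) := (hg.mul_prod hh).swap
        refine i2.mul_bdd (c := 1) (Continuous.aestronglyMeasurable (by fun_prop))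
          (Eventually.of_forall fun z => by simp)
    rw [e2]
    simp_rw [e3, ← integral_const_mul]
    rw [integral_integral_swap]
    · rw [dual_wint hg (hFc ε) (hFb' ε)]
      refine integral_congr_ae (Eventually.of_forall fun ξ => ?_)
      simp only [F, map_smul, smul_eq_mul]
      rw [hΘ, ← integral_sub_right_eq_self (fun q => moyalKernel c q * φ (α.orb a' b' (q + ε • v ξ)))
        (ε • v ξ), ← integral_const_mul, ← integral_const_mul]
      refine integral_congr_ae (Eventually.of_forall fun q => ?_)
      simp only [Φ, sub_add_cancel]
      ring
    · have i3 := (integrable_shear hg (integrable_moyalKernel hc) (continuous_moyalKernel c)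
        (w := fun ξ => ε • v ξ) (by fun_prop)).swap
      have i4 := i3.mul_bdd (c := D) (g := fun z => Φ z.1 *
          cis (c * omega0 (ε • v z.2).1 (ε • v z.2).2))
        (Continuous.aestronglyMeasurable (by fun_prop)) (Eventually.of_forall fun z => by
          rw [norm_mul, norm_cis, mul_one]; exact hD z.1)
      refine i4.congr (Eventually.of_forall fun z => ?_)
      simp only [Function.uncurry, Function.comp, Prod.fst_swap, Prod.snd_swap]
      ring
  -- At ε = 0 the integrand is g times a constant vector, and ∫ g = χ(0) = 1; continuity in ε gives
  -- the limit.
  · have h1 : Continuous fun ε => wint g (F ε) := continuous_wint hg hFc hFc' hFb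
    have h2 : wint g (F 0) = moyal α c a' b' := by
      refine eq_of_dual fun φ => ?_
      rw [dual_wint hg (hFc 0) (hFb' 0)]
      have h3 := hrep 0
      simp only [Prod.fst_zero, Prod.snd_zero] at h3
      have h4 : ∀ x : Body m, omega0 0 x = 0 := fun x => by simp [omega0]
      have h5 : ∀ x : Body m, omega0 x 0 = 0 := fun x => by simp [omega0]
      have h6 : χ (0, 0) = 1 := hχ0
      simp only [h4, h5, add_zero, mul_zero, cis_zero, mul_one] at h3
      simp only [F, Θ, zero_smul, Prod.fst_zero, Prod.snd_zero, h4, mul_zero, cis_zero, one_smul,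
        α.act_zero]
      rw [integral_mul_const, ← h3, hχ0, one_mul]
    rw [← h2]
    exact (h1.tendsto 0).mono_left nhdsWithin_le_nhds

end BodyAction
end Oscillatory

/-! ### Uniqueness and functoriality of oscillatory integrals. -/

section OscIntegral

variable {A : Type*} [AddCommGroup A] [Module ℂ A] [UniformSpace A] [IsUniformAddGroup A]
  [ContinuousSMul ℂ A] [PolynormableSpace ℂ A] [T2Space A] {m : ℕ}

theorem exists_cutoff (m : ℕ) : ∃ χ : Body m × Body m → ℂ, ContDiff ℝ ∞ χ ∧ HasCompactSupport χ ∧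
    χ 0 = 1 := by
  let f : ContDiffBump (0 : Body m × Body m) := ⟨1, 2, one_pos, one_lt_two⟩
  refine ⟨fun p => (f p : ℂ), Complex.ofRealCLM.contDiff.comp f.contDiff,
    f.hasCompactSupport.comp_left (g := fun r : ℝ => (r : ℂ)) Complex.ofReal_zero, ?_⟩
  have : f 0 = 1 := f.one_of_mem_closedBall (by simp [f.rIn_pos.le])
  simp [this]

theorem HasOscIntegral.unique {F : Body m × Body m → A} {a b : A} (ha : HasOscIntegral F a)
    (hb : HasOscIntegral F b) : a = b := by
  obtain ⟨χ, h1, h2, h3⟩ := exists_cutoff m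
  obtain ⟨I, hI, hI'⟩ := ha χ h1 h2 h3
  obtain ⟨I', hJ, hJ'⟩ := hb χ h1 h2 h3
  refine tendsto_nhds_unique hI' (hJ'.congr' ?_)
  filter_upwards [self_mem_nhdsWithin] with ε hε
  exact eq_of_dual fun φ => by rw [← (hI ε hε φ).2, ← (hJ ε hε φ).2]

theorem HasOscIntegral.oscIntegral_eq {F : Body m × Body m → A} {a : A}
    (ha : HasOscIntegral F a) : oscIntegral F = a := by
  have h : ∃ a, HasOscIntegral F a := ⟨a, ha⟩
  rw [oscIntegral, dif_pos h]
  exact h.choose_spec.unique ha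

theorem HasOscIntegral.map {F : Body m × Body m → A} {a : A} (ha : HasOscIntegral F a)
    (T : A →L[ℂ] A) : HasOscIntegral (fun p => T (F p)) (T a) := by
  intro χ h1 h2 h3
  obtain ⟨I, hI, hI'⟩ := ha χ h1 h2 h3
  refine ⟨fun ε => T (I ε), fun ε hε φ => ?_, (T.continuous.tendsto a).comp hI'⟩
  simpa using hI ε hε (φ.comp T)

theorem HasOscIntegral.add {F G : Body m × Body m → A} {a b : A} (ha : HasOscIntegral F a)
    (hb : HasOscIntegral G b) : HasOscIntegral (fun p => F p + G p) (a + b) := by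
  intro χ h1 h2 h3
  obtain ⟨I, hI, hI'⟩ := ha χ h1 h2 h3
  obtain ⟨J, hJ, hJ'⟩ := hb χ h1 h2 h3
  refine ⟨fun ε => I ε + J ε, fun ε hε φ => ?_, hI'.add hJ'⟩
  obtain ⟨e1, e2⟩ := hI ε hε φ
  obtain ⟨e3, e4⟩ := hJ ε hε φ
  simp only [smul_add, map_add]
  exact ⟨e1.add e3, by rw [integral_add e1 e3, e2, e4]⟩

theorem HasOscIntegral.smul {F : Body m × Body m → A} {a : A} (ha : HasOscIntegral F a) (c : ℂ) :
    HasOscIntegral (fun p => c • F p) (c • a) :=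
  ha.map (c • ContinuousLinearMap.id ℂ A)

theorem HasOscIntegral.zero : HasOscIntegral (fun _ : Body m × Body m => (0 : A)) 0 :=
  fun χ _ _ _ => ⟨fun _ => 0, fun ε _ φ => by simp, tendsto_const_nhds⟩

theorem HasOscIntegral.sum {ι : Type*} (s : Finset ι) {F : ι → Body m × Body m → A} {a : ι → A}
    (h : ∀ i ∈ s, HasOscIntegral (F i) (a i)) :
    HasOscIntegral (fun p => ∑ i ∈ s, F i p) (∑ i ∈ s, a i) := by
  classical
  induction s using Finset.induction_on with
  | empty => simpa using HasOscIntegral.zero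
  | insert i s hi ih =>
    simp only [Finset.sum_insert hi]
    exact (h i (by simp)).add (ih fun j hj => h j (by simp [hj]))

end OscIntegral

/-! ### The Moyal product of smooth vectors and its compatibility with operators. -/

section MoyalProduct

variable {m : ℕ} {A : Type*} [NonUnitalRing A] [Module ℂ A] [IsScalarTower ℂ A A]
  [SMulCommClass ℂ A A] [UniformSpace A] [IsUniformAddGroup A] [ContinuousSMul ℂ A]
  [ContinuousMul A] [PolynormableSpace ℂ A] [CompleteSpace A] [T2Space A]
  [FirstCountableTopology A]

namespace BodyAction

variable {α : BodyAction m A} {c : ℝ}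

theorem integrable_moyal (hc : c ≠ 0) (a b : A) (φ : A →L[ℂ] ℂ) :
    Integrable fun p => moyalKernel c p * φ (α.orb a b p) :=
  (α.semBdd_orb (semBdd_const a) (semBdd_const b) _).integrable_dual (by fun_prop)
    (integrable_moyalKernel hc) φ

/-- `moyal` as a bilinear map. -/
def moyalLin (α : BodyAction m A) (hc : c ≠ 0) : A →ₗ[ℂ] A →ₗ[ℂ] A :=
  LinearMap.mk₂ ℂ (moyal α c)
    (fun a b d => eq_of_dual fun φ => by
      rw [map_add, dual_moyal hc, dual_moyal hc, dual_moyal hc,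
        ← integral_add (integrable_moyal hc a d φ) (integrable_moyal hc b d φ)]
      simp [orb, add_mul, mul_add])
    (fun r a b => eq_of_dual fun φ => by
      rw [map_smul, dual_moyal hc, dual_moyal hc, smul_eq_mul, ← integral_const_mul]
      simp [orb, smul_mul_assoc, mul_left_comm])
    (fun a b d => eq_of_dual fun φ => by
      rw [map_add, dual_moyal hc, dual_moyal hc, dual_moyal hc,
        ← integral_add (integrable_moyal hc a b φ) (integrable_moyal hc a d φ)]
      simp [orb, mul_add])
    (fun r a b => eq_of_dual fun φ => by
      rw [map_smul, dual_moyal hc, dual_moyal hc, smul_eq_mul, ← integral_const_mul]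
      simp [orb, mul_smul_comm, mul_left_comm])

@[simp] theorem moyalLin_apply (hc : c ≠ 0) (a b : A) : moyalLin α hc a b = moyal α c a b := rfl

theorem exists_seminorm_moyal (α : BodyAction m A) (hc : c ≠ 0) {q : Seminorm ℂ A}
    (hq : Continuous q) : ∃ (C : ℝ) (q' : Seminorm ℂ A), Continuous q' ∧
      ∀ a b, q (moyal α c a b) ≤ C * (q' a * q' b) := by
  obtain ⟨q₁, hq₁, h₁⟩ := exists_seminorm_mul hq
  obtain ⟨q₂, hq₂, h₂⟩ := α.exists_seminorm_act hq₁
  refine ⟨∫ p : Body m × Body m, ‖moyalKernel c p‖, q₂, hq₂, fun a b => ?_⟩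
  refine seminorm_wint_le (integrable_moyalKernel hc) (by fun_prop)
    (α.semBdd_orb (semBdd_const a) (semBdd_const b) _) hq fun p => ?_
  exact (h₁ _ _).trans (mul_le_mul (h₂ _ _) (h₂ _ _) (apply_nonneg _ _) (apply_nonneg _ _))

theorem tendsto_moyal (hc : c ≠ 0) {ι : Type*} {l : Filter ι} {f g : ι → A} {a b : A}
    (hf : Tendsto f l (𝓝 a)) (hg : Tendsto g l (𝓝 b)) :
    Tendsto (fun i => moyal α c (f i) (g i)) l (𝓝 (moyal α c a b)) := by
  rw [tendsto_iff_seminorm]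
  intro q hq
  obtain ⟨C, q', hq', h⟩ := α.exists_seminorm_moyal hc hq
  have h1 : ∀ i, moyal α c (f i) (g i) - moyal α c a b =
      moyal α c (f i - a) (g i) + moyal α c a (g i - b) := by
    intro i
    simp only [← moyalLin_apply hc, map_sub, LinearMap.sub_apply]
    abel
  have h2 : Tendsto (fun i => C * (q' (f i - a) * q' (g i)) + C * (q' a * q' (g i - b))) l (𝓝 0) := by
    have e1 := (tendsto_iff_seminorm.1 hf) q' hq'
    have e2 := (tendsto_iff_seminorm.1 hg) q' hq'
    have e3 := (hq'.tendsto b).comp hg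
    have := ((e1.mul e3).const_mul C).add ((e2.const_mul (q' a)).const_mul C)
    simpa using this
  refine squeeze_zero (fun _ => apply_nonneg _ _) (fun i => ?_) h2
  rw [h1]
  exact (map_add_le_add q _ _).trans (add_le_add (h _ _) (h _ _))

theorem act_moyal (hc : c ≠ 0) (x : Body m) (a b : A) :
    α.act x (moyal α c a b) = moyal α c (α.act x a) (α.act x b) := by
  refine eq_of_dual fun φ => ?_
  have := dual_moyal (α := α) hc a b (φ.comp (α.act x))
  simp only [ContinuousLinearMap.comp_apply] at this
  rw [this, dual_moyal hc]
  simp_rw [act_orb]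

/-- The action distributes over the product, so the usual splitting of the difference quotient and
continuity of the product give the Leibniz rule; smoothness of products follows by induction on the
order. -/
theorem isGen_moyal (hc : c ≠ 0) {e : Body m} {a a' b b' : A} (ha : IsGen α e a a')
    (hb : IsGen α e b b') :
    IsGen α e (moyal α c a b) (moyal α c a' b + moyal α c a b') := by
  have h1 : Tendsto (fun t : ℝ => α.act (t • e) b) (𝓝[≠] 0) (𝓝 b) := by
    have h : Continuous fun t : ℝ => α.act (t • e) b := by fun_prop
    have := h.tendsto 0
    simp only [zero_smul, α.act_zero] at this
    exact this.mono_left nhdsWithin_le_nhds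
  refine ((tendsto_moyal hc ha h1).add (tendsto_moyal hc tendsto_const_nhds hb)).congr fun t => ?_
  rw [act_moyal hc]
  simp only [← moyalLin_apply hc, map_sub, LinearMap.sub_apply, map_smul, LinearMap.smul_apply]
  rw [← smul_add]
  congr 1
  abel

theorem Smooth.moyal (hc : c ≠ 0) {a b : A} (ha : α.Smooth a) (hb : α.Smooth b) :
    α.Smooth (α.moyal c a b) := by
  intro k
  induction k generalizing a b with
  | zero => exact α.act_continuous _
  | succ k ih =>
    refine ⟨α.act_continuous _, fun e => ?_⟩
    obtain ⟨a', ha', ga⟩ := ha.exists_gen e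
    obtain ⟨b', hb', gb⟩ := hb.exists_gen e
    refine ⟨fun x => α.act x (α.moyal c a' b) + α.act x (α.moyal c a b'), fun x => ?_,
      (ih ha' hb).add k (ih ha hb')⟩
    simp only
    rw [← map_add]
    refine (((α.act x).continuous.tendsto _).comp (isGen_moyal hc ga gb)).congr fun t => ?_
    simp [α.act_add]

theorem IsSmoothing.map {a a' : A} (h : IsSmoothing α a a') (T : A →L[ℂ] A)
    (hT : ∀ x b, T (α.act x b) = α.act x (T b)) : IsSmoothing α (T a) (T a') := fun φ x => by
  have := h (φ.comp T) x
  simpa [hT] using this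

theorem IsSmoothing.add {a a' b b' : A} (ha : IsSmoothing α a a') (hb : IsSmoothing α b b') :
    IsSmoothing α (a + b) (a' + b') := fun φ x => by
  have hi : ∀ d : A, Integrable fun y : Body m => (gamB y : ℂ) * φ (α.act (x + y) d) := fun d =>
    ((α.act_bdd d).comp _).integrable_dual (by fun_prop) integrable_gamB.ofReal φ
  simp only [map_add, mul_add]
  rw [integral_add (hi _) (hi _), ← ha, ← hb]

open Classical in
/-- A vector of which `a` is the average. -/
def smoothing (α : BodyAction m A) (a : A) : A :=
  if h : ∃ a', α.Smooth a' ∧ IsSmoothing α a a' then h.choose else 0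

theorem Smooth.smoothing {a : A} (h : α.Smooth a) : α.Smooth (α.smoothing a) := by
  have h' := h.exists_smoothing
  rw [BodyAction.smoothing, dif_pos h']
  exact h'.choose_spec.1

theorem Smooth.isSmoothing {a : A} (h : α.Smooth a) : IsSmoothing α a (α.smoothing a) := by
  have h' := h.exists_smoothing
  rw [BodyAction.smoothing, dif_pos h']
  exact h'.choose_spec.2

/-- The (unnormalized) Moyal product of smooth vectors. -/
def mprod (α : BodyAction m A) (c : ℝ) (a b : A) : A :=
  α.moyal c (α.smoothing a) (α.smoothing b)

theorem hasOscIntegral_mprod (hc : c ≠ 0) {a b : A} (ha : α.Smooth a) (hb : α.Smooth b) :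
    HasOscIntegral (fun p => cis (-(c * omega0 p.1 p.2)) • α.orb a b p) (α.mprod c a b) :=
  hasOscIntegral_moyal hc ha.isSmoothing hb.isSmoothing

/-- The choice made by `smoothing` is neither linear nor equivariant. Since an oscillatory integral
has only one value, any other presentations as averages may replace it, and the algebraic rules
below follow from suitable ones. -/
theorem mprod_eq (hc : c ≠ 0) {a a' b b' : A} (ha : α.Smooth a) (hb : α.Smooth b)
    (ha' : IsSmoothing α a a') (hb' : IsSmoothing α b b') :
    α.mprod c a b = α.moyal c a' b' :=
  (hasOscIntegral_mprod hc ha hb).unique (hasOscIntegral_moyal hc ha' hb')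

theorem Smooth.mprod (hc : c ≠ 0) {a b : A} (ha : α.Smooth a) (hb : α.Smooth b) :
    α.Smooth (α.mprod c a b) := ha.smoothing.moyal hc hb.smoothing

theorem mprod_add_left (hc : c ≠ 0) {a b d : A} (ha : α.Smooth a) (hb : α.Smooth b)
    (hd : α.Smooth d) : α.mprod c (a + b) d = α.mprod c a d + α.mprod c b d := by
  rw [mprod_eq hc (ha.add hb) hd (ha.isSmoothing.add hb.isSmoothing) hd.isSmoothing]
  simp only [← moyalLin_apply hc, map_add, LinearMap.add_apply, mprod]

theorem mprod_add_right (hc : c ≠ 0) {a b d : A} (ha : α.Smooth a) (hb : α.Smooth b)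
    (hd : α.Smooth d) : α.mprod c a (b + d) = α.mprod c a b + α.mprod c a d := by
  rw [mprod_eq hc ha (hb.add hd) ha.isSmoothing (hb.isSmoothing.add hd.isSmoothing)]
  simp only [← moyalLin_apply hc, map_add, mprod]

theorem mprod_smul_left (hc : c ≠ 0) (r : ℂ) {a b : A} (ha : α.Smooth a) (hb : α.Smooth b) :
    α.mprod c (r • a) b = r • α.mprod c a b := by
  rw [mprod_eq hc (ha.smul r) hb (ha.isSmoothing.map (r • ContinuousLinearMap.id ℂ A) (by simp))
    hb.isSmoothing]
  exact (moyalLin α hc).map_smul₂ r _ _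

theorem mprod_smul_right (hc : c ≠ 0) (r : ℂ) {a b : A} (ha : α.Smooth a) (hb : α.Smooth b) :
    α.mprod c a (r • b) = r • α.mprod c a b := by
  rw [mprod_eq hc ha (hb.smul r) ha.isSmoothing
    (hb.isSmoothing.map (r • ContinuousLinearMap.id ℂ A) (by simp))]
  exact (moyalLin α hc _).map_smul r _

/-- Maps commuting with the action preserve smoothness. -/
theorem Smooth.map {a : A} (ha : α.Smooth a) (T : A →L[ℂ] A)
    (hT : ∀ x b, T (α.act x b) = α.act x (T b)) : α.Smooth (T a) := by
  have key : ∀ (k : ℕ) (f : Body m → A), IsClassC k f → IsClassC k fun y => T (f y) := by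
    intro k
    induction k with
    | zero => exact fun f hf => T.continuous.comp hf
    | succ k ih =>
      intro f hf
      refine ⟨T.continuous.comp hf.1, fun e => ?_⟩
      obtain ⟨g, hg, hg'⟩ := hf.2 e
      refine ⟨_, fun y => ?_, ih g hg'⟩
      refine ((T.continuous.tendsto _).comp (hg y)).congr fun t => ?_
      simp
  intro k
  simpa only [hT] using key k _ (ha k)

/-- A Leibniz rule for the product gives one for the Moyal product. -/
theorem mprod_leibniz (hc : c ≠ 0) {D γ : A →L[ℂ] A} (hD : ∀ x b, D (α.act x b) = α.act x (D b))
    (hγ : ∀ x b, γ (α.act x b) = α.act x (γ b)) (h : ∀ a b, D (a * b) = a * D b + D a * γ b)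
    {a b : A} (ha : α.Smooth a) (hb : α.Smooth b) :
    D (α.mprod c a b) = α.mprod c a (D b) + α.mprod c (D a) (γ b) := by
  rw [mprod_eq hc ha (hb.map D hD) ha.isSmoothing (hb.isSmoothing.map D hD),
    mprod_eq hc (ha.map D hD) (hb.map γ hγ) (ha.isSmoothing.map D hD) (hb.isSmoothing.map γ hγ)]
  refine eq_of_dual fun φ => ?_
  have := dual_moyal (α := α) hc (α.smoothing a) (α.smoothing b) (φ.comp D)
  simp only [ContinuousLinearMap.comp_apply] at this
  rw [mprod, this, map_add, dual_moyal hc, dual_moyal hc,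
    ← integral_add (integrable_moyal hc _ _ φ) (integrable_moyal hc _ _ φ)]
  simp only [orb, h, hD, hγ, map_add, mul_add]

/-- An automorphism of the product is one of the Moyal product. -/
theorem map_mprod (hc : c ≠ 0) {γ : A →L[ℂ] A} (hγ : ∀ x b, γ (α.act x b) = α.act x (γ b))
    (h : ∀ a b, γ (a * b) = γ a * γ b) {a b : A} (ha : α.Smooth a) (hb : α.Smooth b) :
    γ (α.mprod c a b) = α.mprod c (γ a) (γ b) := by
  rw [mprod_eq hc (ha.map γ hγ) (hb.map γ hγ) (ha.isSmoothing.map γ hγ) (hb.isSmoothing.map γ hγ)]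
  refine eq_of_dual fun φ => ?_
  have := dual_moyal (α := α) hc (α.smoothing a) (α.smoothing b) (φ.comp γ)
  simp only [ContinuousLinearMap.comp_apply] at this
  rw [mprod, this, dual_moyal hc]
  simp only [orb, h, hγ]

/-- Products that vanish on orbits vanish. -/
theorem mprod_eq_zero (hc : c ≠ 0) {D D' : A →L[ℂ] A} (hD : ∀ x b, D (α.act x b) = α.act x (D b))
    (hD' : ∀ x b, D' (α.act x b) = α.act x (D' b)) (h : ∀ a b, D a * D' b = 0)
    {a b : A} (ha : α.Smooth a) (hb : α.Smooth b) : α.mprod c (D a) (D' b) = 0 := by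
  rw [mprod_eq hc (ha.map D hD) (hb.map D' hD') (ha.isSmoothing.map D hD)
    (hb.isSmoothing.map D' hD')]
  refine eq_of_dual fun φ => ?_
  rw [dual_moyal hc]
  simp [orb, ← hD, ← hD', h]

end BodyAction
end MoyalProduct

/-! ### Symbols of smooth vectors; the Moyal product as a twisted convolution. -/

section WignerSymbol

variable {m : ℕ}

/-- The reproducing property, smoothed. -/
theorem integral_wig_mul_moyalKernel {l : ℝ} (hl : l ≠ 0) (q : Body m × Body m) (δ : Body m) :
    2 ^ m * ∫ x, wig l x δ * moyalKernel (2 * l) (q - (x, x)) =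
      ∫ d, cis (-(l / 2 * omega0 d δ)) * (wigS l q.1 d * wigS l (q.2 + d) (δ - d)) := by
  have hb : 0 < |l| := abs_pos.2 hl
  have e1 : ∀ x, wig l x δ * moyalKernel (2 * l) (q - (x, x)) =
      ∫ y : Body m × Body m, ((gamB y.1 * gamB y.2 : ℝ) : ℂ) * (wig l x δ *
        cis (-(2 * l * omega0 (q.1 - y.1 - x) (q.2 - y.2 - x)))) := by
    intro x
    rw [moyalKernel, ← integral_const_mul]
    refine integral_congr_ae (Eventually.of_forall fun y => ?_)
    simp only [Prod.fst_sub, Prod.snd_sub]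
    rw [sub_right_comm q.1, sub_right_comm q.2]
    ring
  have e2 : ∀ d, cis (-(l / 2 * omega0 d δ)) * (wigS l q.1 d * wigS l (q.2 + d) (δ - d)) =
      ∫ y : Body m × Body m, ((gamB y.1 * gamB y.2 : ℝ) : ℂ) * (wig l (q.1 - y.1) d *
        wig l (q.2 - y.2 + d) (δ - d) * cis (-(l / 2 * omega0 d δ))) := by
    intro d
    rw [wigS, wigS, Measure.volume_eq_prod (Body m) (Body m), ← integral_prod_mul (μ := volume) (ν := volume)
      (fun y => (gamB y : ℂ) * wig l (q.1 - y) d)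
      (fun y => (gamB y : ℂ) * wig l (q.2 + d - y) (δ - d)), ← integral_const_mul]
    refine integral_congr_ae (Eventually.of_forall fun y => ?_)
    simp only
    rw [sub_add_eq_add_sub]
    push_cast
    ring
  simp_rw [e1, e2]
  -- Both sides are averages over the smoothing variables y of the two sides of
  -- `integral_wig_mul_wig`; only the interchanges of integrals need justification.
  refine ((congrArg (2 ^ m * ·) (integral_integral_swap ?i1)).trans ?mid).trans
    (integral_integral_swap ?i2).symm
  case mid =>
    rw [← integral_const_mul]
    refine integral_congr_ae (Eventually.of_forall fun y => ?_)
    simp only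
    rw [integral_const_mul, integral_const_mul, integral_wig_mul_wig hl]
    ring
  case i2 =>
    -- Domination: the first Wigner factor has the modulus of a Gaussian in d centred at 2(y.1 -
    -- q.1), and the second has modulus at most 1.
    have hκ : Continuous fun d : Body m => (gauss |l| ((1 / 2 : ℝ) • d) : ℂ) := by
      have := continuous_gauss (m := m) |l|
      fun_prop
    have h1 := integrable_shear (integrable_gamB_prod (m := m)) (κ := fun d : Body m =>
      (gauss |l| ((1 / 2 : ℝ) • d) : ℂ))
      (by
        simp only [gauss_smul]
        exact (integrable_gauss (by positivity)).ofReal)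
      hκ
      (w := fun y => (2 : ℝ) • (y.1 - q.1)) (by fun_prop)
    refine h1.swap.mono (Continuous.aestronglyMeasurable (by fun_prop))
      (Eventually.of_forall fun z => ?_)
    simp only [Function.uncurry, Function.comp, Prod.fst_swap, Prod.snd_swap, norm_mul, norm_cis,
      mul_one]
    refine mul_le_mul_of_nonneg_left ?_ (norm_nonneg _)
    refine (mul_le_mul_of_nonneg_left (norm_wig_le_one _ _ _) (norm_nonneg _)).trans ?_
    rw [mul_one, norm_wig, Complex.norm_real, Real.norm_eq_abs, abs_of_pos (gauss_pos _ _)]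
    refine le_of_eq (congrArg _ ?_)
    module
  case i1 =>
    have h1 : Integrable (fun z : (Body m × Body m) × Body m =>
        ((gamB z.1.1 * gamB z.1.2 : ℝ) : ℂ) * wig l z.2 δ) (volume.prod volume) :=
      (integrable_gamB_prod (m := m)).mul_prod (integrable_wig hl δ)
    refine h1.swap.mono (Continuous.aestronglyMeasurable (by fun_prop))
      (Eventually.of_forall fun z => ?_)
    simp [Function.uncurry]

variable {A : Type*} [NonUnitalRing A] [Module ℂ A] [IsScalarTower ℂ A A]
  [SMulCommClass ℂ A A] [UniformSpace A] [IsUniformAddGroup A] [ContinuousSMul ℂ A]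
  [ContinuousMul A] [PolynormableSpace ℂ A] [CompleteSpace A] [T2Space A]
  [FirstCountableTopology A]

namespace BodyAction

variable {α : BodyAction m A} {l : ℝ}

/-- The kernel of the quantization of an orbit in the coherent state representation. -/
def symb (α : BodyAction m A) (l : ℝ) (a : A) (δ : Body m) : A :=
  wint (fun x => wig l x δ) fun x => α.act x a

theorem dual_symb (hl : l ≠ 0) (a : A) (δ : Body m) (φ : A →L[ℂ] ℂ) :
    φ (α.symb l a δ) = ∫ x, wig l x δ * φ (α.act x a) :=
  dual_wint (integrable_wig hl δ) (by fun_prop) (α.act_bdd a) φ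

/-- Shifting by δ/2 makes the weight independent of δ; continuity in δ and the reading of the symbol
as a Fourier transform both rest on this form. -/
theorem symb_eq (hl : l ≠ 0) (a : A) (δ : Body m) :
    α.symb l a δ = wint (fun u : Body m => (gauss |l| u : ℂ)) fun u =>
      cis (l * omega0 u δ) • α.act (u - (1 / 2 : ℝ) • δ) a := by
  have hg : Integrable fun u : Body m => (gauss |l| u : ℂ) :=
    (integrable_gauss (abs_pos.2 hl)).ofReal
  refine eq_of_dual fun φ => ?_
  rw [dual_symb hl, dual_wint (F := fun u : Body m => cis (l * omega0 u δ) •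
      α.act (u - (1 / 2 : ℝ) • δ) a) hg (by fun_prop)
    ((α.semBdd_act _ (semBdd_const a)).smul (K := 1) fun y => by simp),
    ← integral_sub_right_eq_self _ ((1 / 2 : ℝ) • δ)]
  refine integral_congr_ae (Eventually.of_forall fun u => ?_)
  simp only [wig, sub_add_cancel, map_smul, smul_eq_mul, omega0_sub_left, omega0_smul_left,
    omega0_self, mul_zero, sub_zero]
  ring

theorem continuous_symb (hl : l ≠ 0) (a : A) : Continuous (α.symb l a) := by
  have : α.symb l a = fun δ => _ := funext fun δ => symb_eq hl a δ
  rw [this]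
  refine continuous_wint (integrable_gauss (abs_pos.2 hl)).ofReal (fun y => by fun_prop)
    (fun x => by fun_prop) ((α.semBdd_act _ (semBdd_const a)).smul (K := 1) fun y => by simp)

theorem symb_map (hl : l ≠ 0) (T : A →L[ℂ] A) (hT : ∀ x b, T (α.act x b) = α.act x (T b)) (a : A)
    (δ : Body m) : T (α.symb l a δ) = α.symb l (T a) δ := by
  refine eq_of_dual fun φ => ?_
  have := dual_symb (α := α) hl a δ (φ.comp T)
  simp only [ContinuousLinearMap.comp_apply] at this
  rw [this, dual_symb hl]
  simp_rw [hT]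

theorem dual_symb_smoothing (hl : l ≠ 0) {a a' : A} (ha : IsSmoothing α a a') (δ : Body m)
    (φ : A →L[ℂ] ℂ) : φ (α.symb l a δ) = ∫ s, wigS l s δ * φ (α.act s a') := by
  obtain ⟨D, hD⟩ := (α.act_bdd a').dual φ
  rw [dual_symb hl]
  have e1 : ∀ x, wig l x δ * φ (α.act x a) =
      ∫ s, wig l x δ * ((gamB (s - x) : ℂ) * φ (α.act s a')) := by
    intro x
    rw [ha, integral_const_mul,
      ← integral_add_right_eq_self (fun s => (gamB (s - x) : ℂ) * φ (α.act s a')) x]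
    simp [add_comm x]
  simp_rw [e1]
  rw [integral_integral_swap]
  · refine integral_congr_ae (Eventually.of_forall fun s => ?_)
    simp only [wigS]
    rw [← integral_sub_left_eq_self _ volume s, ← integral_mul_const]
    refine integral_congr_ae (Eventually.of_forall fun y => ?_)
    simp only [sub_sub_cancel]; ring
  · have h1 := (integrable_shear (integrable_wig hl δ) (integrable_gamB (m := m)).ofReal
      (by fun_prop) continuous_id).mul_bdd (c := D) (g := fun z => φ (α.act z.2 a'))
      ((φ.continuous.comp (by fun_prop)).aestronglyMeasurable)
      (Eventually.of_forall fun z => hD z.2)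
    simpa [mul_assoc, Function.uncurry_def] using h1

/-- Moving the Gamma average of a smooth vector onto the kernel replaces `wig` by `wigS`, whose
decay in δ survives integration over s. In particular symbols are absolutely integrable in every
continuous seminorm. -/
theorem exists_seminorm_symb_le (hl : l ≠ 0) {a : A} (ha : α.Smooth a) {q : Seminorm ℂ A}
    (hq : Continuous q) : ∃ C : ℝ, 0 ≤ C ∧ ∀ δ, q (α.symb l a δ) ≤ C * wtB δ := by
  obtain ⟨D, hD⟩ := α.act_bdd (α.smoothing a) q hq
  have hD0 : 0 ≤ D := (apply_nonneg _ _).trans (hD 0)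
  obtain ⟨C, hC0, hC⟩ := norm_wigS_le (m := m) hl
  refine ⟨C * D * ∫ s : Body m, wtB s, by
    have : 0 ≤ ∫ s : Body m, wtB s := integral_nonneg fun s => (wtB_pos s).le
    positivity, fun δ => ?_⟩
  refine seminorm_le_of_dual hq fun φ hφ => ?_
  rw [dual_symb_smoothing hl ha.isSmoothing]
  have h1 : Integrable fun s : Body m => C * (wtB (s + (1 / 2 : ℝ) • δ) * wtB δ) * D :=
    (((integrable_wtB.comp_add_right _).mul_const _).const_mul _).mul_const _
  refine (norm_integral_le_of_norm_le h1 (Eventually.of_forall fun s => ?_)).trans_eq ?_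
  · rw [norm_mul]
    exact mul_le_mul (hC s δ) ((hφ _).trans (hD s)) (norm_nonneg _)
      (mul_nonneg hC0 (mul_nonneg (wtB_pos _).le (wtB_pos _).le))
  · rw [integral_mul_const, integral_const_mul, integral_mul_const,
      integral_add_right_eq_self (fun s : Body m => wtB s)]
    ring

theorem integrable_wigS (hl : l ≠ 0) (δ : Body m) : Integrable fun s => wigS l s δ := by
  obtain ⟨C, hC0, hC⟩ := norm_wigS_le (m := m) hl
  refine Integrable.mono' (g := fun s : Body m => C * (wtB (s + (1 / 2 : ℝ) • δ) * wtB δ))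
    (((integrable_wtB.comp_add_right _).mul_const _).const_mul _)
    (Continuous.aestronglyMeasurable ?_) (Eventually.of_forall fun s => hC s δ)
  exact (continuous_wigS l).comp (f := fun s => (s, δ)) (by fun_prop)

/-- The Moyal product becomes a twisted convolution of kernels. -/
theorem dual_symb_mprod (hl : l ≠ 0) {a b : A} (ha : α.Smooth a) (hb : α.Smooth b) (δ : Body m)
    (φ : A →L[ℂ] ℂ) :
    2 ^ m * φ (α.symb l (α.mprod (2 * l) a b) δ) = ∫ d, cis (-(l / 2 * omega0 d δ)) *
      φ (α.symb l a d * α.act (-d) (α.symb l b (δ - d))) := by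
  have hc : 2 * l ≠ 0 := mul_ne_zero two_ne_zero hl
  set a' := α.smoothing a with ha'
  set b' := α.smoothing b with hb'
  obtain ⟨D, hD⟩ := (α.semBdd_orb (semBdd_const a') (semBdd_const b')
    (id : Body m × Body m → _)).dual φ
  let Φ : Body m × Body m → ℂ := fun q => φ (α.orb a' b' q)
  have hΦc : Continuous Φ := φ.continuous.comp (by fun_prop)
  have hS := continuous_wigS (m := m) l
  have e1 : ∀ x, wig l x δ * φ (α.act x (α.mprod (2 * l) a b)) =
      ∫ q, Φ q * (wig l x δ * moyalKernel (2 * l) (q - (x, x))) := by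
    intro x
    rw [mprod, act_moyal hc, dual_moyal hc, ← integral_const_mul,
      ← integral_sub_right_eq_self _ ((x, x) : Body m × Body m)]
    refine integral_congr_ae (Eventually.of_forall fun q => ?_)
    have := α.orb_act a' b' (x, x) (q - (x, x))
    simp only [sub_add_cancel] at this
    simp only [Φ, ← this]
    ring
  have e2 : ∀ d, cis (-(l / 2 * omega0 d δ)) *
      φ (α.symb l a d * α.act (-d) (α.symb l b (δ - d))) =
      ∫ q, Φ q * (cis (-(l / 2 * omega0 d δ)) * (wigS l q.1 d * wigS l (q.2 + d) (δ - d))) := by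
    intro d
    have h1 := dual_symb_smoothing hl ha.isSmoothing d
      (mulRightDual φ (α.act (-d) (α.symb l b (δ - d))))
    simp only [mulRightDual_apply] at h1
    have h2 : ∀ s, φ (α.act s a' * α.act (-d) (α.symb l b (δ - d))) =
        ∫ t, wigS l (t + d) (δ - d) * Φ (s, t) := by
      intro s
      have h3 := dual_symb_smoothing hl hb.isSmoothing (δ - d)
        ((mulLeftDual φ (α.act s a')).comp (α.act (-d)))
      simp only [ContinuousLinearMap.comp_apply, mulLeftDual_apply] at h3
      rw [h3, ← integral_add_right_eq_self _ d]
      refine integral_congr_ae (Eventually.of_forall fun t => ?_)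
      simp only [Φ, orb, ← α.act_add]
      rw [neg_add_cancel_comm_assoc]
    rw [h1, Measure.volume_eq_prod (Body m) (Body m), integral_prod]
    · rw [← integral_const_mul]
      refine integral_congr_ae (Eventually.of_forall fun s => ?_)
      simp only
      rw [← ha', h2, ← integral_const_mul, ← integral_const_mul]
      refine integral_congr_ae (Eventually.of_forall fun t => ?_)
      simp only
      ring
    · have h3 : Integrable (fun q : Body m × Body m => wigS l q.1 d * wigS l (q.2 + d) (δ - d))
          (volume.prod volume) :=
        (integrable_wigS hl d).mul_prod ((integrable_wigS hl (δ - d)).comp_add_right d)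
      refine ((h3.const_mul (cis (-(l / 2 * omega0 d δ)))).mul_bdd (c := D) (g := Φ)
        hΦc.aestronglyMeasurable (Eventually.of_forall hD)).congr (Eventually.of_forall fun q => ?_)
      simp only
      ring
  rw [dual_symb hl]
  simp_rw [e1, e2]
  -- Both sides are integrals of the bounded function Φ against a kernel in q, and the two kernels
  -- agree by `integral_wig_mul_moyalKernel`.
  refine ((congrArg (2 ^ m * ·) (integral_integral_swap ?i1)).trans ?mid).trans
    (integral_integral_swap ?i2).symm
  case mid =>
    rw [← integral_const_mul]
    refine integral_congr_ae (Eventually.of_forall fun q => ?_)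
    simp only
    rw [integral_const_mul, integral_const_mul, ← integral_wig_mul_moyalKernel hl]
    ring
  case i2 =>
    obtain ⟨C, hC0, hC⟩ := norm_wigS_le (m := m) hl
    -- The dominating function is a multiple of `wtB` at d, s + d/2 and t + (δ + d)/2, integrable
    -- after shearing s and t; the decay of the second factor in δ - d is not required.
    have hw : Integrable fun d : Body m => (wtB d : ℂ) := integrable_wtB.ofReal
    have h1 := integrable_shear hw (κ := fun q : Body m × Body m => (wtB q.1 : ℂ) * (wtB q.2 : ℂ))
      (hw.mul_prod hw)
      (by fun_prop) (w := fun d => (-((1 / 2 : ℝ) • d), -((1 / 2 : ℝ) • (δ + d)))) (by fun_prop)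
    refine (h1.const_mul ((D * (C * C) : ℝ) : ℂ)).mono (Continuous.aestronglyMeasurable ?_)
      (Eventually.of_forall fun z => ?_)
    · have := hS.comp (f := fun z : Body m × (Body m × Body m) => (z.2.1, z.1)) (by fun_prop)
      have := hS.comp (f := fun z : Body m × (Body m × Body m) => (z.2.2 + z.1, δ - z.1))
        (by fun_prop)
      simp only [Function.comp_def] at *
      unfold Function.uncurry
      fun_prop
    · obtain ⟨d, s, t⟩ := z
      simp only [Function.uncurry, norm_mul, norm_cis, one_mul, Complex.norm_real, Real.norm_eq_abs,
        Prod.fst_sub, Prod.snd_sub, sub_neg_eq_add, abs_of_pos (wtB_pos _)]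
      have hD0 : 0 ≤ D := (norm_nonneg _).trans (hD 0)
      rw [abs_of_nonneg hD0, abs_of_nonneg hC0]
      have h2 := hC s d
      have h3 : ‖wigS l (t + d) (δ - d)‖ ≤ C * wtB (t + (1 / 2 : ℝ) • (δ + d)) := by
        refine (hC _ _).trans (mul_le_mul_of_nonneg_left ?_ hC0)
        have : t + d + (1 / 2 : ℝ) • (δ - d) = t + (1 / 2 : ℝ) • (δ + d) := by module
        rw [this]
        exact mul_le_of_le_one_right (wtB_pos _).le (wtB_le_one _)
      calc ‖Φ (s, t)‖ * (‖wigS l s d‖ * ‖wigS l (t + d) (δ - d)‖)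
          ≤ D * ((C * (wtB (s + (1 / 2 : ℝ) • d) * wtB d)) *
            (C * wtB (t + (1 / 2 : ℝ) • (δ + d)))) := by
            refine mul_le_mul (hD (s, t)) (mul_le_mul h2 h3 (norm_nonneg _)
              ((norm_nonneg _).trans h2)) (by positivity) hD0
        _ = _ := by ring
  case i1 =>
    have hΦ2 : AEStronglyMeasurable (fun z : Body m × (Body m × Body m) => Φ z.2)
        (volume.prod volume) := (hΦc.comp continuous_snd).aestronglyMeasurable
    have h1 := (integrable_shear (integrable_wig hl δ) (integrable_moyalKernel (m := m) hc)
      (continuous_moyalKernel _) (w := fun x => (x, x)) (by fun_prop)).mul_bdd (c := D)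
      (g := fun z : Body m × (Body m × Body m) => Φ z.2) hΦ2 (Eventually.of_forall fun z => hD z.2)
    refine h1.congr (Eventually.of_forall fun z => ?_)
    simp only [Function.uncurry]
    ring

end BodyAction
end WignerSymbol

/-! ### Injectivity of symbols and associativity of the Moyal product. -/

section Associativity

variable {m : ℕ} {A : Type*} [NonUnitalRing A] [Module ℂ A] [IsScalarTower ℂ A A]
  [SMulCommClass ℂ A A] [UniformSpace A] [IsUniformAddGroup A] [ContinuousSMul ℂ A]
  [ContinuousMul A] [PolynormableSpace ℂ A] [CompleteSpace A] [T2Space A]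
  [FirstCountableTopology A]

open scoped FourierTransform RealInnerProductSpace in
/-- Injectivity of the symplectic Fourier transform. -/
theorem eq_zero_of_integral_cis {l : ℝ} (hl : l ≠ 0) {f : Body m → ℂ} (hf : Continuous f)
    (hf' : Integrable f) (h : ∀ δ, ∫ u, f u * cis (l * omega0 u δ) = 0) (u : Body m) : f u = 0 := by
  have h1 := EuclideanSpace.volume_preserving_symm_measurableEquiv_toLp (Fin m ⊕ Fin m)
  have h2 := volume_measurePreserving_sumPiEquivProdPi (fun _ : Fin m ⊕ Fin m => ℝ)
  let e : EuclideanSpace ℝ (Fin m ⊕ Fin m) ≃ᵐ Body m := (MeasurableEquiv.toLp 2 (Fin m ⊕ Fin m → ℝ)).symm.trans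
    (MeasurableEquiv.sumPiEquivProdPi fun _ => ℝ)
  have he : MeasurePreserving e volume volume := h2.comp h1
  have hev : ∀ v : EuclideanSpace ℝ (Fin m ⊕ Fin m), e v = (fun i => v (.inl i), fun i => v (.inr i)) := fun v => rfl
  have hec : Continuous e := by
    have : (e : EuclideanSpace ℝ (Fin m ⊕ Fin m) → Body m) = fun v => (fun i => v (.inl i), fun i => v (.inr i)) := funext hev
    rw [this]
    fun_prop
  let F : EuclideanSpace ℝ (Fin m ⊕ Fin m) → ℂ := fun v => f (e v)
  have hF : Continuous F := hf.comp hec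
  have hF' : Integrable F := (he.integrable_comp_emb e.measurableEmbedding).2 hf'
  have hz : 𝓕 F = 0 := by
    ext w
    rw [Real.fourier_eq', Pi.zero_apply]
    let δ : Body m := (2 * Real.pi / l) • (fun i => w (.inr i), fun i => -w (.inl i))
    rw [← h δ, ← he.integral_comp e.measurableEmbedding]
    refine integral_congr_ae (Eventually.of_forall fun v => ?_)
    simp only [smul_eq_mul, F]
    rw [mul_comm]
    congr 1
    rw [cis]
    congr 2
    norm_cast
    rw [PiLp.inner_apply, Fintype.sum_sum_type, hev]
    simp only [omega0, δ, Finset.mul_sum, ← Finset.sum_add_distrib]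
    refine Finset.sum_congr rfl fun i _ => ?_
    simp
    field_simp
    ring
  have := hF.fourierInv_fourier_eq hF' (by rw [hz]; exact integrable_zero _ _ _)
  rw [hz] at this
  have h3 : F (e.symm u) = 0 := by
    rw [← this, Real.fourierInv_eq']
    simp
  simpa [F] using h3

namespace BodyAction

variable {α : BodyAction m A} {l : ℝ}

/-- After a translation by δ/2, the symbol paired with φ is the symplectic Fourier transform of u ↦
e^{-|l||u|²} φ(α_u(a)). Its vanishing forces this continuous function to vanish, and u = 0 gives
φ(a) = 0. -/
theorem eq_zero_of_symb (hl : l ≠ 0) {a : A} (h : ∀ δ, α.symb l a δ = 0) : a = 0 := by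
  refine eq_of_dual fun φ => ?_
  rw [map_zero]
  have hg : Integrable fun u : Body m => (gauss |l| u : ℂ) :=
    (integrable_gauss (abs_pos.2 hl)).ofReal
  have key := eq_zero_of_integral_cis hl (f := fun u => (gauss |l| u : ℂ) * φ (α.act u a))
    (by
      have := continuous_gauss (m := m) |l|
      exact Continuous.mul (by fun_prop) (φ.continuous.comp (by fun_prop)))
    ((α.act_bdd a).integrable_dual (by fun_prop) hg φ) ?_ 0
  · have h0 : (gauss |l| (0 : Body m) : ℂ) ≠ 0 := by exact_mod_cast (gauss_pos _ _).ne'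
    simpa [h0, α.act_zero] using key
  · intro δ
    have h1 := symb_map (α := α) hl (α.act ((1 / 2 : ℝ) • δ))
      (fun x b => by rw [← α.act_add, ← α.act_add, add_comm]) a δ
    rw [h, map_zero, symb_eq hl] at h1
    have h2 := congrArg φ h1
    rw [map_zero, dual_wint (F := fun u : Body m => cis (l * omega0 u δ) •
      α.act (u - (1 / 2 : ℝ) • δ) (α.act ((1 / 2 : ℝ) • δ) a)) hg (by fun_prop)
      ((α.semBdd_act _ (semBdd_const _)).smul (K := 1) fun y => by simp)] at h2
    rw [h2]
    refine integral_congr_ae (Eventually.of_forall fun u => ?_)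
    simp only [← α.act_add, sub_add_cancel, map_smul, smul_eq_mul]
    ring

theorem eq_of_symb (hl : l ≠ 0) {a b : A} (h : ∀ δ, α.symb l a δ = α.symb l b δ) : a = b := by
  rw [← sub_eq_zero]
  refine eq_zero_of_symb hl (α := α) fun δ => eq_of_dual fun φ => ?_
  rw [dual_symb hl, map_zero]
  simp only [map_sub, mul_sub]
  have hi : ∀ d : A, Integrable fun x => wig l x δ * φ (α.act x d) := fun d =>
    (α.act_bdd d).integrable_dual (by fun_prop) (integrable_wig hl δ) φ
  rw [integral_sub (hi a) (hi b), ← dual_symb hl, ← dual_symb hl, h, sub_self]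

theorem integrable_symb_triple (hl : l ≠ 0) {a b d : A} (ha : α.Smooth a) (hb : α.Smooth b)
    (hd : α.Smooth d) (δ : Body m) (φ : A →L[ℂ] ℂ) :
    Integrable (fun z : Body m × Body m => φ (α.symb l a z.1 *
      (α.act (-z.1) (α.symb l b (z.2 - z.1)) * α.act (-z.2) (α.symb l d (δ - z.2)))))
      (volume.prod volume) := by
  obtain ⟨q, hq, hφ⟩ := dual_seminorm_continuous φ
  obtain ⟨q₁, hq₁, h₁⟩ := exists_seminorm_mul hq
  obtain ⟨q₂, hq₂, h₂⟩ := exists_seminorm_mul hq₁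
  obtain ⟨q₃, hq₃, h₃⟩ := α.exists_seminorm_act hq₂
  obtain ⟨Ca, hCa, ka⟩ := exists_seminorm_symb_le hl ha hq₁
  obtain ⟨Cb, hCb, kb⟩ := exists_seminorm_symb_le hl hb hq₃
  obtain ⟨Cd, hCd, kd⟩ := exists_seminorm_symb_le hl hd hq₃
  have hw : Integrable fun d : Body m => (wtB d : ℂ) := integrable_wtB.ofReal
  have h1 := (integrable_shear hw hw (by fun_prop) continuous_id).const_mul ((Ca * Cb * Cd : ℝ) : ℂ)
  have e1 := continuous_symb (α := α) hl a
  have e2 := continuous_symb (α := α) hl b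
  have e3 := continuous_symb (α := α) hl d
  refine h1.mono (Continuous.aestronglyMeasurable (φ.continuous.comp (by fun_prop)))
    (Eventually.of_forall fun z => ?_)
  simp only [norm_mul, Complex.norm_real, Real.norm_eq_abs, id, abs_of_pos (wtB_pos _)]
  rw [abs_of_nonneg hCa, abs_of_nonneg hCb, abs_of_nonneg hCd]
  refine ((hφ _).trans (h₁ _ _)).trans ?_
  have f1 := ka z.1
  have f2 := (h₃ (-z.1) _).trans (kb (z.2 - z.1))
  have f3 := ((h₃ (-z.2) _).trans (kd (δ - z.2))).trans
    (mul_le_of_le_one_right hCd (wtB_le_one _))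
  refine (mul_le_mul f1 ((h₂ _ _).trans (mul_le_mul f2 f3 (apply_nonneg _ _)
    (mul_nonneg hCb (wtB_pos _).le))) (apply_nonneg _ _) (mul_nonneg hCa (wtB_pos _).le)).trans_eq ?_
  ring

/-- Associativity of the Moyal product. -/
theorem mprod_assoc (hl : l ≠ 0) {a b d : A} (ha : α.Smooth a) (hb : α.Smooth b)
    (hd : α.Smooth d) :
    α.mprod (2 * l) (α.mprod (2 * l) a b) d = α.mprod (2 * l) a (α.mprod (2 * l) b d) := by
  have hc : 2 * l ≠ 0 := mul_ne_zero two_ne_zero hl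
  refine eq_of_symb hl (α := α) fun δ => eq_of_dual fun φ => ?_
  have h2 : (2 : ℂ) ^ m ≠ 0 := pow_ne_zero _ two_ne_zero
  refine mul_left_cancel₀ h2 (mul_left_cancel₀ h2 ?_)
  rw [dual_symb_mprod hl (ha.mprod hc hb) hd, dual_symb_mprod hl ha (hb.mprod hc hd),
    ← integral_const_mul, ← integral_const_mul]
  -- The common double integrand: either bracketing is an iterated integral of Ψ, in one of the two
  -- orders.
  let Ψ : Body m → Body m → ℂ := fun e x => cis (-(l / 2 * omega0 x δ)) *
    cis (-(l / 2 * omega0 e x)) * φ (α.symb l a e *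
      (α.act (-e) (α.symb l b (x - e)) * α.act (-x) (α.symb l d (δ - x))))
  have hΨ : Integrable (Function.uncurry Ψ) (volume.prod volume) := by
    refine ((integrable_symb_triple hl ha hb hd δ φ).bdd_mul (c := 1)
      (f := fun z : Body m × Body m =>
        cis (-(l / 2 * omega0 z.2 δ)) * cis (-(l / 2 * omega0 z.1 z.2)))
      (Continuous.aestronglyMeasurable (by fun_prop)) (Eventually.of_forall fun z => by simp))
  have e1 : ∀ x, 2 ^ m * (cis (-(l / 2 * omega0 x δ)) *
      φ (α.symb l (α.mprod (2 * l) a b) x * α.act (-x) (α.symb l d (δ - x)))) =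
      ∫ e, Ψ e x := by
    intro x
    have := dual_symb_mprod hl ha hb x (mulRightDual φ (α.act (-x) (α.symb l d (δ - x))))
    simp only [mulRightDual_apply] at this
    rw [mul_left_comm, this, ← integral_const_mul]
    refine integral_congr_ae (Eventually.of_forall fun e => ?_)
    simp only [Ψ]
    rw [mul_assoc (α.symb l a e)]
    ring
  have e2 : ∀ e, 2 ^ m * (cis (-(l / 2 * omega0 e δ)) *
      φ (α.symb l a e * α.act (-e) (α.symb l (α.mprod (2 * l) b d) (δ - e)))) =
      ∫ x, Ψ e x := by
    intro e
    have := dual_symb_mprod hl hb hd (δ - e) ((mulLeftDual φ (α.symb l a e)).comp (α.act (-e)))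
    simp only [ContinuousLinearMap.comp_apply, mulLeftDual_apply] at this
    rw [mul_left_comm, this, ← integral_const_mul, ← integral_sub_right_eq_self _ e]
    refine integral_congr_ae (Eventually.of_forall fun x => ?_)
    simp only [Ψ, α.act_mul, ← α.act_add]
    have e3 : -e + -(x - e) = -x := by abel
    have e4 : δ - e - (x - e) = δ - x := by abel
    -- The cocycle identity: ω(e, δ) + ω(x - e, δ - e) = ω(x, δ) + ω(e, x).
    rw [e3, e4, ← mul_assoc, ← cis_add, ← cis_add]
    congr 2
    simp only [omega0_sub_left, omega0_sub_right, omega0_self]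
    rw [omega0_swap x e]
    ring
  simp_rw [e1, e2]
  exact (integral_integral_swap hΨ).symm

end BodyAction
end Associativity

/-! ### Signs in Grassmann algebras and the pairs ξ₁^k ξ₂^k. -/

section Grassmann

section Eps

variable {S : Type*} [LinearOrder S]

/-- The number of inversions between `I` and `J`. -/
def inv (I J : Finset S) : ℕ := ((I ×ˢ J).filter fun p => p.2 < p.1).card

theorem eps_of_disjoint {I J : Finset S} (h : Disjoint I J) : eps I J = (-1) ^ inv I J := by
  rw [eps, if_pos h, inv]

@[simp] theorem eps_empty_left (J : Finset S) : eps ∅ J = 1 := by simp [eps]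

@[simp] theorem eps_empty_right (J : Finset S) : eps J ∅ = 1 := by simp [eps]

theorem inv_union_left {I I' : Finset S} (h : Disjoint I I') (J : Finset S) :
    inv (I ∪ I') J = inv I J + inv I' J := by
  rw [inv, Finset.union_product, Finset.filter_union, Finset.card_union_of_disjoint]
  · rfl
  · refine Finset.disjoint_filter_filter ?_
    rw [Finset.disjoint_product]
    exact Or.inl h

theorem inv_union_right {J J' : Finset S} (h : Disjoint J J') (I : Finset S) :
    inv I (J ∪ J') = inv I J + inv I J' := by
  rw [inv, Finset.product_union, Finset.filter_union, Finset.card_union_of_disjoint]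
  · rfl
  · refine Finset.disjoint_filter_filter ?_
    rw [Finset.disjoint_product]
    exact Or.inr h

theorem inv_eq_zero {I J : Finset S} (h : ∀ i ∈ I, ∀ j ∈ J, i ≤ j) : inv I J = 0 := by
  rw [inv, Finset.card_eq_zero, Finset.filter_eq_empty_iff]
  rintro ⟨i, j⟩ hij
  rw [Finset.mem_product] at hij
  exact not_lt.2 (h i hij.1 j hij.2)

theorem inv_eq_mul {I J : Finset S} (h : ∀ i ∈ I, ∀ j ∈ J, j < i) : inv I J = I.card * J.card := by
  rw [inv, ← Finset.card_product, Finset.filter_true_of_mem]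
  rintro ⟨i, j⟩ hij
  rw [Finset.mem_product] at hij
  exact h i hij.1 j hij.2

theorem inv_image {T : Type*} [LinearOrder T] {f : S → T} (hf : StrictMono f) (I J : Finset S) :
    inv (I.image f) (J.image f) = inv I J := by
  classical
  rw [inv, inv, ← Finset.prodMap_image_product, Finset.filter_image,
    Finset.card_image_of_injective _ (hf.injective.prodMap hf.injective)]
  simp [hf.lt_iff_lt]

theorem eps_of_le {I J : Finset S} (h : ∀ i ∈ I, ∀ j ∈ J, i < j) : eps I J = 1 := by
  rw [eps_of_disjoint, inv_eq_zero fun i hi j hj => (h i hi j hj).le, pow_zero]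
  exact Finset.disjoint_left.2 fun x hx hx' => lt_irrefl _ (h x hx x hx')

theorem eps_singleton_comm {k l : S} (h : k ≠ l) : eps {k} {l} = -eps {l} {k} := by
  have h1 : eps {k} {l} = if l < k then -1 else 1 := by
    rw [eps_of_disjoint (by simpa using h), inv]
    by_cases hlk : l < k <;> simp [Finset.filter_singleton, hlk]
  have h2 : eps {l} {k} = if k < l then -1 else 1 := by
    rw [eps_of_disjoint (by simpa using h.symm), inv]
    by_cases hlk : k < l <;> simp [Finset.filter_singleton, hlk]
  rw [h1, h2]
  rcases lt_or_gt_of_ne h with h | h <;> simp [h, h.not_gt]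

theorem eps_self_singleton (k : S) : eps {k} {k} = 0 := by simp [eps]

end Eps

variable {n : ℕ}

theorem exists_toLex (x : Gen n) : ∃ l i, x = toLex (l, i) :=
  ⟨(ofLex x).1, (ofLex x).2, rfl⟩

@[simp] theorem mem_layer {k l : Fin 3} {i : Fin n} {I : Finset (Fin n)} :
    toLex (l, i) ∈ layer k I ↔ l = k ∧ i ∈ I := by
  simp only [layer, Finset.mem_image, EmbeddingLike.apply_eq_iff_eq, Prod.mk.injEq]
  constructor
  · rintro ⟨a, ha, rfl, rfl⟩
    exact ⟨rfl, ha⟩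
  · rintro ⟨rfl, h⟩
    exact ⟨i, h, rfl, rfl⟩

@[simp] theorem mem_slice {k : Fin 3} {i : Fin n} {Q : Finset (Gen n)} :
    i ∈ slice k Q ↔ toLex (k, i) ∈ Q := by simp [slice]

@[simp] theorem layer_empty (k : Fin 3) : layer k (∅ : Finset (Fin n)) = ∅ := by simp [layer]

theorem layer_strictMono (k : Fin 3) : StrictMono fun i : Fin n => (toLex (k, i) : Gen n) := by
  intro i j hij
  rw [Prod.Lex.toLex_lt_toLex]
  exact Or.inr ⟨rfl, hij⟩

theorem card_layer (k : Fin 3) (I : Finset (Fin n)) : (layer k I).card = I.card :=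
  Finset.card_image_of_injective _ (layer_strictMono k).injective

theorem layer_lt {k l : Fin 3} (h : k < l) (I J : Finset (Fin n)) :
    ∀ i ∈ layer k I, ∀ j ∈ layer l J, i < j := by
  intro x hx y hy
  obtain ⟨k', i, rfl⟩ := exists_toLex x
  obtain ⟨l', j, rfl⟩ := exists_toLex y
  rw [mem_layer] at hx hy
  rw [Prod.Lex.toLex_lt_toLex]
  exact Or.inl (by rw [hx.1, hy.1]; exact h)

theorem disjoint_layer {k l : Fin 3} {I J : Finset (Fin n)} (h : k ≠ l ∨ Disjoint I J) :
    Disjoint (layer k I) (layer l J) := by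
  rw [Finset.disjoint_left]
  intro x hx hy
  obtain ⟨k', i, rfl⟩ := exists_toLex x
  rw [mem_layer] at hx hy
  rcases h with h | h
  · exact h (hx.1.symm.trans hy.1)
  · exact Finset.disjoint_left.1 h hx.2 hy.2

/-- The set of the generators `ξ₁^k`, `ξ₂^k` with `k ∈ I`. -/
def pair (I : Finset (Fin n)) : Finset (Gen n) := layer 1 I ∪ layer 2 I

@[simp] theorem mem_pair {l : Fin 3} {i : Fin n} {I : Finset (Fin n)} :
    toLex (l, i) ∈ pair I ↔ l ≠ 0 ∧ i ∈ I := by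
  simp only [pair, Finset.mem_union, mem_layer]
  fin_cases l <;> simp

theorem pair_injective : Function.Injective (pair : Finset (Fin n) → Finset (Gen n)) := by
  intro I J h
  ext i
  have := congrArg (fun Q => toLex ((1 : Fin 3), i) ∈ Q) h
  simpa using this

theorem pair_subset {I J : Finset (Fin n)} : pair I ⊆ pair J ↔ I ⊆ J := by
  constructor
  · intro h i hi
    have := h (mem_pair (l := 1).2 ⟨one_ne_zero, hi⟩)
    exact (mem_pair.1 this).2
  · intro h x hx
    obtain ⟨k', i, rfl⟩ := exists_toLex x
    rw [mem_pair] at hx ⊢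
    exact ⟨hx.1, h hx.2⟩

theorem pair_sdiff (I J : Finset (Fin n)) : pair I \ pair J = pair (I \ J) := by
  ext x
  obtain ⟨k', i, rfl⟩ := exists_toLex x
  simp only [Finset.mem_sdiff, mem_pair]
  tauto

theorem card_pair (I : Finset (Fin n)) : (pair I).card = I.card + I.card := by
  rw [pair, Finset.card_union_of_disjoint (disjoint_layer (Or.inl (by decide))), card_layer,
    card_layer]

/-- Of the four blocks of inversions, the one from layer 1 to layer 2 is empty, the one from layer 2
to layer 1 is full, and the two blocks within a layer have equal size and cancel modulo 2. -/
theorem eps_pair {I J : Finset (Fin n)} (h : Disjoint I J) :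
    eps (pair I) (pair J) = (-1) ^ (I.card * J.card) := by
  have h12 : ∀ K : Finset (Fin n), Disjoint (layer 1 K) (layer 2 K) := fun K =>
    disjoint_layer (Or.inl (by decide))
  have hd : Disjoint (pair I) (pair J) := by
    simp only [pair, Finset.disjoint_union_left, Finset.disjoint_union_right]
    exact ⟨⟨disjoint_layer (Or.inr h), disjoint_layer (Or.inr h)⟩,
      disjoint_layer (Or.inr h), disjoint_layer (Or.inr h)⟩
  rw [eps_of_disjoint hd, pair, pair, inv_union_left (h12 I), inv_union_right (h12 J),
    inv_union_right (h12 J), inv_eq_zero (I := layer 1 I) (J := layer 2 J) fun i hi j hj =>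
      (layer_lt (by decide) I J i hi j hj).le,
    inv_eq_mul (I := layer 2 I) (J := layer 1 J) fun i hi j hj =>
      layer_lt (by decide) J I j hj i hi, card_layer, card_layer]
  have e : ∀ k : Fin 3, inv (layer k I) (layer k J) = inv I J := fun k =>
    inv_image (layer_strictMono k) I J
  rw [e, e, add_zero, add_comm (I.card * J.card), ← add_assoc, pow_add, ← two_mul, pow_mul]
  simp

/-! ### The odd kernel -/

/-- The sign `(-1)^{j(j-1)/2}`. -/
def rsign (j : ℕ) : ℤ := (-1) ^ (j * (j - 1) / 2)

theorem rsign_succ (j : ℕ) : rsign (j + 1) = (-1) ^ j * rsign j := by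
  rw [rsign, rsign, ← pow_add, ← Nat.choose_two_right, ← Nat.choose_two_right,
    Nat.choose_succ_succ' j 1, Nat.choose_one_right]

theorem rsign_zero : rsign 0 = 1 := by simp [rsign]

theorem rsign_mul_self (j : ℕ) : rsign j * rsign j = 1 := by
  rw [rsign, ← mul_pow]; simp

theorem rsign_add (i j : ℕ) : rsign (i + j) = (-1) ^ (i * j) * rsign i * rsign j := by
  induction j with
  | zero => simp [rsign_zero]
  | succ j ih =>
    rw [← add_assoc, rsign_succ, ih, rsign_succ, Nat.mul_succ, pow_add, pow_add]
    ring

/-- Only sets of j distinct pairs survive in the j-th power. Any of the pairs can be the factor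
split off, which produces j!; moving it past the others costs (-1)^j at the step from j to j + 1,
and these signs accumulate to `rsign`. -/
theorem grMul_pow_pair (w : Fin n → ℂ) (j : ℕ) (Q : Finset (Gen n)) :
    (grMul id fun Q => ∑ k : Fin n, if Q = pair {k} then w k else 0)^[j]
      (fun I => if I = ∅ then 1 else 0) Q =
    if Q = pair (slice 1 Q) ∧ (slice 1 Q).card = j then
      (j.factorial : ℂ) * rsign j * ∏ k ∈ slice 1 Q, w k else 0 := by
  classical
  have hs : ∀ I : Finset (Fin n), slice 1 (pair I) = I := fun I => by ext; simp
  induction j generalizing Q with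
  | zero =>
    simp only [Function.iterate_zero, id, Finset.card_eq_zero]
    by_cases h : Q = ∅
    · subst h
      simp [slice, rsign_zero, pair]
    · rw [if_neg h, if_neg]
      rintro ⟨h1, h2⟩
      rw [h2] at h1
      exact h (by simpa [pair] using h1)
  | succ j ih =>
    rw [Function.iterate_succ_apply', grMul]
    have e1 : ∀ I ∈ Q.powerset, eps I (Q \ I) • ((∑ k : Fin n, if I = pair {k} then w k else 0) *
        id^[I.card] ((grMul id fun Q => ∑ k : Fin n, if Q = pair {k} then w k else 0)^[j]
          (fun I => if I = ∅ then 1 else 0) (Q \ I))) =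
        ∑ k : Fin n, if I = pair {k} then eps I (Q \ I) • (w k *
          if Q \ I = pair (slice 1 (Q \ I)) ∧ (slice 1 (Q \ I)).card = j then
            (j.factorial : ℂ) * rsign j * ∏ k ∈ slice 1 (Q \ I), w k else 0) else 0 := by
      intro I _
      rw [Function.iterate_id, id, ih, Finset.sum_mul, Finset.smul_sum]
      refine Finset.sum_congr rfl fun k _ => ?_
      split_ifs <;> simp
    rw [Finset.sum_congr rfl e1, Finset.sum_comm]
    have e2 : ∀ k : Fin n, (∑ I ∈ Q.powerset, if I = pair {k} then eps I (Q \ I) • (w k *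
          if Q \ I = pair (slice 1 (Q \ I)) ∧ (slice 1 (Q \ I)).card = j then
            (j.factorial : ℂ) * rsign j * ∏ k ∈ slice 1 (Q \ I), w k else 0) else 0) =
        if pair {k} ⊆ Q then eps (pair {k}) (Q \ pair {k}) • (w k *
          if Q \ pair {k} = pair (slice 1 (Q \ pair {k})) ∧ (slice 1 (Q \ pair {k})).card = j then
            (j.factorial : ℂ) * rsign j * ∏ k ∈ slice 1 (Q \ pair {k}), w k else 0) else 0 := by
      intro k
      rw [Finset.sum_ite_eq']
      simp
    rw [Finset.sum_congr rfl fun k _ => e2 k]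
    by_cases h : Q = pair (slice 1 Q) ∧ (slice 1 Q).card = j + 1
    · rw [if_pos h]
      obtain ⟨h1, h2⟩ := h
      set T := slice 1 Q with hT
      have e3 : ∀ k : Fin n, (if pair {k} ⊆ Q then eps (pair {k}) (Q \ pair {k}) • (w k *
          if Q \ pair {k} = pair (slice 1 (Q \ pair {k})) ∧ (slice 1 (Q \ pair {k})).card = j then
            (j.factorial : ℂ) * rsign j * ∏ k ∈ slice 1 (Q \ pair {k}), w k else 0) else 0) =
          if k ∈ T then (j.factorial : ℂ) * rsign (j + 1) * ∏ k ∈ T, w k else 0 := by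
        intro k
        have hp : pair {k} ⊆ pair T ↔ k ∈ T := by rw [pair_subset, Finset.singleton_subset_iff]
        rw [h1]
        by_cases hk : k ∈ T
        · have h3 : (T \ {k}).card = j := by
            rw [Finset.card_sdiff_of_subset (by simpa), h2]; simp
          rw [if_pos (hp.2 hk), if_pos hk, pair_sdiff, hs, if_pos ⟨rfl, h3⟩, eps_pair (by simp), h3,
            Finset.card_singleton, one_mul, rsign_succ,
            ← Finset.mul_prod_erase T w hk, Finset.sdiff_singleton_eq_erase]
          simp only [zsmul_eq_mul]
          push_cast
          ring
        · rw [if_neg fun h => hk (hp.1 h), if_neg hk]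
      rw [Finset.sum_congr rfl fun k _ => e3 k, Finset.sum_ite_mem,
        Finset.univ_inter, Finset.sum_const, h2, nsmul_eq_mul, Nat.factorial_succ]
      push_cast
      ring
    · rw [if_neg h]
      refine Finset.sum_eq_zero fun k _ => ?_
      split_ifs with h1 h2
      · exfalso
        obtain ⟨h2, h3⟩ := h2
        set T := slice 1 (Q \ pair {k}) with hT
        have hk : k ∉ T := by simp [hT]
        have h4 : Q = pair (insert k T) := by
          rw [← Finset.sdiff_union_of_subset h1, h2]
          ext x
          obtain ⟨k', i, rfl⟩ := exists_toLex x
          simp only [Finset.mem_union, mem_pair, Finset.mem_singleton, Finset.mem_insert]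
          tauto
        refine h ⟨?_, ?_⟩
        · rw [h4, hs]
        · rw [h4, hs, Finset.card_insert_of_notMem hk, h3]
      · simp
      · rfl

/-- A single power contributes to each monomial, and its j! cancels the one in the exponential
series. This power lies below the truncation because the number of pairs does not exceed the number
of generators. -/
theorem oddKernel_eq (θ : ℝ) (η : Fin n → ℤˣ) (Q : Finset (Gen n)) :
    oddKernel θ η Q = if Q = pair (slice 1 Q) then
      (rsign (slice 1 Q).card : ℂ) * ∏ k ∈ slice 1 Q, (-2 * Complex.I / θ * ((η k : ℤ) : ℂ))
    else 0 := by
  change ∑ j ∈ Finset.range (Fintype.card (Gen n) + 1), (1 / (j.factorial : ℂ)) *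
    (grMul id fun Q => ∑ k : Fin n, if Q = pair {k} then
      (fun k => -2 * Complex.I / θ * ((η k : ℤ) : ℂ)) k else 0)^[j]
      (fun I => if I = ∅ then 1 else 0) Q = _
  simp only [grMul_pow_pair]
  split_ifs with hQ
  · rw [Finset.sum_eq_single (slice 1 Q).card]
    · rw [if_pos ⟨hQ, rfl⟩]
      have : ((slice 1 Q).card.factorial : ℂ) ≠ 0 := by exact_mod_cast Nat.factorial_ne_zero _
      field_simp
    · intro j _ hj
      rw [if_neg fun h => hj h.2.symm, mul_zero]
    · intro hj
      refine absurd ?_ hj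
      rw [Finset.mem_range, Nat.lt_succ_iff]
      calc (slice 1 Q).card = (layer 1 (slice 1 Q)).card := (card_layer _ _).symm
        _ ≤ _ := Finset.card_le_univ _
  · refine Finset.sum_eq_zero fun j _ => ?_
    rw [if_neg fun h => hQ h.1, mul_zero]

/-! ### Berezin integration -/

variable {A : Type*} [NonUnitalRing A] [Module ℂ A]

theorem shift_layer {k : Fin 3} (hk : k ≠ 0) (u : Finset (Fin n) → A) (J : Finset (Fin n)) :
    shift k u (layer k J) = u J := by
  have h0 : slice 0 (layer k J) = ∅ := by
    ext i; simp [hk.symm]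
  have h1 : slice k (layer k J) = J := by
    ext i; simp
  rw [shift, if_pos, h0, h1]
  · simp
  · intro l _ hl
    ext i
    simp [hl]

/-- The first factor contains no ξ₂ and the second no ξ₁, so the only splitting of a set of pairs
that contributes assigns all its ξ₁ to the first and all its ξ₂ to the second. -/
theorem grMul_shift_pair (γ : A → A) (hγ : γ 0 = 0) (u w : Finset (Fin n) → A)
    (J : Finset (Fin n)) :
    grMul γ (shift 1 u) (shift 2 w) (pair J) = u J * γ^[J.card] (w J) := by
  have h12 : pair J \ layer 1 J = layer 2 J := by
    rw [pair, Finset.union_sdiff_cancel_left (disjoint_layer (Or.inl (by decide)))]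
  rw [grMul, Finset.sum_eq_single (layer 1 J)]
  · rw [h12, shift_layer one_ne_zero, shift_layer (by decide), card_layer,
      eps_of_le (layer_lt (by decide) J J), one_smul]
  · intro I hI hI'
    rw [Finset.mem_powerset] at hI
    by_cases h1 : slice 2 I = ∅
    · by_cases h2 : slice 1 (pair J \ I) = ∅
      · refine absurd ?_ hI'
        ext x
        obtain ⟨l, i, rfl⟩ := exists_toLex x
        rw [mem_layer]
        constructor
        · intro hx
          have h3 := mem_pair.1 (hI hx)
          refine ⟨?_, h3.2⟩
          have h4 : l ≠ 2 := by
            rintro rfl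
            have : i ∈ slice 2 I := by simpa using hx
            simp [h1] at this
          have h5 := h3.1
          omega
        · rintro ⟨rfl, hi⟩
          by_contra hx
          have : i ∈ slice 1 (pair J \ I) := by simp [hi, hx]
          simp [h2] at this
      · have : shift 2 w (pair J \ I) = 0 := by
          rw [shift, if_neg]
          intro h
          exact h2 (h 1 one_ne_zero (by decide))
        rw [this, Function.iterate_fixed hγ, mul_zero, smul_zero]
    · have : shift 1 u I = 0 := by
        rw [shift, if_neg]
        intro h
        exact h1 (h 2 (by decide) (by decide))
      rw [this, zero_mul, smul_zero]
  · intro h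
    refine absurd (Finset.mem_powerset.2 ?_) h
    exact Finset.subset_union_left

/-- The Berezin integral of the odd factor of the star product. -/
theorem berezin_eq (θ : ℝ) (η : Fin n → ℤˣ) (γ : A → A) (hγ : γ 0 = 0)
    (hγ' : ∀ a, γ (γ a) = a) (u w : Finset (Fin n) → A) :
    grSMul γ (oddKernel θ η) (grMul γ (shift 1 u) (shift 2 w))
      (layer 0 ∅ ∪ layer 1 Finset.univ ∪ layer 2 Finset.univ) =
    ∑ J : Finset (Fin n), ((rsign n * rsign J.card : ℤ) : ℂ) •
      (∏ k ∈ Jᶜ, (-2 * Complex.I / θ * ((η k : ℤ) : ℂ))) • (u J * γ^[J.card] (w J)) := by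
  have hs : ∀ I : Finset (Fin n), slice 1 (pair I) = I := fun I => by ext; simp
  have hit : ∀ k a, γ^[k + k] a = a := by
    intro k a
    rw [← two_mul, Function.iterate_mul]
    exact Function.iterate_fixed (hγ' a) k
  rw [layer_empty, Finset.empty_union, ← pair, grSMul]
  have e1 : ∑ I ∈ (pair (Finset.univ : Finset (Fin n))).powerset,
      eps I (pair Finset.univ \ I) • (oddKernel θ η I • γ^[I.card]
        (grMul γ (shift 1 u) (shift 2 w) (pair Finset.univ \ I))) =
      ∑ I ∈ (Finset.univ : Finset (Finset (Fin n))).image pair,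
      eps I (pair Finset.univ \ I) • (oddKernel θ η I • γ^[I.card]
        (grMul γ (shift 1 u) (shift 2 w) (pair Finset.univ \ I))) := by
    refine (Finset.sum_subset ?_ ?_).symm
    · intro Q hQ
      obtain ⟨I, -, rfl⟩ := Finset.mem_image.1 hQ
      rw [Finset.mem_powerset, pair_subset]
      exact Finset.subset_univ _
    · intro Q _ hQ
      rw [oddKernel_eq, if_neg, zero_smul, smul_zero]
      intro h
      exact hQ (Finset.mem_image.2 ⟨_, Finset.mem_univ _, h.symm⟩)
  rw [e1, Finset.sum_image fun I _ J _ h => pair_injective h]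
  -- If the kernel supplies the pairs in I, the two functions must supply those in the complement J
  -- of I. A product of pairs is even, so γ is applied an even number of times and drops out.
  refine Fintype.sum_equiv (compl_involutive (α := Finset (Fin n))).toPerm _ _ fun I => ?_
  rw [Function.Involutive.coe_toPerm, pair_sdiff, ← Finset.compl_eq_univ_sdiff, grMul_shift_pair γ hγ, card_pair,
    hit, eps_pair disjoint_compl_right, oddKernel_eq, hs, if_pos rfl, compl_compl, mul_smul,
    ← Int.cast_smul_eq_zsmul ℂ, smul_smul]
  have hn : n = I.card + Iᶜ.card := by
    rw [Finset.card_add_card_compl, Fintype.card_fin]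
  have h1 : rsign n * rsign Iᶜ.card = (-1) ^ (I.card * Iᶜ.card) * rsign I.card := by
    rw [congrArg rsign hn, rsign_add, mul_assoc, rsign_mul_self, mul_one]
  rw [h1]
  push_cast
  rw [smul_smul]

end Grassmann

/-! ### Deformation of an associative product by odd superderivations. -/

section OddDeformation

variable {n : ℕ} {S : Type*} [AddCommGroup S] [Module ℂ S]

/-- The deformation of a product by the odd directions in `s`. -/
def oddDeform (γ : S →ₗ[ℂ] S) (D : Finset (Fin n) → S →ₗ[ℂ] S) (κ : Fin n → ℂ)
    (M : S →ₗ[ℂ] S →ₗ[ℂ] S) (s : Finset (Fin n)) : S →ₗ[ℂ] S →ₗ[ℂ] S :=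
  ∑ J ∈ s.powerset, ((rsign J.card : ℂ) * ∏ k ∈ J, κ k) •
    M.compl₁₂ (D J) ((γ ^ J.card) ∘ₗ D J)

theorem oddDeform_apply (γ : S →ₗ[ℂ] S) (D : Finset (Fin n) → S →ₗ[ℂ] S) (κ : Fin n → ℂ)
    (M : S →ₗ[ℂ] S →ₗ[ℂ] S) (s : Finset (Fin n)) (a b : S) :
    oddDeform γ D κ M s a b = ∑ J ∈ s.powerset, ((rsign J.card : ℂ) * ∏ k ∈ J, κ k) •
      M (D J a) ((γ ^ J.card) (D J b)) := by
  simp [oddDeform, LinearMap.sum_apply]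

/-- Operators `γ` and `D_I` with the relations of a graded odd action. -/
structure OddSystem (n : ℕ) (S : Type*) [AddCommGroup S] [Module ℂ S] where
  γ : S →ₗ[ℂ] S
  D : Finset (Fin n) → S →ₗ[ℂ] S
  γ_γ : ∀ a, γ (γ a) = a
  D_empty : ∀ a, D ∅ a = a
  D_D : ∀ I J a, D I (D J a) = eps I J • D (I ∪ J) a
  D_γ : ∀ I a, D I (γ a) = (-1 : ℂ) ^ I.card • γ (D I a)

namespace OddSystem

variable (X : OddSystem n S)

/-- Products for which `γ` is an automorphism and the `D_k` are superderivations. -/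
structure IsCompatible (M : S →ₗ[ℂ] S →ₗ[ℂ] S) : Prop where
  map : ∀ a b, X.γ (M a b) = M (X.γ a) (X.γ b)
  leibniz : ∀ k a b, X.D {k} (M a b) = M a (X.D {k} b) + M (X.D {k} a) (X.γ b)
  assoc : ∀ a b c, M (M a b) c = M a (M b c)

/-- The deformation of a product by `exp(κ D_k ⊗ D_k)`. -/
def step (κ : ℂ) (k : Fin n) (M : S →ₗ[ℂ] S →ₗ[ℂ] S) : S →ₗ[ℂ] S →ₗ[ℂ] S :=
  M + κ • M.compl₁₂ (X.D {k}) (X.γ ∘ₗ X.D {k})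

theorem step_apply (κ : ℂ) (k : Fin n) (M : S →ₗ[ℂ] S →ₗ[ℂ] S) (a b : S) :
    X.step κ k M a b = M a b + κ • M (X.D {k} a) (X.γ (X.D {k} b)) := rfl

theorem D_γ_singleton (k : Fin n) (a : S) : X.D {k} (X.γ a) = -X.γ (X.D {k} a) := by
  rw [X.D_γ]; simp

theorem D_D_self (k : Fin n) (a : S) : X.D {k} (X.D {k} a) = 0 := by
  rw [X.D_D, eps_self_singleton, zero_smul]

theorem D_D_comm (k l : Fin n) (a : S) : X.D {k} (X.D {l} a) = -X.D {l} (X.D {k} a) := by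
  by_cases h : k = l
  · subst h
    rw [X.D_D_self, neg_zero]
  · rw [X.D_D, X.D_D, eps_singleton_comm h, neg_smul, Finset.union_comm]

variable {X}

/-- The rule for D_l persists because D_l anticommutes both with D_k and with γ, and the two signs
cancel. For associativity, D_k² = 0 removes the κ term from D_k of a deformed product; by the
Leibniz rule both bracketings then become the same sum of four terms. -/
theorem IsCompatible.step {M : S →ₗ[ℂ] S →ₗ[ℂ] S} (hM : X.IsCompatible M) (κ : ℂ) (k : Fin n) :
    X.IsCompatible (X.step κ k M) where
  map a b := by
    simp only [step_apply, map_add, map_smul, hM.map, X.D_γ_singleton, map_neg,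
      LinearMap.neg_apply, neg_neg]
  leibniz l a b := by
    simp only [step_apply, map_add, map_smul, hM.leibniz, X.D_γ_singleton, X.γ_γ,
      X.D_D_comm k l, map_neg, LinearMap.neg_apply, neg_neg, smul_add]
    abel
  assoc a b c := by
    simp only [step_apply, map_add, map_smul, hM.leibniz, hM.assoc, hM.map, X.D_γ_singleton, X.γ_γ,
      X.D_D_self, map_zero, LinearMap.add_apply, LinearMap.smul_apply,
      LinearMap.zero_apply, smul_zero, add_zero, smul_add, neg_zero]
    abel

variable (X)

theorem oddDeform_empty (κ : Fin n → ℂ) (M : S →ₗ[ℂ] S →ₗ[ℂ] S) : oddDeform X.γ X.D κ M ∅ = M := by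
  ext a b
  simp [oddDeform_apply, rsign_zero, X.D_empty]

/-- Subsets of the enlarged set either avoid k or contain it. As k is maximal, D_{J ∪ {k}} = D_J D_k
without a sign; the sign from moving D_J past γ is the ratio of consecutive values of `rsign`. -/
theorem oddDeform_insert (κ : Fin n → ℂ) (M : S →ₗ[ℂ] S →ₗ[ℂ] S) (s : Finset (Fin n)) (k : Fin n)
    (hk : ∀ i ∈ s, i < k) : oddDeform X.γ X.D κ M (insert k s) = X.step (κ k) k (oddDeform X.γ X.D κ M s) := by
  have hks : k ∉ s := fun h => lt_irrefl _ (hk k h)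
  ext a b
  rw [step_apply, oddDeform_apply, Finset.sum_powerset_insert hks, ← oddDeform_apply, oddDeform_apply,
    oddDeform_apply, Finset.smul_sum]
  congr 1
  refine Finset.sum_congr rfl fun J hJ => ?_
  have hJs := Finset.mem_powerset.1 hJ
  have hkJ : k ∉ J := fun h => hks (hJs h)
  have hD : ∀ x, X.D (insert k J) x = X.D J (X.D {k} x) := by
    intro x
    rw [X.D_D, eps_of_le, one_smul, Finset.union_comm, Finset.insert_eq]
    intro i hi j hj
    rw [Finset.mem_singleton.1 hj]
    exact hk i (hJs hi)
  rw [Finset.card_insert_of_notMem hkJ, Finset.prod_insert hkJ, rsign_succ, hD, hD, X.D_γ, pow_succ,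
    Module.End.mul_apply, map_smul, map_smul, smul_smul, smul_smul]
  congr 1
  push_cast
  ring

variable {X}

theorem IsCompatible.deform {M : S →ₗ[ℂ] S →ₗ[ℂ] S} (hM : X.IsCompatible M) (κ : Fin n → ℂ)
    (s : Finset (Fin n)) : X.IsCompatible (oddDeform X.γ X.D κ M s) := by
  induction s using Finset.induction_on_max with
  | empty => rwa [oddDeform_empty]
  | insert k s hk ih =>
    rw [oddDeform_insert _ _ _ _ _ hk]
    exact ih.step _ _

end OddSystem
end OddDeformation

/-! ### The star product of orbits as an odd deformation of the Moyal product. -/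

section StarProduct

variable {m n : ℕ} {A : Type*} [NonUnitalRing A] [Module ℂ A] [IsScalarTower ℂ A A]
  [SMulCommClass ℂ A A] [UniformSpace A] [IsUniformAddGroup A] [ContinuousSMul ℂ A]
  [ContinuousMul A] [PolynormableSpace ℂ A] [CompleteSpace A] [T2Space A]
  [FirstCountableTopology A] {G : Supergrading A}

theorem semBdd_of_withSeminorms {p : ℕ → Seminorm ℂ A} (hp : WithSeminorms p) {X : Type*}
    {F : X → A} (h : ∀ j, ∃ C, ∀ x, p j (F x) ≤ C) : SemBdd F := by
  intro q hq
  obtain ⟨s, C, -, hC⟩ := Seminorm.bound_of_continuous hp q hq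
  choose K hK using h
  refine ⟨C * ∑ i ∈ s, |K i|, fun x => (hC _).trans ?_⟩
  change (C : ℝ) * (s.sup p) (F x) ≤ _
  refine mul_le_mul_of_nonneg_left ?_ C.2
  refine Seminorm.finset_sup_apply_le (Finset.sum_nonneg fun i _ => abs_nonneg _) fun i hi => ?_
  exact ((hK i x).trans (le_abs_self _)).trans
    (Finset.single_le_sum (f := fun i => |K i|) (fun i _ => abs_nonneg _) hi)

namespace SuperAction

variable (ρ : SuperAction m n A G)

theorem IsSubisometric.semBdd {ρ : SuperAction m n A G} {p : ℕ → Seminorm ℂ A}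
    (hp : WithSeminorms p) (h : ρ.IsSubisometric p) (I : Finset (Fin n)) (a : A) :
    SemBdd fun x => ρ.coeff x I a := by
  obtain ⟨C, -, hC⟩ := h
  refine semBdd_of_withSeminorms hp fun j => ?_
  obtain ⟨k, hk⟩ := hC a I j
  exact ⟨_, hk⟩

theorem coeff_empty_mul (x : Body m) (a b : A) :
    ρ.coeff x ∅ (a * b) = ρ.coeff x ∅ a * ρ.coeff x ∅ b := by
  have := congrFun (ρ.mul x a b) ∅
  simpa [grMul] using this

theorem coeff_singleton_mul (k : Fin n) (a b : A) :
    ρ.coeff 0 {k} (a * b) = a * ρ.coeff 0 {k} b + ρ.coeff 0 {k} a * G.parity b := by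
  have := congrFun (ρ.mul 0 a b) {k}
  have h : ({k} : Finset (Fin n)).powerset = {∅, {k}} := by
    rw [← insert_empty_eq, Finset.powerset_insert, Finset.powerset_empty]
    rfl
  rw [this, grMul, h, Finset.sum_pair (Finset.singleton_ne_empty k).symm]
  simp [ρ.zero]

theorem coeff_eq (x : Body m) (I : Finset (Fin n)) (a : A) :
    ρ.coeff x I a = ρ.coeff x ∅ (ρ.coeff 0 I a) := by
  rw [ρ.add]; simp

theorem coeff_comm (x : Body m) (I : Finset (Fin n)) (a : A) :
    ρ.coeff 0 I (ρ.coeff x ∅ a) = ρ.coeff x ∅ (ρ.coeff 0 I a) := by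
  rw [ρ.add, ρ.add]; simp

/-- The action of the body. -/
def body (hb : ∀ a, SemBdd fun x => ρ.coeff x ∅ a) : BodyAction m A where
  act x := ρ.coeff x ∅
  act_zero := ρ.zero
  act_add x y a := by rw [ρ.add]; simp
  act_mul := ρ.coeff_empty_mul
  act_continuous := ρ.continuous ∅
  act_bdd := hb

variable {ρ} (hb : ∀ a, SemBdd fun x => ρ.coeff x ∅ a)

theorem Smooth.coeff {a : A} (h : (ρ.body hb).Smooth a) (I : Finset (Fin n)) :
    (ρ.body hb).Smooth (ρ.coeff 0 I a) :=
  h.map (ρ.coeff 0 I) fun x b => ρ.coeff_comm x I b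

/-- Every component of the orbit is the body orbit of a vector D_I a, and D_I is continuous and
commutes with the body; smoothness under the body alone therefore decides. -/
theorem mem_smoothVectors {a : A} : a ∈ ρ.smoothVectors ↔ (ρ.body hb).Smooth a := by
  constructor
  · exact fun h k => h ∅ k
  · intro h I k
    have := Smooth.coeff hb h I k
    have e : (fun x => ρ.orbit a x I) = fun x => ρ.coeff x ∅ (ρ.coeff 0 I a) :=
      funext fun x => ρ.coeff_eq x I a
    rw [e]
    exact this

/-- The components `D_I` of the action, on smooth vectors. -/
def odd (ρ : SuperAction m n A G) (hb : ∀ a, SemBdd fun x => ρ.coeff x ∅ a)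
    (I : Finset (Fin n)) : ρ.smoothVectors →ₗ[ℂ] ρ.smoothVectors :=
  ((ρ.coeff 0 I : A →ₗ[ℂ] A) ∘ₗ ρ.smoothVectors.subtype).codRestrict ρ.smoothVectors fun a =>
    (mem_smoothVectors hb).2 (Smooth.coeff hb ((mem_smoothVectors hb).1 a.2) I)

@[simp] theorem coe_odd (I : Finset (Fin n)) (a : ρ.smoothVectors) :
    (ρ.odd hb I a : A) = ρ.coeff 0 I a := rfl

/-- The Moyal product of smooth vectors as a bilinear map. -/
def moyalProd (ρ : SuperAction m n A G) (hb : ∀ a, SemBdd fun x => ρ.coeff x ∅ a) {c : ℝ}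
    (hc : c ≠ 0) : ρ.smoothVectors →ₗ[ℂ] ρ.smoothVectors →ₗ[ℂ] ρ.smoothVectors :=
  LinearMap.mk₂ ℂ (fun a b => ⟨(ρ.body hb).mprod c a b, (mem_smoothVectors hb).2
      (((mem_smoothVectors hb).1 a.2).mprod hc ((mem_smoothVectors hb).1 b.2))⟩)
    (fun a b d => Subtype.ext (BodyAction.mprod_add_left hc ((mem_smoothVectors hb).1 a.2)
      ((mem_smoothVectors hb).1 b.2) ((mem_smoothVectors hb).1 d.2)))
    (fun r a b => Subtype.ext (BodyAction.mprod_smul_left hc r ((mem_smoothVectors hb).1 a.2)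
      ((mem_smoothVectors hb).1 b.2)))
    (fun a b d => Subtype.ext (BodyAction.mprod_add_right hc ((mem_smoothVectors hb).1 a.2)
      ((mem_smoothVectors hb).1 b.2) ((mem_smoothVectors hb).1 d.2)))
    (fun r a b => Subtype.ext (BodyAction.mprod_smul_right hc r ((mem_smoothVectors hb).1 a.2)
      ((mem_smoothVectors hb).1 b.2)))

@[simp] theorem coe_moyalProd {c : ℝ} (hc : c ≠ 0) (a b : ρ.smoothVectors) :
    (ρ.moyalProd hb hc a b : A) = (ρ.body hb).mprod c a b := rfl

theorem moyalProd_assoc {l : ℝ} (hl : l ≠ 0) (hc : 2 * l ≠ 0) (a b d : ρ.smoothVectors) :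
    ρ.moyalProd hb hc (ρ.moyalProd hb hc a b) d = ρ.moyalProd hb hc a (ρ.moyalProd hb hc b d) :=
  Subtype.ext (BodyAction.mprod_assoc hl ((mem_smoothVectors hb).1 a.2)
      ((mem_smoothVectors hb).1 b.2) ((mem_smoothVectors hb).1 d.2))

/-- The parity commutes with the body. -/
theorem parity_coeff (hdeg : G.odd = ⊥ ∨ ρ.PreservesDegree) (x : Body m) (a : A) :
    G.parity (ρ.coeff x ∅ a) = ρ.coeff x ∅ (G.parity a) := by
  rcases hdeg with h | h
  · rw [G.parity_eq_id h, G.parity_eq_id h]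
  · obtain ⟨a₀, h₀, a₁, h₁, rfl⟩ := G.exists_add a
    have e₀ := h 0 a₀ (by simpa) x ∅
    have e₁ := h 1 a₁ (by simpa) x ∅
    simp only [Finset.card_empty, Nat.cast_zero, add_zero, Supergrading.part_zero,
      Supergrading.part_one] at e₀ e₁
    rw [map_add, G.parity_add e₀ e₁, G.parity_add h₀ h₁, map_sub]

theorem parity_odd (h : ρ.PreservesDegree) (I : Finset (Fin n)) (a : A) :
    ρ.coeff 0 I (G.parity a) = (-1 : ℂ) ^ I.card • G.parity (ρ.coeff 0 I a) := by
  obtain ⟨a₀, h₀, a₁, h₁, rfl⟩ := G.exists_add a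
  have e₀ := G.parity_of_mem_part (h 0 a₀ (by simpa) 0 I)
  have e₁ := G.parity_of_mem_part (h 1 a₁ (by simpa) 0 I)
  rw [ksign_add, ksign_natCast, ksign_zero, one_mul] at e₀
  rw [ksign_add, ksign_natCast, ksign_one, neg_one_mul] at e₁
  rw [G.parity_add h₀ h₁, map_add, map_add, e₀, e₁, map_sub, smul_add, smul_smul, smul_smul,
    mul_neg, ← mul_pow]
  simp [sub_eq_add_neg]

/-- The parity of smooth vectors. -/
def smoothParity (ρ : SuperAction m n A G) (hb : ∀ a, SemBdd fun x => ρ.coeff x ∅ a)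
    (hγ : Continuous G.parity) (hdeg : G.odd = ⊥ ∨ ρ.PreservesDegree) :
    ρ.smoothVectors →ₗ[ℂ] ρ.smoothVectors :=
  (G.parity ∘ₗ ρ.smoothVectors.subtype).codRestrict ρ.smoothVectors fun a =>
    (mem_smoothVectors hb).2 (((mem_smoothVectors hb).1 a.2).map ⟨G.parity, hγ⟩
      fun x b => parity_coeff hdeg x b)

@[simp] theorem coe_smoothParity (hγ : Continuous G.parity)
    (hdeg : G.odd = ⊥ ∨ ρ.PreservesDegree) (a : ρ.smoothVectors) :
    (ρ.smoothParity hb hγ hdeg a : A) = G.parity a := rfl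

/-- Smooth vectors of a graded action. -/
def oddSystem (ρ : SuperAction m n A G) (hb : ∀ a, SemBdd fun x => ρ.coeff x ∅ a)
    (hγ : Continuous G.parity) (h : ρ.PreservesDegree) : OddSystem n ρ.smoothVectors where
  γ := ρ.smoothParity hb hγ (Or.inr h)
  D := ρ.odd hb
  γ_γ a := Subtype.ext (by simp)
  D_empty a := Subtype.ext (ρ.zero _)
  D_D I J a := Subtype.ext (by simp [ρ.add])
  D_γ I a := Subtype.ext (by simp [parity_odd h])

/-- The parity and the D_k commute with the body, so the automorphism and Leibniz rules of the
original product pass through the integral. The Leibniz rule itself is the coefficient of ξ^k in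
ρ(ab) = ρ(a)ρ(b). -/
theorem isCompatible_moyalProd (hG : G.IsAlgebraGrading) (hγ : Continuous G.parity)
    (h : ρ.PreservesDegree) {l : ℝ} (hl : l ≠ 0) (hc : 2 * l ≠ 0) :
    (ρ.oddSystem hb hγ h).IsCompatible (ρ.moyalProd hb hc) where
  map a b := by
    have e := BodyAction.map_mprod (α := ρ.body hb) (γ := ⟨G.parity, hγ⟩) hc
      (fun x b => parity_coeff (Or.inr h) x b) (fun a b => G.parity_mul hG a b)
      ((mem_smoothVectors hb).1 a.2) ((mem_smoothVectors hb).1 b.2)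
    exact Subtype.ext e
  leibniz k a b := by
    have e := BodyAction.mprod_leibniz (α := ρ.body hb) (D := ρ.coeff 0 {k}) (γ := ⟨G.parity, hγ⟩)
      hc (fun x b => ρ.coeff_comm x {k} b) (fun x b => parity_coeff (Or.inr h) x b)
      (fun a b => ρ.coeff_singleton_mul k a b) ((mem_smoothVectors hb).1 a.2)
      ((mem_smoothVectors hb).1 b.2)
    exact Subtype.ext e
  assoc := moyalProd_assoc hb hl hc

/-- Ungraded odd components annihilate each other. -/
theorem coeff_mul_coeff_of_odd_eq_bot (h : G.odd = ⊥) {J : Finset (Fin n)} (hJ : J.Nonempty)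
    (a b : A) : ρ.coeff 0 J a * ρ.coeff 0 J b = 0 := by
  have h1 : ∀ (k : Fin n) (a b : A), ρ.coeff 0 {k} a * ρ.coeff 0 {k} b = 0 := by
    intro k a b
    have hD : ∀ x, ρ.coeff 0 {k} (ρ.coeff 0 {k} x) = 0 := fun x => by
      rw [ρ.add, eps_self_singleton, zero_smul]
    -- Without signs D_k is an ordinary derivation of square zero, and D_k²(ab) = 2 D_k a · D_k b.
    have h2 := hD (a * b)
    rw [ρ.coeff_singleton_mul, map_add, ρ.coeff_singleton_mul, ρ.coeff_singleton_mul, hD, hD,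
      mul_zero, zero_mul, zero_add, add_zero, G.parity_eq_id h, G.parity_eq_id h, ← two_nsmul,
      ← Nat.cast_smul_eq_nsmul ℂ] at h2
    exact (smul_eq_zero.1 h2).resolve_left (by simp)
  obtain ⟨k, hk⟩ := hJ
  have h2 : ∃ s : ℤ, s ≠ 0 ∧ ∀ a, ρ.coeff 0 {k} (ρ.coeff 0 (J.erase k) a) = s • ρ.coeff 0 J a := by
    refine ⟨eps {k} (J.erase k), ?_, fun a => ?_⟩
    · rw [eps_of_disjoint (by simp)]
      exact pow_ne_zero _ (by norm_num)
    · rw [ρ.add, add_zero, ← Finset.insert_eq, Finset.insert_erase hk]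
  obtain ⟨s, hs, h3⟩ := h2
  have h4 := h1 k (ρ.coeff 0 (J.erase k) a) (ρ.coeff 0 (J.erase k) b)
  rw [h3, h3, ← Int.cast_smul_eq_zsmul ℂ, ← Int.cast_smul_eq_zsmul ℂ, smul_mul_smul_comm] at h4
  exact (smul_eq_zero.1 h4).resolve_left (mul_ne_zero (by exact_mod_cast hs) (by exact_mod_cast hs))

/-! ### The star product of orbits -/

section Star

variable (θ : ℝ) (η : Fin n → ℤˣ)

theorem exp_eq_cis (hθ : θ ≠ 0) (r : ℝ) : Complex.exp (-2 * Complex.I / θ * r) =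
    cis (-(2 * θ⁻¹ * r)) := by
  rw [cis]
  congr 1
  push_cast
  have : (θ : ℂ) ≠ 0 := by exact_mod_cast hθ
  field_simp

theorem hasOscIntegral_coeff (hθ : θ ≠ 0) {a b : A} (ha : (ρ.body hb).Smooth a)
    (hb' : (ρ.body hb).Smooth b) :
    HasOscIntegral (fun p : Body m × Body m => Complex.exp (-2 * Complex.I / θ * omega0 p.1 p.2) •
      (ρ.coeff p.1 ∅ a * ρ.coeff p.2 ∅ b)) ((ρ.body hb).mprod (2 * θ⁻¹) a b) := by
  have := BodyAction.hasOscIntegral_mprod (c := 2 * θ⁻¹)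
    (mul_ne_zero two_ne_zero (inv_ne_zero hθ)) ha hb'
  simp_rw [exp_eq_cis θ hθ]
  exact this

/-- For every z and every coefficient the integrand is a finite combination of e^{-icω} α_{p.1}(u)
α_{p.2}(v), up to powers of γ, with smooth vectors u and v; the exact combination is irrelevant for
convergence. -/
theorem starConverges_orbit (hθ : θ ≠ 0) (hγ : Continuous G.parity)
    (hdeg : G.odd = ⊥ ∨ ρ.PreservesDegree) {a b : A} (ha : (ρ.body hb).Smooth a)
    (hb' : (ρ.body hb).Smooth b) : StarConverges θ η G.parity (ρ.orbit a) (ρ.orbit b) := by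
  intro x K
  let γ : A →L[ℂ] A := ⟨G.parity, hγ⟩
  have hγa : ∀ x b, γ (ρ.coeff x ∅ b) = ρ.coeff x ∅ (γ b) := fun x b => parity_coeff hdeg x b
  have hit : ∀ (k : ℕ) (b : A), G.parity^[k] b = (γ ^ k) b := fun k b => by
    induction k with
    | zero => rfl
    | succ k ih => rw [Function.iterate_succ_apply', ih, pow_succ']; rfl
  have hγk : ∀ (k : ℕ) x b, (γ ^ k) (ρ.coeff x ∅ b) = ρ.coeff x ∅ ((γ ^ k) b) := by
    intro k x b
    induction k with
    | zero => rfl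
    | succ k ih => rw [pow_succ', mul_apply_eq_comp, ih, hγa]; rfl
  have key : ∃ v, HasOscIntegral (starIntegrand θ η G.parity (ρ.orbit a) (ρ.orbit b) x K) v := by
    have hsh : ∀ (k : Fin 3) (Q : Finset (Gen n)), ∃ (s : ℤ) (I : Finset (Fin n)),
        ∀ u : Finset (Fin n) → A, shift k u Q = s • u I := by
      intro k Q
      by_cases h : ∀ l : Fin 3, l ≠ 0 → l ≠ k → slice l Q = ∅
      · exact ⟨eps (slice 0 Q) (slice k Q), slice 0 Q ∪ slice k Q, fun u => by
          rw [shift, if_pos h]⟩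
      · exact ⟨0, ∅, fun u => by rw [shift, if_neg h, zero_smul]⟩
    choose s I hsI using hsh
    have hco : ∀ (y : Body m) (J : Finset (Fin n)) (d : A),
        ρ.coeff (x + y) J d = ρ.coeff y ∅ (ρ.coeff x J d) := by
      intro y J d
      rw [ρ.add, add_comm y x]; simp
    have hsm : ∀ (J : Finset (Fin n)) {d : A}, (ρ.body hb).Smooth d →
        (ρ.body hb).Smooth (ρ.coeff x J d) := by
      intro J d hd
      rw [ρ.coeff_eq]
      exact (Smooth.coeff hb hd J).act x
    unfold starIntegrand grSMul grMul
    simp only [hit, hsI, orbit, hco, Finset.smul_sum, map_sum, map_zsmul]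
    have hterm : ∀ (r r' : ℕ) (e e' e₁ e₂ : ℤ) (z : ℂ) (J J' : Finset (Fin n)),
        ∃ v, HasOscIntegral (fun p : Body m × Body m =>
          Complex.exp (-2 * Complex.I / θ * omega0 p.1 p.2) • e • z • e' • (γ ^ r)
            (e₁ • ρ.coeff p.1 ∅ (ρ.coeff x J a) *
              e₂ • (γ ^ r') (ρ.coeff p.2 ∅ (ρ.coeff x J' b)))) v := by
      intro r r' e e' e₁ e₂ z J J'
      have hs' : (ρ.body hb).Smooth ((γ ^ r') (ρ.coeff x J' b)) :=
        (hsm J' hb').map (γ ^ r') fun y d => hγk r' y d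
      have h1 := hasOscIntegral_coeff hb θ hθ (hsm J ha) hs'
      have h2 := (((h1.map (γ ^ r)).smul ((e : ℂ) * z * e' * e₁ * e₂)))
      refine ⟨_, (congrArg (fun F => HasOscIntegral F _) (funext fun p => ?_)).mp h2⟩
      simp only [hγk, ← Int.cast_smul_eq_zsmul ℂ, smul_mul_smul_comm, map_smul, smul_smul]
      congr 1
      ring
    choose V hV using hterm
    exact ⟨_, HasOscIntegral.sum _ fun i _ => HasOscIntegral.sum _ fun j _ => hV _ _ _ _ _ _ _ _ _⟩
  obtain ⟨v, hv⟩ := key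
  rw [hv.oscIntegral_eq]
  exact hv

/-- The normalization of the deformed product. -/
def starConst (m : ℕ) (θ : ℝ) (η : Fin n → ℤˣ) : ℂ :=
  ((1 / (Real.pi ^ (2 * m) * θ ^ (2 * (m : ℤ) - (n : ℤ))) : ℝ) : ℂ) *
    (rsign n * ∏ k : Fin n, (-2 * Complex.I / θ * ((η k : ℤ) : ℂ)))

/-- The strength of the odd deformation. -/
def oddCoeff (θ : ℝ) (η : Fin n → ℤˣ) (k : Fin n) : ℂ := (-2 * Complex.I / θ * ((η k : ℤ) : ℂ))⁻¹

/-- In the Berezin sum the kernel contributes a product over the complement of J. Writing it as the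
product over all k times inverses over J separates the overall factor `starConst` from the
deformation parameters `oddCoeff`. -/
theorem starProduct_orbit (hθ : θ ≠ 0) (hc : 2 * θ⁻¹ ≠ 0) (hγ : Continuous G.parity)
    (hdeg : G.odd = ⊥ ∨ ρ.PreservesDegree) (a b : ρ.smoothVectors) :
    starProduct θ η G.parity (ρ.orbit a) (ρ.orbit b) 0 ∅ = ((starConst m θ η •
      oddDeform (ρ.smoothParity hb hγ hdeg) (ρ.odd hb) (oddCoeff θ η) (ρ.moyalProd hb hc)
        Finset.univ a b : ρ.smoothVectors) : A) := by
  have hit : ∀ (k : ℕ) (d : ρ.smoothVectors), G.parity^[k] d =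
      (((ρ.smoothParity hb hγ hdeg) ^ k) d : ρ.smoothVectors) := by
    intro k d
    induction k with
    | zero => rfl
    | succ k ih => rw [Function.iterate_succ_apply', ih, pow_succ']; rfl
  have hco : ∀ (x : Body m) (J : Finset (Fin n)) (d : ρ.smoothVectors),
      ρ.orbit d x J = ρ.coeff x ∅ (ρ.odd hb J d) := fun x J d => ρ.coeff_eq x J d
  have hγk : ∀ (k : ℕ) x b, G.parity^[k] (ρ.coeff x ∅ b) = ρ.coeff x ∅ (G.parity^[k] b) := by
    intro k x b
    induction k with
    | zero => rfl
    | succ k ih => rw [Function.iterate_succ_apply', ih, Function.iterate_succ_apply',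
        parity_coeff hdeg]
  have hosc : HasOscIntegral (starIntegrand θ η G.parity (ρ.orbit a) (ρ.orbit b) 0 ∅)
      (∑ J : Finset (Fin n), ((rsign n * rsign J.card : ℤ) : ℂ) •
        (∏ k ∈ Jᶜ, (-2 * Complex.I / θ * ((η k : ℤ) : ℂ))) •
        (ρ.body hb).mprod (2 * θ⁻¹) (ρ.odd hb J a)
          (((ρ.smoothParity hb hγ hdeg) ^ J.card) (ρ.odd hb J b) : ρ.smoothVectors)) := by
    unfold starIntegrand
    simp only [zero_add]
    have e : ∀ p : Body m × Body m, _ := fun p => berezin_eq θ η G.parity (map_zero _)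
      G.parity_parity (ρ.orbit a p.1) (ρ.orbit b p.2)
    simp_rw [e, hco, hγk, hit, Finset.smul_sum]
    refine HasOscIntegral.sum _ fun J _ => ?_
    have h1 := hasOscIntegral_coeff hb θ hθ ((mem_smoothVectors hb).1 (ρ.odd hb J a).2)
      ((mem_smoothVectors hb).1
        (((ρ.smoothParity hb hγ hdeg) ^ J.card) (ρ.odd hb J b) : ρ.smoothVectors).2)
    have h2 := (h1.smul (∏ k ∈ Jᶜ, (-2 * Complex.I / θ * ((η k : ℤ) : ℂ)))).smul
      ((rsign n * rsign J.card : ℤ) : ℂ)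
    refine (congrArg (fun F => HasOscIntegral F _) (funext fun p => ?_)).mp h2
    simp only [smul_smul]
    congr 1
    ring
  rw [starProduct, hosc.oscIntegral_eq, oddDeform_apply, Finset.powerset_univ, starConst,
    Finset.smul_sum, Finset.smul_sum]
  rw [AddSubmonoidClass.coe_finsetSum]
  refine Finset.sum_congr rfl fun J _ => ?_
  simp only [Submodule.coe_smul, coe_moyalProd, smul_smul]
  congr 1
  have hne : ∀ k : Fin n, (-2 * Complex.I / θ * ((η k : ℤ) : ℂ)) ≠ 0 := by
    intro k
    have h1 : (θ : ℂ) ≠ 0 := by exact_mod_cast hθ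
    have h2 : ((η k : ℤ) : ℂ) ≠ 0 := by exact_mod_cast (η k).ne_zero
    exact mul_ne_zero (div_ne_zero (mul_ne_zero (by norm_num) Complex.I_ne_zero) h1) h2
  have hJ : (∏ k : Fin n, (-2 * Complex.I / θ * ((η k : ℤ) : ℂ))) * ∏ k ∈ J, oddCoeff θ η k =
      ∏ k ∈ Jᶜ, (-2 * Complex.I / θ * ((η k : ℤ) : ℂ)) := by
    simp only [oddCoeff]
    rw [← Finset.prod_compl_mul_prod J, mul_assoc, ← Finset.prod_mul_distrib,
      Finset.prod_eq_one fun k _ => mul_inv_cancel₀ (hne k), mul_one]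
  rw [← hJ]
  push_cast
  ring

end Star
end SuperAction
end StarProduct

/-! ### Associativity of the star product, graded and ungraded. -/

section StarAssoc

variable {m n : ℕ} {A : Type*} [NonUnitalRing A] [Module ℂ A] [IsScalarTower ℂ A A]
  [SMulCommClass ℂ A A] [UniformSpace A] [IsUniformAddGroup A] [ContinuousSMul ℂ A]
  [ContinuousMul A] [PolynormableSpace ℂ A] [CompleteSpace A] [T2Space A]
  [FirstCountableTopology A] {G : Supergrading A}

namespace SuperAction

variable {ρ : SuperAction m n A G} (hb : ∀ a, SemBdd fun x => ρ.coeff x ∅ a)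

/-- Here γ is the identity and need not anticommute with D_k, so the graded argument is not
available; instead all terms with J nonempty vanish, because D_J a · D_J b = 0 on A and hence under
the integral. -/
theorem oddDeform_of_odd_eq_bot (hγ : Continuous G.parity) (h : G.odd = ⊥) (κ : Fin n → ℂ)
    {c : ℝ} (hc : c ≠ 0) (s : Finset (Fin n)) :
    oddDeform (ρ.smoothParity hb hγ (Or.inl h)) (ρ.odd hb) κ (ρ.moyalProd hb hc) s =
      ρ.moyalProd hb hc := by
  have hp : ρ.smoothParity hb hγ (Or.inl h) = 1 := by
    ext a
    exact G.parity_eq_id h a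
  ext a b : 2
  rw [oddDeform_apply, Finset.sum_eq_single ∅]
  · have h0 : ∀ a, ρ.odd hb ∅ a = a := fun a => Subtype.ext (ρ.zero _)
    simp [h0, rsign_zero]
  · intro J _ hJ
    rw [hp, one_pow]
    have : ρ.moyalProd hb hc (ρ.odd hb J a) (ρ.odd hb J b) = 0 :=
      Subtype.ext (BodyAction.mprod_eq_zero (α := ρ.body hb) hc (fun x b => ρ.coeff_comm x J b)
        (fun x b => ρ.coeff_comm x J b)
        (coeff_mul_coeff_of_odd_eq_bot h (Finset.nonempty_iff_ne_empty.2 hJ))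
        ((mem_smoothVectors hb).1 a.2) ((mem_smoothVectors hb).1 b.2))
    rw [Module.End.one_apply, this, smul_zero]
  · exact fun h => absurd (Finset.empty_mem_powerset s) h

/-- The deformed product of smooth vectors. -/
def star (ρ : SuperAction m n A G) (hb : ∀ a, SemBdd fun x => ρ.coeff x ∅ a)
    (hγ : Continuous G.parity) (hdeg : G.odd = ⊥ ∨ ρ.PreservesDegree) (θ : ℝ) (η : Fin n → ℤˣ)
    (hc : 2 * θ⁻¹ ≠ 0) : ρ.smoothVectors →ₗ[ℂ] ρ.smoothVectors →ₗ[ℂ] ρ.smoothVectors :=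
  starConst m θ η • oddDeform (ρ.smoothParity hb hγ hdeg) (ρ.odd hb) (oddCoeff θ η)
    (ρ.moyalProd hb hc) Finset.univ

theorem star_assoc (hG : G.IsAlgebraGrading) (hγ : Continuous G.parity)
    (hdeg : G.odd = ⊥ ∨ ρ.PreservesDegree) {θ : ℝ} (hθ : θ ≠ 0) (η : Fin n → ℤˣ)
    (hc : 2 * θ⁻¹ ≠ 0) (a b d : ρ.smoothVectors) :
    ρ.star hb hγ hdeg θ η hc (ρ.star hb hγ hdeg θ η hc a b) d =
      ρ.star hb hγ hdeg θ η hc a (ρ.star hb hγ hdeg θ η hc b d) := by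
  have key : ∀ a b d, oddDeform (ρ.smoothParity hb hγ hdeg) (ρ.odd hb) (oddCoeff θ η)
      (ρ.moyalProd hb hc) Finset.univ (oddDeform (ρ.smoothParity hb hγ hdeg) (ρ.odd hb)
        (oddCoeff θ η) (ρ.moyalProd hb hc) Finset.univ a b) d =
      oddDeform (ρ.smoothParity hb hγ hdeg) (ρ.odd hb) (oddCoeff θ η)
      (ρ.moyalProd hb hc) Finset.univ a (oddDeform (ρ.smoothParity hb hγ hdeg) (ρ.odd hb)
        (oddCoeff θ η) (ρ.moyalProd hb hc) Finset.univ b d) := by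
    rcases hdeg with h | h
    · rw [oddDeform_of_odd_eq_bot hb hγ h]
      exact moyalProd_assoc hb (inv_ne_zero hθ) hc
    · exact ((isCompatible_moyalProd hb hG hγ h (inv_ne_zero hθ) hc).deform
        (oddCoeff θ η) Finset.univ).assoc
  simp only [star, LinearMap.smul_apply, map_smul, key]

end SuperAction
end StarAssoc

/-! ### Hilbert superspaces as Krein spaces; the superadjoint; norm closures. -/

section Krein

/-- The grading defined by an involution. -/
def Supergrading.ofInvolution {V : Type*} [AddCommGroup V] [Module ℂ V] (P : V →ₗ[ℂ] V)
    (hP : ∀ v, P (P v) = v) : Supergrading V where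
  even := LinearMap.eqLocus P LinearMap.id
  odd := LinearMap.eqLocus P (-LinearMap.id)
  isCompl := by
    constructor
    · rw [Submodule.disjoint_def]
      intro v h0 h1
      have h0' : P v = v := h0
      have h1' : P v = -v := h1
      have h2 : (2 : ℂ) • v = 0 := by
        rw [two_smul]
        nth_rewrite 1 [h0'.symm.trans h1']
        simp
      exact (smul_eq_zero.1 h2).resolve_left two_ne_zero
    · rw [codisjoint_iff, eq_top_iff]
      intro v _
      refine Submodule.mem_sup.2 ⟨(1 / 2 : ℂ) • (v + P v), ?_, (1 / 2 : ℂ) • (v - P v), ?_, ?_⟩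
      · change P _ = _
        rw [map_smul, map_add, hP, add_comm]; rfl
      · change P _ = -_
        rw [map_smul, map_sub, hP, LinearMap.id_apply, ← smul_neg, neg_sub]
      · module

theorem Supergrading.mem_part_ofInvolution {V : Type*} [AddCommGroup V] [Module ℂ V]
    {P : V →ₗ[ℂ] V} {hP : ∀ v, P (P v) = v} {i : ZMod 2} {v : V} :
    v ∈ (Supergrading.ofInvolution P hP).part i ↔ P v = ksign i • v := by
  rcases zmod_two_cases i with rfl | rfl
  · rw [part_zero, ksign_zero, one_smul]; rfl
  · rw [part_one, ksign_one, neg_one_smul]; rfl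

/-- A Hilbert space with a grading `γ` and a fundamental symmetry `J`. -/
structure Krein (H : Type*) [NormedAddCommGroup H] [InnerProductSpace ℂ H] where
  γ : H →L[ℂ] H
  J : H →L[ℂ] H
  r : ZMod 2
  γ_γ : ∀ x, γ (γ x) = x
  inner_γ : ∀ x y, inner ℂ (γ x) (γ y) = inner ℂ x y
  inner_J : ∀ x y, inner ℂ (J x) (J y) = inner ℂ x y
  J_γ : ∀ x, J (γ x) = ksign r • γ (J x)
  J_J : ∀ x, J (J x) = if r = 0 then γ x else x

namespace Krein

variable {H : Type*} [NormedAddCommGroup H] [InnerProductSpace ℂ H] (K : Krein H)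

/-- The power `γ^i`. -/
def p (i : ZMod 2) : H →L[ℂ] H := if i = 0 then ContinuousLinearMap.id ℂ H else K.γ

@[simp] theorem p_zero (x : H) : K.p 0 x = x := by simp [p]

@[simp] theorem p_one (x : H) : K.p 1 x = K.γ x := by simp [p]

/-- The inverse of `J`. -/
def Jinv : H →L[ℂ] H := K.J.comp (K.p (K.r + 1))

theorem one_add_one : (1 + 1 : ZMod 2) = 0 := rfl

@[simp] theorem J_Jinv (x : H) : K.J (K.Jinv x) = x := by
  rw [Jinv, ContinuousLinearMap.comp_apply, K.J_J]
  rcases zmod_two_cases K.r with h | h <;> simp [h, one_add_one, K.γ_γ]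

@[simp] theorem Jinv_J (x : H) : K.Jinv (K.J x) = x := by
  rw [Jinv, ContinuousLinearMap.comp_apply]
  rcases zmod_two_cases K.r with h | h
  · simp [h, K.J_γ, ksign_zero, K.J_J, K.γ_γ]
  · simp [h, one_add_one, K.J_J]

theorem inner_Jinv_right (x y : H) : inner ℂ x (K.Jinv y) = inner ℂ (K.J x) y := by
  rw [← K.inner_J x, J_Jinv]

theorem inner_γ_right (x y : H) : inner ℂ x (K.γ y) = inner ℂ (K.γ x) y := by
  rw [← K.inner_γ (K.γ x), K.γ_γ]

theorem inner_p (i : ZMod 2) (x y : H) : inner ℂ (K.p i x) (K.p i y) = inner ℂ x y := by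
  rcases zmod_two_cases i with rfl | rfl <;> simp [K.inner_γ]

theorem p_p (i j : ZMod 2) (x : H) : K.p i (K.p j x) = K.p (i + j) x := by
  rcases zmod_two_cases i with rfl | rfl <;> rcases zmod_two_cases j with rfl | rfl <;>
    simp [K.γ_γ, one_add_one]

theorem J_p (i : ZMod 2) (x : H) : K.J (K.p i x) = ksign (K.r * i) • K.p i (K.J x) := by
  rcases zmod_two_cases i with rfl | rfl <;> simp [K.J_γ, ksign_zero]

theorem J_J' (x : H) : K.J (K.J x) = K.p (K.r + 1) x := by
  rw [K.J_J]
  rcases zmod_two_cases K.r with h | h <;> simp [h, one_add_one]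

theorem Jinv_γ (x : H) : K.Jinv (K.γ x) = ksign K.r • K.γ (K.Jinv x) := by
  have h := K.J_γ (K.Jinv x)
  rw [J_Jinv] at h
  have h2 : K.J (ksign K.r • K.γ (K.Jinv x)) = K.γ x := by
    rw [map_smul, h, smul_smul, ksign_mul_self, one_smul]
  rw [← h2, Jinv_J]

theorem ksign_ne_zero (i : ZMod 2) : ksign i ≠ 0 := fun h => by
  simpa [h] using ksign_mul_self i

theorem ksign_inj {i j : ZMod 2} (h : ksign i = ksign j) : i = j := by
  rcases zmod_two_cases i with rfl | rfl <;> rcases zmod_two_cases j with rfl | rfl <;>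
    simp [ksign_zero, ksign_one] at h ⊢
  all_goals norm_num at h

theorem inner_eq_zero {i j : ZMod 2} {x y : H} (hx : K.γ x = ksign i • x)
    (hy : K.γ y = ksign j • y) (h : i ≠ j) : inner ℂ x y = 0 := by
  have h1 := K.inner_γ x y
  rw [hx, hy, inner_smul_left, inner_smul_right, conj_ksign, ← mul_assoc] at h1
  by_contra h0
  have h2 : ksign i * ksign j = 1 := by
    have := mul_right_cancel₀ h0 (h1.trans (one_mul _).symm)
    exact this
  refine h (ksign_inj (mul_right_cancel₀ (ksign_ne_zero j) (h2.trans (ksign_mul_self j).symm)))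

/-- The Hilbert superspace of a graded Hilbert space with a fundamental symmetry. -/
def toHilbertSuperspace : HilbertSuperspace H where
  grading := Supergrading.ofInvolution (K.γ : H →ₗ[ℂ] H) K.γ_γ
  degree := K.r
  form := (innerₛₗ ℂ).compl₂ (K.Jinv : H →ₗ[ℂ] H)
  superhermitian i j x y hx hy := by
    rw [Supergrading.mem_part_ofInvolution] at hx hy
    have hx' : K.γ x = ksign i • x := hx
    have hy' : K.γ y = ksign j • y := hy
    change conj (inner ℂ x (K.Jinv y)) = ksign (i * j) * inner ℂ y (K.Jinv x)
    rw [inner_Jinv_right, inner_conj_symm]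
    have e1 : K.Jinv x = ksign ((K.r + 1) * i) • K.J x := by
      rw [Jinv, ContinuousLinearMap.comp_apply]
      rcases zmod_two_cases K.r with h | h
      · simp [h, hx']
      · simp [h, one_add_one, ksign_zero]
    rw [e1, inner_smul_right]
    -- Vectors of other degrees are orthogonal and both sides vanish; in the remaining case the
    -- exponent ij + (r+1)i is even.
    by_cases h : j = i + K.r
    · rw [← mul_assoc, ← ksign_add]
      have : i * j + (K.r + 1) * i = 0 := by
        rw [h]
        rcases zmod_two_cases K.r with h | h <;> rcases zmod_two_cases i with h' | h' <;>
          simp [h, h', one_add_one]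
      rw [this, ksign_zero, one_mul]
    · have : inner ℂ y (K.J x) = 0 := by
        refine K.inner_eq_zero (j := i + K.r) hy' ?_ h
        have h2 := K.J_γ x
        rw [hx', map_smul] at h2
        rw [ksign_add, mul_comm, mul_smul, h2, smul_smul, ksign_mul_self, one_smul]
      rw [this]; simp
  homogeneous i j x y hx hy h := by
    rw [Supergrading.mem_part_ofInvolution] at hx hy
    have hx' : K.γ x = ksign i • x := hx
    have hy' : K.γ y = ksign j • y := hy
    change inner ℂ x (K.Jinv y) = 0
    refine K.inner_eq_zero (j := j + K.r) hx' ?_ ?_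
    · have h2 := K.Jinv_γ y
      rw [hy', map_smul] at h2
      rw [ksign_add, mul_comm, mul_smul, h2, smul_smul, ksign_mul_self, one_smul]
    · rintro rfl
      refine h ?_
      rw [add_right_comm]
      rcases zmod_two_cases j with h' | h' <;> simp [h', one_add_one]
  J := K.J
  J_degree i x hx := by
    rw [Supergrading.mem_part_ofInvolution] at hx ⊢
    have hx' : K.γ x = ksign i • x := hx
    change K.γ (K.J x) = _ • K.J x
    have h2 := K.J_γ x
    rw [hx', map_smul] at h2
    rw [ksign_add, mul_comm, mul_smul, h2, smul_smul, ksign_mul_self, one_smul]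
  J_sq i x hx := by
    rw [Supergrading.mem_part_ofInvolution] at hx
    have hx' : K.γ x = ksign i • x := hx
    change K.J (K.J x) = _
    rw [K.J_J]
    rcases zmod_two_cases K.r with h | h
    · simp [h, hx']
    · simp [h, one_add_one, ksign_zero]
  J_isometry x y := by
    change inner ℂ (K.J x) (K.Jinv (K.J y)) = inner ℂ x (K.Jinv y)
    rw [inner_Jinv_right, inner_Jinv_right, K.inner_J]
  inner_eq x y := by
    change _ = inner ℂ x (K.Jinv (K.J y))
    rw [Jinv_J]

theorem toHilbertSuperspace_form (x y : H) :
    K.toHilbertSuperspace.form x y = inner ℂ x (K.Jinv y) := rfl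

theorem mem_part {i : ZMod 2} {x : H} :
    x ∈ K.toHilbertSuperspace.grading.part i ↔ K.γ x = ksign i • x :=
  Supergrading.mem_part_ofInvolution (hP := K.γ_γ)

/-- The Krein space of a Hilbert superspace. -/
def ofHilbertSuperspace (S : HilbertSuperspace H) : Krein H :=
  have hJ : ∀ x y, inner ℂ (S.J x) (S.J y) = inner ℂ x y := fun x y => by
    rw [S.inner_eq, S.J_isometry, ← S.inner_eq]
  -- The degree of J compensates that of the form, so different degrees are orthogonal for the
  -- scalar product; hence the parity is unitary.
  have horth : ∀ (i j : ZMod 2) (x y : H), x ∈ S.grading.part i → y ∈ S.grading.part j →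
      i ≠ j → inner ℂ x y = 0 := fun i j x y hx hy hij => by
    rw [S.inner_eq]
    refine S.homogeneous i (j + S.degree) x _ hx (S.J_degree j y hy) fun h => hij ?_
    have h2 : i + j = 0 := by
      rw [← add_assoc] at h
      simpa using h
    rcases zmod_two_cases i with rfl | rfl <;> rcases zmod_two_cases j with rfl | rfl <;>
      first | rfl | (exfalso; revert h2; decide)
  have hγ : ∀ x y, inner ℂ (S.grading.parity x) (S.grading.parity y) = inner ℂ x y := fun x y => by
    obtain ⟨x₀, hx₀, x₁, hx₁, rfl⟩ := S.grading.exists_add x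
    obtain ⟨y₀, hy₀, y₁, hy₁, rfl⟩ := S.grading.exists_add y
    have e1 := horth 0 1 x₀ y₁ (by simpa) (by simpa) (by decide)
    have e2 := horth 1 0 x₁ y₀ (by simpa) (by simpa) (by decide)
    rw [S.grading.parity_add hx₀ hx₁, S.grading.parity_add hy₀ hy₁]
    simp only [inner_sub_left, inner_sub_right, inner_add_left, inner_add_right, e1, e2]
    ring
  have hnorm : ∀ (T : H →ₗ[ℂ] H), (∀ x y, inner ℂ (T x) (T y) = inner ℂ x y) → Continuous T := by
    intro T hT
    refine AddMonoidHomClass.continuous_of_bound T 1 fun x => ?_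
    rw [one_mul, @norm_eq_sqrt_re_inner ℂ, @norm_eq_sqrt_re_inner ℂ _ _ _ _ x, hT]
  { γ := ⟨S.grading.parity, hnorm _ hγ⟩
    J := ⟨S.J, hnorm _ hJ⟩
    r := S.degree
    γ_γ := fun x => S.grading.parity_parity x
    inner_γ := hγ
    inner_J := hJ
    J_γ := fun x => by
      change S.J (S.grading.parity x) = ksign S.degree • S.grading.parity (S.J x)
      obtain ⟨x₀, hx₀, x₁, hx₁, rfl⟩ := S.grading.exists_add x
      have e0 := S.grading.parity_of_mem_part (S.J_degree 0 x₀ (by simpa))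
      have e1 := S.grading.parity_of_mem_part (S.J_degree 1 x₁ (by simpa))
      rw [S.grading.parity_add hx₀ hx₁, map_sub, map_add, map_add, e0, e1, smul_add, smul_smul,
        smul_smul, ← ksign_add, ← ksign_add]
      rcases zmod_two_cases S.degree with h | h <;>
        simp [h, ksign_zero, ksign_one, one_add_one, sub_eq_add_neg]
    J_J := fun x => by
      change S.J (S.J x) = if S.degree = 0 then S.grading.parity x else x
      obtain ⟨x₀, hx₀, x₁, hx₁, rfl⟩ := S.grading.exists_add x
      have e0 := S.J_sq 0 x₀ (by simpa)
      have e1 := S.J_sq 1 x₁ (by simpa)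
      rw [map_add, map_add, e0, e1, S.grading.parity_add hx₀ hx₁]
      rcases zmod_two_cases S.degree with h | h <;>
        simp [h, ksign_zero, ksign_one, one_add_one, sub_eq_add_neg] }

theorem form_eq (S : HilbertSuperspace H) (x y : H) :
    S.form x y = inner ℂ x ((ofHilbertSuperspace S).Jinv y) := by
  rw [S.inner_eq]
  have : S.J ((ofHilbertSuperspace S).Jinv y) = y := (ofHilbertSuperspace S).J_Jinv y
  rw [this]

/-- Operators of degree `i`. -/
def IsHom (i : ZMod 2) (T : H →L[ℂ] H) : Prop := ∀ x, K.γ (T (K.γ x)) = ksign i • T x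

variable {K}

theorem IsHom.γ_apply {i : ZMod 2} {T : H →L[ℂ] H} (hT : K.IsHom i T) (x : H) :
    K.γ (T x) = ksign i • T (K.γ x) := by
  rw [← hT, K.γ_γ]

theorem IsHom.p_apply {i : ZMod 2} {T : H →L[ℂ] H} (hT : K.IsHom i T) (k : ZMod 2) (x : H) :
    K.p k (T x) = ksign (i * k) • T (K.p k x) := by
  rcases zmod_two_cases k with rfl | rfl
  · simp [ksign_zero]
  · simp [hT.γ_apply]

variable (K) [CompleteSpace H]

open ContinuousLinearMap in
/-- The superadjoint. -/
def sadj : (H →L[ℂ] H) →ₗ⋆[ℂ] (H →L[ℂ] H) where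
  -- For T of degree i, with X = J⁻¹TJ, this equals X*γ^i: the first two terms extract the even part
  -- of X*, the last two the odd part followed by γ. The formula extends this antilinearly to all T.
  toFun T := (1 / 2 : ℂ) • (adjoint (K.Jinv * T * K.J) + K.γ * adjoint (K.Jinv * T * K.J) * K.γ +
    (adjoint (K.Jinv * T * K.J) * K.γ - K.γ * adjoint (K.Jinv * T * K.J)))
  map_add' S T := by
    simp only [mul_add, add_mul, map_add]
    module
  map_smul' c T := by
    simp only [mul_smul_comm, smul_mul_assoc, map_smulₛₗ]
    module

theorem continuous_sadj : Continuous K.sadj := by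
  change Continuous fun T => _
  simp only [sadj, LinearMap.coe_mk, AddHom.coe_mk]
  have h : Continuous fun T : H →L[ℂ] H => ContinuousLinearMap.adjoint (K.Jinv * T * K.J) :=
    ContinuousLinearMap.adjoint.continuous.comp (by fun_prop)
  fun_prop

variable {K}

/-- The relation ⟨T†x, y⟩ = (-1)^{|T||x|}⟨x, Ty⟩ expressed by the scalar product; γ^i x carries the
sign for all x at once. Together with `sadj_unique` it characterizes the superadjoint of a
homogeneous operator. -/
theorem inner_sadj {i : ZMod 2} {T : H →L[ℂ] H} (hT : K.IsHom i T) (x y : H) :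
    inner ℂ (K.sadj T x) y = inner ℂ (K.p i x) (K.Jinv (T (K.J y))) := by
  have hX : ∀ x y, inner ℂ (ContinuousLinearMap.adjoint (K.Jinv * T * K.J) x) y =
      inner ℂ x (K.Jinv (T (K.J y))) := fun x y => ContinuousLinearMap.adjoint_inner_left _ _ _
  have hc : ∀ y, K.Jinv (T (K.J (K.γ y))) = ksign i • K.γ (K.Jinv (T (K.J y))) := by
    intro y
    have h1 := hT.γ_apply (K.J y)
    have h2 : T (K.γ (K.J y)) = ksign i • K.γ (T (K.J y)) := by
      rw [h1, smul_smul, ksign_mul_self, one_smul]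
    rw [K.J_γ, map_smul, h2, map_smul, map_smul, K.Jinv_γ, smul_smul, smul_smul, mul_right_comm,
      ksign_mul_self, one_mul]
  have e : inner ℂ (K.sadj T x) y = (1 / 2 : ℂ) * (inner ℂ x (K.Jinv (T (K.J y))) +
      inner ℂ (K.γ x) (K.Jinv (T (K.J (K.γ y)))) + (inner ℂ (K.γ x) (K.Jinv (T (K.J y))) -
      inner ℂ x (K.Jinv (T (K.J (K.γ y)))))) := by
    have h2 : conj (1 / 2 : ℂ) = 1 / 2 := by
      rw [map_div₀, map_one, Complex.conj_ofNat]
    simp only [sadj, LinearMap.coe_mk, AddHom.coe_mk, _root_.smul_apply, _root_.add_apply,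
      _root_.sub_apply, mul_apply_eq_comp, inner_smul_left, inner_add_left,
      inner_sub_left, ← K.inner_γ_right, hX, h2]
  rw [e, hc, inner_smul_right, inner_smul_right, K.inner_γ_right, K.inner_γ_right, K.γ_γ]
  rcases zmod_two_cases i with rfl | rfl
  · simp [ksign_zero]; ring
  · simp [ksign_one]; ring

theorem sadj_unique {i : ZMod 2} {T S : H →L[ℂ] H} (hT : K.IsHom i T)
    (h : ∀ x y, inner ℂ (S x) y = inner ℂ (K.p i x) (K.Jinv (T (K.J y)))) : K.sadj T = S := by
  ext x
  refine ext_inner_right ℂ fun y => ?_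
  rw [inner_sadj hT, h]

theorem IsHom.sadj {i : ZMod 2} {T : H →L[ℂ] H} (hT : K.IsHom i T) : K.IsHom i (K.sadj T) := by
  intro x
  refine ext_inner_right ℂ fun y => ?_
  rw [← K.inner_γ_right, inner_sadj hT, inner_smul_left, inner_sadj hT, conj_ksign]
  have h2 : T (K.γ (K.J y)) = ksign i • K.γ (T (K.J y)) := by
    rw [hT.γ_apply, smul_smul, ksign_mul_self, one_smul]
  rw [K.J_γ, map_smul, h2, map_smul, map_smul, K.Jinv_γ, smul_smul, smul_smul, mul_right_comm,
    ksign_mul_self, one_mul, inner_smul_right, K.inner_γ_right]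
  congr 2
  have := K.p_p 1 i (K.γ x)
  have h3 := K.p_p (1 + i) 1 x
  simp only [p_one] at this h3
  rw [this, h3, add_right_comm, one_add_one, zero_add]

theorem sadj_sadj {i : ZMod 2} {T : H →L[ℂ] H} (hT : K.IsHom i T) : K.sadj (K.sadj T) = T := by
  refine sadj_unique hT.sadj fun x y => ?_
  rw [K.inner_Jinv_right, ← inner_conj_symm (K.J _), inner_sadj hT, K.inner_Jinv_right,
    inner_conj_symm, K.J_J' (K.p i x), K.J_p i (K.J y), K.J_J' y, inner_smul_right, K.p_p, K.p_p,
    add_comm i]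
  have h := hT.p_apply (K.r + 1 + i) x
  have h2 : T (K.p (K.r + 1 + i) x) = ksign (i * (K.r + 1 + i)) • K.p (K.r + 1 + i) (T x) := by
    rw [h, smul_smul, ksign_mul_self, one_smul]
  rw [h2, inner_smul_left, conj_ksign, ← mul_assoc, ← ksign_add, K.inner_p]
  have : K.r * i + i * (K.r + 1 + i) = 0 := by
    rcases zmod_two_cases i with rfl | rfl <;> rcases zmod_two_cases K.r with h | h <;>
      simp [h, one_add_one]
  rw [this, ksign_zero, one_mul]

theorem IsHom.mul {i j : ZMod 2} {T S : H →L[ℂ] H} (hT : K.IsHom i T) (hS : K.IsHom j S) :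
    K.IsHom (i + j) (T * S) := by
  intro x
  change K.γ (T (S (K.γ x))) = ksign (i + j) • T (S x)
  rw [hT.γ_apply, hS.γ_apply, K.γ_γ, map_smul, smul_smul, ksign_add]

theorem sadj_mul {i j : ZMod 2} {T S : H →L[ℂ] H} (hT : K.IsHom i T) (hS : K.IsHom j S) :
    K.sadj (T * S) = ksign (i * j) • (K.sadj S * K.sadj T) := by
  refine sadj_unique (hT.mul hS) fun x y => ?_
  change inner ℂ (ksign (i * j) • K.sadj S (K.sadj T x)) y = inner ℂ _ (K.Jinv (T (S (K.J y))))
  rw [inner_smul_left, conj_ksign, inner_sadj hS, hT.sadj.p_apply, inner_smul_left, conj_ksign,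
    inner_sadj hT, K.J_Jinv, ← mul_assoc, ksign_mul_self, one_mul, K.p_p]

theorem mem_part_iff_isHom {i : ZMod 2} {T : H →L[ℂ] H} :
    K.γ * T * K.γ = ksign i • T ↔ K.IsHom i T :=
  ⟨fun h x => congrArg (fun f : H →L[ℂ] H => f x) h, fun h => ContinuousLinearMap.ext h⟩

/-- The norm closure of a represented algebra is a C*-superalgebra. -/
theorem exists_isCStarSuperalgebra {S : Type*} [AddCommGroup S] [Module ℂ S]
    (M : S →ₗ[ℂ] S →ₗ[ℂ] S) (γ : S →ₗ[ℂ] S) (dag : S → S)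
    {H : Type v} [NormedAddCommGroup H] [InnerProductSpace ℂ H] [CompleteSpace H]
    (K : Krein H) (T : S →ₗ[ℂ] (H →L[ℂ] H)) (hinj : Function.Injective T)
    (hmul : ∀ a b, T (M a b) = T a * T b) (hγ : ∀ a, K.γ * T a * K.γ = T (γ a))
    (hdag : ∀ a, K.sadj (T a) = T (dag a)) :
    ∃ (B : Type v) (_ : NonUnitalRing B) (_ : Module ℂ B) (_ : IsScalarTower ℂ B B)
      (_ : SMulCommClass ℂ B B) (_ : TopologicalSpace B)
      (GB : Supergrading B) (dagB : B →ₗ⋆[ℂ] B) (ι : S →ₗ[ℂ] B),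
      IsCStarSuperalgebra.{v, v} GB dagB ∧ Function.Injective ι ∧ DenseRange ι ∧
      (∀ a b, ι (M a b) = ι a * ι b) ∧
      (∀ (i : ZMod 2) (a : S), γ a = ksign i • a → ι a ∈ GB.part i) ∧
      (∀ a, dagB (ι a) = ι (dag a)) := by
  let R : NonUnitalSubalgebra ℂ (H →L[ℂ] H) :=
    { LinearMap.range T with
      mul_mem' := by
        rintro _ _ ⟨a, rfl⟩ ⟨b, rfl⟩
        exact ⟨M a b, hmul a b⟩ }
  let B := R.topologicalClosure
  have hclosed : IsClosed (B : Set (H →L[ℂ] H)) := R.isClosed_topologicalClosure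
  have hTB : ∀ a, T a ∈ B := fun a => R.le_topologicalClosure ⟨a, rfl⟩
  -- Applied to conjugation by γ and to the superadjoint, which are norm continuous; both therefore
  -- pass from the represented algebra to its closure.
  have hmaps : ∀ f : (H →L[ℂ] H) → (H →L[ℂ] H), Continuous f → (∀ a, f (T a) ∈ B) →
      ∀ b ∈ B, f b ∈ B := by
    intro f hf h b hb
    have hb' : b ∈ closure (R : Set (H →L[ℂ] H)) := hb
    have := map_mem_closure (t := (B : Set (H →L[ℂ] H))) hf hb' (by rintro _ ⟨a, rfl⟩; exact h a)
    rwa [hclosed.closure_eq] at this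
  have hP : ∀ b ∈ B, K.γ * b * K.γ ∈ B :=
    hmaps (fun b => K.γ * b * K.γ) (by fun_prop) fun a => by rw [hγ]; exact hTB _
  have hS : ∀ b ∈ B, K.sadj b ∈ B := hmaps _ K.continuous_sadj fun a => by rw [hdag]; exact hTB _
  have hγγ : K.γ * K.γ = 1 := ContinuousLinearMap.ext K.γ_γ
  let P : B →ₗ[ℂ] B :=
    { toFun := fun b => ⟨K.γ * b * K.γ, hP b b.2⟩
      map_add' := fun a b => Subtype.ext (by
        change K.γ * (a + b : H →L[ℂ] H) * K.γ = K.γ * a * K.γ + K.γ * b * K.γ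
        rw [mul_add, add_mul])
      map_smul' := fun c a => Subtype.ext (by
        change K.γ * (c • (a : H →L[ℂ] H)) * K.γ = c • (K.γ * a * K.γ)
        rw [mul_smul_comm, smul_mul_assoc]) }
  have hPP : ∀ b, P (P b) = b := fun b => Subtype.ext (by
    change K.γ * (K.γ * b * K.γ) * K.γ = (b : H →L[ℂ] H)
    rw [← mul_assoc, ← mul_assoc, hγγ, one_mul, mul_assoc, hγγ, mul_one])
  let GB := Supergrading.ofInvolution P hPP
  have hmem : ∀ (i : ZMod 2) (b : B), b ∈ GB.part i ↔ K.IsHom i b := by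
    intro i b
    rw [Supergrading.mem_part_ofInvolution, ← mem_part_iff_isHom, Subtype.ext_iff]
    rfl
  let dagB : B →ₗ⋆[ℂ] B :=
    { toFun := fun b => ⟨K.sadj b, hS b b.2⟩
      map_add' := fun a b => Subtype.ext (map_add K.sadj _ _)
      map_smul' := fun c a => Subtype.ext (map_smulₛₗ K.sadj c _) }
  refine ⟨B, inferInstance, inferInstance, inferInstance, inferInstance, inferInstance, GB, dagB,
    T.codRestrict B.toSubmodule hTB, ⟨?_, ⟨?_, ?_, ?_⟩, H, inferInstance, inferInstance,
      inferInstance, K.toHilbertSuperspace, NonUnitalSubalgebraClass.subtype B, ?_, ?_, ?_⟩,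
    ?_, ?_, ?_, ?_, ?_⟩
  · intro i j a b ha hb
    rw [hmem] at ha hb ⊢
    exact ha.mul hb
  · intro i a ha
    rw [hmem] at ha ⊢
    exact ha.sadj
  · intro a
    obtain ⟨a₀, h₀, a₁, h₁, rfl⟩ := GB.exists_add a
    have e : ∀ (i : ZMod 2) (b : B), b ∈ GB.part i → dagB (dagB b) = b := fun i b hb =>
      Subtype.ext (sadj_sadj ((hmem i b).1 hb))
    rw [map_add, map_add, e 0 a₀ (by simpa), e 1 a₁ (by simpa)]
  · intro i j a b ha hb
    rw [hmem] at ha hb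
    exact Subtype.ext (sadj_mul ha hb)
  · exact hclosed.isClosedEmbedding_subtypeVal
  · intro i j a x ha hx
    rw [hmem] at ha
    rw [mem_part] at hx ⊢
    change K.γ ((a : H →L[ℂ] H) x) = _ • (a : H →L[ℂ] H) x
    rw [ha.γ_apply, hx, map_smul, smul_smul, ksign_add]
  · intro i j a x y ha hx
    rw [hmem] at ha
    rw [mem_part] at hx
    rw [toHilbertSuperspace_form, toHilbertSuperspace_form]
    change inner ℂ (K.sadj a x) (K.Jinv y) = _ * inner ℂ x (K.Jinv ((a : H →L[ℂ] H) y))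
    rw [inner_sadj ha, J_Jinv]
    have : K.p i x = ksign (i * j) • x := by
      rcases zmod_two_cases i with rfl | rfl
      · simp [ksign_zero]
      · simp [hx]
    rw [this, inner_smul_left, conj_ksign]
  · exact fun a b h => hinj (congrArg Subtype.val h)
  · intro b
    rw [closure_subtype]
    have hb : (b : H →L[ℂ] H) ∈ closure (R : Set (H →L[ℂ] H)) := b.2
    convert hb using 2
    ext x
    constructor
    · rintro ⟨_, ⟨a, rfl⟩, rfl⟩
      exact ⟨a, rfl⟩
    · rintro ⟨a, rfl⟩
      exact ⟨_, ⟨a, rfl⟩, rfl⟩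
  · exact fun a b => Subtype.ext (hmul a b)
  · intro i a ha
    rw [hmem, ← mem_part_iff_isHom]
    change K.γ * T a * K.γ = _ • T a
    rw [hγ, ha, map_smul]
  · exact fun a => Subtype.ext (hdag a)

end Krein
end Krein

/-! ### Representing odd deformations by block operators. -/

section OddRepresentations

variable {H : Type v} [NormedAddCommGroup H] [InnerProductSpace ℂ H]

/-- Block operators on `H ⊕ H`. -/
def block (a b c d : H →L[ℂ] H) : WithLp 2 (H × H) →L[ℂ] WithLp 2 (H × H) :=
  ((WithLp.prodContinuousLinearEquiv 2 ℂ H H).symm : H × H →L[ℂ] WithLp 2 (H × H)).comp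
    ((a.comp (WithLp.fstL 2 ℂ H H) + b.comp (WithLp.sndL 2 ℂ H H)).prod
      (c.comp (WithLp.fstL 2 ℂ H H) + d.comp (WithLp.sndL 2 ℂ H H)))

@[simp] theorem block_fst (a b c d : H →L[ℂ] H) (x : WithLp 2 (H × H)) :
    (block a b c d x).fst = a x.fst + b x.snd := rfl

@[simp] theorem block_snd (a b c d : H →L[ℂ] H) (x : WithLp 2 (H × H)) :
    (block a b c d x).snd = c x.fst + d x.snd := rfl

theorem prod_ext_two {x y : WithLp 2 (H × H)} (h₁ : x.fst = y.fst) (h₂ : x.snd = y.snd) : x = y :=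
  (WithLp.equiv 2 (H × H)).injective (Prod.ext h₁ h₂)

theorem inner_prod_two (x y : WithLp 2 (H × H)) :
    inner ℂ x y = inner ℂ x.fst y.fst + inner ℂ x.snd y.snd := WithLp.prod_inner_apply x y

theorem conj_mul_self_of_skew {c : ℂ} (hc : conj c = -c) (hcc : c * c = -1) : conj c * c = 1 := by
  rw [hc, neg_mul, hcc, neg_neg]

namespace Krein

/-- The sum of a Krein space and its parity-shifted copy. -/
def double (K : Krein H) {c : ℂ} (hc : conj c = -c) (hcc : c * c = -1) :
    Krein (WithLp 2 (H × H)) where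
  γ := block K.γ 0 0 (-K.γ)
  -- On the second copy the grading is -γ, so the square of the symmetry must be -γ for degree 0 and
  -- 1 for degree 1; c² = -1 gives both, and |c| = 1 keeps it isometric.
  J := block K.J 0 0 (-c • (K.γ * K.J))
  r := K.r
  γ_γ x := prod_ext_two (by simp [K.γ_γ]) (by simp [K.γ_γ])
  inner_γ x y := by
    rw [inner_prod_two, inner_prod_two]
    simp [K.inner_γ]
  inner_J x y := by
    rw [inner_prod_two, inner_prod_two]
    have h : c * (conj c * inner ℂ x.snd y.snd) = inner ℂ x.snd y.snd := by
      rw [← mul_assoc, mul_comm c, conj_mul_self_of_skew hc hcc, one_mul]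
    simp [K.inner_γ, K.inner_J, inner_smul_left, inner_smul_right, h]
  J_γ x := by
    refine prod_ext_two ?_ ?_
    · simp [K.J_γ]
    · simp [K.J_γ, smul_comm c]
  J_J x := by
    have h2 : c • K.γ (K.J (c • K.γ (K.J x.snd))) = if K.r = 0 then -K.γ x.snd else x.snd := by
      rw [map_smul, K.J_γ, map_smul, map_smul, K.γ_γ, smul_smul, smul_smul, hcc, K.J_J]
      rcases zmod_two_cases K.r with h | h <;> simp [h, ksign_zero, ksign_one]
    refine prod_ext_two ?_ ?_
    · rcases zmod_two_cases K.r with h | h <;> simp [h, K.J_J]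
    · rcases zmod_two_cases K.r with h | h <;> simpa [h] using h2

variable {K : Krein H} {c : ℂ} (hc : conj c = -c) (hcc : c * c = -1)

@[simp] theorem double_p_fst (i : ZMod 2) (x : WithLp 2 (H × H)) :
    ((K.double hc hcc).p i x).fst = K.p i x.fst := by
  rcases zmod_two_cases i with rfl | rfl <;> simp [double]

@[simp] theorem double_p_snd (i : ZMod 2) (x : WithLp 2 (H × H)) :
    ((K.double hc hcc).p i x).snd = ksign i • K.p i x.snd := by
  rcases zmod_two_cases i with rfl | rfl <;> simp [double, ksign_zero, ksign_one]

@[simp] theorem double_Jinv_fst (x : WithLp 2 (H × H)) :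
    ((K.double hc hcc).Jinv x).fst = K.Jinv x.fst := by
  have h : ((K.double hc hcc).J ((K.double hc hcc).Jinv x)).fst = x.fst := by rw [J_Jinv]
  rw [← h]
  simp [double]

@[simp] theorem double_Jinv_snd (x : WithLp 2 (H × H)) :
    ((K.double hc hcc).Jinv x).snd = c • K.Jinv (K.γ x.snd) := by
  have h : ((K.double hc hcc).J ((K.double hc hcc).Jinv x)).snd = x.snd := by rw [J_Jinv]
  rw [show K.γ x.snd = -c • K.J ((K.double hc hcc).Jinv x).snd by
    rw [← h]; simp [double, K.γ_γ]]
  simp [smul_smul, hcc]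

/-- Faithful graded representations, up to the scalar `z`, of a product `M` such that `dag` becomes
the superadjoint. -/
structure IsRep [CompleteSpace H] (K : Krein H) {S : Type*} [AddCommGroup S] [Module ℂ S]
    (γ : S →ₗ[ℂ] S) (dag : S →ₗ⋆[ℂ] S) (z : ℂ) (M : S →ₗ[ℂ] S →ₗ[ℂ] S)
    (T : S →ₗ[ℂ] (H →L[ℂ] H)) : Prop where
  inj : Function.Injective T
  mul : ∀ a b, z • T (M a b) = T a * T b
  parity : ∀ a, K.γ * T a * K.γ = T (γ a)
  sadj : ∀ a, K.sadj (T a) = T (dag a)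

theorem sadj_eq_of_homogeneous [CompleteSpace H] {K : Krein H} {S : Type*} [AddCommGroup S]
    [Module ℂ S] {γ : S →ₗ[ℂ] S} (hγ : ∀ a, γ (γ a) = a) {dag : S →ₗ⋆[ℂ] S}
    {T : S →ₗ[ℂ] (H →L[ℂ] H)}
    (h : ∀ (i : ZMod 2) (a : S), γ a = ksign i • a → K.sadj (T a) = T (dag a)) (a : S) :
    K.sadj (T a) = T (dag a) := by
  have h0 : γ (a + γ a) = ksign 0 • (a + γ a) := by
    rw [map_add, hγ, ksign_zero, one_smul, add_comm]
  have h1 : γ (a - γ a) = ksign 1 • (a - γ a) := by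
    rw [map_sub, hγ, ksign_one, neg_one_smul, neg_sub]
  have e : a = (1 / 2 : ℂ) • (a + γ a) + (1 / 2 : ℂ) • (a - γ a) := by module
  rw [e]
  rw [map_add T, map_add K.sadj, map_add dag, map_add T, map_smul T, map_smul T,
    map_smulₛₗ K.sadj, map_smulₛₗ K.sadj, map_smulₛₗ dag, map_smulₛₗ dag, h 0 _ h0, h 1 _ h1,
    map_smul T, map_smul T]

variable {n : ℕ} {S : Type*} [AddCommGroup S] [Module ℂ S]

/-- The representation on `H ⊕ H` of a product deformed in one odd direction. -/
def doubleRep (K : Krein H) (D : S →ₗ[ℂ] S) (c μ : ℂ) (T : S →ₗ[ℂ] (H →L[ℂ] H)) :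
    S →ₗ[ℂ] (WithLp 2 (H × H) →L[ℂ] WithLp 2 (H × H)) where
  toFun a := block (T a) ((c * μ) • (T (D a) * K.γ)) (μ • (T (D a) * K.γ)) (T a)
  map_add' a b := by
    ext x
    refine prod_ext_two ?_ ?_
    · simp only [block_fst, map_add, smul_apply, add_apply, mul_apply_eq_comp, WithLp.add_fst]
      module
    · simp only [block_snd, map_add, smul_apply, add_apply, mul_apply_eq_comp, WithLp.add_snd]
      module
  map_smul' t a := by
    ext x
    refine prod_ext_two ?_ ?_
    · simp only [block_fst, map_smul, smul_apply, mul_apply_eq_comp, WithLp.smul_fst, RingHom.id_apply]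
      module
    · simp only [block_snd, map_smul, smul_apply, mul_apply_eq_comp, WithLp.smul_snd, RingHom.id_apply]
      module

theorem doubleRep_fst (D : S →ₗ[ℂ] S) (μ : ℂ) (T : S →ₗ[ℂ] (H →L[ℂ] H)) (a : S)
    (x : WithLp 2 (H × H)) : (K.doubleRep D c μ T a x).fst =
      T a x.fst + (c * μ) • T (D a) (K.γ x.snd) := rfl

theorem doubleRep_snd (D : S →ₗ[ℂ] S) (μ : ℂ) (T : S →ₗ[ℂ] (H →L[ℂ] H)) (a : S)
    (x : WithLp 2 (H × H)) : (K.doubleRep D c μ T a x).snd =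
      μ • T (D a) (K.γ x.fst) + T a x.snd := rfl

variable [CompleteSpace H] {X : OddSystem n S} {M : S →ₗ[ℂ] S →ₗ[ℂ] S} {dag : S →ₗ⋆[ℂ] S} {z : ℂ}
  {T : S →ₗ[ℂ] (H →L[ℂ] H)}

theorem IsRep.γ_apply (h : K.IsRep X.γ dag z M T) (a : S) (x : H) :
    K.γ (T a x) = T (X.γ a) (K.γ x) := by
  rw [← h.parity, mul_apply_eq_comp, mul_apply_eq_comp, K.γ_γ]

theorem IsRep.mul_apply (h : K.IsRep X.γ dag z M T) (a b : S) (x : H) :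
    T a (T b x) = z • T (M a b) x := by
  rw [← mul_apply_eq_comp, ← h.mul]; rfl

theorem IsRep.isHom (h : K.IsRep X.γ dag z M T) {i : ZMod 2} {a : S} (ha : X.γ a = ksign i • a) :
    K.IsHom i (T a) := by
  rw [← mem_part_iff_isHom, h.parity, ha, map_smul]

/-- The diagonal block of a product is T(a)T(b) + cμ² T(Da)γT(Db)γ, which is z times T of the
deformed product with parameter cμ²; the off-diagonal blocks reproduce the Leibniz rule. The
superadjoint comes out right because μ is real and c is the phase occurring in J on the second copy.
-/
theorem IsRep.double (hM : X.IsCompatible M) (h : K.IsRep X.γ dag z M T) (k : Fin n)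
    (hD : ∀ a, dag (X.D {k} a) = X.D {k} (dag a)) {μ : ℂ} (hμ : conj μ = μ) :
    (K.double hc hcc).IsRep X.γ dag z (X.step (c * μ * μ) k M) (K.doubleRep (X.D {k}) c μ T) where
  inj := by
    intro a b hab
    refine h.inj (ContinuousLinearMap.ext fun x => ?_)
    have := congrArg (fun f : WithLp 2 (H × H) →L[ℂ] WithLp 2 (H × H) =>
      (f (WithLp.toLp 2 (x, 0))).fst) hab
    simpa [doubleRep_fst] using this
  mul a b := by
    ext x
    have hD' : X.D {k} (X.step (c * μ * μ) k M a b) =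
        M a (X.D {k} b) + M (X.D {k} a) (X.γ b) := by
      rw [X.step_apply, map_add, map_smul, hM.leibniz, hM.leibniz, X.D_D_self, X.D_γ_singleton,
        X.D_D_self]
      simp
    refine prod_ext_two ?_ ?_
    · rw [smul_apply, WithLp.smul_fst, doubleRep_fst, mul_apply_eq_comp, doubleRep_fst,
        doubleRep_fst, doubleRep_snd, hD', X.step_apply]
      simp only [map_add, map_smul, h.γ_apply, K.γ_γ, h.mul_apply, _root_.add_apply,
        _root_.smul_apply]
      module
    · rw [smul_apply, WithLp.smul_snd, doubleRep_snd, mul_apply_eq_comp, doubleRep_snd,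
        doubleRep_fst, doubleRep_snd, hD', X.step_apply]
      simp only [map_add, map_smul, h.γ_apply, K.γ_γ, h.mul_apply, _root_.add_apply,
        _root_.smul_apply]
      module
  parity a := by
    ext x
    refine prod_ext_two ?_ ?_
    · simp only [mul_apply_eq_comp, doubleRep_fst]
      simp [Krein.double, doubleRep_fst, doubleRep_snd, h.γ_apply, K.γ_γ, X.D_γ_singleton]
    · simp only [mul_apply_eq_comp, doubleRep_snd]
      simp [Krein.double, doubleRep_fst, doubleRep_snd, h.γ_apply, K.γ_γ, X.D_γ_singleton, add_comm]
  sadj := by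
    refine sadj_eq_of_homogeneous X.γ_γ fun i a ha => ?_
    have hDa : X.γ (X.D {k} a) = ksign (i + 1) • X.D {k} a := by
      have := X.D_γ_singleton k a
      rw [ha, map_smul] at this
      rw [ksign_add, ksign_one, mul_neg_one, neg_smul, this, neg_neg]
    have hom : ∀ {i a}, X.γ a = ksign i • a → ∀ x, T a (K.γ x) = ksign i • K.γ (T a x) := by
      intro i a ha x
      rw [(h.isHom ha).γ_apply, smul_smul, ksign_mul_self, one_smul]
    have h1 := fun x y => inner_sadj (h.isHom ha) x y
    have h2 := fun x y => inner_sadj (h.isHom hDa) x y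
    rw [h.sadj] at h1 h2
    rw [hD] at h2
    have hp : ∀ x, K.p (i + 1) (K.γ x) = K.p i x := by
      intro x
      rw [← K.p_one, K.p_p, add_assoc, one_add_one, add_zero]
    have hk := ksign_mul_self i
    refine sadj_unique (i := i) ?_ fun x y => ?_
    · intro x
      refine prod_ext_two ?_ ?_
      · simp [Krein.double, doubleRep_fst, hom ha, hom hDa, K.γ_γ, ksign_add, ksign_one]
        match_scalars
        linear_combination (-(c * μ)) * hk
      · simp [Krein.double, doubleRep_snd, hom ha, hom hDa, K.γ_γ, ksign_add, ksign_one]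
        match_scalars <;> first | ring1 | linear_combination μ * hk
    · rw [inner_prod_two, inner_prod_two, doubleRep_fst, doubleRep_snd,
        inner_add_left, inner_add_left, inner_smul_left, inner_smul_left, h1, h1, h2, h2, hp, hp,
        double_Jinv_fst, double_Jinv_snd, double_p_fst, double_p_snd, doubleRep_fst, doubleRep_snd]
      have e1 : ((K.double hc hcc).J y).fst = K.J y.fst := by simp [Krein.double]
      have e2 : ((K.double hc hcc).J y).snd = -c • K.γ (K.J y.snd) := by simp [Krein.double]
      rw [e1, e2]
      simp only [map_add, map_smul, hom ha, hom hDa, K.γ_γ, inner_add_right, inner_smul_right,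
        inner_smul_left, conj_ksign, map_mul, hc, hμ, ksign_add, ksign_one]
      generalize inner ℂ (K.p i x.snd) (K.Jinv (T (X.D {k} a) (K.J y.fst))) = I₂
      generalize inner ℂ (K.p i x.fst) (K.Jinv (T (X.D {k} a) (K.J y.snd))) = I₃
      generalize inner ℂ (K.p i x.snd) (K.Jinv (T a (K.J y.snd))) = I₄
      linear_combination (c * μ * I₂ - I₄) * hk + (μ * I₃ + I₄ * (ksign i * ksign i)) * hcc

/-- One doubling for each odd direction, taken in increasing order; compatibility of the partially
deformed product is what permits the next doubling. -/
theorem IsRep.exists_oddDeform (hM : X.IsCompatible M) (h : K.IsRep X.γ dag z M T)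
    (hD : ∀ k a, dag (X.D {k} a) = X.D {k} (dag a)) {κ : Fin n → ℂ}
    (hκ : ∀ k, ∃ c μ : ℂ, conj c = -c ∧ c * c = -1 ∧ conj μ = μ ∧ κ k = c * μ * μ)
    (s : Finset (Fin n)) :
    ∃ (H' : Type v) (_ : NormedAddCommGroup H') (_ : InnerProductSpace ℂ H') (_ : CompleteSpace H')
      (K' : Krein H') (T' : S →ₗ[ℂ] (H' →L[ℂ] H')),
      K'.IsRep X.γ dag z (oddDeform X.γ X.D κ M s) T' := by
  induction s using Finset.induction_on_max with
  | empty =>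
    rw [OddSystem.oddDeform_empty]
    exact ⟨H, inferInstance, inferInstance, inferInstance, K, T, h⟩
  | insert k s hk ih =>
    obtain ⟨H', _, _, _, K', T', h'⟩ := ih
    obtain ⟨c, μ, hc, hcc, hμ, e⟩ := hκ k
    rw [OddSystem.oddDeform_insert _ _ _ _ _ hk, e]
    exact ⟨WithLp 2 (H' × H'), inferInstance, inferInstance, inferInstance, K'.double hc hcc, _,
      h'.double hc hcc (hM.deform κ s) k (hD k) hμ⟩

end Krein

end OddRepresentations

/-! ### Covariant representations and quantization of smooth vectors. -/

section CovariantRepresentations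

variable {m : ℕ} {A : Type*} [NonUnitalRing A] [Module ℂ A] [IsScalarTower ℂ A A]
  [SMulCommClass ℂ A A] [UniformSpace A] [IsUniformAddGroup A] [ContinuousSMul ℂ A]
  [ContinuousMul A] [PolynormableSpace ℂ A] [CompleteSpace A] [T2Space A]
  [FirstCountableTopology A]

namespace BodyAction

variable {α : BodyAction m A} {l : ℝ}

theorem symb_add (hl : l ≠ 0) (a b : A) (δ : Body m) :
    α.symb l (a + b) δ = α.symb l a δ + α.symb l b δ := by
  have hi : ∀ (φ : A →L[ℂ] ℂ) (d : A), Integrable fun x => wig l x δ * φ (α.act x d) := fun φ d =>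
    (α.act_bdd d).integrable_dual (by fun_prop) (integrable_wig hl δ) φ
  refine eq_of_dual fun φ => ?_
  rw [map_add, dual_symb hl, dual_symb hl, dual_symb hl, ← integral_add (hi φ a) (hi φ b)]
  simp only [map_add, mul_add]

theorem symb_smul (hl : l ≠ 0) (c : ℂ) (a : A) (δ : Body m) :
    α.symb l (c • a) δ = c • α.symb l a δ := by
  refine eq_of_dual fun φ => ?_
  rw [map_smul, dual_symb hl, dual_symb hl, smul_eq_mul, ← integral_const_mul]
  simp only [map_smul, smul_eq_mul, mul_left_comm c]

/-- The functional `b ↦ conj (φ (dag b))`. -/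
def conjDual (φ : A →L[ℂ] ℂ) (dag : A →ₗ⋆[ℂ] A) (h : Continuous dag) : A →L[ℂ] ℂ where
  toFun b := conj (φ (dag b))
  map_add' a b := by simp
  map_smul' c a := by simp
  cont := Complex.continuous_conj.comp (φ.continuous.comp h)

theorem conj_conjDual (φ : A →L[ℂ] ℂ) (dag : A →ₗ⋆[ℂ] A) (h : Continuous dag) (b : A) :
    conj (conjDual φ dag h b) = φ (dag b) := Complex.conj_conj _

/-- The reflection symmetry of the kernel, wig(x - δ, δ) = conj wig(x, -δ), after a translation of
the integration variable. -/
theorem symb_dag (hl : l ≠ 0) (dag : A →ₗ⋆[ℂ] A) (h : Continuous dag)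
    (hα : ∀ x a, α.act x (dag a) = dag (α.act x a)) (a : A) (δ : Body m) :
    α.symb l (dag a) δ = dag (α.act (-δ) (α.symb l a (-δ))) := by
  refine eq_of_dual fun φ => ?_
  have h1 := dual_symb (α := α) hl a (-δ) ((conjDual φ dag h).comp (α.act (-δ)))
  simp only [ContinuousLinearMap.comp_apply] at h1
  rw [← conj_conjDual φ dag h, h1, dual_symb hl, ← integral_conj,
    ← integral_sub_right_eq_self _ δ]
  refine integral_congr_ae (Eventually.of_forall fun x => ?_)
  simp only [map_mul, conj_conjDual, ← α.act_add, ← hα]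
  congr 1
  · simp only [wig, map_mul, conj_cis, Complex.conj_ofReal]
    rw [show x - δ + (1 / 2 : ℝ) • δ = x + (1 / 2 : ℝ) • -δ by module]
    congr 2
    · simp [omega0_sub_left, omega0_neg_right]
  · rw [sub_eq_neg_add]

end BodyAction

/-- Covariant representations of `(A, α)` over a projective representation `V` of `ℝ^{2m}`, together
with multiplication operators `W` by characters. -/
structure Covariant (α : BodyAction m A) (l : ℝ) (H : Type*) [NormedAddCommGroup H]
    [InnerProductSpace ℂ H] where
  op : A →ₗ[ℂ] (H →L[ℂ] H)
  V : Body m → H →L[ℂ] H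
  W : Body m → H →L[ℂ] H
  op_continuous : Continuous op
  op_injective : Function.Injective op
  op_mul : ∀ a b, op (a * b) = op a * op b
  V_continuous : ∀ x, Continuous fun δ => V δ x
  inner_V : ∀ δ x y, inner ℂ (V δ x) (V δ y) = inner ℂ x y
  V_zero : ∀ x, V 0 x = x
  V_V : ∀ d e x, V d (V e x) = cis (-(l / 2 * omega0 d e)) • V (d + e) x
  V_op : ∀ d b x, V d (op b x) = op (α.act (-d) b) (V d x)
  W_W : ∀ y x, W y (W (-y) x) = x
  W_op : ∀ y b x, W y (op b x) = op b (W y x)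
  W_V : ∀ y d x, W y (V d x) = cis (omega0 d y) • V d (W y x)

namespace Covariant

open BodyAction

variable {α : BodyAction m A} {l : ℝ} {H : Type*} [NormedAddCommGroup H] [InnerProductSpace ℂ H]
  [CompleteSpace H] (R : Covariant α l H)

theorem V_V_neg (d : Body m) (x : H) : R.V d (R.V (-d) x) = x := by
  rw [R.V_V, omega0_neg_right, omega0_self, add_neg_cancel, R.V_zero]
  simp

theorem inner_V_right (d : Body m) (x y : H) : inner ℂ x (R.V d y) = inner ℂ (R.V (-d) x) y := by
  rw [← R.inner_V d (R.V (-d) x), V_V_neg]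

theorem norm_V (d : Body m) (x : H) : ‖R.V d x‖ = ‖x‖ := by
  rw [@norm_eq_sqrt_re_inner ℂ, @norm_eq_sqrt_re_inner ℂ _ _ _ _ x, R.inner_V]

theorem exists_norm_op_symb_le (hl : l ≠ 0) {a : A} (ha : α.Smooth a) :
    ∃ C : ℝ, 0 ≤ C ∧ ∀ δ, ‖R.op (α.symb l a δ)‖ ≤ C * wtB δ :=
  exists_seminorm_symb_le hl ha (q := (normSeminorm ℂ (H →L[ℂ] H)).comp R.op)
    (continuous_norm.comp R.op_continuous)

theorem continuous_op_symb (hl : l ≠ 0) (a : A) (x : H) :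
    Continuous fun δ => R.op (α.symb l a δ) (R.V δ x) :=
  (R.op_continuous.comp (continuous_symb hl a)).clm_apply (R.V_continuous x)

theorem norm_op_apply_le {C : ℝ} {a : A} (hC : ∀ δ, ‖R.op (α.symb l a δ)‖ ≤ C * wtB δ)
    (x : H) (δ : Body m) : ‖R.op (α.symb l a δ) (R.V δ x)‖ ≤ C * wtB δ * ‖x‖ := by
  refine ((R.op _).le_opNorm _).trans ?_
  rw [R.norm_V]
  exact mul_le_mul_of_nonneg_right (hC δ) (norm_nonneg _)

theorem integrable_op_symb (hl : l ≠ 0) {a : A} (ha : α.Smooth a) (x : H) :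
    Integrable fun δ => R.op (α.symb l a δ) (R.V δ x) := by
  obtain ⟨C, hC0, hC⟩ := R.exists_norm_op_symb_le hl ha
  refine ((integrable_wtB.const_mul C).mul_const ‖x‖).mono'
    (R.continuous_op_symb hl a x).aestronglyMeasurable (Eventually.of_forall fun δ => ?_)
  exact R.norm_op_apply_le hC x δ

variable {S : Type*} [AddCommGroup S] [Module ℂ S]

/-- The quantization map, on a space of smooth elements. -/
def quant (hl : l ≠ 0) (E : S →ₗ[ℂ] A) (hE : ∀ s, α.Smooth (E s)) : S →ₗ[ℂ] (H →L[ℂ] H) where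
  toFun s := LinearMap.mkContinuousOfExistsBound
    { toFun := fun x => ∫ δ, R.op (α.symb l (E s) δ) (R.V δ x)
      map_add' := fun x y => by
        simp only [map_add]
        exact integral_add (R.integrable_op_symb hl (hE s) x) (R.integrable_op_symb hl (hE s) y)
      map_smul' := fun c x => by
        simp only [map_smul]
        exact integral_smul _ _ } (by
    obtain ⟨C, hC0, hC⟩ := R.exists_norm_op_symb_le hl (hE s)
    refine ⟨∫ δ : Body m, C * wtB δ, fun x => ?_⟩
    change ‖∫ δ, R.op (α.symb l (E s) δ) (R.V δ x)‖ ≤ _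
    rw [← integral_mul_const]
    exact norm_integral_le_of_norm_le ((integrable_wtB.const_mul C).mul_const ‖x‖)
      (Eventually.of_forall fun δ => R.norm_op_apply_le hC x δ))
  map_add' s t := by
    ext x
    change ∫ δ, R.op (α.symb l (E (s + t)) δ) (R.V δ x) =
      (∫ δ, R.op (α.symb l (E s) δ) (R.V δ x)) + ∫ δ, R.op (α.symb l (E t) δ) (R.V δ x)
    rw [← integral_add (R.integrable_op_symb hl (hE s) x) (R.integrable_op_symb hl (hE t) x)]
    simp only [map_add, symb_add hl, add_apply]
  map_smul' c s := by
    ext x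
    change ∫ δ, R.op (α.symb l (E (c • s)) δ) (R.V δ x) =
      c • ∫ δ, R.op (α.symb l (E s) δ) (R.V δ x)
    rw [← integral_smul]
    simp only [map_smul, symb_smul hl, smul_apply]

variable (hl : l ≠ 0) (E : S →ₗ[ℂ] A) (hE : ∀ s, α.Smooth (E s))

theorem quant_apply (s : S) (x : H) :
    R.quant hl E hE s x = ∫ δ, R.op (α.symb l (E s) δ) (R.V δ x) := rfl

theorem map_quant (s : S) (x : H) (L : H →L[ℂ] ℂ) :
    L (R.quant hl E hE s x) = ∫ δ, L (R.op (α.symb l (E s) δ) (R.V δ x)) :=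
  (L.integral_comp_comm (R.integrable_op_symb hl (hE s) x)).symm

theorem inner_quant (s : S) (x y : H) :
    inner ℂ y (R.quant hl E hE s x) = ∫ δ, inner ℂ y (R.op (α.symb l (E s) δ) (R.V δ x)) :=
  R.map_quant hl E hE s x (innerSL ℂ y)

/-- Conjugation by W_w multiplies the operator at d by a character of d. If the quantization
vanishes, so do all Fourier coefficients of the matrix elements of op(symb d) V_d; the symbol is
then zero, and so is the vector by `eq_zero_of_symb`. The operators W serve only this purpose. -/
theorem quant_injective (hEi : Function.Injective E) : Function.Injective (R.quant hl E hE) := by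
  rw [injective_iff_map_eq_zero]
  intro s hs
  refine hEi (eq_zero_of_symb hl (α := α) (fun δ => ?_) |>.trans (map_zero E).symm)
  refine R.op_injective (ContinuousLinearMap.ext fun x => ext_inner_left ℂ fun y => ?_)
  -- The vector V_{-δ} x is inserted so that the translation disappears at d = δ.
  have key := eq_zero_of_integral_cis (l := 1) one_ne_zero
    (f := fun d => inner ℂ y (R.op (α.symb l (E s) d) (R.V d (R.V (-δ) x))))
    (((innerSL ℂ y).continuous).comp (R.continuous_op_symb hl _ _))
    ((innerSL ℂ y).integrable_comp (R.integrable_op_symb hl (hE s) _)) (fun w => ?_) δ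
  · rw [R.V_V_neg] at key
    rw [key]; simp
  · generalize R.V (-δ) x = z
    have h1 := R.map_quant hl E hE s (R.W (-w) z) ((innerSL ℂ y).comp (R.W w))
    rw [hs] at h1
    simp only [zero_apply, map_zero, ContinuousLinearMap.comp_apply, innerSL_apply_apply, R.W_op,
      R.W_V, R.W_W, map_smul, smul_eq_mul] at h1
    rw [h1]
    refine integral_congr_ae (Eventually.of_forall fun d => ?_)
    simp only [one_mul]
    ring

theorem op_V_op_V (a b : A) (d e : Body m) (x : H) : R.op a (R.V d (R.op b (R.V e x))) =
    cis (-(l / 2 * omega0 d e)) • R.op (a * α.act (-d) b) (R.V (d + e) x) := by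
  rw [R.V_op, R.V_V, map_smul, map_smul, R.op_mul]; rfl

/-- By covariance op(a) V_d op(b) V_e is a phase times op(a α_{-d}(b)) V_{d+e}. With δ = d + e the
product of two quantizations is thus the twisted convolution of symbols, which `dual_symb_mprod`
identifies with 2^m times the symbol of the product. -/
theorem quant_mul (M : S →ₗ[ℂ] S →ₗ[ℂ] S) (hM : ∀ s t, E (M s t) = α.mprod (2 * l) (E s) (E t))
    (s t : S) : (2 : ℂ) ^ m • R.quant hl E hE (M s t) = R.quant hl E hE s * R.quant hl E hE t := by
  ext x
  refine ext_inner_left ℂ fun y => ?_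
  let F : Body m → Body m → ℂ := fun d δ => cis (-(l / 2 * omega0 d δ)) *
    inner ℂ y (R.op (α.symb l (E s) d * α.act (-d) (α.symb l (E t) (δ - d))) (R.V δ x))
  have hF : Integrable (Function.uncurry F) (volume.prod volume) := by
    obtain ⟨C, hC0, hC⟩ := R.exists_norm_op_symb_le hl (hE s)
    obtain ⟨q, hq, h₁⟩ := α.exists_seminorm_act (q := (normSeminorm ℂ (H →L[ℂ] H)).comp R.op)
      (continuous_norm.comp R.op_continuous)
    obtain ⟨C', hC0', hC'⟩ := exists_seminorm_symb_le hl (hE t) hq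
    have hw : Integrable fun d : Body m => (wtB d : ℂ) := integrable_wtB.ofReal
    have h1 := (integrable_shear hw hw (by fun_prop) continuous_id).const_mul
      ((‖y‖ * (C * C' * ‖x‖) : ℝ) : ℂ)
    have f1 := continuous_symb (α := α) hl (E s)
    have f2 := continuous_symb (α := α) hl (E t)
    have f3 : Continuous fun z : Body m × Body m =>
        R.op (α.symb l (E s) z.1 * α.act (-z.1) (α.symb l (E t) (z.2 - z.1))) :=
      R.op_continuous.comp (by fun_prop)
    refine h1.mono (Continuous.aestronglyMeasurable (Continuous.mul (by fun_prop)
      (continuous_const.inner (f3.clm_apply ((R.V_continuous x).comp continuous_snd)))))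
      (Eventually.of_forall fun z => ?_)
    simp only [Function.uncurry, F, norm_mul, norm_cis, one_mul, Complex.norm_real, Real.norm_eq_abs,
      id, abs_of_pos (wtB_pos _), abs_norm, abs_of_nonneg hC0, abs_of_nonneg hC0']
    refine (norm_inner_le_norm _ _).trans ?_
    rw [mul_assoc]
    refine mul_le_mul_of_nonneg_left ((ContinuousLinearMap.le_opNorm _ _).trans ?_) (norm_nonneg _)
    rw [R.norm_V, R.op_mul]
    have h2 : ‖R.op (α.act (-z.1) (α.symb l (E t) (z.2 - z.1)))‖ ≤ C' * wtB (z.2 - z.1) :=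
      (h₁ _ _).trans (hC' _)
    refine (mul_le_mul_of_nonneg_right ((norm_mul_le _ _).trans (mul_le_mul (hC z.1) h2
      (norm_nonneg _) (mul_nonneg hC0 (wtB_pos _).le))) (norm_nonneg x)).trans_eq ?_
    ring
  have e1 : ∀ d, inner ℂ y (R.op (α.symb l (E s) d) (R.V d (R.quant hl E hE t x))) =
      ∫ δ, F d δ := by
    intro d
    have h1 := R.map_quant hl E hE t x
      (((innerSL ℂ y).comp (R.op (α.symb l (E s) d))).comp (R.V d))
    simp only [ContinuousLinearMap.comp_apply, innerSL_apply_apply] at h1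
    rw [h1, ← integral_sub_right_eq_self _ d]
    refine integral_congr_ae (Eventually.of_forall fun δ => ?_)
    simp only [F, R.op_V_op_V, inner_smul_right, omega0_sub_right, omega0_self, sub_zero,
      add_sub_cancel]
  have e2 : ∀ δ, 2 ^ m * inner ℂ y (R.op (α.symb l (E (M s t)) δ) (R.V δ x)) = ∫ d, F d δ := by
    intro δ
    let φ : A →L[ℂ] ℂ := ⟨(innerₛₗ ℂ y) ∘ₗ (ContinuousLinearMap.apply ℂ H (R.V δ x) : (H →L[ℂ] H) →ₗ[ℂ] H) ∘ₗ R.op,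
      (innerSL ℂ y).continuous.comp ((ContinuousLinearMap.apply ℂ H (R.V δ x)).continuous.comp
        R.op_continuous)⟩
    have h1 := dual_symb_mprod hl (hE s) (hE t) δ φ
    rw [← hM] at h1
    exact h1
  rw [mul_apply_eq_comp, smul_apply, inner_smul_right, inner_quant, inner_quant,
    ← integral_const_mul]
  simp_rw [e1, e2]
  exact (integral_integral_swap hF).symm

theorem parity_quant {K : Krein H} (hVγ : ∀ d x, K.γ (R.V d x) = R.V d (K.γ x)) {γ : A →L[ℂ] A} (hγ : ∀ b, K.γ * R.op b * K.γ = R.op (γ b))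
    (hα : ∀ x b, γ (α.act x b) = α.act x (γ b)) {Γ : S →ₗ[ℂ] S} (hΓ : ∀ s, E (Γ s) = γ (E s))
    (s : S) : K.γ * R.quant hl E hE s * K.γ = R.quant hl E hE (Γ s) := by
  ext x
  rw [mul_apply_eq_comp, mul_apply_eq_comp, quant_apply, quant_apply,
    ← K.γ.integral_comp_comm (R.integrable_op_symb hl (hE s) _)]
  refine integral_congr_ae (Eventually.of_forall fun d => ?_)
  simp only
  rw [← hVγ, hΓ, ← symb_map hl γ hα, ← hγ]
  rfl

/-- The translations are unitary with adjoint V_{-δ} and commute with γ and J, so the superadjoint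
acts on the coefficients only; reflecting δ and applying `symb_dag` gives the quantization of the
image under the involution. -/
theorem sadj_quant {K : Krein H} (hVγ : ∀ d x, K.γ (R.V d x) = R.V d (K.γ x))
    (hVJ : ∀ d x, K.J (R.V d x) = R.V d (K.J x)) {γ : A →L[ℂ] A} (hγ : ∀ b, K.γ * R.op b * K.γ = R.op (γ b))
    (hα : ∀ x b, γ (α.act x b) = α.act x (γ b)) {Γ : S →ₗ[ℂ] S} (hΓ : ∀ s, E (Γ s) = γ (E s))
    (hΓΓ : ∀ s, Γ (Γ s) = s) {dag : A →ₗ⋆[ℂ] A} (hdag : Continuous dag)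
    (hαd : ∀ x a, α.act x (dag a) = dag (α.act x a)) (hop : ∀ b, K.sadj (R.op b) = R.op (dag b))
    {Δ : S →ₗ⋆[ℂ] S} (hΔ : ∀ s, E (Δ s) = dag (E s)) (s : S) :
    K.sadj (R.quant hl E hE s) = R.quant hl E hE (Δ s) := by
  refine Krein.sadj_eq_of_homogeneous hΓΓ (fun i s hs => ?_) s
  have hom : K.IsHom i (R.quant hl E hE s) := by
    rw [← Krein.mem_part_iff_isHom, R.parity_quant hl E hE hVγ hγ hα hΓ, hs, map_smul]
  refine Krein.sadj_unique hom fun x y => ?_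
  have hVp : ∀ d x, K.p i (R.V d x) = R.V d (K.p i x) := by
    intro d x
    rcases zmod_two_cases i with rfl | rfl <;> simp [hVγ]
  have hVJinv : ∀ d x, K.Jinv (R.V d x) = R.V d (K.Jinv x) := by
    intro d x
    rw [← K.Jinv_J (R.V d (K.Jinv x)), hVJ, K.J_Jinv]
  have homs : ∀ δ, K.IsHom i (R.op (α.act δ (α.symb l (E s) δ))) := by
    intro δ
    rw [← Krein.mem_part_iff_isHom, hγ, hα, symb_map hl γ hα, ← hΓ, hs, map_smul, symb_smul hl,
      map_smul, map_smul]
  rw [K.inner_Jinv_right, inner_quant, ← inner_conj_symm, inner_quant, ← integral_conj,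
    ← integral_neg_eq_self]
  refine integral_congr_ae (Eventually.of_forall fun δ => ?_)
  simp only [inner_conj_symm]
  rw [hΔ, symb_dag hl dag hdag hαd, ← hop, neg_neg, Krein.inner_sadj (homs _), hVp,
    ← R.inner_V_right, ← hVJinv, R.V_op, ← α.act_add, neg_add_cancel, α.act_zero,
    K.inner_Jinv_right]

end Covariant
end CovariantRepresentations

/-! ### The regular covariant representation on square integrable functions. -/

section Multiplication

open scoped BoundedContinuousFunction

variable {m : ℕ} {H : Type v} [NormedAddCommGroup H] [InnerProductSpace ℂ H]

theorem memLp_mulOp (B : Body m →ᵇ (H →L[ℂ] H)) (φ : Lp H 2 (volume : Measure (Body m))) :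
    MemLp (fun z => B z (φ z)) 2 volume :=
  (Lp.memLp φ).of_le_mul (c := ‖B‖)
    (isBoundedBilinearMap_apply.continuous.comp_aestronglyMeasurable
      (B.continuous.aestronglyMeasurable.prodMk (Lp.aestronglyMeasurable φ)))
    (Eventually.of_forall fun z => ((B z).le_opNorm _).trans
      (mul_le_mul_of_nonneg_right (B.norm_coe_le_norm z) (norm_nonneg _)))

/-- Multiplication of square integrable functions by a bounded continuous operator function. -/
def mulOp (B : Body m →ᵇ (H →L[ℂ] H)) :
    Lp H 2 (volume : Measure (Body m)) →L[ℂ] Lp H 2 (volume : Measure (Body m)) :=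
  LinearMap.mkContinuous
    { toFun := fun φ => (memLp_mulOp B φ).toLp _
      map_add' := fun φ ψ => by
        refine Lp.ext ?_
        filter_upwards [(memLp_mulOp B (φ + ψ)).coeFn_toLp, (memLp_mulOp B φ).coeFn_toLp,
          (memLp_mulOp B ψ).coeFn_toLp, Lp.coeFn_add φ ψ, Lp.coeFn_add
            ((memLp_mulOp B φ).toLp _) ((memLp_mulOp B ψ).toLp _)] with z h1 h2 h3 h4 h5
        rw [h1, h5, Pi.add_apply, h2, h3, h4, Pi.add_apply, map_add]
      map_smul' := fun c φ => by
        refine Lp.ext ?_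
        filter_upwards [(memLp_mulOp B (c • φ)).coeFn_toLp, (memLp_mulOp B φ).coeFn_toLp,
          Lp.coeFn_smul c φ, Lp.coeFn_smul c ((memLp_mulOp B φ).toLp _)] with z h1 h2 h3 h4
        rw [RingHom.id_apply, h1, h4, Pi.smul_apply, h2, h3, Pi.smul_apply, map_smul] }
    ‖B‖ fun φ => by
      refine Lp.norm_le_mul_norm_of_ae_le_mul ?_
      filter_upwards [(memLp_mulOp B φ).coeFn_toLp] with z h1
      change ‖(memLp_mulOp B φ).toLp _ z‖ ≤ _
      rw [h1]
      exact ((B z).le_opNorm _).trans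
        (mul_le_mul_of_nonneg_right (B.norm_coe_le_norm z) (norm_nonneg _))

theorem mulOp_coeFn (B : Body m →ᵇ (H →L[ℂ] H)) (φ : Lp H 2 (volume : Measure (Body m))) :
    mulOp B φ =ᵐ[volume] fun z => B z (φ z) := (memLp_mulOp B φ).coeFn_toLp

theorem norm_mulOp_le (B : Body m →ᵇ (H →L[ℂ] H)) : ‖mulOp B‖ ≤ ‖B‖ :=
  LinearMap.mkContinuous_norm_le _ (norm_nonneg B) _

/-- Multiplication by the character `cis (c ω(·, y))`. -/
def charOp (H : Type v) [NormedAddCommGroup H] [InnerProductSpace ℂ H] (c : ℝ) (y : Body m) :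
    Lp H 2 (volume : Measure (Body m)) →L[ℂ] Lp H 2 (volume : Measure (Body m)) :=
  mulOp (BoundedContinuousFunction.ofNormedAddCommGroup
    (fun z => cis (c * omega0 z y) • ContinuousLinearMap.id ℂ H) (by fun_prop) 1 fun z => by
      rw [norm_smul, norm_cis, one_mul]; exact ContinuousLinearMap.norm_id_le)

theorem charOp_coeFn (c : ℝ) (y : Body m) (φ : Lp H 2 (volume : Measure (Body m))) :
    charOp H c y φ =ᵐ[volume] fun z => cis (c * omega0 z y) • φ z := mulOp_coeFn _ φ

theorem inner_charOp (c : ℝ) (y : Body m) (φ ψ : Lp H 2 (volume : Measure (Body m))) :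
    inner ℂ (charOp H c y φ) (charOp H c y ψ) = inner ℂ φ ψ := by
  rw [L2.inner_def, L2.inner_def]
  refine integral_congr_ae ?_
  filter_upwards [charOp_coeFn c y φ, charOp_coeFn c y ψ] with z h1 h2
  rw [h1, h2, inner_smul_left, inner_smul_right, conj_cis, ← mul_assoc, ← cis_add]
  simp

/-- Weakly continuous families of isometries are strongly continuous. -/
theorem continuous_of_inner {X K : Type*} [TopologicalSpace X] [NormedAddCommGroup K]
    [InnerProductSpace ℂ K] {U : X → K} {r : ℝ} (hU : ∀ d, ‖U d‖ = r)
    (h : ∀ y, Continuous fun d => (inner ℂ (U d) y : ℂ)) : Continuous U := by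
  refine continuous_iff_continuousAt.2 fun d => tendsto_iff_norm_sub_tendsto_zero.2 ?_
  have h1 : ∀ e, ‖U e - U d‖ = √(r ^ 2 - 2 * (inner ℂ (U e) (U d) : ℂ).re + r ^ 2) := by
    intro e
    have := @norm_sub_sq ℂ _ _ _ _ (U e) (U d)
    rw [hU, hU] at this
    rw [← Real.sqrt_sq (norm_nonneg _), this]
    rfl
  have h2 : Tendsto (fun e => √(r ^ 2 - 2 * (inner ℂ (U e) (U d) : ℂ).re + r ^ 2)) (𝓝 d)
      (𝓝 ‖U d - U d‖) := by
    rw [h1 d]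
    have := Complex.continuous_re.comp (h (U d))
    exact Continuous.tendsto (Real.continuous_sqrt.comp
      ((continuous_const.sub (continuous_const.mul this)).add continuous_const)) d
  simpa [h1] using h2

theorem norm_charOp (c : ℝ) (y : Body m) (φ : Lp H 2 (volume : Measure (Body m))) :
    ‖charOp H c y φ‖ = ‖φ‖ := by
  rw [@norm_eq_sqrt_re_inner ℂ, @norm_eq_sqrt_re_inner ℂ _ _ _ _ φ, inner_charOp]

theorem continuous_charOp (c : ℝ) (φ : Lp H 2 (volume : Measure (Body m))) :
    Continuous fun y => charOp H c y φ := by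
  refine continuous_of_inner (fun y => norm_charOp c y φ) fun ψ => ?_
  have h : ∀ y, inner ℂ (charOp H c y φ) ψ = ∫ z, cis (-(c * omega0 z y)) * inner ℂ (φ z) (ψ z) := by
    intro y
    rw [L2.inner_def]
    refine integral_congr_ae ?_
    filter_upwards [charOp_coeFn c y φ] with z h1
    rw [h1, inner_smul_left, conj_cis]
  simp_rw [h]
  have hi := L2.integrable_inner (𝕜 := ℂ) φ ψ
  refine continuous_of_dominated (bound := fun z => ‖(inner ℂ (φ z) (ψ z) : ℂ)‖) (fun y => ?_)
    (fun y => Eventually.of_forall fun z => by simp) hi.norm (Eventually.of_forall fun z => by fun_prop)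
  exact (Continuous.aestronglyMeasurable (by fun_prop)).mul hi.1

/-- Translation of square integrable functions. -/
def transl (H : Type v) [NormedAddCommGroup H] [InnerProductSpace ℂ H] (d : Body m) :
    Lp H 2 (volume : Measure (Body m)) →L[ℂ] Lp H 2 (volume : Measure (Body m)) :=
  (Lp.compMeasurePreservingₗᵢ ℂ (fun z => z - d)
    (measurePreserving_sub_right volume d)).toContinuousLinearMap

theorem transl_coeFn (d : Body m) (φ : Lp H 2 (volume : Measure (Body m))) :
    transl H d φ =ᵐ[volume] fun z => φ (z - d) := Lp.coeFn_compMeasurePreserving φ _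

theorem ae_sub {p : Body m → Prop} (d : Body m) (h : ∀ᵐ z, p z) : ∀ᵐ z, p (z - d) :=
  (measurePreserving_sub_right volume d).quasiMeasurePreserving.ae h

theorem inner_transl (d : Body m) (φ ψ : Lp H 2 (volume : Measure (Body m))) :
    inner ℂ (transl H d φ) (transl H d ψ) = inner ℂ φ ψ := LinearIsometry.inner_map_map _ _ _

theorem continuous_transl (φ : Lp H 2 (volume : Measure (Body m))) :
    Continuous fun d => transl H d φ := by
  have h := Continuous.compMeasurePreservingLp (E := H) (p := 2) (μ := (volume : Measure (Body m)))
    (ν := volume) (Z := Body m) (f := fun _ => φ)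
    (g := fun d => (⟨fun z => z - d, by fun_prop⟩ : C(Body m, Body m))) continuous_const
    (ContinuousMap.continuous_of_continuous_uncurry _
      (continuous_snd.sub continuous_fst : Continuous fun z : Body m × Body m => z.2 - z.1))
    (fun d => measurePreserving_sub_right volume d) (by norm_num)
  exact h

/-- The projective representation of `ℝ^{2m}` by magnetic translations. -/
def magn (H : Type v) [NormedAddCommGroup H] [InnerProductSpace ℂ H] (l : ℝ) (d : Body m) :
    Lp H 2 (volume : Measure (Body m)) →L[ℂ] Lp H 2 (volume : Measure (Body m)) :=
  (charOp H (l / 2) d).comp (transl H d)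

theorem magn_coeFn (l : ℝ) (d : Body m) (φ : Lp H 2 (volume : Measure (Body m))) :
    magn H l d φ =ᵐ[volume] fun z => cis (l / 2 * omega0 z d) • φ (z - d) := by
  filter_upwards [charOp_coeFn (l / 2) d (transl H d φ), transl_coeFn d φ] with z h1 h2
  rw [← h2, ← h1]; rfl

/-- The characters act by isometries, so strong continuity of the translations can be used uniformly
in the character. -/
theorem continuous_magn (l : ℝ) (φ : Lp H 2 (volume : Measure (Body m))) :
    Continuous fun d => magn H l d φ := by
  refine continuous_iff_continuousAt.2 fun d => ?_
  have h1 : ∀ e, magn H l e φ = charOp H (l / 2) e (transl H e φ - transl H d φ) +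
      charOp H (l / 2) e (transl H d φ) := fun e => by rw [← map_add, sub_add_cancel]; rfl
  have h2 : Tendsto (fun e => charOp H (l / 2) e (transl H e φ - transl H d φ)) (𝓝 d) (𝓝 0) := by
    rw [tendsto_zero_iff_norm_tendsto_zero]
    simp only [norm_charOp]
    exact tendsto_iff_norm_sub_tendsto_zero.1 ((continuous_transl φ).tendsto d)
  have h3 := h2.add ((continuous_charOp (l / 2) (transl H d φ)).tendsto d)
  rw [zero_add] at h3
  exact h3.congr fun e => (h1 e).symm

variable {A : Type u} [NonUnitalRing A] [Module ℂ A] [IsScalarTower ℂ A A]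
  [SMulCommClass ℂ A A] [UniformSpace A] [IsUniformAddGroup A] [ContinuousSMul ℂ A]
  [ContinuousMul A] [PolynormableSpace ℂ A] [CompleteSpace A] [T2Space A]
  [FirstCountableTopology A] (α : BodyAction m A)

/-- The norm of the represented elements. -/
def opSeminorm (π : A →ₙₐ[ℂ] (H →L[ℂ] H)) : Seminorm ℂ A :=
  (normSeminorm ℂ (H →L[ℂ] H)).comp (π : A →ₗ[ℂ] (H →L[ℂ] H))

theorem continuous_opSeminorm {π : A →ₙₐ[ℂ] (H →L[ℂ] H)} (hπ : Continuous π) :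
    Continuous (opSeminorm π) := hπ.norm

theorem exists_norm_orbit_le {π : A →ₙₐ[ℂ] (H →L[ℂ] H)} (hπ : Continuous π) (b : A) :
    ∃ C, ∀ z, ‖π (α.act z b)‖ ≤ C := α.act_bdd b (opSeminorm π) (continuous_opSeminorm hπ)

/-- The operator function `z ↦ π (α_z b)`. -/
def orbitOp (π : A →ₙₐ[ℂ] (H →L[ℂ] H)) (hπ : Continuous π) (b : A) : Body m →ᵇ (H →L[ℂ] H) :=
  BoundedContinuousFunction.ofNormedAddCommGroup (fun z => π (α.act z b))
    (hπ.comp (by fun_prop)) _ (exists_norm_orbit_le α hπ b).choose_spec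

variable {α} {π : A →ₙₐ[ℂ] (H →L[ℂ] H)} (hπ : Continuous π)

theorem mulOp_orbitOp_coeFn (b : A) (φ : Lp H 2 (volume : Measure (Body m))) :
    mulOp (orbitOp α π hπ b) φ =ᵐ[volume] fun z => π (α.act z b) (φ z) := mulOp_coeFn _ φ

variable (α)

theorem continuous_of_seminorm_bound {E : Type*} [NormedAddCommGroup E] [NormedSpace ℂ E]
    {T : A →ₗ[ℂ] (E →L[ℂ] E)} {q : Seminorm ℂ A} (hq : Continuous q) (h : ∀ a, ‖T a‖ ≤ q a) :
    Continuous T := by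
  refine continuous_iff_continuousAt.2 fun a => tendsto_iff_norm_sub_tendsto_zero.2 ?_
  have h0 : Tendsto (fun b => q (b - a)) (𝓝 a) (𝓝 (q (a - a))) :=
    (hq.comp (continuous_id.sub continuous_const)).tendsto a
  rw [sub_self, map_zero] at h0
  refine squeeze_zero (fun b => norm_nonneg _) (fun b => ?_) h0
  rw [← map_sub]
  exact h (b - a)

/-- The representation by multiplication with orbits. -/
def orbitRep : A →ₗ[ℂ] (Lp H 2 (volume : Measure (Body m)) →L[ℂ] Lp H 2 (volume : Measure (Body m))) where
  toFun b := mulOp (orbitOp α π hπ b)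
  map_add' a b := by
    ext1 φ
    refine Lp.ext ?_
    filter_upwards [mulOp_orbitOp_coeFn (α := α) hπ (a + b) φ, mulOp_orbitOp_coeFn (α := α) hπ a φ,
      mulOp_orbitOp_coeFn (α := α) hπ b φ, Lp.coeFn_add (mulOp (orbitOp α π hπ a) φ)
        (mulOp (orbitOp α π hπ b) φ)] with z h1 h2 h3 h4
    rw [h1, add_apply, h4, Pi.add_apply, h2, h3, map_add, map_add, add_apply]
  map_smul' c a := by
    ext1 φ
    refine Lp.ext ?_
    filter_upwards [mulOp_orbitOp_coeFn (α := α) hπ (c • a) φ, mulOp_orbitOp_coeFn (α := α) hπ a φ,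
      Lp.coeFn_smul c (mulOp (orbitOp α π hπ a) φ)] with z h1 h2 h4
    rw [h1, RingHom.id_apply, smul_apply, h4, Pi.smul_apply, h2, map_smul, map_smul, smul_apply]

theorem orbitRep_coeFn (b : A) (φ : Lp H 2 (volume : Measure (Body m))) :
    orbitRep α hπ b φ =ᵐ[volume] fun z => π (α.act z b) (φ z) := mulOp_coeFn _ φ

theorem continuous_orbitRep : Continuous (orbitRep α hπ) := by
  obtain ⟨q, hq, h⟩ := α.exists_seminorm_act (continuous_opSeminorm hπ)
  have hb : ∀ b, ‖orbitRep α hπ b‖ ≤ q b := fun b => (norm_mulOp_le (orbitOp α π hπ b)).trans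
    ((BoundedContinuousFunction.norm_le (apply_nonneg _ _)).2 fun z => h z b)
  exact continuous_of_seminorm_bound hq hb

/-- Test on a Gaussian times h: a continuous function vanishing almost everywhere vanishes at z = 0,
where it is a nonzero multiple of π(b)h. -/
theorem orbitRep_injective (hi : Function.Injective π) : Function.Injective (orbitRep α hπ) := by
  rw [injective_iff_map_eq_zero]
  intro b hb
  refine hi (ContinuousLinearMap.ext fun h => ?_)
  rw [map_zero, zero_apply]
  have hg := continuous_gauss (m := m) 1
  have hm : MemLp (fun z : Body m => (gauss 1 z : ℂ) • h) 2 := by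
    rw [memLp_two_iff_integrable_sq_norm (Continuous.aestronglyMeasurable (by fun_prop))]
    refine ((integrable_gauss (m := m) (b := 2) two_pos).mul_const (‖h‖ ^ 2)).congr
      (Eventually.of_forall fun z => ?_)
    simp only
    rw [norm_smul, Complex.norm_real, Real.norm_eq_abs, abs_of_pos (gauss_pos _ _), mul_pow,
      gauss_half_sq 2]
    norm_num
  have h0 := orbitRep_coeFn α hπ b (hm.toLp _)
  rw [hb] at h0
  have h1 : (fun z => π (α.act z b) ((gauss 1 z : ℂ) • h)) =ᵐ[volume] fun _ => 0 := by
    filter_upwards [h0, hm.coeFn_toLp, Lp.coeFn_zero H 2 (volume : Measure (Body m))] with z h2 h3 h4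
    rw [← h3, ← h2, zero_apply, h4]; rfl
  have h2 := Continuous.ae_eq_iff_eq volume
    ((hπ.comp (α.continuous_act continuous_id b)).clm_apply (by fun_prop)) continuous_const |>.1 h1
  have h3 := congrFun h2 0
  have h4 : gauss 1 (0 : Body m) ≠ 0 := (gauss_pos _ _).ne'
  simpa [α.act_zero, h4] using h3

/-- The regular covariant representation. -/
def regular (l : ℝ) (hi : Function.Injective π) :
    Covariant α l (Lp H 2 (volume : Measure (Body m))) where
  op := orbitRep α hπ
  V := magn H l
  W := charOp H 1
  op_continuous := continuous_orbitRep α hπ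
  op_injective := orbitRep_injective α hπ hi
  op_mul a b := by
    ext1 φ
    refine Lp.ext ?_
    filter_upwards [orbitRep_coeFn α hπ (a * b) φ, orbitRep_coeFn α hπ a (orbitRep α hπ b φ),
      orbitRep_coeFn α hπ b φ] with z h1 h2 h3
    rw [h1, mul_apply_eq_comp, h2, h3, α.act_mul, map_mul, mul_apply_eq_comp]
  V_continuous := continuous_magn l
  inner_V d x y := by
    rw [magn, ContinuousLinearMap.comp_apply, ContinuousLinearMap.comp_apply, inner_charOp,
      inner_transl]
  V_zero φ := by
    refine Lp.ext ?_
    filter_upwards [magn_coeFn l 0 φ] with z h1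
    rw [h1]; simp [omega0]
  V_V d e φ := by
    refine Lp.ext ?_
    filter_upwards [magn_coeFn l d (magn H l e φ), ae_sub d (magn_coeFn l e φ),
      magn_coeFn l (d + e) φ, Lp.coeFn_smul (cis (-(l / 2 * omega0 d e))) (magn H l (d + e) φ)]
      with z h1 h2 h3 h4
    rw [h1, h2, h4, Pi.smul_apply, h3, smul_smul, smul_smul, ← cis_add, ← cis_add, sub_sub]
    congr 2
    rw [omega0_sub_left, omega0_add_right]
    ring
  V_op d b φ := by
    refine Lp.ext ?_
    filter_upwards [magn_coeFn l d (orbitRep α hπ b φ), ae_sub d (orbitRep_coeFn α hπ b φ),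
      orbitRep_coeFn α hπ (α.act (-d) b) (magn H l d φ), magn_coeFn l d φ] with z h1 h2 h3 h4
    rw [h1, h2, h3, h4, map_smul, ← α.act_add, sub_eq_add_neg]
  W_W y φ := by
    refine Lp.ext ?_
    filter_upwards [charOp_coeFn 1 y (charOp H 1 (-y) φ), charOp_coeFn 1 (-y) φ] with z h1 h2
    rw [h1, h2, smul_smul, ← cis_add, omega0_neg_right]
    simp
  W_op y b φ := by
    refine Lp.ext ?_
    filter_upwards [charOp_coeFn 1 y (orbitRep α hπ b φ), orbitRep_coeFn α hπ b φ,
      orbitRep_coeFn α hπ b (charOp H 1 y φ), charOp_coeFn 1 y φ] with z h1 h2 h3 h4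
    rw [h1, h2, h3, h4, map_smul]
  W_V y d φ := by
    refine Lp.ext ?_
    filter_upwards [charOp_coeFn 1 y (magn H l d φ), magn_coeFn l d φ,
      Lp.coeFn_smul (cis (omega0 d y)) (magn H l d (charOp H 1 y φ)),
      magn_coeFn l d (charOp H 1 y φ), ae_sub d (charOp_coeFn 1 y φ)] with z h1 h2 h3 h4 h5
    rw [h1, h2, h3, Pi.smul_apply, h4, h5, smul_smul, smul_smul, smul_smul, ← cis_add, ← cis_add,
      ← cis_add]
    congr 2
    rw [omega0_sub_left]
    ring

end Multiplication

/-! ### Krein structure on square integrable functions, and compatibility with the regular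
representation. -/

section KreinFunctions

variable {m : ℕ} {H : Type v} [NormedAddCommGroup H] [InnerProductSpace ℂ H]

namespace Krein

/-- Square integrable functions with values in a Krein space. -/
def lift (m : ℕ) (K : Krein H) : Krein (Lp H 2 (volume : Measure (Body m))) where
  γ := K.γ.compLpL 2 volume
  J := K.J.compLpL 2 volume
  r := K.r
  γ_γ φ := by
    refine Lp.ext ?_
    filter_upwards [K.γ.coeFn_compLpL (K.γ.compLpL 2 volume φ), K.γ.coeFn_compLpL φ] with z h1 h2
    rw [h1, h2, K.γ_γ]
  inner_γ φ ψ := by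
    rw [L2.inner_def, L2.inner_def]
    refine integral_congr_ae ?_
    filter_upwards [K.γ.coeFn_compLpL φ, K.γ.coeFn_compLpL ψ] with z h1 h2
    rw [h1, h2, K.inner_γ]
  inner_J φ ψ := by
    rw [L2.inner_def, L2.inner_def]
    refine integral_congr_ae ?_
    filter_upwards [K.J.coeFn_compLpL φ, K.J.coeFn_compLpL ψ] with z h1 h2
    rw [h1, h2, K.inner_J]
  J_γ φ := by
    refine Lp.ext ?_
    filter_upwards [K.J.coeFn_compLpL (K.γ.compLpL 2 volume φ), K.γ.coeFn_compLpL φ,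
      Lp.coeFn_smul (ksign K.r) (K.γ.compLpL 2 volume (K.J.compLpL 2 volume φ)),
      K.γ.coeFn_compLpL (K.J.compLpL 2 volume φ), K.J.coeFn_compLpL φ] with z h1 h2 h3 h4 h5
    rw [h1, h2, h3, Pi.smul_apply, h4, h5, K.J_γ]
  J_J φ := by
    refine Lp.ext ?_
    filter_upwards [K.J.coeFn_compLpL (K.J.compLpL 2 volume φ), K.J.coeFn_compLpL φ,
      K.γ.coeFn_compLpL φ] with z h1 h2 h3
    rw [h1, h2, K.J_J]
    split_ifs
    · rw [h3]
    · rfl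

variable (K : Krein H)

theorem lift_γ_coeFn (φ : Lp H 2 (volume : Measure (Body m))) :
    (K.lift m).γ φ =ᵐ[volume] fun z => K.γ (φ z) := K.γ.coeFn_compLpL φ

theorem lift_J_coeFn (φ : Lp H 2 (volume : Measure (Body m))) :
    (K.lift m).J φ =ᵐ[volume] fun z => K.J (φ z) := K.J.coeFn_compLpL φ

theorem lift_p_coeFn (i : ZMod 2) (φ : Lp H 2 (volume : Measure (Body m))) :
    (K.lift m).p i φ =ᵐ[volume] fun z => K.p i (φ z) := by
  rcases zmod_two_cases i with rfl | rfl
  · simp only [p_zero]; rfl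
  · simp only [p_one]; exact K.lift_γ_coeFn φ

theorem lift_Jinv_coeFn (φ : Lp H 2 (volume : Measure (Body m))) :
    (K.lift m).Jinv φ =ᵐ[volume] fun z => K.Jinv (φ z) := by
  filter_upwards [K.lift_J_coeFn ((K.lift m).Jinv φ)] with z h1
  rw [J_Jinv] at h1
  rw [h1, Jinv_J]

theorem lift_γ_magn (l : ℝ) (d : Body m) (φ : Lp H 2 (volume : Measure (Body m))) :
    (K.lift m).γ (magn H l d φ) = magn H l d ((K.lift m).γ φ) := by
  refine Lp.ext ?_
  filter_upwards [K.lift_γ_coeFn (magn H l d φ), magn_coeFn l d φ,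
    magn_coeFn l d ((K.lift m).γ φ), ae_sub d (K.lift_γ_coeFn φ)] with z h1 h2 h3 h4
  rw [h1, h2, h3, h4, map_smul]

theorem lift_J_magn (l : ℝ) (d : Body m) (φ : Lp H 2 (volume : Measure (Body m))) :
    (K.lift m).J (magn H l d φ) = magn H l d ((K.lift m).J φ) := by
  refine Lp.ext ?_
  filter_upwards [K.lift_J_coeFn (magn H l d φ), magn_coeFn l d φ,
    magn_coeFn l d ((K.lift m).J φ), ae_sub d (K.lift_J_coeFn φ)] with z h1 h2 h3 h4
  rw [h1, h2, h3, h4, map_smul]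

variable {K} {A : Type u} [NonUnitalRing A] [Module ℂ A] [IsScalarTower ℂ A A]
  [SMulCommClass ℂ A A] [UniformSpace A] [IsUniformAddGroup A] [ContinuousSMul ℂ A]
  [ContinuousMul A] [PolynormableSpace ℂ A] [CompleteSpace A] [T2Space A]
  [FirstCountableTopology A] (α : BodyAction m A) {π : A →ₙₐ[ℂ] (H →L[ℂ] H)} (hπ : Continuous π)

theorem lift_orbitRep {γ : A →L[ℂ] A} (hα : ∀ x b, γ (α.act x b) = α.act x (γ b))
    (h : ∀ b, K.γ * π b * K.γ = π (γ b)) (b : A) :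
    (K.lift m).γ * orbitRep α hπ b * (K.lift m).γ = orbitRep α hπ (γ b) := by
  ext1 φ
  refine Lp.ext ?_
  filter_upwards [K.lift_γ_coeFn (orbitRep α hπ b ((K.lift m).γ φ)),
    orbitRep_coeFn α hπ b ((K.lift m).γ φ), K.lift_γ_coeFn φ, orbitRep_coeFn α hπ (γ b) φ]
    with z h1 h2 h3 h4
  rw [mul_apply_eq_comp, mul_apply_eq_comp, h1, h2, h3, h4, ← hα, ← h]
  rfl

theorem sadj_orbitRep [CompleteSpace H] {γ : A →L[ℂ] A} (hγγ : ∀ a, γ (γ a) = a)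
    (hα : ∀ x b, γ (α.act x b) = α.act x (γ b)) (h : ∀ b, K.γ * π b * K.γ = π (γ b))
    {dag : A →ₗ⋆[ℂ] A} (hαd : ∀ x a, α.act x (dag a) = dag (α.act x a))
    (hs : ∀ b, K.sadj (π b) = π (dag b)) (b : A) :
    (K.lift m).sadj (orbitRep α hπ b) = orbitRep α hπ (dag b) := by
  refine sadj_eq_of_homogeneous (γ := (γ : A →ₗ[ℂ] A)) hγγ (fun i b hb => ?_) b
  have hb' : γ b = ksign i • b := hb
  refine sadj_unique (i := i) ?_ fun φ ψ => ?_
  · rw [← mem_part_iff_isHom, lift_orbitRep α hπ hα h, hb', map_smul]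
  rw [L2.inner_def, L2.inner_def]
  refine integral_congr_ae ?_
  filter_upwards [orbitRep_coeFn α hπ (dag b) φ, K.lift_p_coeFn i φ,
    K.lift_Jinv_coeFn (orbitRep α hπ b ((K.lift m).J ψ)), orbitRep_coeFn α hπ b ((K.lift m).J ψ),
    K.lift_J_coeFn ψ] with z h1 h2 h3 h4 h5
  have hom : K.IsHom i (π (α.act z b)) := by
    rw [← mem_part_iff_isHom, h, hα, hb', map_smul, map_smul]
  rw [h1, h2, h3, h4, h5, hαd, ← hs, inner_sadj hom]

section CStar

variable [CompleteSpace H] {G : Supergrading A} (S : HilbertSuperspace H)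

theorem parity_rep (hdeg : ∀ (i j : ZMod 2) (a : A) (x : H), a ∈ G.part i →
      x ∈ S.grading.part j → π a x ∈ S.grading.part (i + j)) (b : A) :
    (ofHilbertSuperspace S).γ * π b * (ofHilbertSuperspace S).γ = π (G.parity b) := by
  have key : ∀ (i : ZMod 2) (b : A), b ∈ G.part i → (ofHilbertSuperspace S).γ * π b *
      (ofHilbertSuperspace S).γ = π (G.parity b) := by
    intro i b hb
    have hx : ∀ (j : ZMod 2) (x : H), x ∈ S.grading.part j → S.grading.parity
        (π b (S.grading.parity x)) = ksign i • π b x := by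
      intro j x hx
      rw [S.grading.parity_of_mem_part hx, map_smul, map_smul,
        S.grading.parity_of_mem_part (hdeg i j b x hb hx), smul_smul, ksign_add, mul_left_comm,
        ksign_mul_self, mul_one]
    ext x
    obtain ⟨x₀, h₀, x₁, h₁, rfl⟩ := S.grading.exists_add x
    rw [mul_apply_eq_comp, mul_apply_eq_comp, G.parity_of_mem_part hb, map_smul, smul_apply]
    change S.grading.parity (π b (S.grading.parity (x₀ + x₁))) = _
    simp only [map_add, smul_add, hx 0 x₀ (by simpa), hx 1 x₁ (by simpa)]
  obtain ⟨b₀, h₀, b₁, h₁, rfl⟩ := G.exists_add b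
  rw [map_add, mul_add, add_mul, key 0 b₀ (by simpa), key 1 b₁ (by simpa), map_add, map_add]

/-- The hypothesis concerns the superhermitian form and homogeneous x. Replacing y by Jy converts it
to the scalar product, and the degree sign becomes γ^i, which matches `sadj_unique`. -/
theorem sadj_rep {dag : A →ₗ⋆[ℂ] A} (hdeg : ∀ (i j : ZMod 2) (a : A) (x : H), a ∈ G.part i →
      x ∈ S.grading.part j → π a x ∈ S.grading.part (i + j))
    (hdag : ∀ (i j : ZMod 2) (a : A) (x y : H), a ∈ G.part i → x ∈ S.grading.part j →
      S.form (π (dag a) x) y = ksign (i * j) * S.form x (π a y)) (b : A) :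
    (ofHilbertSuperspace S).sadj (π b) = π (dag b) := by
  set K := ofHilbertSuperspace S with hK
  refine sadj_eq_of_homogeneous (T := (π : A →ₗ[ℂ] (H →L[ℂ] H))) G.parity_parity
    (fun i b hb => ?_) b
  change K.sadj (π b) = π (dag b)
  refine sadj_unique (i := i) ?_ fun x y => ?_
  · rw [← mem_part_iff_isHom, parity_rep S hdeg, hb, map_smul]
  have key : ∀ (j : ZMod 2) (x : H), x ∈ S.grading.part j →
      inner ℂ (π (dag b) x) y = inner ℂ (K.p i x) (K.Jinv (π b (K.J y))) := by
    intro j x hx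
    have h1 := hdag i j b x (K.J y) (G.mem_part_iff.2 hb) hx
    rw [form_eq, form_eq, ← hK, Jinv_J] at h1
    have h2 : K.p i x = ksign (i * j) • x := by
      rcases zmod_two_cases i with rfl | rfl
      · simp [ksign_zero]
      · rw [p_one, one_mul]
        exact S.grading.parity_of_mem_part hx
    rw [h1, h2, inner_smul_left, conj_ksign]
  obtain ⟨x₀, h₀, x₁, h₁, rfl⟩ := S.grading.exists_add x
  rw [map_add, map_add, inner_add_left, inner_add_left, key 0 x₀ (by simpa), key 1 x₁ (by simpa)]

/-- The topology of A is induced by π, and there the involution becomes the norm continuous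
superadjoint. -/
theorem continuous_dag {dag : A →ₗ⋆[ℂ] A} (hi : IsClosedEmbedding π) {K : Krein H}
    (hs : ∀ b, K.sadj (π b) = π (dag b)) : Continuous dag := by
  rw [hi.isInducing.continuous_iff]
  exact (K.continuous_sadj.comp hi.continuous).congr hs

end CStar

end Krein
end KreinFunctions

/-! ### The completion of the deformed algebra. -/

section Completion

variable {A : Type u} [NonUnitalRing A] [Module ℂ A] [IsScalarTower ℂ A A]
  [SMulCommClass ℂ A A] [UniformSpace A] [IsUniformAddGroup A] [ContinuousSMul ℂ A]
  [ContinuousMul A] [PolynormableSpace ℂ A] [CompleteSpace A] [T2Space A]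
  [FirstCountableTopology A] {m n : ℕ} {G : Supergrading A} {ρ : SuperAction m n A G}

/-- Antilinear maps commuting with the action preserve smoothness. -/
theorem BodyAction.Smooth.map_star {α : BodyAction m A} {a : A} (ha : α.Smooth a)
    {T : A →ₗ⋆[ℂ] A} (hTc : Continuous T) (hT : ∀ x b, α.act x (T b) = T (α.act x b)) :
    α.Smooth (T a) := by
  have key : ∀ (k : ℕ) (f : Body m → A), IsClassC k f → IsClassC k fun y => T (f y) := by
    intro k
    induction k with
    | zero => exact fun f hf => hTc.comp hf
    | succ k ih =>
      intro f hf
      refine ⟨hTc.comp hf.1, fun e => ?_⟩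
      obtain ⟨g, hg, hg'⟩ := hf.2 e
      refine ⟨_, fun y => ?_, ih g hg'⟩
      refine ((hTc.tendsto _).comp (hg y)).congr fun t => ?_
      simp [map_smulₛₗ T]
  intro k
  simpa only [hT] using key k _ (ha k)

namespace SuperAction

/-- Each of the n odd factors is purely imaginary and everything else is real; this is the source of
the sign (-1)^n in the deformed involution. -/
theorem conj_starConst (m : ℕ) (θ : ℝ) (η : Fin n → ℤˣ) :
    conj (starConst m θ η) = (-1) ^ n * starConst m θ η := by
  have h : ∀ k, conj (-2 * Complex.I / θ * ((η k : ℤ) : ℂ)) =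
      -1 * (-2 * Complex.I / θ * ((η k : ℤ) : ℂ)) := by
    intro k
    simp only [map_mul, map_div₀, map_neg, Complex.conj_I, Complex.conj_ofReal, map_intCast,
      Complex.conj_ofNat]
    ring
  rw [starConst, map_mul, map_mul, Complex.conj_ofReal, map_intCast, map_prod,
    Finset.prod_congr rfl fun k _ => h k, Finset.prod_mul_distrib, Finset.prod_const,
    Finset.card_univ, Fintype.card_fin]
  ring

theorem oddFactor_ne_zero {θ : ℝ} (hθ : θ ≠ 0) (η : Fin n → ℤˣ) (k : Fin n) :
    -2 * Complex.I / θ * ((η k : ℤ) : ℂ) ≠ 0 := by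
  have h1 : (θ : ℂ) ≠ 0 := by exact_mod_cast hθ
  have h2 : ((η k : ℤ) : ℂ) ≠ 0 := by exact_mod_cast (η k).ne_zero
  have h3 : -2 * Complex.I ≠ 0 := mul_ne_zero (by norm_num) Complex.I_ne_zero
  exact mul_ne_zero (div_ne_zero h3 h1) h2

theorem starConst_ne_zero (m : ℕ) {θ : ℝ} (hθ : θ ≠ 0) (η : Fin n → ℤˣ) :
    starConst m θ η ≠ 0 := by
  have h1 : (rsign n : ℂ) ≠ 0 := by
    have : rsign n ≠ 0 := by simp [rsign]
    exact_mod_cast this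
  refine mul_ne_zero ?_ (mul_ne_zero h1 (Finset.prod_ne_zero_iff.2 fun k _ => oddFactor_ne_zero hθ η k))
  have : 1 / (Real.pi ^ (2 * m) * θ ^ (2 * (m : ℤ) - (n : ℤ))) ≠ 0 :=
    one_div_ne_zero (mul_ne_zero (pow_ne_zero _ Real.pi_ne_zero) (zpow_ne_zero _ hθ))
  exact_mod_cast this

/-- The parameter is iθη_k/2. The sign of θη_k goes into c = ±i, so that μ can be a real square
root. -/
theorem exists_oddCoeff_eq {θ : ℝ} (hθ : θ ≠ 0) (η : Fin n → ℤˣ) (k : Fin n) :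
    ∃ c μ : ℂ, conj c = -c ∧ c * c = -1 ∧ conj μ = μ ∧ oddCoeff θ η k = c * μ * μ := by
  have hη : ((η k : ℤ) : ℝ) * ((η k : ℤ) : ℝ) = 1 := by
    have h := congrArg (fun u : ℤˣ => (u : ℤ)) (Int.units_mul_self (η k))
    simp only [Units.val_mul, Units.val_one] at h
    exact_mod_cast h
  have e : oddCoeff θ η k = Complex.I * ((θ * (η k : ℤ) / 2 : ℝ) : ℂ) := by
    refine inv_eq_of_mul_eq_one_right ?_
    have h1 : (θ : ℂ) ≠ 0 := by exact_mod_cast hθ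
    have h2 : ((η k : ℤ) : ℂ) * ((η k : ℤ) : ℂ) = 1 := by exact_mod_cast hη
    push_cast
    field_simp
    linear_combination (-Complex.I ^ 2) * h2 - Complex.I_sq
  rcases le_total 0 (θ * (η k : ℤ) / 2) with h | h
  · refine ⟨Complex.I, (√(θ * (η k : ℤ) / 2) : ℝ), Complex.conj_I, Complex.I_mul_I,
      Complex.conj_ofReal _, ?_⟩
    rw [e, mul_assoc, ← Complex.ofReal_mul, Real.mul_self_sqrt h]
  · refine ⟨-Complex.I, (√(-(θ * (η k : ℤ) / 2)) : ℝ), by simp, by simp, Complex.conj_ofReal _, ?_⟩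
    rw [e, mul_assoc, ← Complex.ofReal_mul, Real.mul_self_sqrt (neg_nonneg.2 h)]
    push_cast
    ring

/-- The superinvolution of smooth vectors. -/
def smoothDag (ρ : SuperAction m n A G) (hb : ∀ a, SemBdd fun x => ρ.coeff x ∅ a)
    {dag : A →ₗ⋆[ℂ] A} (hd : Continuous dag) (h : ρ.PreservesDag dag) :
    ρ.smoothVectors →ₗ⋆[ℂ] ρ.smoothVectors :=
  (dag ∘ₛₗ ρ.smoothVectors.subtype).codRestrict ρ.smoothVectors fun a =>
    (mem_smoothVectors hb).2 (((mem_smoothVectors hb).1 a.2).map_star hd fun x b => h x ∅ b)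

/-- Lift the given representation to the regular one, quantize the smooth vectors, double once per
odd direction, and take the norm closure. -/
theorem exists_completion (hb : ∀ a, SemBdd fun x => ρ.coeff x ∅ a) (hG : G.IsAlgebraGrading)
    (hγ : Continuous G.parity) (hdeg : G.odd = ⊥ ∨ ρ.PreservesDegree) {θ : ℝ} (hθ : θ ≠ 0)
    (η : Fin n → ℤˣ) (hc : 2 * θ⁻¹ ≠ 0) (dag : A →ₗ⋆[ℂ] A)
    (hA : IsCStarSuperalgebra.{u, v} G dag) (h : ρ.PreservesDegree) (hdag : ρ.PreservesDag dag) :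
    ∃ (B : Type v) (_ : NonUnitalRing B) (_ : Module ℂ B) (_ : IsScalarTower ℂ B B)
      (_ : SMulCommClass ℂ B B) (_ : TopologicalSpace B)
      (GB : Supergrading B) (dagB : B →ₗ⋆[ℂ] B) (ι : ρ.smoothVectors →ₗ[ℂ] B),
      IsCStarSuperalgebra.{v, v} GB dagB ∧ Function.Injective ι ∧ DenseRange ι ∧
      (∀ a b, ι (ρ.star hb hγ hdeg θ η hc a b) = ι a * ι b) ∧
      (∀ (i : ZMod 2) (a : ρ.smoothVectors), (a : A) ∈ G.part i → ι a ∈ GB.part i) ∧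
      (∀ a : ρ.smoothVectors, ∃ b : ρ.smoothVectors,
        (b : A) = (-1 : ℂ) ^ n • dag (a : A) ∧ dagB (ι a) = ι b) := by
  obtain ⟨-, -, H, _, _, _, S, π, hπ, hπdeg, hπdag⟩ := hA
  set K := Krein.ofHilbertSuperspace S
  have hpar := Krein.parity_rep S hπdeg
  have hs := Krein.sadj_rep S hπdeg hπdag
  have hd : Continuous dag := Krein.continuous_dag hπ hs
  have hl : θ⁻¹ ≠ 0 := inv_ne_zero hθ
  let γA : A →L[ℂ] A := ⟨G.parity, hγ⟩
  have hαγ : ∀ x b, γA ((ρ.body hb).act x b) = (ρ.body hb).act x (γA b) := parity_coeff hdeg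
  have hαd : ∀ x a, (ρ.body hb).act x (dag a) = dag ((ρ.body hb).act x a) := fun x a => hdag x ∅ a
  let X := ρ.oddSystem hb hγ h
  let E : ρ.smoothVectors →ₗ[ℂ] A := ρ.smoothVectors.subtype
  have hE : ∀ s, (ρ.body hb).Smooth (E s) := fun s => (mem_smoothVectors hb).1 s.2
  let R := regular (ρ.body hb) hπ.continuous θ⁻¹ hπ.injective
  let K' := K.lift m
  have hVγ : ∀ d x, K'.γ (R.V d x) = R.V d (K'.γ x) := K.lift_γ_magn θ⁻¹
  have hVJ : ∀ d x, K'.J (R.V d x) = R.V d (K'.J x) := K.lift_J_magn θ⁻¹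
  have hop : ∀ b, K'.γ * R.op b * K'.γ = R.op (γA b) :=
    Krein.lift_orbitRep (ρ.body hb) hπ.continuous hαγ hpar
  have hrep : K'.IsRep X.γ (ρ.smoothDag hb hd hdag) (2 ^ m) (ρ.moyalProd hb hc)
      (R.quant hl E hE) :=
    { inj := R.quant_injective hl E hE Subtype.val_injective
      mul := R.quant_mul hl E hE _ fun s t => rfl
      parity := R.parity_quant hl E hE hVγ hop hαγ fun s => rfl
      sadj := R.sadj_quant hl E hE hVγ hVJ hop hαγ (Γ := X.γ) (fun s => rfl) X.γ_γ hd hαd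
        (Krein.sadj_orbitRep (ρ.body hb) hπ.continuous (fun a => G.parity_parity a) hαγ hpar hαd hs)
        fun s => rfl }
  obtain ⟨H', _, _, _, K'', T, hT⟩ := hrep.exists_oddDeform
    (isCompatible_moyalProd hb hG hγ h hl hc) (fun k a => Subtype.ext (hdag 0 {k} a).symm)
    (exists_oddCoeff_eq hθ η) Finset.univ
  have hz : (2 : ℂ) ^ m ≠ 0 := pow_ne_zero _ two_ne_zero
  set C := starConst m θ η with hC
  have hC0 : C ≠ 0 := starConst_ne_zero m hθ η
  obtain ⟨B, i1, i2, i3, i4, i5, GB, dagB, ι, h1, h2, h3, h4, h5, h6⟩ :=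
    -- T(a)T(b) is 2^m times T of the odd deformation, and the star product is C times that
    -- deformation, so C/2^m is the scalar that makes the map multiplicative. Since conj C = (-1)^n
    -- C, the same rescaling puts the sign into the involution.
    Krein.exists_isCStarSuperalgebra (ρ.star hb hγ hdeg θ η hc) X.γ
      (fun a => (-1 : ℂ) ^ n • ρ.smoothDag hb hd hdag a) K'' ((C / 2 ^ m) • T)
      (fun a b hab => hT.inj (smul_right_injective _ (div_ne_zero hC0 hz) hab))
      (fun a b => by
        change (C / 2 ^ m) • T (C • oddDeform X.γ X.D (oddCoeff θ η) (ρ.moyalProd hb hc)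
          Finset.univ a b) = ((C / 2 ^ m) • T a) * ((C / 2 ^ m) • T b)
        rw [smul_mul_smul_comm, ← hT.mul, map_smul, smul_smul, smul_smul]
        congr 1
        field_simp)
      (fun a => by
        rw [LinearMap.smul_apply, LinearMap.smul_apply, ← hT.parity, mul_smul_comm, smul_mul_assoc])
      (fun a => by
        rw [LinearMap.smul_apply, LinearMap.smul_apply, map_smulₛₗ K''.sadj, hT.sadj, map_smul,
          smul_smul, map_div₀, hC, conj_starConst, map_pow, Complex.conj_ofNat]
        congr 1
        ring)
  refine ⟨B, i1, i2, i3, i4, i5, GB, dagB, ι, h1, h2, h3, h4, fun i a ha => h5 i a ?_, fun a =>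
    ⟨_, rfl, h6 a⟩⟩
  exact Subtype.ext (G.parity_of_mem_part ha)

end SuperAction
end Completion

end SuperDeformation

end

/-! ### The deformation theorem. -/

theorem mainTheorem4 (m n : ℕ) (θ : ℝ) (hθ : θ ≠ 0) (η : Fin n → ℤˣ)
    {A : Type u} [NonUnitalRing A] [Module ℂ A] [IsScalarTower ℂ A A] [SMulCommClass ℂ A A]
    [UniformSpace A] [IsUniformAddGroup A] [ContinuousSMul ℂ A] [ContinuousMul A]
    [CompleteSpace A] [T2Space A]
    (p : ℕ → Seminorm ℂ A) (hp : WithSeminorms p)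
    (G : SuperDeformation.Supergrading A) (hG : G.IsAlgebraGrading)
    (hG0 : IsClosed (G.even : Set A)) (hG1 : IsClosed (G.odd : Set A))
    (ρ : SuperDeformation.SuperAction m n A G) (hρ : ρ.IsSubisometric p)
    (hdeg : G.odd = ⊥ ∨ ρ.PreservesDegree) :
    ∃ star : ρ.smoothVectors →ₗ[ℂ] ρ.smoothVectors →ₗ[ℂ] ρ.smoothVectors,
      (∀ a b : ρ.smoothVectors,
        SuperDeformation.StarConverges θ η G.parity (ρ.orbit a) (ρ.orbit b) ∧
        (star a b : A) =
          SuperDeformation.starProduct θ η G.parity (ρ.orbit a) (ρ.orbit b) 0 ∅) ∧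
      (∀ a b c : ρ.smoothVectors, star (star a b) c = star a (star b c)) ∧
      (∀ dag : A →ₗ⋆[ℂ] A, SuperDeformation.IsCStarSuperalgebra.{u, v} G dag →
        ρ.PreservesDegree → ρ.PreservesDag dag →
        ∃ (B : Type v) (_ : NonUnitalRing B) (_ : Module ℂ B) (_ : IsScalarTower ℂ B B)
          (_ : SMulCommClass ℂ B B) (_ : TopologicalSpace B)
          (GB : SuperDeformation.Supergrading B) (dagB : B →ₗ⋆[ℂ] B)
          (ι : ρ.smoothVectors →ₗ[ℂ] B),
          SuperDeformation.IsCStarSuperalgebra.{v, v} GB dagB ∧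
          Function.Injective ι ∧ DenseRange ι ∧
          (∀ a b : ρ.smoothVectors, ι (star a b) = ι a * ι b) ∧
          (∀ (i : ZMod 2) (a : ρ.smoothVectors), (a : A) ∈ G.part i → ι a ∈ GB.part i) ∧
          (∀ a : ρ.smoothVectors, ∃ b : ρ.smoothVectors,
            (b : A) = (-1 : ℂ) ^ n • dag (a : A) ∧ dagB (ι a) = ι b)) := by
  have : PolynormableSpace ℂ A := hp.toPolynormableSpace
  have : FirstCountableTopology A := hp.firstCountableTopology
  have hγ : Continuous G.parity := G.parity_continuous hG0 hG1
  have hb : ∀ a, SuperDeformation.SemBdd fun x => ρ.coeff x ∅ a := fun a => hρ.semBdd hp ∅ a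
  have hc : 2 * θ⁻¹ ≠ 0 := mul_ne_zero two_ne_zero (inv_ne_zero hθ)
  refine ⟨ρ.star hb hγ hdeg θ η hc, fun a b => ⟨?_, ?_⟩,
    SuperDeformation.SuperAction.star_assoc hb hG hγ hdeg hθ η hc, ?_⟩
  · exact SuperDeformation.SuperAction.starConverges_orbit hb θ η hθ hγ hdeg
      ((SuperDeformation.SuperAction.mem_smoothVectors hb).1 a.2)
      ((SuperDeformation.SuperAction.mem_smoothVectors hb).1 b.2)
  · exact (SuperDeformation.SuperAction.starProduct_orbit hb θ η hθ hc hγ hdeg a b).symm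
  · exact fun dag hA h hdag => SuperDeformation.SuperAction.exists_completion hb hG hγ hdeg hθ η hc
      dag hA h hdag
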